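/- \textbf{Asymptotics.} All quantities depend on an index $n\to\infty$, which is suppressed. For non-negative sequences, $u=\Theta(v)$ means $c\,v\le u\le C\,v$ for all large $n$ with constants $c,C>0$; $u=o(v)$, $u\ll v$ and $v\gg u$ all mean that for every $c>0$, $u\le c\,v$ for all large $n$. Relations involving a hidden node $h$ or a coordinate $i$ hold uniformly in $h$, $i$. \textbf{Data.} Let $d\to\infty$ and $k\ge 1$ with $k=o(d)$. The coordinates of $X\in\mathbb R^d$ are i.i.d. and symmetric with $|X_i|\in\{0\}\cup[1/\sqrt k,1]$, $P(X_i\ne0)=\Theta(k/d)$, $\mathbb E|X_i|=\Theta(\sqrt k/d)$, $\mathbb EX_i^2=\Theta(1/d)$ and $\mathbb E|X_i|^3=\Theta(1/(d\sqrt k))$. One observes $Z=MX+\xi$, where $M$ is a real orthogonal matrix and $\xi\sim N(0,\zeta^2I_d/d)$ is independent of $X$, with $\zeta>0$ fixed. The coefficient $\theta_0\in\mathbb R^d$ satisfies $|(\theta_0)_i|=\Theta(1)$. Either $Y=\theta_0^\top X+\varepsilon$ with an independent Gaussian noise $\varepsilon$ of mean zero and fixed positive variance, and $l(f,y)=(f-y)^2$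 or $l(f,y)=|f-y|$; or $Y\in\{0,1\}$ with $P(Y=1\mid X,\xi)=1/(1+e^{\theta_0^\top X})$, and $l(f,y)=y\log(1+e^{f})+(1-y)\log(1+e^{-f})$. \textbf{Networks and attack.} $f_{W,b}(z)=\sum_{h=1}^H\sigma(z^\top W_h,b_h)$ with $\sigma(v,e)=v\,1\{|v|\ge e\}$, and $U=M^\top W$. The clean loss is $l_0(z,y;f)=l(f(z),y)$. The adversarial loss is $l_\epsilon(z,y;f)=l(f(z+\delta),y)$ with $\delta=\epsilon\,\nabla_z l(f(z),y)/\|\nabla_z l(f(z),y)\|_2$ ($\delta=0$ if the gradient vanishes). We write $l_\epsilon(z,y;W,b)$ for $f=f_{W,b}$, and $l_0(x,y;\theta_0)=l(\theta_0^\top x,y)$. \textbf{The class $\mathcal M$.} Given $m^*\in\mathbb N$, $(W,b)\in\mathcal M$ means: (1) $b_h\ll\|U_h\|/\sqrt{k\|U_h\|_0}$; (2) $b_h\gg\|U_h\|/(\sqrt{k\|U_h\|_0}\log d)\gg\|U_h\|/\sqrt d$; (3) $U_h\ne0$ and $\|U_h\|_0\le m^*$ for all $h$, $m^*=o(d/k)$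 and $H\gg d$; (4) for each $i$ the non-zero $U_{i,h}$ have the same sign, and there is a sequence $\gamma>0$ (which may depend on the network) such that all non-zero $U_{i,h}$ satisfy $|U_{i,h}|=\Theta(\gamma)$. Put $$\psi=\frac{H(m^*)^3k^3\log^2k}{d^2}+\sqrt{\frac kd}.$$ \textbf{Theorem.} Assume $\epsilon=\Theta(1/(\sqrt{km^*}\log d))$ and $H=o(\epsilon d^{3/2})$. Let $(W,b)\in\mathcal M$ have adversarial loss within $O(\psi)$ of the minimum over $\mathcal M$: for every $(W',b')\in\mathcal M$, $$\mathbb El_\epsilon(Z,Y;W,b)\le\mathbb El_\epsilon(Z,Y;W',b')+O(\psi).$$ Then (1) $\mathbb El_0(Z,Y;W,b)-\mathbb El_0(X,Y;\theta_0)=O(\psi)+O(\epsilon\sqrt k)$; (2) if moreover $\epsilon\sqrt k\,d/H\gg\psi$, then $(1-o(1))H$ of the hidden nodes $h$ satisfy $\|U_h\|_0=1$. -/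

import Mathlib

open MeasureTheory ProbabilityTheory Filter Topology Asymptotics
open scoped Matrix

namespace FeaturePurification

noncomputable section

/-- `u = Θ(v)` for real sequences: `c * v n ≤ u n ≤ C * v n` for all large `n`, with constants
`c, C > 0`. -/
def IsOrder (u v : ℕ → ℝ) : Prop :=
  ∃ c > 0, ∃ C > 0, ∀ᶠ n in atTop, c * v n ≤ u n ∧ u n ≤ C * v n

/-! ### Two-layer networks -/

/-- The gated activation `σ(v, e) = v 1{|v| ≥ e}`. -/
def gate (v e : ℝ) : ℝ := if e ≤ |v| then v else 0

/-- The trainable parameters of a two-layer network with `H` hidden nodes on `ℝ^d`: the weights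
(the column `W_h` belongs to node `h`) and the intercepts. -/
structure Network (d H : ℕ) where
  W : Matrix (Fin d) (Fin H) ℝ
  b : Fin H → ℝ

/-- `f_{W,b}(z) = ∑_h a_h σ(zᵀ W_h, b_h)` with all output weights `a_h` equal to `1`. -/
def Network.eval {d H : ℕ} (N : Network d H) (z : EuclideanSpace ℝ (Fin d)) : ℝ :=
  ∑ h, gate (∑ i, z i * N.W i h) (N.b h)

/-- Euclidean norm `‖U_h‖` of the `h`-th column. -/
def colNorm {d H : ℕ} (U : Matrix (Fin d) (Fin H) ℝ) (h : Fin H) : ℝ :=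
  Real.sqrt (∑ i, U i h ^ 2)

/-- `‖U_h‖₀`, the number of non-zero entries of the `h`-th column. -/
def colSupp {d H : ℕ} (U : Matrix (Fin d) (Fin H) ℝ) (h : Fin H) : ℕ :=
  {i : Fin d | U i h ≠ 0}.ncard

/-! ### Losses and the gradient attack -/

/-- The three supervised problems: linear regression with square or with absolute loss, and
logistic classification. -/
inductive Task
  | square
  | absolute
  | logistic

/-- The loss of the prediction `f` at the response `y`. In the classification task the response is
`0` or `1`, success has probability `1 / (1 + exp f)` under the model `f`, and the logistic loss is
the negative log-likelihood. -/
def Task.loss : Task → ℝ → ℝ → ℝ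
  | .square, f, y => (f - y) ^ 2
  | .absolute, f, y => |f - y|
  | .logistic, f, y => y * Real.log (1 + Real.exp f) + (1 - y) * Real.log (1 + Real.exp (-f))

/-- The conditional law of the response `Y` given `θ₀ᵀ X = t`: `N(t, s²)` in the regression tasks,
`Bern(1 / (1 + exp t))` in the classification task. -/
def Task.response (τ : Task) (s t : ℝ) : Measure ℝ :=
  match τ with
  | .square => gaussianReal t (s ^ 2).toNNReal
  | .absolute => gaussianReal t (s ^ 2).toNNReal
  | .logistic =>
      ENNReal.ofReal (1 / (1 + Real.exp t)) • Measure.dirac 1 +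
        ENNReal.ofReal (1 - 1 / (1 + Real.exp t)) • Measure.dirac 0

/-- The fast gradient attack `δ = ε (∂l/∂z) / ‖∂l/∂z‖` on the predictor `f` at the sample `(z, y)`
(`δ = 0` where the gradient vanishes). -/
def attack {d : ℕ} (ε : ℝ) (l : ℝ → ℝ → ℝ) (f : EuclideanSpace ℝ (Fin d) → ℝ)
    (z : EuclideanSpace ℝ (Fin d)) (y : ℝ) : EuclideanSpace ℝ (Fin d) :=
  (ε / ‖gradient (fun w => l (f w) y) z‖) • gradient (fun w => l (f w) y) z

/-- The loss `l_ε(z, y; f) = l(z + δ, y; f)` at the attacked input. -/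
def attackedLoss {d : ℕ} (ε : ℝ) (l : ℝ → ℝ → ℝ) (f : EuclideanSpace ℝ (Fin d) → ℝ)
    (z : EuclideanSpace ℝ (Fin d)) (y : ℝ) : ℝ :=
  l (f (z + attack ε l f z y)) y

theorem attackedLoss_zero {d : ℕ} (l : ℝ → ℝ → ℝ) (f : EuclideanSpace ℝ (Fin d) → ℝ)
    (z : EuclideanSpace ℝ (Fin d)) (y : ℝ) : attackedLoss 0 l f z y = l (f z) y := by
  simp [attackedLoss, attack]

/-! ### The sparse coding model -/

/-- The parameters of a sequence of problems, indexed by `n`: dimension `d`, number `H` of hidden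
nodes, sparsity `k`, bound `m` on the number of features per node, attack strength `ε`, the common
law `law` of the coordinates of `X`, the matrix `M`, the true coefficient `θ₀`; and the
`n`-independent levels `ζ` of the input noise and `s` of the regression noise. -/
structure Model where
  d : ℕ → ℕ
  H : ℕ → ℕ
  k : ℕ → ℝ
  m : ℕ → ℕ
  ε : ℕ → ℝ
  law : ℕ → Measure ℝ
  M : ∀ n, Matrix (Fin (d n)) (Fin (d n)) ℝ
  θ₀ : ∀ n, Fin (d n) → ℝ
  ζ : ℝ
  s : ℝ

/-- The sparse coding assumption on the data. -/
structure Model.SparseCoding (P : Model) : Prop where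
  dim : Tendsto P.d atTop atTop
  one_le_k : ∀ n, 1 ≤ P.k n
  k_small : P.k =o[atTop] fun n => (P.d n : ℝ)
  prob : ∀ n, IsProbabilityMeasure (P.law n)
  symm : ∀ n, (P.law n).map (fun x => -x) = P.law n
  range : ∀ n, ∀ᵐ x ∂P.law n, x = 0 ∨ (1 / Real.sqrt (P.k n) ≤ |x| ∧ |x| ≤ 1)
  active : IsOrder (fun n => (P.law n).real {x | x ≠ 0}) fun n => P.k n / P.d n
  moment_one : IsOrder (fun n => ∫ x, |x| ∂P.law n) fun n => Real.sqrt (P.k n) / P.d n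
  moment_two : IsOrder (fun n => ∫ x, x ^ 2 ∂P.law n) fun n => 1 / P.d n
  moment_three : IsOrder (fun n => ∫ x, |x| ^ 3 ∂P.law n)
    fun n => 1 / (P.d n * Real.sqrt (P.k n))
  orthogonal : ∀ n, P.M n ∈ Matrix.orthogonalGroup (Fin (P.d n)) ℝ
  noise_pos : 0 < P.ζ
  regression_noise_pos : 0 < P.s
  coeff : ∃ c > 0, ∃ C > 0, ∀ᶠ n in atTop, ∀ i, c ≤ |P.θ₀ n i| ∧ |P.θ₀ n i| ≤ C

/-- The law of the feature vector `X`: i.i.d. coordinates. -/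
def Model.featureLaw (P : Model) (n : ℕ) : Measure (Fin (P.d n) → ℝ) :=
  Measure.pi fun _ => P.law n

/-- The law `N(0, ζ² I_d / d)` of the input noise `ξ`. -/
def Model.noiseLaw (P : Model) (n : ℕ) : Measure (Fin (P.d n) → ℝ) :=
  Measure.pi fun _ => gaussianReal 0 (P.ζ ^ 2 / P.d n).toNNReal

/-- `θ₀ᵀ x`. -/
def Model.signal (P : Model) (n : ℕ) (x : Fin (P.d n) → ℝ) : ℝ := ∑ i, P.θ₀ n i * x i

/-- The observed input `z = M x + ξ`. -/
def Model.input (P : Model) (n : ℕ) (x ξ : Fin (P.d n) → ℝ) : EuclideanSpace ℝ (Fin (P.d n)) :=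
  WithLp.toLp 2 (P.M n *ᵥ x + ξ)

/-- `E l_ε(Z, Y; f)`, with `X` and `ξ` independent and `Y` drawn from its law given `X`. -/
def Model.attackedRisk (P : Model) (τ : Task) (n : ℕ) (ε : ℝ)
    (f : EuclideanSpace ℝ (Fin (P.d n)) → ℝ) : ℝ :=
  ∫ w, ∫ y, attackedLoss ε τ.loss f (P.input n w.1 w.2) y ∂τ.response P.s (P.signal n w.1)
    ∂(P.featureLaw n).prod (P.noiseLaw n)

/-- The adversarial risk `E l_ε(Z, Y; W, b)`. -/
def Model.advRisk (P : Model) (τ : Task) (n : ℕ) (N : Network (P.d n) (P.H n)) : ℝ :=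
  P.attackedRisk τ n (P.ε n) N.eval

/-- The clean risk `E l_0(Z, Y; W, b)`. -/
def Model.cleanRisk (P : Model) (τ : Task) (n : ℕ) (N : Network (P.d n) (P.H n)) : ℝ :=
  P.attackedRisk τ n 0 N.eval

/-- The risk `E l_0(X, Y; θ₀)` of the true linear predictor of the true features. -/
def Model.oracleRisk (P : Model) (τ : Task) (n : ℕ) : ℝ :=
  ∫ x, ∫ y, τ.loss (P.signal n x) y ∂τ.response P.s (P.signal n x) ∂P.featureLaw n

/-- `U = Mᵀ W`: the strength of each true feature in each hidden node. -/
def Model.features (P : Model) (n : ℕ) (N : Network (P.d n) (P.H n)) :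
    Matrix (Fin (P.d n)) (Fin (P.H n)) ℝ :=
  (P.M n)ᵀ * N.W

/-- The class `𝓜` of (sequences of) networks. All asymptotic relations between quantities attached
to a node hold uniformly over the nodes, and the scale `γ` may depend on the network. -/
structure Model.InClass (P : Model) (N : ∀ n, Network (P.d n) (P.H n)) : Prop where
  /-- `b_h ≪ ‖U_h‖ / √(k ‖U_h‖₀)` -/
  intercept_small : ∀ c > 0, ∀ᶠ n in atTop, ∀ h,
    (N n).b h ≤ c * (colNorm (P.features n (N n)) h /
      Real.sqrt (P.k n * colSupp (P.features n (N n)) h))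
  /-- `b_h ≫ ‖U_h‖ / √(k ‖U_h‖₀) / log d` -/
  intercept_large : ∀ C > 0, ∀ᶠ n in atTop, ∀ h,
    C * (colNorm (P.features n (N n)) h /
      Real.sqrt (P.k n * colSupp (P.features n (N n)) h) / Real.log (P.d n)) ≤ (N n).b h
  /-- `‖U_h‖ / √(k ‖U_h‖₀) / log d ≫ ‖U_h‖ / √d` -/
  noise_screened : ∀ C > 0, ∀ᶠ n in atTop, ∀ h,
    C * (colNorm (P.features n (N n)) h / Real.sqrt (P.d n)) ≤
      colNorm (P.features n (N n)) h /
        Real.sqrt (P.k n * colSupp (P.features n (N n)) h) / Real.log (P.d n)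
  few_features : ∀ᶠ n in atTop, ∀ h, colSupp (P.features n (N n)) h ≤ P.m n
  m_small : (fun n => (P.m n : ℝ)) =o[atTop] fun n => (P.d n : ℝ) / P.k n
  nonzero : ∀ᶠ n in atTop, ∀ h, ∃ i, P.features n (N n) i h ≠ 0
  wide : (fun n => (P.d n : ℝ)) =o[atTop] fun n => (P.H n : ℝ)
  same_sign : ∀ᶠ n in atTop, ∀ i h h',
    0 ≤ P.features n (N n) i h * P.features n (N n) i h'
  same_size : ∃ γ : ℕ → ℝ, (∀ n, 0 < γ n) ∧ ∃ c > 0, ∃ C > 0, ∀ᶠ n in atTop, ∀ i h,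
    P.features n (N n) i h ≠ 0 →
      c * γ n ≤ |P.features n (N n) i h| ∧ |P.features n (N n) i h| ≤ C * γ n

/-- `ψ = H m³ k³ log² k / d² + √(k / d)`, where `m` bounds the number of features per node. -/
def Model.ψ (P : Model) (n : ℕ) : ℝ :=
  P.H n * (P.m n : ℝ) ^ 3 * P.k n ^ 3 * Real.log (P.k n) ^ 2 / (P.d n : ℝ) ^ 2 +
    Real.sqrt (P.k n / P.d n)

/-- The number of purified nodes, i.e. of hidden nodes with `‖U_h‖₀ = 1`. -/
def Model.purified (P : Model) (n : ℕ) (N : Network (P.d n) (P.H n)) : ℕ :=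
  {h : Fin (P.H n) | colSupp (P.features n N) h = 1}.ncard

end

end FeaturePurification

namespace FeaturePurification

noncomputable section

open Real (exp log sigmoid sqrt_nonneg sigmoid_nonneg sqrt_pos norm_of_nonneg sq_sqrt sqrt_le_iff
  sigmoid_neg sqrt_mul sqrt_le_sqrt sigmoid_monotone exp_add sqrt_sq norm_eq_abs mul_self_sqrt
  sqrt_div le_sqrt_of_sq_le exp_le_exp sigmoid_pos exp_pos exp_nonneg one_le_sqrt
  log_natCast_nonneg exp_neg sqrt_le_one sigmoid_lt_one sigmoid_le_one sigmoid_def)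
open Function (update update_of_ne update_self)
open Finset (mul_sum sum_le_sum sum_congr sum_nonneg sum_mul sum_add_distrib mem_univ sum_comm
  sum_sub_distrib card_univ sum_const univ abs_sum_le_sum_abs sum_eq_single sum_div mem_filter
  sum_neg_distrib sum_eq_zero sum_boole single_le_sum measurable_sum add_sum_erase)

/-- Real vectors with `d` coordinates. -/
local notation:max "ℝ^" d:max => Fin d → ℝ

/-- Euclidean space of dimension `d`. -/
local notation:max "𝔼^" d:max => EuclideanSpace ℝ (Fin d)

/-- The centred Gaussian law with standard deviation `s`. -/
local notation:max "𝓝₀" s:max => gaussianReal 0 (Real.toNNReal (s ^ 2))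

/-- The features of a network. -/
local notation:max "Φ" N:max => Model.features _ _ N

/-! In the feature basis a node is a gate applied to a linear form of the sparse vector `X` plus a
small Gaussian. Off the thresholds a network is locally linear, so the attack moves the input by `ε`
along plus or minus the slope, the sum of the weights of the active nodes. The weights of each
feature have one sign and every threshold exceeds the shift that the attack can cause, so the
prediction moves by at least `ε` times the norm of the slope, in the direction that raises the loss
(`Network.eval_add_slope_le_up`). Integrating out the response turns this into a lower bound by the
mean of `profile`, a function that is convex in the prediction `f` and the displacement `G`,
increasing in `|G|`, and for `G = 0` minimal at the true signal.

A network whose nodes see one feature each acts like a linear predictor `T` of `X`, attacked by `ε`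
times the norm of `T` on the active features. The risk of that predictor is `linRisk`. Purified
networks attain it up to `O(√(k/d))` (`Model.exists_pureNetwork_advRisk_le`) and belong to the
class. The first assertion is then a sandwich: Bayes risk, clean risk, adversarial risk, `linRisk`
at `θ₀` plus `O(ψ)`, Bayes risk plus `O(ψ) + O(ε√k)`.

The second assertion concerns an effect of order `ε√k d/H`, smaller than `ε√k`, so the comparison
must be with the minimum of `linRisk`. For a weak attack this convex function has a global minimiser
`T₀` whose coefficients are comparable to those of `θ₀` (`exists_minimizer_linRisk`): at the
boundary of the box around `θ₀` a coefficient can be moved inwards with profit. For an arbitrary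
network, Jensen's inequality over the noise replaces the output by its mean, nearly the linear form
with the total strengths `T` of the features, and the norm of the slope by its inner product with
any test vector of norm at most one. The test vector puts weight `1 - l²` on the direction of `T₀`
on the active features, and weight `l` on the direction of the averaged slope outside them. The
former part reproduces the derivative of the active norm at `T₀` towards `T`, so first-order
optimality of `T₀` (`linRisk_add_gain_le`) bounds the adversarial risk below by the minimum of
`linRisk`, plus a gain linear in `l`, minus a cost quadratic in `l` and an error from nodes with
several active features (`Model.exists_gain_le`).

A mixed node with one active feature contributes its other weights to the slope, where they serve
only the attacker. If a fixed proportion of the nodes is mixed, this waste has mean at least of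
order `√k √(d/H)` (`Model.ClassAt.le_wasted_of_mixed`). With `l` a small multiple of `√(d/H)` the
net gain is of order `ε√k d/H`, whereas near-minimality, tested on the purified network built from
`T₀`, bounds it by `O(ψ)`. Hence `ε√k d/H ≫ ψ` excludes a fixed proportion of mixed nodes. The error
from superposed features is charged to `ψ` or, for `k` near one where `log k` may vanish, to the
waste itself.

All estimates are made at a single index, with a constant `K` and a small ratio `c`
(`Model.RegimeAt`, `Model.ClassAt`). Limits enter only when these conditions are extracted and at
the very end. -/

theorem mul_le_left {a b c : ℝ} (h : b ≤ c) (ha : 0 ≤ a := by positivity) : a * b ≤ a * c :=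
  mul_le_mul_of_nonneg_left h ha

theorem mul_le_right {a b c : ℝ} (h : b ≤ c) (ha : 0 ≤ a := by positivity) : b * a ≤ c * a :=
  mul_le_mul_of_nonneg_right h ha

theorem sq_le_of_abs_le {a b : ℝ} (h : |a| ≤ b) : a ^ 2 ≤ b ^ 2 := by
  rw [← sq_abs]; exact pow_le_pow_left₀ (abs_nonneg _) h 2

/-! ### The mean absolute value of a shifted Gaussian -/

/-- `E |u + n|` for `n ∼ N(0, s²)`. -/
def absMean (s u : ℝ) : ℝ := ∫ n, |u + n| ∂𝓝₀ s

theorem integrable_id_gaussian (s : ℝ) : Integrable (fun n : ℝ => n) (𝓝₀ s) :=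
  (memLp_id_gaussianReal (μ := 0) (v := (s ^ 2).toNNReal) 1).integrable (by norm_num)

theorem integrable_add_gaussian (s u : ℝ) : Integrable (fun n : ℝ => u + n) (𝓝₀ s) :=
  (integrable_const u).add (integrable_id_gaussian s)

theorem integrable_abs_add_gaussian (s u : ℝ) : Integrable (fun n : ℝ => |u + n|) (𝓝₀ s) :=
  (integrable_add_gaussian s u).abs

theorem integrable_sq_gaussian (s : ℝ) : Integrable (fun n : ℝ => n ^ 2) (𝓝₀ s) :=
  (memLp_id_gaussianReal (μ := 0) (v := (s ^ 2).toNNReal) 2).integrable_sq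

theorem integral_sq_gaussian (s : ℝ) : ∫ n, n ^ 2 ∂𝓝₀ s = s ^ 2 := by
  have h := variance_fun_id_gaussianReal (μ := 0) (v := (s ^ 2).toNNReal)
  rw [variance_eq_integral (by fun_prop)] at h
  simpa [integral_id_gaussianReal, Real.coe_toNNReal _ (sq_nonneg s)] using h

theorem absMean_sub_le (s u v : ℝ) : absMean s u - absMean s v ≤ |u - v| := by
  unfold absMean
  rw [← integral_sub (integrable_abs_add_gaussian s u) (integrable_abs_add_gaussian s v)]
  calc _ ≤ ∫ _ : ℝ, |u - v| ∂𝓝₀ s := by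
        refine integral_mono ((integrable_abs_add_gaussian s u).sub
          (integrable_abs_add_gaussian s v)) (integrable_const _) fun n => ?_
        have := abs_sub_abs_le_abs_sub (u + n) (v + n)
        simpa using this
    _ = |u - v| := by simp

theorem abs_absMean_sub_le (s u v : ℝ) : |absMean s u - absMean s v| ≤ |u - v| :=
  abs_le.2 ⟨by have := absMean_sub_le s v u; rw [abs_sub_comm] at this; linarith,
    absMean_sub_le s u v⟩

theorem absMean_neg (s u : ℝ) : absMean s (-u) = absMean s u := by
  have h := gaussianReal_map_neg (μ := 0) (v := (s ^ 2).toNNReal)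
  rw [neg_zero] at h
  unfold absMean
  conv_rhs => rw [← h]
  rw [integral_map (by fun_prop) (by fun_prop)]
  refine integral_congr_ae (.of_forall fun n => ?_)
  show |-u + n| = |u + -n|
  rw [← abs_neg]; ring_nf

theorem absMean_abs (s u : ℝ) : absMean s |u| = absMean s u := by
  rcases abs_cases u with ⟨h, _⟩ | ⟨h, _⟩ <;> simp [h, absMean_neg]

theorem convexOn_absMean (s : ℝ) : ConvexOn ℝ Set.univ (absMean s) := by
  refine ⟨convex_univ, fun u _ v _ a b ha hb hab => ?_⟩
  simp only [smul_eq_mul, absMean]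
  rw [← integral_const_mul, ← integral_const_mul, ← integral_add
    ((integrable_abs_add_gaussian s u).const_mul a) ((integrable_abs_add_gaussian s v).const_mul b)]
  refine integral_mono (integrable_abs_add_gaussian s _)
    (((integrable_abs_add_gaussian s u).const_mul a).add
      ((integrable_abs_add_gaussian s v).const_mul b)) fun n => ?_
  have : a * u + b * v + n = a * (u + n) + b * (v + n) := by linear_combination -hab * n
  show |a * u + b * v + n| ≤ a * |u + n| + b * |v + n|
  rw [this]
  refine (abs_add_le _ _).trans ?_
  rw [abs_mul, abs_mul, abs_of_nonneg ha, abs_of_nonneg hb]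

theorem absMean_zero_le (s u : ℝ) : absMean s 0 ≤ absMean s u := by
  have h := (convexOn_absMean s).2 (Set.mem_univ u) (Set.mem_univ (-u))
    (by norm_num : (0 : ℝ) ≤ 1 / 2) (by norm_num : (0 : ℝ) ≤ 1 / 2) (by norm_num)
  simp only [smul_eq_mul, absMean_neg] at h
  have e : 1 / 2 * u + 1 / 2 * -u = 0 := by ring
  rw [e] at h; linarith

theorem absMean_le (s u : ℝ) : absMean s u ≤ |u| + absMean s 0 := by
  have := absMean_sub_le s u 0
  rw [sub_zero] at this; linarith

theorem absMean_nonneg (s u : ℝ) : 0 ≤ absMean s u := integral_nonneg fun _ => abs_nonneg _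

theorem continuous_absMean (s : ℝ) : Continuous (absMean s) := by
  refine (LipschitzWith.of_dist_le_mul (K := 1) fun u v => ?_).continuous
  simpa [Real.dist_eq] using abs_absMean_sub_le s u v

theorem abs_add_add_abs_sub (a p : ℝ) (hp : 0 ≤ p) : |a + p| + |a - p| = 2 * max |a| p := by
  rcases le_total |a| p with h | h
  · rw [max_eq_right h]
    have := abs_le.1 h
    rw [abs_of_nonneg (by linarith), abs_of_nonpos (by linarith)]; ring
  · rw [max_eq_left h]
    rcases le_total 0 a with ha | ha
    · rw [abs_of_nonneg ha] at h ⊢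
      rw [abs_of_nonneg (by linarith), abs_of_nonneg (by linarith)]; ring
    · rw [abs_of_nonpos ha] at h ⊢
      rw [abs_of_nonpos (by linarith), abs_of_nonpos (by linarith)]; ring

theorem absMean_add_add_absMean_sub (s D p : ℝ) (hp : 0 ≤ p) : absMean s (D + p) + absMean s (D - p)
      = ∫ n, 2 * max |D + n| p ∂𝓝₀ s := by
  unfold absMean
  rw [← integral_add (integrable_abs_add_gaussian s _) (integrable_abs_add_gaussian s _)]
  refine integral_congr_ae (.of_forall fun n => ?_)
  show |D + p + n| + |D - p + n| = 2 * max |D + n| p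
  rw [← abs_add_add_abs_sub _ _ hp]; ring_nf

/-- Since `|a + p| + |a - p| = 2 max |a| p`, passing from `q` to `p` raises the integrand by exactly
`2 (p - q)` where `|D + n| ≤ q` and lowers it nowhere. The absolute loss has no curvature of its
own; its strict convexity in the mean comes from this Gaussian mass. -/
theorem absMean_second_diff (s D : ℝ) {p q : ℝ} (hq : 0 ≤ q) (hqp : q ≤ p) :
    2 * (p - q) * (𝓝₀ s).real {n | |D + n| ≤ q} ≤
      absMean s (D + p) + absMean s (D - p) - (absMean s (D + q) + absMean s (D - q)) := by
  rw [absMean_add_add_absMean_sub s D p (hq.trans hqp), absMean_add_add_absMean_sub s D q hq]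
  have hi : ∀ r : ℝ, Integrable (fun n => 2 * max |D + n| r) (𝓝₀ s) :=
    fun r => ((integrable_abs_add_gaussian s D).sup (integrable_const r)).const_mul 2
  rw [← integral_sub (hi p) (hi q)]
  have hm : MeasurableSet {n : ℝ | |D + n| ≤ q} := measurableSet_le (by fun_prop) measurable_const
  rw [mul_comm, ← smul_eq_mul, ← integral_indicator_const _ hm]
  refine integral_mono ((integrable_const _).indicator hm) ((hi p).sub (hi q)) fun n => ?_
  by_cases h : |D + n| ≤ q
  · rw [Set.indicator_of_mem (by exact h)]
    rw [max_eq_right (h.trans hqp), max_eq_right h]; linarith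
  · rw [Set.indicator_of_notMem (by exact h)]
    have : max |D + n| q ≤ max |D + n| p := max_le_max le_rfl hqp
    linarith

/-- A Gaussian charges short intervals in a bounded region proportionally to their length. -/
theorem gaussian_interval_lower {s : ℝ} (hs : 0 < s) (R : ℝ) :
    ∃ c > 0, ∀ D q : ℝ, |D| ≤ R → 0 ≤ q → q ≤ R → c * q ≤ (𝓝₀ s).real {n | |D + n| ≤ q} := by
  have hv : (s ^ 2).toNNReal ≠ 0 := by simpa using hs.ne'
  set v := (s ^ 2).toNNReal
  -- The interval has length `2 q` and lies in `[-2R, 2R]`, where the density is at least its value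
  -- at `2 R`.
  refine ⟨2 * gaussianPDFReal 0 v (2 * R), mul_pos two_pos (gaussianPDFReal_pos _ _ _ hv),
    fun D q hD hq hqR => ?_⟩
  have hset : {n : ℝ | |D + n| ≤ q} = Set.Icc (-D - q) (-D + q) := by
    ext n; simp only [Set.mem_ofPred_eq, abs_le, Set.mem_Icc]
    constructor <;> rintro ⟨h1, h2⟩ <;> constructor <;> linarith
  rw [hset, Measure.real, gaussianReal_apply_eq_integral _ hv,
    ENNReal.toReal_ofReal (integral_nonneg fun _ => gaussianPDFReal_nonneg _ _ _)]
  have hle : ∀ n ∈ Set.Icc (-D - q) (-D + q),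
      gaussianPDFReal 0 v (2 * R) ≤ gaussianPDFReal 0 v n := by
    intro n hn
    have hD' := abs_le.1 hD
    have hn2 : n ^ 2 ≤ (2 * R) ^ 2 := by
      apply sq_le_sq'
      · linarith [hn.1]
      · linarith [hn.2]
    unfold gaussianPDFReal
    simp only [sub_zero]
    refine mul_le_left (exp_le_exp.2 ?_)
    rw [neg_div, neg_div, neg_le_neg_iff]
    exact div_le_div_of_nonneg_right hn2 (by positivity)
  calc 2 * gaussianPDFReal 0 v (2 * R) * q
      = ∫ _ in Set.Icc (-D - q) (-D + q), gaussianPDFReal 0 v (2 * R) := by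
        rw [setIntegral_const, Measure.real, Real.volume_Icc, ENNReal.toReal_ofReal (by linarith)]
        rw [smul_eq_mul]; ring
    _ ≤ _ := setIntegral_mono_on (integrableOn_const (by simp))
        (integrable_gaussianPDFReal 0 v).integrableOn measurableSet_Icc hle

theorem absMean_zero_pos {s : ℝ} (hs : 0 < s) : 0 < absMean s 0 := by
  have hv : (s ^ 2).toNNReal ≠ 0 := by simpa using hs.ne'
  have := nullSingletonClass_gaussianReal (μ := 0) hv
  unfold absMean
  rw [integral_pos_iff_support_of_nonneg (fun _ => abs_nonneg _) (integrable_abs_add_gaussian s 0)]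
  have : (Function.support fun n : ℝ => |0 + n|) = {0}ᶜ := by ext; simp
  rw [this, measure_compl (measurableSet_singleton _) (measure_ne_top _ _)]
  simp

/-- The second difference at `D = 0` between `η` and `η / 2`, combined with the Gaussian mass of the
interval of radius `η / 2`. -/
theorem exists_absMean_gap {s : ℝ} (hs : 0 < s) {η : ℝ} (hη : 0 < η) :
    ∃ c > 0, c ≤ absMean s η - absMean s 0 := by
  obtain ⟨c, hc, h⟩ := gaussian_interval_lower hs η
  have h1 := h 0 (η / 2) (by simpa using hη.le) (by positivity) (by linarith)
  have h2 := absMean_second_diff s 0 (by positivity : 0 ≤ η / 2) (by linarith : η / 2 ≤ η)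
  have h3 := absMean_zero_le s (η / 2)
  simp only [zero_add, zero_sub, absMean_neg] at h1 h2
  refine ⟨c * (η / 2) * (η / 2), by positivity, ?_⟩
  nlinarith

/-! ### Softplus and the sigmoid -/

/-- `log (1 + e^u)`. -/
def softplus (u : ℝ) : ℝ := log (1 + exp u)

theorem hasDerivAt_softplus (u : ℝ) : HasDerivAt softplus (sigmoid u) u := by
  have h1 : HasDerivAt (fun u => 1 + exp u) (exp u) u := (Real.hasDerivAt_exp u).const_add 1
  have h2 := h1.log (by positivity)
  have e : sigmoid u = exp u / (1 + exp u) := by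
    rw [sigmoid_def, exp_neg]
    field_simp
    ring
  rw [e]; exact h2

theorem softplus_nonneg (u : ℝ) : 0 ≤ softplus u := Real.log_nonneg (by linarith [exp_pos u])

theorem continuous_softplus : Continuous softplus :=
  continuous_iff_continuousAt.2 fun u => (hasDerivAt_softplus u).continuousAt

theorem convexOn_softplus : ConvexOn ℝ Set.univ softplus := by
  refine Monotone.convexOn_univ_of_deriv (fun u => (hasDerivAt_softplus u).differentiableAt) ?_
  have : deriv softplus = sigmoid := funext fun u => (hasDerivAt_softplus u).deriv
  rw [this]; exact sigmoid_monotone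

theorem softplus_tangent (a b : ℝ) : softplus a + sigmoid a * (b - a) ≤ softplus b := by
  have hd := hasDerivAt_softplus a
  rcases lt_trichotomy a b with h | h | h
  · have := convexOn_softplus.le_slope_of_hasDerivAt (Set.mem_univ a) (Set.mem_univ b) h hd
    rw [slope_def_field, le_div_iff₀ (by linarith)] at this; linarith
  · simp [h]
  · have := convexOn_softplus.slope_le_of_hasDerivAt (Set.mem_univ b) (Set.mem_univ a) h hd
    rw [slope_def_field, div_le_iff₀ (by linarith)] at this; linarith

theorem softplus_mono : Monotone softplus := fun a b h => by
  have := softplus_tangent a b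
  have h2 := mul_nonneg (sigmoid_nonneg a) (sub_nonneg.2 h)
  linarith

theorem abs_softplus_sub_le (a b : ℝ) : |softplus a - softplus b| ≤ |a - b| := by
  have key : ∀ a b, softplus a - softplus b ≤ |a - b| := fun a b => by
    have h1 := softplus_tangent a b
    have h2 : sigmoid a * (a - b) ≤ |a - b| := by
      calc sigmoid a * (a - b) ≤ sigmoid a * |a - b| :=
            mul_le_left (le_abs_self _) (sigmoid_nonneg a)
        _ ≤ 1 * |a - b| := mul_le_right (sigmoid_le_one a) (abs_nonneg _)
        _ = _ := one_mul _
    linarith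
  rw [abs_le]
  have := key b a
  rw [abs_sub_comm] at this
  exact ⟨by linarith, key a b⟩

theorem softplus_neg (u : ℝ) : softplus (-u) = softplus u - u := by
  unfold softplus
  have : 1 + exp u = exp u * (1 + exp (-u)) := by rw [mul_add, ← exp_add]; simp [add_comm]
  rw [this, Real.log_mul (by positivity) (by positivity), Real.log_exp]; ring

theorem sigmoid_ge_exp (t : ℝ) : exp (-|t|) / 2 ≤ sigmoid t := by
  rw [sigmoid_def, exp_neg, div_eq_mul_inv, ← mul_inv]
  refine inv_anti₀ (by positivity) ?_
  have h1 : exp (-t) ≤ exp |t| := exp_le_exp.2 (neg_le_abs t)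
  have h2 : 1 ≤ exp |t| := Real.one_le_exp (abs_nonneg t)
  linarith

/-- The derivative is `sigmoid u * sigmoid (-u)`, and on `[-R, R]` each factor is at least `exp (-R)
/ 2`. -/
theorem sigmoid_gap {R a b : ℝ} (ha : |a| ≤ R) (hb : |b| ≤ R) (hab : a ≤ b) :
    exp (-(2 * R)) / 4 * (b - a) ≤ sigmoid b - sigmoid a := by
  refine Convex.mul_sub_le_image_sub_of_le_deriv (D := Set.Icc (-R) R) (convex_Icc _ _)
    continuous_sigmoid.continuousOn differentiable_sigmoid.differentiableOn ?_ a
    (abs_le.1 ha) b (abs_le.1 hb) hab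
  intro u hu
  rw [interior_Icc] at hu
  have huR : |u| ≤ R := abs_le.2 ⟨hu.1.le, hu.2.le⟩
  rw [Real.deriv_sigmoid]
  simp only [← sigmoid_neg]
  have h1 : exp (-R) / 2 ≤ sigmoid u := le_trans (by gcongr) (sigmoid_ge_exp u)
  have h2 : exp (-R) / 2 ≤ sigmoid (-u) :=
    le_trans (by rw [abs_neg]; gcongr) (sigmoid_ge_exp (-u))
  calc exp (-(2 * R)) / 4 = (exp (-R) / 2) * (exp (-R) / 2) := by
        rw [show -(2 * R) = -R + -R by ring, exp_add]; ring
    _ ≤ _ := mul_le_mul h1 h2 (by positivity) (sigmoid_nonneg _)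

theorem abs_sigmoid_sub_le (a b : ℝ) : |sigmoid a - sigmoid b| ≤ |a - b| := by
  have := Convex.norm_image_sub_le_of_norm_deriv_le (f := sigmoid) (C := 1) (s := Set.univ)
    (x := b) (y := a) (fun x _ => differentiableAt_sigmoid) (fun x _ => ?_) convex_univ
    (Set.mem_univ _) (Set.mem_univ _)
  · simpa using this
  · rw [Real.deriv_sigmoid, norm_eq_abs, abs_le]
    have h1 := sigmoid_pos x
    have h2 := sigmoid_lt_one x
    constructor <;> nlinarith

/-- The increment of the sigmoid over the interval of radius `v` around `a`. -/
def sigmoidIncr (a v : ℝ) : ℝ := sigmoid (a + v) - sigmoid (a - v)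

theorem sigmoidIncr_neg (a v : ℝ) : sigmoidIncr (-a) v = sigmoidIncr a v := by
  unfold sigmoidIncr
  rw [show -a + v = -(a - v) by ring, show -a - v = -(a + v) by ring, sigmoid_neg,
    sigmoid_neg]; ring

theorem sigmoidIncr_le (a : ℝ) {v : ℝ} (hv : 0 ≤ v) : sigmoidIncr a v ≤ 2 * v := by
  have := abs_sigmoid_sub_le (a + v) (a - v)
  rw [show a + v - (a - v) = 2 * v by ring, abs_of_nonneg (by positivity : 0 ≤ 2 * v)] at this
  exact (le_abs_self _).trans this

theorem sigmoidIncr_nonneg (a : ℝ) {v : ℝ} (hv : 0 ≤ v) : 0 ≤ sigmoidIncr a v :=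
  sub_nonneg.2 (sigmoid_monotone (by linarith))

/-- Both increments vanish at `v = 0`. The derivative in `v` of their difference consists of two
differences of `sigmoid'` at points `|a - b|` apart, and `sigmoid' = sigmoid (1 - sigmoid)` is
1-Lipschitz. -/
theorem abs_sigmoidIncr_sub_le (a b : ℝ) {v : ℝ} (hv : 0 ≤ v) :
    |sigmoidIncr a v - sigmoidIncr b v| ≤ 2 * |a - b| * v := by
  have hσ : ∀ x y : ℝ, |sigmoid x * (1 - sigmoid x)
      - sigmoid y * (1 - sigmoid y)| ≤ |x - y| := fun x y => by
    have : sigmoid x * (1 - sigmoid x) - sigmoid y * (1 - sigmoid y)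
        = (sigmoid x - sigmoid y) * (1 - sigmoid x - sigmoid y) := by ring
    rw [this, abs_mul]
    have h1 : |1 - sigmoid x - sigmoid y| ≤ 1 := by
      rw [abs_le]
      have := sigmoid_pos x
      have := sigmoid_pos y
      have := sigmoid_lt_one x
      have := sigmoid_lt_one y
      constructor <;> linarith
    calc _ ≤ |x - y| * 1 := mul_le_mul (abs_sigmoid_sub_le x y) h1 (abs_nonneg _) (abs_nonneg _)
      _ = _ := mul_one _
  have hd : ∀ c w : ℝ, HasDerivAt (fun w => sigmoidIncr c w)
      (sigmoid (c + w) * (1 - sigmoid (c + w))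
        + sigmoid (c - w) * (1 - sigmoid (c - w))) w := fun c w => by
    have h1 := (Real.hasDerivAt_sigmoid (c + w)).comp w ((hasDerivAt_id w).const_add c)
    have h2 := (Real.hasDerivAt_sigmoid (c - w)).comp w ((hasDerivAt_id w).const_sub c)
    have h3 := h1.sub h2
    simp only [mul_one, mul_neg, sub_neg_eq_add] at h3
    exact h3
  have h := Convex.norm_image_sub_le_of_norm_hasDerivWithin_le
    (f := fun w => sigmoidIncr a w - sigmoidIncr b w) (C := 2 * |a - b|) (s := Set.univ)
    (x := 0) (y := v) (fun w _ => ((hd a w).sub (hd b w)).hasDerivWithinAt) (fun w _ => ?_)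
    convex_univ (Set.mem_univ _) (Set.mem_univ _)
  · simpa [sigmoidIncr, abs_of_nonneg hv] using h
  · rw [norm_eq_abs]
    have h1 := hσ (a + w) (b + w)
    have h2 := hσ (a - w) (b - w)
    rw [show a + w - (b + w) = a - b by ring] at h1
    rw [show a - w - (b - w) = a - b by ring] at h2
    rw [abs_le] at h1 h2 ⊢
    constructor <;> linarith [h1.1, h1.2, h2.1, h2.2]

/-- The Bregman divergence of softplus. -/
def logisticExcess (t f : ℝ) : ℝ := softplus f - softplus t - sigmoid t * (f - t)

theorem logisticExcess_nonneg (t f : ℝ) : 0 ≤ logisticExcess t f := by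
  have := softplus_tangent t f; unfold logisticExcess; linarith

/-- The tangents at `t` and at the midpoint `t + u / 2` are added. The growth of the sigmoid between
these two points gives a factor `u / 2`, the remaining half-step another one, which together with
the `1 / 4` of `sigmoid_gap` explains the `16`. -/
theorem logisticExcess_lower {K η t u : ℝ} (ht : |t| ≤ K) (hu : |u| = η) :
    exp (-(2 * (K + η))) / 16 * η ^ 2 ≤ logisticExcess t (t + u) := by
  have h1 := softplus_tangent (t + u / 2) (t + u)
  have h2 := softplus_tangent t (t + u / 2)
  have hη : 0 ≤ η := hu ▸ abs_nonneg _
  have hK : |t| ≤ K + η := by linarith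
  have hm : |t + u / 2| ≤ K + η := by
    refine (abs_add_le _ _).trans (add_le_add ht ?_)
    rw [abs_div, hu, abs_two]; linarith
  have key : exp (-(2 * (K + η))) / 16 * η ^ 2
      ≤ (sigmoid (t + u / 2) - sigmoid t) * (u / 2) := by
    rw [← hu, sq_abs]
    rcases le_total 0 u with h0 | h0
    · have := sigmoid_gap hK hm (by linarith)
      rw [hu]
      nlinarith [mul_le_right this (by linarith : (0:ℝ) ≤ u / 2)]
    · have := sigmoid_gap hm hK (by linarith)
      rw [hu]
      nlinarith [mul_le_right this (by linarith : (0:ℝ) ≤ -u / 2)]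
  unfold logisticExcess
  rw [show t + u - (t + u / 2) = u / 2 by ring] at h1
  rw [show t + u / 2 - t = u / 2 by ring] at h2
  rw [show t + u - t = u by ring]
  linarith

/-! ### The conditional robust risk -/

/-- The conditional mean, given `θ₀ᵀ X = t`, of the worst loss over the predictions in
`{f - G, f + G}`. -/
def profile (τ : Task) (s t f G : ℝ) : ℝ :=
  match τ with
  | .square => (f - t) ^ 2 + s ^ 2 + 2 * |G| * absMean s (f - t) + G ^ 2
  | .absolute => absMean s (f - t) + |G|
  | .logistic => sigmoid (-t) * softplus (f + |G|) + sigmoid t * softplus (|G| - f)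

theorem profile_nonneg (τ : Task) (s t f G : ℝ) : 0 ≤ profile τ s t f G := by
  have h1 := absMean_nonneg s (f - t)
  have h2 := softplus_nonneg (f + |G|)
  have h3 := softplus_nonneg (|G| - f)
  have h4 := sigmoid_nonneg t
  have h5 := sigmoid_nonneg (-t)
  cases τ <;> simp only [profile] <;> positivity

theorem continuous_profile (τ : Task) (s : ℝ) :
    Continuous fun p : ℝ × ℝ × ℝ => profile τ s p.1 p.2.1 p.2.2 := by
  have h1 := continuous_absMean s
  have h2 := continuous_softplus
  have h3 := continuous_sigmoid
  cases τ <;> simp only [profile] <;> fun_prop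

theorem profile_mono (τ : Task) (s t f : ℝ) {G G' : ℝ} (h : |G| ≤ |G'|) :
    profile τ s t f G ≤ profile τ s t f G' := by
  have h1 := absMean_nonneg s (f - t)
  have h4 := sigmoid_nonneg t
  have h5 := sigmoid_nonneg (-t)
  cases τ <;> simp only [profile]
  · have : G ^ 2 ≤ G' ^ 2 := sq_le_sq.2 h
    nlinarith
  · linarith
  · exact add_le_add (mul_le_left (softplus_mono (by linarith)) h5)
      (mul_le_left (softplus_mono (by linarith)) h4)

theorem profile_logistic_excess (s t f : ℝ) :
    profile .logistic s t f 0 - profile .logistic s t t 0 = logisticExcess t f := by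
  simp only [profile, abs_zero, add_zero, zero_sub, softplus_neg, sigmoid_neg, logisticExcess]
  ring

theorem profile_bayes (τ : Task) (s t f : ℝ) : profile τ s t t 0 ≤ profile τ s t f 0 := by
  rcases τ with _ | _ | _
  · simp only [profile, abs_zero, sub_self]; nlinarith [sq_nonneg (f - t)]
  · simp only [profile, abs_zero, sub_self]; linarith [absMean_zero_le s (f - t)]
  · have := logisticExcess_nonneg t f
    rw [← profile_logistic_excess s] at this; linarith

/-- The rate has to be uniform in the prediction `f`. For the logistic loss the derivative in `G` is
a mean of `sigmoid (f + G)` and `sigmoid (G - f)` with weights at least `exp (-|t|) / 2`, and these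
two values add up to at least `sigmoid f + sigmoid (-f) = 1`. For the regression losses the rate
does not depend on `t`. -/
theorem profile_growth (τ : Task) {s : ℝ} (hs : 0 < s) : ∃ c > 0, ∀ t f G G' : ℝ, 0 ≤ G → G ≤ G' →
      c * exp (-|t|) * (G' - G) ≤ profile τ s t f G' - profile τ s t f G := by
  have hN := absMean_zero_pos hs
  rcases τ with _ | _ | _
  · refine ⟨2 * absMean s 0, by positivity, fun t f G G' h0 h => ?_⟩
    simp only [profile, abs_of_nonneg h0, abs_of_nonneg (h0.trans h)]
    have h1 := absMean_zero_le s (f - t)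
    have h2 : exp (-|t|) ≤ 1 := Real.exp_le_one_iff.2 (by simp)
    have h3 : 2 * absMean s 0 * exp (-|t|) * (G' - G) ≤ 2 * absMean s 0 * 1 * (G' - G) := by gcongr
    nlinarith [mul_le_right h1 (sub_nonneg.2 h)]
  · refine ⟨1, one_pos, fun t f G G' h0 h => ?_⟩
    simp only [profile, abs_of_nonneg h0, abs_of_nonneg (h0.trans h)]
    have h2 : exp (-|t|) ≤ 1 := Real.exp_le_one_iff.2 (by simp)
    nlinarith
  · refine ⟨1 / 4, by norm_num, fun t f G G' h0 h => ?_⟩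
    simp only [profile, abs_of_nonneg h0, abs_of_nonneg (h0.trans h)]
    have h1 := softplus_tangent (f + G) (f + G')
    have h2 := softplus_tangent (G - f) (G' - f)
    have e1 := sigmoid_ge_exp t
    have e2 := sigmoid_ge_exp (-t)
    rw [abs_neg] at e2
    have m1 : sigmoid f ≤ sigmoid (f + G) := sigmoid_monotone (by linarith)
    have m2 : 1 - sigmoid f ≤ sigmoid (G - f) := by
      rw [← sigmoid_neg]; exact sigmoid_monotone (by linarith)
    have p1 := sigmoid_nonneg f
    have p2 : 0 ≤ 1 - sigmoid f := by linarith [sigmoid_le_one f]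
    have hE := exp_pos (-|t|)
    have key : exp (-|t|) / 2 ≤ sigmoid (-t) * sigmoid (f + G) + sigmoid t * sigmoid (G - f) := by
      calc exp (-|t|) / 2
          = exp (-|t|) / 2 * sigmoid f + exp (-|t|) / 2 * (1 - sigmoid f) := by ring
        _ ≤ _ := add_le_add (mul_le_mul e2 m1 p1 (sigmoid_nonneg _))
            (mul_le_mul e1 m2 p2 (sigmoid_nonneg _))
    have k1 := mul_le_left h1 (sigmoid_nonneg (-t))
    have k2 := mul_le_left h2 (sigmoid_nonneg t)
    have k3 := mul_le_right key (sub_nonneg.2 h)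
    have k4 := mul_nonneg hE.le (sub_nonneg.2 h)
    nlinarith

/-- The weight in front is needed for the square loss only; the other two profiles are globally
1-Lipschitz. -/
theorem profile_lipschitz (τ : Task) (s : ℝ) :
    ∃ C > 0, ∀ t f G f' G' : ℝ, |profile τ s t f' G' - profile τ s t f G| ≤
      C * (1 + |f - t| + |G| + |f' - t| + |G'|) * (|f' - f| + |G' - G|) := by
  rcases τ with _ | _ | _
  · refine ⟨2 + 2 * absMean s 0, by have := absMean_nonneg s 0; positivity,
      fun t f G f' G' => ?_⟩
    have hN := absMean_nonneg s 0
    simp only [profile]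
    have e : (f' - t) ^ 2 + s ^ 2 + 2 * |G'| * absMean s (f' - t) + G' ^ 2
        - ((f - t) ^ 2 + s ^ 2 + 2 * |G| * absMean s (f - t) + G ^ 2)
        = (f' - f) * ((f' - t) + (f - t)) + 2 * |G'| * (absMean s (f' - t) - absMean s (f - t))
          + 2 * absMean s (f - t) * (|G'| - |G|) + (G' - G) * (G' + G) := by ring
    rw [e]
    have h1 : |(f' - f) * ((f' - t) + (f - t))| ≤ |f' - f| * (|f' - t| + |f - t|) := by
      rw [abs_mul]; gcongr; exact abs_add_le _ _
    have h2 : |2 * |G'| * (absMean s (f' - t) - absMean s (f - t))| ≤ 2 * |G'| * |f' - f| := by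
      rw [abs_mul, abs_of_nonneg (by positivity : 0 ≤ 2 * |G'|)]
      refine mul_le_left ?_
      have := abs_absMean_sub_le s (f' - t) (f - t)
      rwa [show f' - t - (f - t) = f' - f by ring] at this
    have h3 : |2 * absMean s (f - t) * (|G'| - |G|)| ≤ 2 * (|f - t| + absMean s 0) * |G' - G| := by
      have := absMean_nonneg s (f - t)
      rw [abs_mul, abs_of_nonneg (by positivity : 0 ≤ 2 * absMean s (f - t))]
      exact mul_le_mul (by linarith [absMean_le s (f - t)]) (abs_abs_sub_abs_le _ _) (abs_nonneg _)
        (by positivity)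
    have h4 : |(G' - G) * (G' + G)| ≤ |G' - G| * (|G'| + |G|) := by
      rw [abs_mul]; gcongr; exact abs_add_le _ _
    refine (abs_add_le _ _).trans ((add_le_add ((abs_add_le _ _).trans
      (add_le_add ((abs_add_le _ _).trans (add_le_add h1 h2)) h3)) h4).trans ?_)
    have hp : ∀ u v : ℝ, 0 ≤ |u| * |v| := fun u v => by positivity
    have : (2 + 2 * absMean s 0) * (1 + |f - t| + |G| + |f' - t| + |G'|) * (|f' - f| + |G' - G|)
        = 2 * (1 + |f - t| + |G| + |f' - t| + |G'|) * (|f' - f| + |G' - G|) +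
          2 * absMean s 0 * (|f' - f| + |G' - G|) +
          2 * absMean s 0 * ((|f - t| + |G| + |f' - t| + |G'|) * (|f' - f| + |G' - G|)) := by ring
    rw [this]
    have c1 : 0 ≤ 2 * absMean s 0 *
        ((|f - t| + |G| + |f' - t| + |G'|) * (|f' - f| + |G' - G|)) := by positivity
    have c2 : 0 ≤ absMean s 0 * |f' - f| := by positivity
    linarith [hp (f' - t) (f' - f), hp (f - t) (f' - f), hp G (f' - f), hp G' (f' - f),
      hp (f' - t) (G' - G), hp (f - t) (G' - G), hp G (G' - G), hp G' (G' - G),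
      abs_nonneg (f' - f), abs_nonneg (G' - G)]
  · refine ⟨1, one_pos, fun t f G f' G' => ?_⟩
    simp only [profile]
    have h1 := abs_absMean_sub_le s (f' - t) (f - t)
    have h2 := abs_abs_sub_abs_le G' G
    rw [show f' - t - (f - t) = f' - f by ring] at h1
    have h3 : |absMean s (f' - t) + |G'| - (absMean s (f - t) + |G|)| ≤ |f' - f| + |G' - G| := by
      rw [show absMean s (f' - t) + |G'| - (absMean s (f - t) + |G|)
        = (absMean s (f' - t) - absMean s (f - t)) + (|G'| - |G|) by ring]
      exact (abs_add_le _ _).trans (add_le_add h1 h2)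
    refine h3.trans (le_mul_of_one_le_left (by positivity) ?_)
    have : 0 ≤ |f - t| + |G| + |f' - t| + |G'| := by positivity
    linarith
  · refine ⟨1, one_pos, fun t f G f' G' => ?_⟩
    simp only [profile]
    have h2 := abs_abs_sub_abs_le G' G
    have h1 := abs_softplus_sub_le (f' + |G'|) (f + |G|)
    have h1' := abs_softplus_sub_le (|G'| - f') (|G| - f)
    have k1 : |f' + |G'| - (f + |G|)| ≤ |f' - f| + |G' - G| := by
      rw [show f' + |G'| - (f + |G|) = (f' - f) + (|G'| - |G|) by ring]
      exact (abs_add_le _ _).trans (add_le_add le_rfl h2)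
    have k2 : |(|G'| - f') - (|G| - f)| ≤ |f' - f| + |G' - G| := by
      rw [show (|G'| - f') - (|G| - f) = (|G'| - |G|) - (f' - f) by ring]
      exact (abs_sub _ _).trans (by linarith)
    have p1 := sigmoid_nonneg t
    have p2 := sigmoid_nonneg (-t)
    have p3 := sigmoid_neg t
    have h3 : |sigmoid (-t) * softplus (f' + |G'|) + sigmoid t * softplus (|G'| - f')
        - (sigmoid (-t) * softplus (f + |G|) + sigmoid t * softplus (|G| - f))|
        ≤ |f' - f| + |G' - G| := by
      rw [show sigmoid (-t) * softplus (f' + |G'|) + sigmoid t * softplus (|G'| - f')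
        - (sigmoid (-t) * softplus (f + |G|) + sigmoid t * softplus (|G| - f))
        = sigmoid (-t) * (softplus (f' + |G'|) - softplus (f + |G|))
          + sigmoid t * (softplus (|G'| - f') - softplus (|G| - f)) by ring]
      refine (abs_add_le _ _).trans ?_
      rw [abs_mul, abs_mul, abs_of_nonneg p1, abs_of_nonneg p2]
      calc _ ≤ sigmoid (-t) * (|f' - f| + |G' - G|)
            + sigmoid t * (|f' - f| + |G' - G|) := by
            gcongr
            · exact h1.trans k1
            · exact h1'.trans k2
        _ = _ := by rw [p3]; ring
    refine h3.trans (le_mul_of_one_le_left (by positivity) ?_)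
    have : 0 ≤ |f - t| + |G| + |f' - t| + |G'| := by positivity
    linarith

theorem profile_self_le (τ : Task) (s t : ℝ) :
    profile τ s t t 0 ≤ 1 + s ^ 2 + absMean s 0 + |t| := by
  have hN := absMean_nonneg s 0
  rcases τ with _ | _ | _
  · simp only [profile, sub_self, abs_zero]; nlinarith [abs_nonneg t]
  · simp only [profile, sub_self, abs_zero]; nlinarith [abs_nonneg t, sq_nonneg s]
  · simp only [profile, abs_zero, add_zero, zero_sub]
    have hsp : ∀ u, softplus u ≤ 1 + |u| := fun u => by
      have := abs_softplus_sub_le u 0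
      have h0 : softplus 0 ≤ 1 := by
        unfold softplus
        rw [Real.exp_zero]; norm_num
        linarith [Real.log_two_lt_d9]
      rw [sub_zero] at this
      linarith [le_abs_self (softplus u - softplus 0)]
    have p1 := sigmoid_nonneg t
    have p2 := sigmoid_nonneg (-t)
    have p3 := sigmoid_neg t
    have h1 := mul_le_left (hsp t) p2
    have h2 := mul_le_left (hsp (-t)) p1
    rw [abs_neg] at h2
    have : sigmoid (-t) * (1 + |t|) + sigmoid t * (1 + |t|) = 1 + |t| := by rw [p3]; ring
    nlinarith [sq_nonneg s]

theorem sq_abs_add_abs_eq (u G : ℝ) : (fun n : ℝ => (|u + n| + |G|) ^ 2) =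
    fun n => u ^ 2 + G ^ 2 + 2 * u * n + n ^ 2 + 2 * |G| * |u + n| := by
  funext n
  linear_combination sq_abs (u + n) + sq_abs G

theorem integrable_sq_abs_add_gaussian (s u G : ℝ) :
    Integrable (fun n : ℝ => (|u + n| + |G|) ^ 2) (𝓝₀ s) := by
  rw [sq_abs_add_abs_eq]
  exact (((integrable_const _).add ((integrable_id_gaussian s).const_mul _)).add
    (integrable_sq_gaussian s)).add ((integrable_abs_add_gaussian s u).const_mul _)

theorem integral_sq_abs_add_gaussian (s u G : ℝ) : ∫ n, (|u + n| + |G|) ^ 2 ∂𝓝₀ s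
      = u ^ 2 + s ^ 2 + 2 * |G| * absMean s u + G ^ 2 := by
  have i1 := (integrable_id_gaussian s).const_mul (2 * u)
  have i2 := integrable_sq_gaussian s
  have i3 := (integrable_abs_add_gaussian s u).const_mul (2 * |G|)
  have j1 : Integrable (fun n : ℝ => u ^ 2 + G ^ 2 + 2 * u * n) (𝓝₀ s) :=
    (integrable_const _).add i1
  have j2 : Integrable (fun n : ℝ => u ^ 2 + G ^ 2 + 2 * u * n + n ^ 2)
    (𝓝₀ s) := j1.add i2
  rw [sq_abs_add_abs_eq, integral_add j2 i3, integral_add j1 i2, integral_add (integrable_const _) i1,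
    integral_const_mul, integral_const_mul, integral_sq_gaussian, integral_id_gaussianReal]
  simp only [integral_const, probReal_univ, smul_eq_mul, absMean]
  ring

/-- For the square loss the profile is the Gaussian mean of `(|f - t + n| + |G|) ^ 2`, the square of
a nonnegative convex function. For the logistic loss, softplus is convex and increasing and is
applied to convex functions of `(f, G)`. -/
theorem profile_convex (τ : Task) (s t : ℝ) :
    ConvexOn ℝ Set.univ fun p : ℝ × ℝ => profile τ s t p.1 p.2 := by
  refine ⟨convex_univ, ?_⟩
  rintro ⟨f, G⟩ - ⟨f', G'⟩ - a b ha hb hab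
  have hG : |a * G + b * G'| ≤ a * |G| + b * |G'| := by
    refine (abs_add_le _ _).trans ?_
    rw [abs_mul, abs_mul, abs_of_nonneg ha, abs_of_nonneg hb]
  have hi := integrable_sq_abs_add_gaussian s
  rcases τ with _ | _ | _ <;> simp only [profile, smul_eq_mul, Prod.smul_mk, Prod.mk_add_mk]
  · rw [← integral_sq_abs_add_gaussian, ← integral_sq_abs_add_gaussian,
      ← integral_sq_abs_add_gaussian, ← integral_const_mul, ← integral_const_mul, ←
      integral_add ((hi _ _).const_mul a) ((hi _ _).const_mul b)]
    refine integral_mono (hi _ _) (((hi _ _).const_mul a).add ((hi _ _).const_mul b)) fun n => ?_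
    have e : a * f + b * f' - t + n = a * (f - t + n) + b * (f' - t + n) := by
      linear_combination (t - n) * hab
    have h1 : |a * f + b * f' - t + n| ≤ a * |f - t + n| + b * |f' - t + n| := by
      rw [e]
      refine (abs_add_le _ _).trans ?_
      rw [abs_mul, abs_mul, abs_of_nonneg ha, abs_of_nonneg hb]
    show (|a * f + b * f' - t + n| + |a * G + b * G'|) ^ 2 ≤
      a * (|f - t + n| + |G|) ^ 2 + b * (|f' - t + n| + |G'|) ^ 2
    have h2 : (|a * f + b * f' - t + n| + |a * G + b * G'|) ^ 2 ≤
        (a * (|f - t + n| + |G|) + b * (|f' - t + n| + |G'|)) ^ 2 := by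
      apply pow_le_pow_left₀ (by positivity); linarith
    have h3 := (Even.convexOn_pow (𝕜 := ℝ) even_two).2 (Set.mem_univ (|f - t + n| + |G|))
      (Set.mem_univ (|f' - t + n| + |G'|)) ha hb hab
    simp only [smul_eq_mul] at h3
    exact h2.trans h3
  · have h1 := (convexOn_absMean s).2 (Set.mem_univ (f - t)) (Set.mem_univ (f' - t)) ha hb hab
    have e : a * (f - t) + b * (f' - t) = a * f + b * f' - t := by linear_combination (-t) * hab
    simp only [smul_eq_mul, e] at h1
    nlinarith
  · have h1 := convexOn_softplus.2 (Set.mem_univ (f + |G|)) (Set.mem_univ (f' + |G'|)) ha hb hab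
    have h2 := convexOn_softplus.2 (Set.mem_univ (|G| - f)) (Set.mem_univ (|G'| - f')) ha hb hab
    simp only [smul_eq_mul] at h1 h2
    have m1 : softplus (a * f + b * f' + |a * G + b * G'|) ≤
        softplus (a * (f + |G|) + b * (f' + |G'|)) := softplus_mono (by linarith)
    have m2 : softplus (|a * G + b * G'| - (a * f + b * f')) ≤
        softplus (a * (|G| - f) + b * (|G'| - f')) := softplus_mono (by linarith)
    have k1 := mul_le_left (m1.trans h1) (sigmoid_nonneg (-t))
    have k2 := mul_le_left (m2.trans h2) (sigmoid_nonneg t)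
    linarith

/-- A nonnegative convex function that vanishes at `0` and is at least `c η` at `± η` is at least
`c (|u| - η)`. -/
theorem ConvexOn.linear_lower_of_two_points {φ : ℝ → ℝ} (hφ : ConvexOn ℝ Set.univ φ)
    (h0 : φ 0 ≤ 0) (hnn : ∀ u, 0 ≤ φ u) {c η : ℝ} (hc : 0 ≤ c) (hη : 0 < η)
    (h1 : ∀ u, |u| = η → c * η ≤ φ u) (u : ℝ) : c * (|u| - η) ≤ φ u := by
  rcases le_total |u| η with h | h
  · exact (mul_nonpos_of_nonneg_of_nonpos hc (by linarith)).trans (hnn u)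
  · have hu : 0 < |u| := hη.trans_le h
    have h2 := hφ.2 (Set.mem_univ u) (Set.mem_univ 0) (by positivity : 0 ≤ η / |u|)
      (by rw [sub_nonneg, div_le_one hu]; exact h : 0 ≤ 1 - η / |u|) (by ring)
    simp only [smul_eq_mul, mul_zero, add_zero] at h2
    have h3 := h1 (η / |u| * u) (by
      rw [abs_mul, abs_div, abs_abs, abs_of_pos hη]; field_simp)
    have h4 : (1 - η / |u|) * φ 0 ≤ 0 := mul_nonpos_of_nonneg_of_nonpos
      (by rw [sub_nonneg, div_le_one hu]; exact h) h0
    have h5 : c * η ≤ η / |u| * φ u := by linarith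
    rw [div_mul_eq_mul_div, le_div_iff₀ hu] at h5
    have h6 : c * |u| ≤ φ u := by
      have : η * (c * |u|) ≤ η * φ u := by linarith
      exact le_of_mul_le_mul_left this hη
    nlinarith

/-- Growth is only quadratic near `f = t`, so a linear lower bound needs the offset `η`. By
convexity it suffices to bound the excess from below at distance exactly `η`; for the square loss
the inequality `η (|u| - η) ≤ u ^ 2` is direct. -/
theorem profile_closeness (τ : Task) {s : ℝ} (hs : 0 < s) (K : ℝ) {η : ℝ} (hη : 0 < η) :
    ∃ c > 0, ∀ t f : ℝ, |t| ≤ K → c * (|f - t| - η) ≤ profile τ s t f 0 - profile τ s t t 0 := by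
  rcases τ with _ | _ | _
  · refine ⟨η, hη, fun t f _ => ?_⟩
    simp only [profile, abs_zero, sub_self]
    nlinarith [sq_abs (f - t), sq_nonneg (|f - t| - η), abs_nonneg (f - t)]
  · obtain ⟨c, hc, h⟩ := exists_absMean_gap hs hη
    refine ⟨c / η, by positivity, fun t f _ => ?_⟩
    have hcv : ConvexOn ℝ Set.univ fun u => absMean s u - absMean s 0 :=
      (convexOn_absMean s).sub (concaveOn_const _ convex_univ)
    have := ConvexOn.linear_lower_of_two_points hcv (by simp)
      (fun u => by linarith [absMean_zero_le s u]) (by positivity : 0 ≤ c / η) hη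
      (fun u hu => by rw [← absMean_abs s u, hu, div_mul_cancel₀ _ hη.ne']; exact h) (f - t)
    simpa [profile] using this
  · refine ⟨exp (-(2 * (K + η))) / 16 * η, by positivity, fun t f ht => ?_⟩
    rw [profile_logistic_excess]
    have hcv : ConvexOn ℝ Set.univ fun u => logisticExcess t (t + u) := by
      have h1 : ConvexOn ℝ Set.univ fun u => softplus (t + u) :=
        convexOn_softplus.translate_right t |>.subset (Set.subset_univ _) convex_univ |> fun h => by
          simpa [Function.comp_def] using h
      have h2 : ConcaveOn ℝ Set.univ fun u => softplus t + sigmoid t * u := by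
        refine ⟨convex_univ, fun x _ y _ a b _ _ hab => ?_⟩
        simp only [smul_eq_mul]
        apply le_of_eq
        linear_combination (softplus t) * hab
      have h3 := h1.sub h2
      have e : (fun u => logisticExcess t (t + u))
          = (fun u => softplus (t + u)) - fun u => softplus t + sigmoid t * u := by
        funext u; simp only [logisticExcess, Pi.sub_apply]; ring
      rw [e]; exact h3
    have := ConvexOn.linear_lower_of_two_points hcv (by simp [logisticExcess])
      (fun u => logisticExcess_nonneg _ _)
      (by positivity : 0 ≤ exp (-(2 * (K + η))) / 16 * η) hη
      (fun u hu => by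
        have := logisticExcess_lower ht hu
        linarith [this]) (f - t)
    simpa using this

/-! ### Effect of moving the weight of one feature, symmetrised over its sign. -/

theorem absMean_second_diff_nonneg (s D : ℝ) {p q : ℝ} (hqp : |q| ≤ |p|) :
    absMean s (D + q) + absMean s (D - q) ≤ absMean s (D + p) + absMean s (D - p) := by
  have h := absMean_second_diff s D (abs_nonneg q) hqp
  have h0 : 0 ≤ 2 * (|p| - |q|) * (𝓝₀ s).real {n | |D + n| ≤ |q|} :=
    mul_nonneg (by linarith) measureReal_nonneg
  have e : ∀ r : ℝ, absMean s (D + |r|) + absMean s (D - |r|)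
      = absMean s (D + r) + absMean s (D - r) := fun r => by
    rcases abs_cases r with ⟨h, _⟩ | ⟨h, _⟩ <;> rw [h]
    rw [sub_neg_eq_add, ← sub_eq_add_neg, add_comm]
  rw [e, e] at h
  linarith

/-- The symmetrised logistic profile along the direction of one feature. -/
def logisticPair (A B w G v : ℝ) : ℝ :=
  profile .logistic 1 (B + w) (A + v) G + profile .logistic 1 (B - w) (A - v) G

/-- The derivative of the symmetrised logistic profile. -/
def logisticSlope (A B w G v : ℝ) : ℝ :=
  (1 - sigmoid (B + w)) * sigmoid (A + v + G) - sigmoid (B + w) * sigmoid (G - (A + v)) -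
    (1 - sigmoid (B - w)) * sigmoid (A - v + G) + sigmoid (B - w) * sigmoid (G - (A - v))

theorem logisticPair_hasDerivAt (A B w v : ℝ) {G : ℝ} (hG : 0 ≤ G) :
    HasDerivAt (logisticPair A B w G)
      (logisticSlope A B w G v) v := by
  have d1 := (hasDerivAt_softplus (A + v + G)).comp v (((hasDerivAt_id v).const_add A).add_const G)
  have d2 := (hasDerivAt_softplus (G - (A + v))).comp v (((hasDerivAt_id v).const_add A).const_sub G)
  have d3 := (hasDerivAt_softplus (A - v + G)).comp v (((hasDerivAt_id v).const_sub A).add_const G)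
  have d4 := (hasDerivAt_softplus (G - (A - v))).comp v (((hasDerivAt_id v).const_sub A).const_sub G)
  have h := ((d1.const_mul (1 - sigmoid (B + w))).add (d2.const_mul (sigmoid (B + w)))).add
    ((d3.const_mul (1 - sigmoid (B - w))).add (d4.const_mul (sigmoid (B - w))))
  have e : logisticPair A B w G = (fun v => (1 - sigmoid (B + w)) * softplus (A + v + G)
      + sigmoid (B + w) * softplus (G - (A + v))
      + ((1 - sigmoid (B - w)) * softplus (A - v + G)
      + sigmoid (B - w) * softplus (G - (A - v)))) := by
    funext v; simp only [logisticPair, profile, abs_of_nonneg hG, sigmoid_neg]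
  rw [e]
  exact h.congr_deriv (by unfold logisticSlope; ring)

/-- The derivative of the symmetrised profile differs from the difference of two sigmoid increments
by a term of the order of the shifts. -/
theorem logisticPair_deriv_close {A B w v G : ℝ} (hw : 0 ≤ w) (hv : 0 ≤ v) (hvw : v ≤ 2 * w)
    (hG : 0 ≤ G) :
    |logisticSlope A B w G v - (sigmoidIncr A v - sigmoidIncr A w)| ≤ 8 * w * (|A - B| + G) := by
  unfold logisticSlope
  set a := sigmoid (B + w)
  set b := sigmoid (B - w)
  have ha0 : 0 ≤ a := sigmoid_nonneg _
  have ha1 : a ≤ 1 := sigmoid_le_one _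
  have hb0 : 0 ≤ b := sigmoid_nonneg _
  have hb1 : b ≤ 1 := sigmoid_le_one _
  have hab : a - b = sigmoidIncr B w := rfl
  have F1 := abs_le.1 (abs_sigmoidIncr_sub_le (A + G) A hv)
  have F2 := abs_le.1 (abs_sigmoidIncr_sub_le (A - G) A hv)
  rw [show A + G - A = G by ring, abs_of_nonneg hG] at F1
  rw [show A - G - A = -G by ring, abs_neg, abs_of_nonneg hG] at F2
  have F3 := abs_le.1 (abs_sigmoidIncr_sub_le A B hw)
  have e1 : sigmoidIncr (A + G) v = sigmoid (A + v + G) - sigmoid (A - v + G) := by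
    unfold sigmoidIncr; ring_nf
  have e2 : sigmoidIncr (A - G) v = sigmoid (G - (A - v)) - sigmoid (G - (A + v)) := by
    rw [← sigmoidIncr_neg]; unfold sigmoidIncr; ring_nf
  have s1 : ∀ y, 1 ≤ sigmoid (y + G) + sigmoid (G - y) ∧
      sigmoid (y + G) + sigmoid (G - y) ≤ 1 + 2 * G := fun y => by
    have h1 : sigmoid y ≤ sigmoid (y + G) := sigmoid_monotone (by linarith)
    have h2 : sigmoid (-y) ≤ sigmoid (G - y) := sigmoid_monotone (by linarith)
    have h3 := (abs_le.1 (abs_sigmoid_sub_le (y + G) y)).2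
    have h4 := (abs_le.1 (abs_sigmoid_sub_le (G - y) (-y))).2
    rw [show y + G - y = G by ring, abs_of_nonneg hG] at h3
    rw [show G - y - -y = G by ring, abs_of_nonneg hG] at h4
    rw [sigmoid_neg] at h2 h4
    constructor <;> linarith
  have sp := s1 (A + v)
  have sm := s1 (A - v)
  have hI0 := sigmoidIncr_nonneg B hw
  have hI1 := sigmoidIncr_le B hw
  set P1 := sigmoid (A + v + G)
  set P2 := sigmoid (A - v + G)
  set Q1 := sigmoid (G - (A + v))
  set Q2 := sigmoid (G - (A - v))
  -- With the averaged weight `(a + b) / 2` the derivative splits into increments at `A + G` and `A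
  -- - G`, each close to the increment at `A`, and into the increment at `B` times half the sum of
  -- `P1`, `Q1`, `P2`, `Q2`, which lies between `1` and `1 + 2 G`.
  have key : (1 - a) * P1 - a * Q1 - (1 - b) * P2 + b * Q2
      = (1 - (a + b) / 2) * sigmoidIncr (A + G) v + (a + b) / 2 * sigmoidIncr (A - G) v
        - (a - b) / 2 * ((P1 + Q1) + (P2 + Q2)) := by
    rw [e1, e2]; ring
  rw [key, hab]
  have hc0 : 0 ≤ (a + b) / 2 := by linarith
  have hc1 : 0 ≤ 1 - (a + b) / 2 := by linarith
  have u1 := mul_le_left F1.1 hc1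
  have u2 := mul_le_left F1.2 hc1
  have u3 := mul_le_left F2.1 hc0
  have u4 := mul_le_left F2.2 hc0
  have hS1 : 2 ≤ (P1 + Q1) + (P2 + Q2) := by linarith
  have hS2 : (P1 + Q1) + (P2 + Q2) ≤ 2 + 4 * G := by linarith
  have u5 := mul_le_left hS1 (by linarith : 0 ≤ sigmoidIncr B w / 2)
  have u6 := mul_le_left hS2 (by linarith : 0 ≤ sigmoidIncr B w / 2)
  have u7 : sigmoidIncr B w * G ≤ 2 * w * G := mul_le_right hI1 hG
  have u8 : v * G ≤ 2 * w * G := mul_le_right hvw hG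
  have u9 : 0 ≤ w * |A - B| := by positivity
  rw [abs_le]
  constructor <;> nlinarith

/-- Up to the error of `logisticPair_deriv_close` the slope at `v` is the increment of the sigmoid
at radius `v` minus that at radius `w`: negative below `w`, positive above. On the quarter-width
interval crossed by the move, `v` stays at distance at least `w / 4` from `w`, which gives a
decrease of order `(w / 4) ^ 2`; the error `8 w (|A - B| + G)` is multiplied by the length `w / 4`.
-/
theorem logisticPair_flip_decrease {K R : ℝ} (hK : 1 ≤ K) :
    ∃ c > 0, ∀ A B w G r r' : ℝ, 0 ≤ w → w ≤ K → 0 ≤ G →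
      ((r = 1 / 2 ∧ r' = 3 / 4) ∨ (r = 3 / 2 ∧ r' = 5 / 4)) →
      logisticPair A B w G (r' * w) - logisticPair A B w G (r * w) ≤
        2 * w ^ 2 * (|A - B| + G) - if |A| ≤ R then c * w ^ 2 else 0 := by
  set c := exp (-(2 * (R + 2 * K))) / 4 with hc
  have hcpos : 0 < c := by positivity
  refine ⟨c / 16, by positivity, fun A B w G r r' hw hwK hG hr => ?_⟩
  have hE : 0 ≤ |A - B| + G := by positivity
  have gap : ∀ v v' : ℝ, 0 ≤ v → v ≤ v' → v' ≤ 2 * K → 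
      (if |A| ≤ R then c * (v' - v) else 0) ≤ sigmoidIncr A v' - sigmoidIncr A v := by
    intro v v' hv hvv hvK
    have h1 : sigmoid (A + v) ≤ sigmoid (A + v') := sigmoid_monotone (by linarith)
    have h2 : sigmoid (A - v') ≤ sigmoid (A - v) := sigmoid_monotone (by linarith)
    unfold sigmoidIncr
    split_ifs with hA
    · have hA' := abs_le.1 hA
      have := sigmoid_gap (R := R + 2 * K) (a := A + v) (b := A + v')
        (abs_le.2 ⟨by linarith, by linarith⟩) (abs_le.2 ⟨by linarith, by linarith⟩) (by linarith)
      have e : A + v' - (A + v) = v' - v := by ring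
      rw [e, ← hc] at this
      linarith
    · linarith
  have hd := fun v => logisticPair_hasDerivAt A B w v hG
  rcases hr with ⟨rfl, rfl⟩ | ⟨rfl, rfl⟩
  · have := Convex.image_sub_le_mul_sub_of_deriv_le (D := Set.Icc (1 / 2 * w) (3 / 4 * w))
      (f := logisticPair A B w G)
      (C := 8 * w * (|A - B| + G) - if |A| ≤ R then c * (w / 4) else 0) (convex_Icc _ _)
      (fun v _ => (hd v).continuousAt.continuousWithinAt)
      (fun v _ => (hd v).differentiableAt.differentiableWithinAt)
      (fun v hv => by
        rw [interior_Icc] at hv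
        have hv0 : 0 ≤ v := by linarith [hv.1]
        rw [(hd v).deriv]
        have h1 := (abs_le.1 (logisticPair_deriv_close (A := A) (B := B) hw hv0
          (by linarith [hv.2]) hG)).2
        have h2 := gap v w hv0 (by linarith [hv.2]) (by linarith)
        have h3 : (if |A| ≤ R then c * (w / 4) else 0) ≤ if |A| ≤ R then c * (w - v) else 0 := by
          split_ifs
          · exact mul_le_left (by linarith [hv.2]) hcpos.le
          · exact le_rfl
        linarith)
      (1 / 2 * w) ⟨le_rfl, by linarith⟩ (3 / 4 * w) ⟨by linarith, le_rfl⟩ (by linarith)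
    refine this.trans ?_
    split_ifs <;> nlinarith
  · have := Convex.mul_sub_le_image_sub_of_le_deriv (D := Set.Icc (5 / 4 * w) (3 / 2 * w))
      (f := logisticPair A B w G)
      (C := -(8 * w * (|A - B| + G)) + if |A| ≤ R then c * (w / 4) else 0) (convex_Icc _ _)
      (fun v _ => (hd v).continuousAt.continuousWithinAt)
      (fun v _ => (hd v).differentiableAt.differentiableWithinAt)
      (fun v hv => by
        rw [interior_Icc] at hv
        have hv0 : 0 ≤ v := by linarith [hv.1]
        rw [(hd v).deriv]
        have h1 := (abs_le.1 (logisticPair_deriv_close (A := A) (B := B) hw hv0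
          (by linarith [hv.2]) hG)).1
        have h2 := gap w v hw (by linarith [hv.1]) (by linarith [hv.2])
        have h3 : (if |A| ≤ R then c * (w / 4) else 0) ≤ if |A| ≤ R then c * (v - w) else 0 := by
          split_ifs
          · exact mul_le_left (by linarith [hv.1]) hcpos.le
          · exact le_rfl
        linarith)
      (5 / 4 * w) ⟨le_rfl, by linarith⟩ (3 / 2 * w) ⟨by linarith, le_rfl⟩ (by linarith)
    have h2 : (if |A| ≤ R then c * (w / 4) else 0) * (w / 4)
        = if |A| ≤ R then c / 16 * w ^ 2 else 0 := by split_ifs <;> ring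
    nlinarith

/-- Moving the weight of one feature from the boundary of `[1/2, 3/2]` towards the true weight
decreases the symmetrised profile, up to a term of the order of the shifts. -/
theorem profile_flip_decrease (τ : Task) {s K R : ℝ} (hs : 0 < s) (hK : 1 ≤ K) (hR : 0 ≤ R) :
    ∃ c > 0, ∀ A B w G r r' : ℝ, |w| ≤ K → 0 ≤ G →
      ((r = 1 / 2 ∧ r' = 3 / 4) ∨ (r = 3 / 2 ∧ r' = 5 / 4)) →
      profile τ s (B + w) (A + r' * w) G + profile τ s (B - w) (A - r' * w) G
        - (profile τ s (B + w) (A + r * w) G + profile τ s (B - w) (A - r * w) G) ≤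
        2 * w ^ 2 * (|A - B| + G) - if |A| ≤ R ∧ |B| ≤ R then c * w ^ 2 else 0 := by
  -- Either move halves the residual `(r - 1) w`, from `|w| / 2` to `|w| / 4`, so for the regression
  -- losses only second differences at these two radii matter.
  have par : ∀ {r r' : ℝ} (w : ℝ), ((r = 1 / 2 ∧ r' = 3 / 4) ∨ (r = 3 / 2 ∧ r' = 5 / 4)) →
      |(r - 1) * w| = |w| / 2 ∧ |(r' - 1) * w| = |w| / 4 := by
    rintro r r' w (⟨rfl, rfl⟩ | ⟨rfl, rfl⟩) <;> rw [abs_mul, abs_mul] <;> norm_num <;>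
      constructor <;> ring
  have argp : ∀ A B w r : ℝ, A + r * w - (B + w) = (A - B) + (r - 1) * w := by intros; ring
  have argm : ∀ A B w r : ℝ, A - r * w - (B - w) = (A - B) - (r - 1) * w := by intros; ring
  rcases τ with _ | _ | _
  · refine ⟨1 / 4, by norm_num, fun A B w G r r' hw hG hr => ?_⟩
    obtain ⟨h1, h2⟩ := par w hr
    have h3 := absMean_second_diff_nonneg s (A - B) (p := (r - 1) * w) (q := (r' - 1) * w)
      (by rw [h1, h2]; linarith [abs_nonneg w])
    simp only [profile, argp, argm, abs_of_nonneg hG]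
    have h4 := mul_le_left h3 hG
    have q1 : ((r - 1) * w) ^ 2 = w ^ 2 / 4 := by rw [← sq_abs, h1, div_pow, sq_abs]; norm_num
    have q2 : ((r' - 1) * w) ^ 2 = w ^ 2 / 16 := by rw [← sq_abs, h2, div_pow, sq_abs]; norm_num
    have h5 : 0 ≤ 2 * w ^ 2 * (|A - B| + G) := by positivity
    have h6 : (if |A| ≤ R ∧ |B| ≤ R then 1 / 4 * w ^ 2 else 0) ≤ 1 / 4 * w ^ 2 := by
      split_ifs
      · exact le_rfl
      · positivity
    nlinarith [sq_nonneg w]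
  · obtain ⟨c, hc, h⟩ := gaussian_interval_lower hs (2 * R + K)
    refine ⟨c / 8, by positivity, fun A B w G r r' hw hG hr => ?_⟩
    obtain ⟨h1, h2⟩ := par w hr
    simp only [profile, argp, argm]
    have h5 : 0 ≤ 2 * w ^ 2 * (|A - B| + G) := by positivity
    have ea : ∀ r : ℝ, absMean s (A - B + |r|) + absMean s (A - B - |r|)
        = absMean s (A - B + r) + absMean s (A - B - r) := fun r => by
      rcases abs_cases r with ⟨h, _⟩ | ⟨h, _⟩ <;> rw [h]
      rw [sub_neg_eq_add, ← sub_eq_add_neg, add_comm]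
    have h3 := absMean_second_diff s (A - B) (p := |(r - 1) * w|) (q := |(r' - 1) * w|)
      (abs_nonneg _) (by rw [h1, h2]; linarith [abs_nonneg w])
    rw [ea, ea, h1, h2] at h3
    split_ifs with hAB
    · have hD : |A - B| ≤ 2 * R + K := by
        refine (abs_sub _ _).trans ?_; linarith [hAB.1, hAB.2]
      have h4 := h (A - B) (|w| / 4) hD (by positivity) (by linarith [abs_nonneg w])
      have h6 := mul_le_left h4 (by linarith [abs_nonneg w] : 0 ≤ 2 * (|w| / 2 - |w| / 4))
      have h7 := sq_abs w
      nlinarith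
    · have h6 : 0 ≤ 2 * (|w| / 2 - |w| / 4) * (𝓝₀ s).real {n | |A - B + n| ≤ |w| / 4} :=
        mul_nonneg (by linarith [abs_nonneg w]) measureReal_nonneg
      linarith
  · obtain ⟨c, hc, h⟩ := logisticPair_flip_decrease (R := R) hK
    refine ⟨c, hc, fun A B w G r r' hw hG hr => ?_⟩
    have h0 := h A B |w| G r r' (abs_nonneg w) hw hG hr
    have e : ∀ r, logisticPair A B |w| G (r * |w|) =
        profile .logistic s (B + w) (A + r * w) G + profile .logistic s (B - w) (A - r * w) G := by
      intro r
      unfold logisticPair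
      rcases abs_cases w with ⟨h, _⟩ | ⟨h, _⟩ <;> rw [h]
      · rfl
      · rw [mul_neg, sub_neg_eq_add, sub_neg_eq_add, ← sub_eq_add_neg, ← sub_eq_add_neg, add_comm]
        rfl
    rw [e, e, sq_abs] at h0
    refine h0.trans ?_
    have : (if |A| ≤ R ∧ |B| ≤ R then c * w ^ 2 else 0) ≤ if |A| ≤ R then c * w ^ 2 else 0 := by
      have := mul_nonneg hc.le (sq_nonneg w)
      by_cases hA : |A| ≤ R
      · by_cases hB : |B| ≤ R
        · rw [if_pos ⟨hA, hB⟩, if_pos hA]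
        · rw [if_neg (fun h => hB h.2), if_pos hA]; exact this
      · rw [if_neg (fun h => hA h.1), if_neg hA]
    linarith

/-! ### Conditional risks as integrals over the response -/

/-- The sign of the derivative of the loss at the prediction `f` is positive. -/
def Task.increasing (τ : Task) (f y : ℝ) : Prop :=
  match τ with
  | .square => y < f
  | .absolute => y < f
  | .logistic => 1 / 2 < y

open Classical in
/-- The loss after an attack that replaces the prediction `f` by `fp` where the loss increases in
the prediction, and by `fm` where it decreases. -/
def Task.robustLoss (τ : Task) (f fp fm y : ℝ) : ℝ :=
  if τ.increasing f y then τ.loss fp y else τ.loss fm y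

theorem Task.robustLoss_self (τ : Task) (f y : ℝ) : τ.robustLoss f f f y = τ.loss f y := by
  simp [Task.robustLoss]

theorem gaussianReal_eq_map_const_sub (t : ℝ) (v : NNReal) :
    gaussianReal t v = (gaussianReal 0 v).map (fun n => t - n) := by
  rw [gaussianReal_map_const_sub, sub_zero]

theorem measurable_loss (τ : Task) : Measurable fun p : ℝ × ℝ => τ.loss p.1 p.2 := by
  cases τ <;> simp only [Task.loss] <;> fun_prop

theorem measurableSet_increasing (τ : Task) : MeasurableSet {p : ℝ × ℝ | τ.increasing p.1 p.2} := by
  cases τ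
  · exact measurableSet_lt measurable_snd measurable_fst
  · exact measurableSet_lt measurable_snd measurable_fst
  · exact measurableSet_lt measurable_const measurable_snd

theorem measurable_robustLoss (τ : Task) {α : Type*} [MeasurableSpace α] {f fp fm y : α → ℝ}
    (hf : Measurable f) (hp : Measurable fp) (hm : Measurable fm) (hy : Measurable y) :
    Measurable fun a => τ.robustLoss (f a) (fp a) (fm a) (y a) := by
  unfold Task.robustLoss
  refine Measurable.ite ((hf.prodMk hy) (measurableSet_increasing τ)) ?_ ?_
  · exact (measurable_loss τ).comp (hp.prodMk hy)
  · exact (measurable_loss τ).comp (hm.prodMk hy)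

theorem response_logistic_eq (s t : ℝ) :
    Task.response .logistic s t = ENNReal.ofReal (sigmoid (-t)) • Measure.dirac 1 +
      ENNReal.ofReal (sigmoid t) • Measure.dirac 0 := by
  have h : 1 / (1 + exp t) = sigmoid (-t) := by rw [sigmoid_def, neg_neg, one_div]
  simp only [Task.response, h, sigmoid_neg, sub_sub_cancel]

theorem integrable_response_logistic (s t : ℝ) (F : ℝ → ℝ) :
    Integrable F (Task.response .logistic s t) := by
  rw [response_logistic_eq]
  exact ((integrable_dirac enorm_lt_top).smul_measure ENNReal.ofReal_ne_top).add_measure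
    ((integrable_dirac enorm_lt_top).smul_measure ENNReal.ofReal_ne_top)

theorem integral_response_logistic (s t : ℝ) (F : ℝ → ℝ) : ∫ y, F y ∂Task.response .logistic s t
      = sigmoid (-t) * F 1 + sigmoid t * F 0 := by
  rw [response_logistic_eq, integral_add_measure
    ((integrable_dirac enorm_lt_top).smul_measure ENNReal.ofReal_ne_top)
    ((integrable_dirac enorm_lt_top).smul_measure ENNReal.ofReal_ne_top),
    integral_smul_measure, integral_smul_measure, integral_dirac, integral_dirac,
    ENNReal.toReal_ofReal (sigmoid_nonneg _), ENNReal.toReal_ofReal (sigmoid_nonneg _)]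
  rfl

theorem integral_gaussian_eq {t : ℝ} (s : ℝ) {F : ℝ → ℝ} (hF : Measurable F) :
    ∫ y, F y ∂gaussianReal t (s ^ 2).toNNReal
      = ∫ n, F (t - n) ∂𝓝₀ s := by
  rw [gaussianReal_eq_map_const_sub, integral_map (by fun_prop) hF.aestronglyMeasurable]

theorem integrable_gaussian_iff {t : ℝ} (s : ℝ) {F : ℝ → ℝ} (hF : Measurable F) :
    Integrable F (gaussianReal t (s ^ 2).toNNReal)
      ↔ Integrable (fun n => F (t - n)) (𝓝₀ s) := by
  rw [gaussianReal_eq_map_const_sub, integrable_map_measure hF.aestronglyMeasurable (by fun_prop)]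
  rfl

theorem measurable_robustLoss_right (τ : Task) (f fp fm : ℝ) : Measurable (τ.robustLoss f fp fm) :=
  measurable_robustLoss τ measurable_const measurable_const measurable_const measurable_id

theorem integrable_sq_loss_gaussian (s u : ℝ) : Integrable (fun n : ℝ => (u + n) ^ 2) (𝓝₀ s) := by
  have := integrable_sq_abs_add_gaussian s u 0
  simpa using this

theorem integrable_robustLoss (τ : Task) (s t f fp fm : ℝ) :
    Integrable (τ.robustLoss f fp fm) (τ.response s t) := by
  rcases τ with _ | _ | _
  · show Integrable _ (gaussianReal t (s ^ 2).toNNReal)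
    rw [integrable_gaussian_iff s (measurable_robustLoss_right _ f fp fm)]
    refine ((integrable_sq_loss_gaussian s (fp - t)).add
      (integrable_sq_loss_gaussian s (fm - t))).mono'
      ((measurable_robustLoss_right _ f fp fm).comp (by fun_prop)).aestronglyMeasurable
      (.of_forall fun n => ?_)
    simp only [Task.robustLoss, Task.loss, Pi.add_apply]
    have h1 : fp - (t - n) = fp - t + n := by ring
    have h2 : fm - (t - n) = fm - t + n := by ring
    rw [h1, h2]
    split_ifs <;> rw [norm_of_nonneg (sq_nonneg _)] <;> nlinarith [sq_nonneg (fp - t + n), sq_nonneg (fm - t + n)]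
  · show Integrable _ (gaussianReal t (s ^ 2).toNNReal)
    rw [integrable_gaussian_iff s (measurable_robustLoss_right _ f fp fm)]
    refine ((integrable_abs_add_gaussian s (fp - t)).add
      (integrable_abs_add_gaussian s (fm - t))).mono'
      ((measurable_robustLoss_right _ f fp fm).comp (by fun_prop)).aestronglyMeasurable
      (.of_forall fun n => ?_)
    simp only [Task.robustLoss, Task.loss, Pi.add_apply]
    have h1 : fp - (t - n) = fp - t + n := by ring
    have h2 : fm - (t - n) = fm - t + n := by ring
    rw [h1, h2]
    split_ifs <;> rw [norm_of_nonneg (abs_nonneg _)] <;>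
      linarith [abs_nonneg (fp - t + n), abs_nonneg (fm - t + n)]
  · exact integrable_response_logistic s t _

/-- At every response the prediction used is pushed away from the response by at least `G`, so in
regression the residual `|f - y|` grows by at least `G`. One-sided bounds on `fp` and `fm` suffice,
because an attack that achieves more only raises the loss. -/
theorem profile_le_integral_robustLoss (τ : Task) (s t : ℝ) {f fp fm G : ℝ} (hG : 0 ≤ G)
    (hp : f + G ≤ fp) (hm : fm ≤ f - G) :
    profile τ s t f G ≤ ∫ y, τ.robustLoss f fp fm y ∂τ.response s t := by
  have hi := integrable_robustLoss τ s t f fp fm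
  have hmeas := measurable_robustLoss_right τ f fp fm
  rcases τ with _ | _ | _
  · change Integrable _ (gaussianReal t (s ^ 2).toNNReal) at hi
    rw [integrable_gaussian_iff s hmeas] at hi
    show _ ≤ ∫ y, _ ∂gaussianReal t (s ^ 2).toNNReal
    rw [integral_gaussian_eq s hmeas]
    simp only [profile]
    rw [← integral_sq_abs_add_gaussian]
    refine integral_mono (integrable_sq_abs_add_gaussian _ _ _) hi fun n => ?_
    simp only [Task.robustLoss, Task.loss, abs_of_nonneg hG]
    have e : f - t + n = f - (t - n) := by ring
    by_cases h : Task.square.increasing f (t - n)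
    · have h' : t - n < f := h
      rw [if_pos h]
      have h1 : |f - t + n| = f - (t - n) := by rw [e, abs_of_nonneg (by linarith)]
      rw [h1]
      have a1 : 0 ≤ f - (t - n) + G := by linarith
      have a2 : f - (t - n) + G ≤ fp - (t - n) := by linarith
      exact pow_le_pow_left₀ a1 a2 2
    · have h' : f ≤ t - n := not_lt.1 h
      rw [if_neg h]
      have h1 : |f - t + n| = (t - n) - f := by rw [e, abs_of_nonpos (by linarith)]; ring
      rw [h1, ← neg_sq (fm - (t - n))]
      have a1 : 0 ≤ t - n - f + G := by linarith
      have a2 : t - n - f + G ≤ -(fm - (t - n)) := by linarith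
      exact pow_le_pow_left₀ a1 a2 2
  · change Integrable _ (gaussianReal t (s ^ 2).toNNReal) at hi
    rw [integrable_gaussian_iff s hmeas] at hi
    show _ ≤ ∫ y, _ ∂gaussianReal t (s ^ 2).toNNReal
    rw [integral_gaussian_eq s hmeas]
    have e0 : profile .absolute s t f G
        = ∫ n, (|f - t + n| + |G|) ∂𝓝₀ s := by
      rw [integral_add (integrable_abs_add_gaussian _ _) (integrable_const _)]
      simp [profile, absMean]
    rw [e0]
    refine integral_mono ((integrable_abs_add_gaussian _ _).add (integrable_const _)) hi fun n => ?_
    simp only [Task.robustLoss, Task.loss, abs_of_nonneg hG]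
    have e : f - t + n = f - (t - n) := by ring
    by_cases h : Task.absolute.increasing f (t - n)
    · have h' : t - n < f := h
      rw [if_pos h, e, abs_of_nonneg (by linarith)]
      have a2 : f - (t - n) + G ≤ fp - (t - n) := by linarith
      exact a2.trans (le_abs_self _)
    · have h' : f ≤ t - n := not_lt.1 h
      rw [if_neg h, e, abs_of_nonpos (by linarith)]
      have a2 : -(f - (t - n)) + G ≤ -(fm - (t - n)) := by linarith
      exact a2.trans (neg_le_abs _)
  · rw [integral_response_logistic]
    simp only [profile, Task.robustLoss, Task.loss, Task.increasing, abs_of_nonneg hG]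
    norm_num
    refine add_le_add (mul_le_left ?_ (sigmoid_nonneg _))
      (mul_le_left ?_ (sigmoid_nonneg _))
    · exact softplus_mono hp
    · exact softplus_mono (by linarith : G - f ≤ -fm)

/-- In regression the side of the attack is decided at `f`, while the profile is centred at `F`. No
comparison of `f` and `F` is needed: on either side the residual is at most `|F - y| + G + e`. In
the logistic task the side depends on the response alone. -/
theorem integral_robustLoss_le (τ : Task) (s : ℝ) :
    ∃ C > 0, ∀ t f fp fm F G e : ℝ, 0 ≤ G → 0 ≤ e → |fp - (F + G)| ≤ e → |fm - (F - G)| ≤ e →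
      ∫ y, τ.robustLoss f fp fm y ∂τ.response s t ≤
        profile τ s t F G + C * (1 + |F - t| + G) * e + C * e ^ 2 := by
  rcases τ with _ | _ | _
  · refine ⟨2 + 2 * absMean s 0, by have := absMean_nonneg s 0; positivity,
      fun t f fp fm F G e hG he hp hm => ?_⟩
    have hi := integrable_robustLoss .square s t f fp fm
    have hmeas := measurable_robustLoss_right .square f fp fm
    change Integrable _ (gaussianReal t (s ^ 2).toNNReal) at hi
    rw [integrable_gaussian_iff s hmeas] at hi
    show ∫ y, _ ∂gaussianReal t (s ^ 2).toNNReal ≤ _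
    rw [integral_gaussian_eq s hmeas]
    have hb : ∀ n, Task.square.robustLoss f fp fm (t - n) ≤ (|F - t + n| + |G + e|) ^ 2 := by
      intro n
      have hGe : |G + e| = G + e := abs_of_nonneg (by linarith)
      simp only [Task.robustLoss, Task.loss, hGe]
      have hp' := abs_le.1 hp
      have hm' := abs_le.1 hm
      have ha := le_abs_self (F - t + n)
      have ha' := neg_abs_le (F - t + n)
      split_ifs
      · rw [sq_le_sq, abs_of_nonneg (by positivity : 0 ≤ |F - t + n| + (G + e)), abs_le]
        constructor <;> linarith
      · rw [sq_le_sq, abs_of_nonneg (by positivity : 0 ≤ |F - t + n| + (G + e)), abs_le]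
        constructor <;> linarith
    refine (integral_mono hi (integrable_sq_abs_add_gaussian _ _ _) hb).trans ?_
    rw [integral_sq_abs_add_gaussian]
    simp only [profile, abs_of_nonneg hG, abs_of_nonneg (by linarith : 0 ≤ G + e)]
    have h1 := absMean_le s (F - t)
    have h0 := absMean_nonneg s 0
    have h2 := mul_le_left h1 he
    have h3 : 0 ≤ absMean s 0 * ((|F - t| + G) * e) := by positivity
    have h4 : 0 ≤ absMean s 0 * e ^ 2 := by positivity
    have h5 : 0 ≤ |F - t| * e := by positivity
    nlinarith [mul_nonneg hG he]
  · refine ⟨1, one_pos, fun t f fp fm F G e hG he hp hm => ?_⟩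
    have hi := integrable_robustLoss .absolute s t f fp fm
    have hmeas := measurable_robustLoss_right .absolute f fp fm
    change Integrable _ (gaussianReal t (s ^ 2).toNNReal) at hi
    rw [integrable_gaussian_iff s hmeas] at hi
    show ∫ y, _ ∂gaussianReal t (s ^ 2).toNNReal ≤ _
    rw [integral_gaussian_eq s hmeas]
    have hb : ∀ n, Task.absolute.robustLoss f fp fm (t - n) ≤ |F - t + n| + (G + e) := by
      intro n
      simp only [Task.robustLoss, Task.loss]
      have hp' := abs_le.1 hp
      have hm' := abs_le.1 hm
      have ha := le_abs_self (F - t + n)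
      have ha' := neg_abs_le (F - t + n)
      split_ifs <;> rw [abs_le] <;> constructor <;> linarith
    refine (integral_mono hi ((integrable_abs_add_gaussian _ _).add (integrable_const _)) hb).trans ?_
    rw [integral_add' (integrable_abs_add_gaussian _ _) (integrable_const _)]
    simp only [profile, abs_of_nonneg hG, integral_const, probReal_univ, one_smul]
    have : absMean s (F - t) = ∫ n, |F - t + n| ∂𝓝₀ s := rfl
    rw [← this]
    have h5 : 0 ≤ |F - t| * e := by positivity
    nlinarith [mul_nonneg hG he, sq_nonneg e]
  · refine ⟨1, one_pos, fun t f fp fm F G e hG he hp hm => ?_⟩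
    rw [integral_response_logistic]
    simp only [profile, Task.robustLoss, Task.loss, Task.increasing, abs_of_nonneg hG]
    norm_num
    have h1 : softplus fp ≤ softplus (F + G) + e := by
      have := (abs_le.1 (abs_softplus_sub_le fp (F + G))).2
      linarith
    have h2 : softplus (-fm) ≤ softplus (G - F) + e := by
      have := (abs_le.1 (abs_softplus_sub_le (-fm) (G - F))).2
      rw [show -fm - (G - F) = -(fm - (F - G)) by ring, abs_neg] at this
      linarith
    have p1 := sigmoid_nonneg t
    have p2 := sigmoid_nonneg (-t)
    have k1 := mul_le_left h1 p2
    have k2 := mul_le_left h2 p1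
    have k3 : sigmoid (-t) * e + sigmoid t * e = e := by rw [sigmoid_neg]; ring
    have h5 : 0 ≤ |F - t| * e := by positivity
    have h6 := mul_nonneg hG he
    change sigmoid (-t) * softplus fp + sigmoid t * softplus (-fm) ≤ _
    nlinarith [sq_nonneg e]

theorem integral_loss_eq (τ : Task) (s t f : ℝ) :
    ∫ y, τ.loss f y ∂τ.response s t = profile τ s t f 0 := by
  have e : τ.robustLoss f f f = τ.loss f := funext (τ.robustLoss_self f)
  apply le_antisymm
  · obtain ⟨C, -, h⟩ := integral_robustLoss_le τ s
    have := h t f f f f 0 0 le_rfl le_rfl (by simp) (by simp)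
    rw [e] at this
    simpa using this
  · have := profile_le_integral_robustLoss τ s t (f := f) (fp := f) (fm := f) le_rfl (by simp)
      (by simp)
    rwa [e] at this

theorem measurable_integral_robustLoss (τ : Task) (s : ℝ) {α : Type*} [MeasurableSpace α]
    {t f fp fm : α → ℝ} (ht : Measurable t) (hf : Measurable f) (hp : Measurable fp)
    (hm : Measurable fm) :
    Measurable fun a => ∫ y, τ.robustLoss (f a) (fp a) (fm a) y ∂τ.response s (t a) := by
  have reg : ∀ τ : Task, Measurable fun a =>
      ∫ n, τ.robustLoss (f a) (fp a) (fm a) (t a - n) ∂𝓝₀ s := by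
    intro τ
    refine (StronglyMeasurable.integral_prod_right (f := fun a n =>
      τ.robustLoss (f a) (fp a) (fm a) (t a - n)) ?_).measurable
    refine Measurable.stronglyMeasurable ?_
    exact measurable_robustLoss τ (f := fun p : α × ℝ => f p.1) (fp := fun p : α × ℝ => fp p.1)
      (fm := fun p : α × ℝ => fm p.1) (y := fun p : α × ℝ => t p.1 - p.2)
      (by fun_prop) (by fun_prop) (by fun_prop) (by fun_prop)
  have hmeas : ∀ (τ : Task) (a : α), Measurable (τ.robustLoss (f a) (fp a) (fm a)) := fun τ a =>
    measurable_robustLoss_right τ _ _ _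
  rcases τ with _ | _ | _
  · convert reg .square using 2 with a
    exact integral_gaussian_eq s (hmeas _ a)
  · convert reg .absolute using 2 with a
    exact integral_gaussian_eq s (hmeas _ a)
  · simp only [integral_response_logistic]
    have h1 : ∀ c : ℝ, Measurable fun a => Task.logistic.robustLoss (f a) (fp a) (fm a) c := fun c =>
      measurable_robustLoss _ hf hp hm measurable_const
    have h2 := continuous_sigmoid.measurable
    exact ((h2.comp ht.neg).mul (h1 1)).add ((h2.comp ht).mul (h1 0))

section

theorem integral_robustLoss_nonneg (τ : Task) (s t f fp fm : ℝ) :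
    0 ≤ ∫ y, τ.robustLoss f fp fm y ∂τ.response s t := by
  rcases τ with _ | _ | _
  · refine integral_nonneg fun y => ?_
    simp only [Task.robustLoss, Task.loss]; split_ifs <;> exact sq_nonneg _
  · refine integral_nonneg fun y => ?_
    simp only [Task.robustLoss, Task.loss]; split_ifs <;> exact abs_nonneg _
  · rw [integral_response_logistic]
    have h1 : ∀ u, 0 ≤ log (1 + exp u) := softplus_nonneg
    simp only [Task.robustLoss, Task.loss]
    refine add_nonneg (mul_nonneg (sigmoid_nonneg _) ?_)
      (mul_nonneg (sigmoid_nonneg _) ?_) <;> split_ifs <;> simp [h1]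

/-! ### The gradient attack on a gated network -/

theorem gate_neg (v e : ℝ) : gate (-v) e = -gate v e := by
  unfold gate; rw [abs_neg]; split_ifs <;> simp

/-- An active node with positive preactivation stays active. An active one with negative
preactivation that is switched off jumps to `0`, which is no less than `v + δ` because `δ ≤ e`. An
inactive node can only be switched on to a nonnegative value. -/
theorem gate_add_ge {v e δ : ℝ} (hδ : 0 ≤ δ) (hδe : δ ≤ e) :
    gate v e + (if e ≤ |v| then δ else 0) ≤ gate (v + δ) e := by
  unfold gate
  by_cases h : e ≤ |v|
  · rw [if_pos h, if_pos h]
    split_ifs with h'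
    · exact le_rfl
    · rcases le_abs'.1 h with h1 | h1
      · linarith
      · exact absurd (h1.trans ((le_add_of_nonneg_right hδ).trans (le_abs_self _))) h'
  · rw [if_neg h, if_neg h, add_zero]
    split_ifs with h'
    · rcases le_abs'.1 h' with h1 | h1
      · exact absurd (le_abs'.2 (Or.inl (by linarith : v ≤ -e))) h
      · linarith
    · exact le_rfl

theorem abs_gate_le (v e : ℝ) : |gate v e| ≤ |v| := by unfold gate; split_ifs <;> simp

theorem abs_gate_sub_le (v e : ℝ) : |gate v e - v| ≤ if |v| < e then e else 0 := by
  unfold gate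
  by_cases h : e ≤ |v|
  · rw [if_pos h, if_neg (not_lt.2 h)]; simp
  · rw [if_neg h, if_pos (not_le.1 h), zero_sub, abs_neg]; exact (not_le.1 h).le

theorem measurable_gate (e : ℝ) : Measurable fun v => gate v e :=
  Measurable.ite (measurableSet_le measurable_const (by fun_prop)) measurable_id measurable_const

variable {d H : ℕ}

/-- The preactivation `zᵀ W_h`. -/
def Network.pre (N : Network d H) (z : 𝔼^d) (h : Fin H) : ℝ := ∑ i, z i * N.W i h

/-- The sum of the weights of the active nodes. -/
def Network.slope (N : Network d H) (z : 𝔼^d) : 𝔼^d :=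
  WithLp.toLp 2 fun i => ∑ h, if N.b h ≤ |N.pre z h| then N.W i h else 0

/-- The normalised slope. -/
def Network.dir (N : Network d H) (z : 𝔼^d) : 𝔼^d := ‖N.slope z‖⁻¹ • N.slope z

/-- `f(z + ε g / ‖g‖)`. -/
def Network.up (N : Network d H) (ε : ℝ) (z : 𝔼^d) : ℝ := N.eval (z + ε • N.dir z)

/-- `f(z - ε g / ‖g‖)`. -/
def Network.down (N : Network d H) (ε : ℝ) (z : 𝔼^d) : ℝ := N.eval (z - ε • N.dir z)

theorem Network.eval_eq (N : Network d H) (z : 𝔼^d) :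
    N.eval z = ∑ h, gate (N.pre z h) (N.b h) := rfl

theorem Network.pre_add (N : Network d H) (z w : 𝔼^d) (h : Fin H) :
    N.pre (z + w) h = N.pre z h + N.pre w h := by
  simp [Network.pre, add_mul, sum_add_distrib]

theorem Network.pre_smul (N : Network d H) (c : ℝ) (z : 𝔼^d) (h : Fin H) :
    N.pre (c • z) h = c * N.pre z h := by
  simp [Network.pre, mul_sum, mul_assoc]

theorem Network.continuous_pre (N : Network d H) (h : Fin H) : Continuous fun z => N.pre z h := by
  unfold Network.pre; fun_prop

theorem Network.measurable_eval (N : Network d H) : Measurable N.eval :=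
  measurable_sum _ fun h _ => (measurable_gate _).comp (N.continuous_pre h).measurable

theorem Network.measurable_slope (N : Network d H) : Measurable N.slope := by
  refine (WithLp.measurable_toLp 2 _).comp (measurable_pi_lambda _ fun i => ?_)
  refine measurable_sum _ fun h _ => Measurable.ite ?_ measurable_const measurable_const
  exact measurableSet_le measurable_const (N.continuous_pre h).measurable.abs

theorem Network.measurable_dir (N : Network d H) : Measurable N.dir :=
  (N.measurable_slope.norm.inv).smul N.measurable_slope

theorem Network.measurable_up (N : Network d H) (ε : ℝ) : Measurable (N.up ε) :=
  N.measurable_eval.comp (measurable_id.add (N.measurable_dir.const_smul ε))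

theorem Network.measurable_down (N : Network d H) (ε : ℝ) : Measurable (N.down ε) :=
  N.measurable_eval.comp (measurable_id.sub (N.measurable_dir.const_smul ε))

theorem Network.inner_slope (N : Network d H) (z w : 𝔼^d) :
    inner ℝ (N.slope z) w = ∑ h, if N.b h ≤ |N.pre z h| then N.pre w h else 0 := by
  rw [PiLp.inner_apply]
  simp only [Network.slope, Network.pre]
  have : ∀ i : Fin d, inner ℝ (∑ h, if N.b h ≤ |∑ j, z j * N.W j h| then N.W i h else 0) (w i)
      = ∑ h, if N.b h ≤ |∑ j, z j * N.W j h| then w i * N.W i h else 0 := fun i => by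
    simp only [RCLike.inner_apply, conj_trivial, mul_sum, mul_ite, mul_zero]
  simp only [this]
  rw [sum_comm]
  refine sum_congr rfl fun h _ => ?_
  split_ifs <;> simp

/-- Off the thresholds the set of active nodes is locally constant, so the network coincides near
`z` with a linear form. -/
theorem Network.hasGradientAt_eval (N : Network d H) {z : 𝔼^d}
    (hz : ∀ h, |N.pre z h| ≠ N.b h) : HasGradientAt N.eval (N.slope z) z := by
  have hev : ∀ᶠ w in 𝓝 z, N.eval w = inner ℝ (N.slope z) w := by
    have : ∀ᶠ w in 𝓝 z, ∀ h, (N.b h ≤ |N.pre w h| ↔ N.b h ≤ |N.pre z h|) := by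
      rw [eventually_all]
      intro h
      have hc : ContinuousAt (fun w => |N.pre w h|) z := (N.continuous_pre h).abs.continuousAt
      rcases lt_or_gt_of_ne (hz h) with h1 | h1
      · filter_upwards [hc.eventually_lt_const h1] with w hw
        exact ⟨fun h2 => absurd h2 (not_le.2 hw), fun h2 => absurd h2 (not_le.2 h1)⟩
      · filter_upwards [hc.eventually_const_lt h1] with w hw
        exact ⟨fun _ => h1.le, fun _ => hw.le⟩
    filter_upwards [this] with w hw
    rw [N.inner_slope, N.eval_eq]
    refine sum_congr rfl fun h _ => ?_
    unfold gate
    simp only [hw h]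
  rw [hasGradientAt_iff_hasFDerivAt]
  refine HasFDerivAt.congr_of_eventuallyEq ?_ hev
  exact ((InnerProductSpace.toDual ℝ _) (N.slope z)).hasFDerivAt

/-- The responses at which the loss is differentiable in the prediction `f` with non-zero
derivative. -/
def Task.Regular (τ : Task) (f y : ℝ) : Prop :=
  match τ with
  | .square => y ≠ f
  | .absolute => y ≠ f
  | .logistic => y = 1 ∨ y = 0

theorem ae_regular (τ : Task) {s : ℝ} (hs : 0 < s) (t f : ℝ) :
    ∀ᵐ y ∂τ.response s t, τ.Regular f y := by
  have hv : (s ^ 2).toNNReal ≠ 0 := by simpa using hs.ne'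
  have := nullSingletonClass_gaussianReal (μ := t) hv
  have hg : ∀ᵐ y ∂gaussianReal t (s ^ 2).toNNReal, y ≠ f := by rw [ae_iff]; simp
  rcases τ with _ | _ | _
  · exact hg
  · exact hg
  · rw [response_logistic_eq]
    refine ae_add_measure_iff.2 ⟨Measure.ae_smul_measure ?_ _, Measure.ae_smul_measure ?_ _⟩
    · exact ae_dirac_iff (by simp only [Task.Regular]; measurability) |>.2 (Or.inl rfl)
    · exact ae_dirac_iff (by simp only [Task.Regular]; measurability) |>.2 (Or.inr rfl)

theorem exists_hasDerivAt_loss (τ : Task) {f y : ℝ} (h : τ.Regular f y) :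
    ∃ c : ℝ, HasDerivAt (fun u => τ.loss u y) c f ∧
      ((τ.increasing f y ∧ 0 < c) ∨ (¬ τ.increasing f y ∧ c < 0)) := by
  rcases τ with _ | _ | _
  · refine ⟨2 * (f - y), ?_, ?_⟩
    · exact (((hasDerivAt_id f).sub_const y).pow 2).congr_deriv (by simp)
    · rcases lt_or_gt_of_ne h with h1 | h1
      · exact Or.inl ⟨h1, by linarith⟩
      · exact Or.inr ⟨not_lt.2 h1.le, by linarith⟩
  · rcases lt_or_gt_of_ne h with h1 | h1
    · refine ⟨1, ?_, Or.inl ⟨h1, one_pos⟩⟩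
      have h3 := (hasDerivAt_abs_pos (sub_pos.2 h1)).comp f ((hasDerivAt_id f).sub_const y)
      rw [mul_one] at h3
      exact h3
    · refine ⟨-1, ?_, Or.inr ⟨not_lt.2 h1.le, by norm_num⟩⟩
      have h3 := (hasDerivAt_abs_neg (sub_neg.2 h1)).comp f ((hasDerivAt_id f).sub_const y)
      rw [mul_one] at h3
      exact h3
  · rcases h with rfl | rfl
    · refine ⟨sigmoid f, ?_, Or.inl ⟨by norm_num [Task.increasing], sigmoid_pos f⟩⟩
      have e : (fun u => Task.logistic.loss u 1) = softplus := by
        funext u; simp [Task.loss, softplus]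
      rw [e]; exact hasDerivAt_softplus f
    · refine ⟨-sigmoid (-f), ?_,
        Or.inr ⟨by norm_num [Task.increasing], by linarith [sigmoid_pos (-f)]⟩⟩
      have e : (fun u => Task.logistic.loss u 0) = fun u => softplus (-u) := by
        funext u; simp [Task.loss, softplus]
      rw [e]
      exact ((hasDerivAt_softplus (-f)).comp f (hasDerivAt_neg f)).congr_deriv (by simp)

/-- The gradient of the loss is the slope of the network times the scalar derivative of the loss.
Normalisation leaves only the sign of the latter, which is what `Task.increasing` records. -/
theorem Network.attackedLoss_eq (N : Network d H) (τ : Task) (ε : ℝ)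
    {z : 𝔼^d} (hz : ∀ h, |N.pre z h| ≠ N.b h) {y : ℝ}
    (hy : τ.Regular (N.eval z) y) :
    attackedLoss ε τ.loss N.eval z y = τ.robustLoss (N.eval z) (N.up ε z) (N.down ε z) y := by
  obtain ⟨c, hc, hsign⟩ := exists_hasDerivAt_loss τ hy
  have hg : HasGradientAt (fun w => τ.loss (N.eval w) y) (c • N.slope z) z := by
    have h1 := N.hasGradientAt_eval hz
    rw [hasGradientAt_iff_hasFDerivAt] at h1 ⊢
    have h2 := hc.comp_hasFDerivAt z h1
    rw [map_smulₛₗ]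
    exact h2
  have hgr : gradient (fun w => τ.loss (N.eval w) y) z = c • N.slope z := hg.gradient
  unfold attackedLoss attack Task.robustLoss
  rw [hgr, norm_smul, smul_smul]
  rcases hsign with ⟨hi, hc0⟩ | ⟨hi, hc0⟩
  · rw [if_pos hi]
    have : (ε / (‖c‖ * ‖N.slope z‖) * c) • N.slope z = ε • N.dir z := by
      rw [Network.dir, smul_smul, norm_of_nonneg hc0.le]
      congr 1
      field_simp
    rw [this]; rfl
  · rw [if_neg hi]
    have : (ε / (‖c‖ * ‖N.slope z‖) * c) • N.slope z = -(ε • N.dir z) := by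
      rw [Network.dir, smul_smul, ← neg_smul, Real.norm_of_nonpos hc0.le]
      congr 1
      have := hc0.ne
      rw [neg_mul, div_neg, neg_mul, div_mul_eq_mul_div, mul_comm c, mul_div_mul_right _ _ this,
        div_eq_mul_inv]
    rw [this, ← sub_eq_add_neg]; rfl

/-- The slope is a sum of columns whose mutual inner products are nonnegative, so a step along it
raises every preactivation, whether the node is active or not. -/
theorem Network.pre_dir_nonneg (N : Network d H)
    (hpos : ∀ h h', 0 ≤ ∑ i, N.W i h * N.W i h') (z : 𝔼^d) (h : Fin H) :
    0 ≤ N.pre (N.dir z) h := by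
  rw [Network.dir, N.pre_smul]
  refine mul_nonneg (inv_nonneg.2 (norm_nonneg _)) ?_
  have : N.pre (N.slope z) h
      = ∑ h', if N.b h' ≤ |N.pre z h'| then ∑ i, N.W i h' * N.W i h else 0 := by
    rw [Network.pre]
    simp only [Network.slope, sum_mul, ite_mul, zero_mul]
    rw [sum_comm]
    refine sum_congr rfl fun h' _ => ?_
    split_ifs <;> simp
  rw [this]
  refine sum_nonneg fun h' _ => ?_
  split_ifs
  · exact hpos h' h
  · exact le_rfl

theorem Network.norm_dir_le (N : Network d H) (z : 𝔼^d) : ‖N.dir z‖ ≤ 1 := by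
  rw [Network.dir, norm_smul, norm_inv, norm_norm]
  exact inv_mul_le_one

theorem Network.abs_pre_le (N : Network d H) (z : 𝔼^d) (h : Fin H) :
    |N.pre z h| ≤ ‖z‖ * colNorm N.W h := by
  have := abs_real_inner_le_norm z (WithLp.toLp 2 fun i => N.W i h)
  rw [PiLp.inner_apply, EuclideanSpace.norm_eq (WithLp.toLp 2 fun i => N.W i h)] at this
  simpa [Network.pre, colNorm, mul_comm] using this

theorem Network.inner_slope_dir (N : Network d H) (z : 𝔼^d) :
    inner ℝ (N.slope z) (N.dir z) = ‖N.slope z‖ := by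
  rw [Network.dir, inner_smul_right, real_inner_self_eq_norm_sq]
  by_cases h : ‖N.slope z‖ = 0
  · simp [h]
  · field_simp

/-- All shifts are nonnegative and, by `hsmall`, below the thresholds, so `gate_add_ge` applies node
by node. The shifts of the active nodes add up to `ε` times the inner product of the slope with its
own direction. -/
theorem Network.eval_add_slope_le_up (N : Network d H) {ε : ℝ} (hε : 0 ≤ ε)
    (hpos : ∀ h h', 0 ≤ ∑ i, N.W i h * N.W i h') (hsmall : ∀ h, ε * colNorm N.W h ≤ N.b h)
    (z : 𝔼^d) :
    N.eval z + ε * ‖N.slope z‖ ≤ N.up ε z := by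
  rw [← N.inner_slope_dir, N.inner_slope, mul_sum, N.eval_eq, ← sum_add_distrib,
    Network.up, N.eval_eq]
  refine sum_le_sum fun h _ => ?_
  rw [N.pre_add, N.pre_smul]
  have h1 := N.pre_dir_nonneg hpos z h
  have h2 := N.abs_pre_le (N.dir z) h
  rw [abs_of_nonneg h1] at h2
  have h3 : ε * N.pre (N.dir z) h ≤ N.b h := by
    refine le_trans (mul_le_left (h2.trans ?_) hε) (hsmall h)
    exact mul_le_of_le_one_left (sqrt_nonneg _) (N.norm_dir_le z)
  have := gate_add_ge (v := N.pre z h) (mul_nonneg hε h1) h3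
  rw [mul_ite, mul_zero]
  exact this

/-- The network is odd and its slope is even, so this is the upward bound at `-z`. -/
theorem Network.down_le_eval_sub_slope (N : Network d H) {ε : ℝ} (hε : 0 ≤ ε)
    (hpos : ∀ h h', 0 ≤ ∑ i, N.W i h * N.W i h') (hsmall : ∀ h, ε * colNorm N.W h ≤ N.b h)
    (z : 𝔼^d) :
    N.down ε z ≤ N.eval z - ε * ‖N.slope z‖ := by
  have hev : ∀ w, N.eval (-w) = -N.eval w := fun w => by
    rw [N.eval_eq, N.eval_eq, ← sum_neg_distrib]
    refine sum_congr rfl fun h _ => ?_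
    rw [← gate_neg]; congr 1; simp [Network.pre]
  have hsl : N.slope (-z) = N.slope z := by
    unfold Network.slope
    have : ∀ h, |N.pre (-z) h| = |N.pre z h| := fun h => by
      rw [← abs_neg]; congr 1; simp [Network.pre]
    simp only [this]
  have h := N.eval_add_slope_le_up hε hpos hsmall (-z)
  have hd : N.dir (-z) = N.dir z := by unfold Network.dir; rw [hsl]
  unfold Network.up at h
  unfold Network.down
  rw [hd, hsl, hev, show -z + ε • N.dir z = -(z - ε • N.dir z) by abel, hev] at h
  linarith

theorem Network.abs_eval_le (N : Network d H) (z : 𝔼^d) :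
    |N.eval z| ≤ ‖z‖ * ∑ h, colNorm N.W h := by
  rw [N.eval_eq, mul_sum]
  refine (abs_sum_le_sum_abs _ _).trans (sum_le_sum fun h _ => ?_)
  exact (abs_gate_le _ _).trans (N.abs_pre_le z h)

end

section

/-! ### Linear forms of Gaussian noise -/

/-- The law of a linear form `∑ i, ξ i * w i` of i.i.d. centred Gaussian coordinates. -/
theorem map_gaussian_form {d : ℕ} (v : NNReal) (w : ℝ^d) :
    (Measure.pi fun _ : Fin d => gaussianReal 0 v).map (fun ξ => ∑ i, ξ i * w i) =
      gaussianReal 0 (v * (∑ i, w i ^ 2).toNNReal) := by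
  have hm : Measurable fun ξ : ℝ^d => ∑ i, ξ i * w i := by fun_prop
  have : IsProbabilityMeasure ((Measure.pi fun _ : Fin d => gaussianReal 0 v).map
      (fun ξ => ∑ i, ξ i * w i)) := Measure.isProbabilityMeasure_map hm.aemeasurable
  refine Measure.ext_of_charFun (funext fun t => ?_)
  rw [charFun_apply_real, integral_map hm.aemeasurable (by fun_prop), charFun_gaussianReal]
  have h1 : ∀ ξ : ℝ^d, Complex.exp (t * ((∑ i, ξ i * w i : ℝ) : ℂ) * Complex.I) =
      ∏ i, Complex.exp (((t * w i : ℝ) : ℂ) * (ξ i : ℂ) * Complex.I) := fun ξ => by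
    rw [← Complex.exp_sum]; congr 1; push_cast
    rw [mul_sum, sum_mul]
    exact sum_congr rfl fun i _ => by ring
  simp only [h1]
  rw [integral_fintype_prod_eq_prod
    (fun i (a : ℝ) => Complex.exp (((t * w i : ℝ) : ℂ) * (a : ℂ) * Complex.I))]
  simp only [← charFun_apply_real, charFun_gaussianReal]
  rw [← Complex.exp_sum]
  congr 1
  have : ((v * (∑ i, w i ^ 2).toNNReal : NNReal) : ℂ) = (v : ℂ) * ∑ i, (w i : ℂ) ^ 2 := by
    rw [NNReal.coe_mul, Real.coe_toNNReal _ (sum_nonneg fun i _ => sq_nonneg _)]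
    push_cast; rfl
  rw [this]
  simp only [Complex.ofReal_zero, mul_zero, zero_mul, zero_sub, sum_neg_distrib]
  rw [← sum_div]
  congr 2
  rw [mul_sum, sum_mul]
  exact sum_congr rfl fun i _ => by push_cast; ring

variable {d : ℕ} (v : NNReal) (w : ℝ^d)

theorem integral_gaussian_form {g : ℝ → ℝ} (hg : Measurable g) :
    ∫ ξ, g (∑ i, ξ i * w i) ∂(Measure.pi fun _ : Fin d => gaussianReal 0 v) =
      ∫ y, g y ∂gaussianReal 0 (v * (∑ i, w i ^ 2).toNNReal) := by
  rw [← map_gaussian_form, integral_map (Measurable.aemeasurable (by fun_prop))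
    hg.aestronglyMeasurable]

theorem integrable_gaussian_form {g : ℝ → ℝ}
    (h : Integrable g (gaussianReal 0 (v * (∑ i, w i ^ 2).toNNReal))) :
    Integrable (fun ξ => g (∑ i, ξ i * w i)) (Measure.pi fun _ : Fin d => gaussianReal 0 v) := by
  rw [← map_gaussian_form] at h
  exact h.comp_measurable (by fun_prop)

theorem integral_odd_gaussian_form {g : ℝ → ℝ} (hg : ∀ y, g (-y) = -g y) :
    ∫ ξ, g (∑ i, ξ i * w i) ∂(Measure.pi fun _ : Fin d => gaussianReal 0 v) = 0 := by
  have hmp : MeasurePreserving (fun (ξ : ℝ^d) i => -ξ i)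
      (Measure.pi fun _ : Fin d => gaussianReal 0 v)
      (Measure.pi fun _ : Fin d => gaussianReal 0 v) :=
    measurePreserving_pi (fun _ => gaussianReal 0 v) (fun _ => gaussianReal 0 v)
      (f := fun _ a => -a) fun i => ⟨measurable_neg, by rw [gaussianReal_map_neg, neg_zero]⟩
  have he : MeasurableEmbedding (fun (ξ : ℝ^d) i => -ξ i) :=
    (MeasurableEquiv.neg ℝ^d).measurableEmbedding
  have h := hmp.integral_comp he fun ξ => g (∑ i, ξ i * w i)
  simp only [neg_mul, sum_neg_distrib, hg, integral_neg] at h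
  linarith

theorem integrable_sq_gaussian_form :
    Integrable (fun ξ => (∑ i, ξ i * w i) ^ 2) (Measure.pi fun _ : Fin d => gaussianReal 0 v) := by
  refine integrable_gaussian_form v w (g := fun y => y ^ 2) ?_
  have := (memLp_id_gaussianReal (μ := 0) (v := v * (∑ i, w i ^ 2).toNNReal) 2).integrable_sq
  simpa using this

theorem integral_sq_gaussian_form :
    ∫ ξ, (∑ i, ξ i * w i) ^ 2 ∂(Measure.pi fun _ : Fin d => gaussianReal 0 v) =
      v * ∑ i, w i ^ 2 := by
  rw [integral_gaussian_form v w (g := fun y => y ^ 2) (by fun_prop)]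
  have h := variance_id_gaussianReal (μ := 0) (v := v * (∑ i, w i ^ 2).toNNReal)
  rw [variance_eq_integral (by fun_prop)] at h
  simp only [id_eq, integral_id_gaussianReal, sub_zero] at h
  rw [h, NNReal.coe_mul, Real.coe_toNNReal _ (sum_nonneg fun i _ => sq_nonneg _)]

theorem measure_gaussian_form_eq (hv : v ≠ 0) (hw : ∃ i, w i ≠ 0) (c : ℝ) :
    (Measure.pi fun _ : Fin d => gaussianReal 0 v) {ξ | ∑ i, ξ i * w i = c} = 0 := by
  obtain ⟨i, hi⟩ := hw
  have hpos : 0 < ∑ i, w i ^ 2 :=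
    Finset.sum_pos' (fun i _ => sq_nonneg _) ⟨i, mem_univ _, by positivity⟩
  have hne : v * (∑ i, w i ^ 2).toNNReal ≠ 0 := mul_ne_zero hv (by simpa using hpos)
  have := nullSingletonClass_gaussianReal (μ := 0) hne
  have h : (Measure.pi fun _ : Fin d => gaussianReal 0 v).map (fun ξ => ∑ i, ξ i * w i) {c} = 0 := by
    rw [map_gaussian_form]; simp
  rwa [Measure.map_apply (by fun_prop) (measurableSet_singleton c)] at h

/-- Exponential tilting: for `|y| ≥ r` one has `1 + y ^ 2 ≤ 2 exp |y| ≤ 2 exp (-r (r - 1)) exp (r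
|y|)`. The moment generating function leaves `4 exp (r - r ^ 2 / 2)`, at most `4 e exp (-r ^ 2 / 4)`
because `(r - 2) ^ 2 ≥ 0`, and `4 e < 12`. Probability and second moment of the tail are bounded
together. -/
theorem gaussian_tail {r : ℝ} (hr : 1 ≤ r) :
    ∫ y, (if r ≤ |y| then 1 + y ^ 2 else 0) ∂gaussianReal 0 1 ≤ 12 * exp (-r ^ 2 / 4) := by
  have hi : ∀ a : ℝ, Integrable (fun y => exp (a * y)) (gaussianReal 0 1) := fun a =>
    integrable_exp_mul_gaussianReal a
  have hE : ∀ a : ℝ, ∫ y, exp (a * y) ∂gaussianReal 0 1 = exp (a ^ 2 / 2) := fun a => by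
    have := congrFun (mgf_id_gaussianReal (μ := 0) (v := 1)) a
    simp only [mgf, id_eq] at this
    rw [this]; congr 1; simp
  have hb : ∀ y : ℝ, (if r ≤ |y| then 1 + y ^ 2 else 0) ≤
      2 * exp (-(r * (r - 1))) * (exp (r * y) + exp ((-r) * y)) := fun y => by
    have key : ∀ a : ℝ, r ≤ a → 1 + a ^ 2 ≤ 2 * exp (-(r * (r - 1))) * exp (r * a) := by
      intro a ha
      have h1 : 1 + a ^ 2 ≤ 2 * exp a := by
        have := Real.quadratic_le_exp_of_nonneg (by linarith : 0 ≤ a)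
        nlinarith
      refine h1.trans ?_
      rw [mul_assoc, ← exp_add]
      have : a ≤ -(r * (r - 1)) + r * a := by nlinarith
      linarith [exp_le_exp.2 this]
    split_ifs with h
    · have hp : 0 < 2 * exp (-(r * (r - 1))) := by positivity
      have e1 := exp_pos (r * y)
      have e2 := exp_pos ((-r) * y)
      rcases le_abs.1 h with h' | h'
      · refine (key y h').trans ?_
        exact mul_le_left (by linarith) hp.le
      · have := key (-y) h'
        rw [neg_sq, mul_neg r y, ← neg_mul r y] at this
        refine this.trans ?_
        exact mul_le_left (by linarith) hp.le
    · positivity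
  refine (integral_mono_of_nonneg (ae_of_all _ fun y => ?_)
    (((hi r).add (hi (-r))).const_mul _) (ae_of_all _ hb)).trans ?_
  · simp only [Pi.zero_apply]; split_ifs <;> positivity
  · simp only [Pi.add_apply]
    rw [integral_const_mul, integral_add (hi r) (hi (-r)), hE, hE, neg_sq]
    have h3 : exp (-(r * (r - 1))) * exp (r ^ 2 / 2) ≤ exp 1 * exp (-r ^ 2 / 4) := by
      rw [← exp_add, ← exp_add]
      refine exp_le_exp.2 ?_
      nlinarith [sq_nonneg (r - 2)]
    have h4 := Real.exp_one_lt_d9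
    have h5 := exp_pos (-r ^ 2 / 4)
    nlinarith

theorem gaussian_form_tail {r b : ℝ} (hr : 1 ≤ r) (hv : v ≠ 0) (hw : ∃ i, w i ≠ 0)
    (hb : r * √(v * ∑ i, w i ^ 2) ≤ b) :
    ∫ ξ, (if b ≤ |∑ i, ξ i * w i| then 1 else 0)
        ∂(Measure.pi fun _ : Fin d => gaussianReal 0 v) ≤ 12 * exp (-r ^ 2 / 4) ∧
    ∫ ξ, (if b ≤ |∑ i, ξ i * w i| then (∑ i, ξ i * w i) ^ 2 else 0)
        ∂(Measure.pi fun _ : Fin d => gaussianReal 0 v) ≤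
      (v * ∑ i, w i ^ 2) * (12 * exp (-r ^ 2 / 4)) := by
  obtain ⟨i, hi⟩ := hw
  have hpos : 0 < ∑ i, w i ^ 2 :=
    Finset.sum_pos' (fun i _ => sq_nonneg _) ⟨i, mem_univ _, by positivity⟩
  have hv' : (0 : ℝ) < v := by exact_mod_cast pos_iff_ne_zero.2 hv
  set V : ℝ := v * ∑ i, w i ^ 2 with hV
  have hVpos : 0 < V := by positivity
  set ρ := √V with hρ
  have hρ0 : 0 < ρ := sqrt_pos.2 hVpos
  have hρ2 : ρ ^ 2 = V := sq_sqrt hVpos.le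
  have hlaw : gaussianReal 0 (v * (∑ i, w i ^ 2).toNNReal) = (gaussianReal 0 1).map (ρ * ·) := by
    rw [gaussianReal_map_const_mul, mul_zero, mul_one]
    congr 1
    apply NNReal.coe_injective
    rw [NNReal.coe_mul, Real.coe_toNNReal _ hpos.le]
    exact hρ2.symm
  have hms : ∀ c : ℝ, MeasurableSet {y : ℝ | c ≤ |y|} := fun c =>
    measurableSet_le measurable_const (by fun_prop)
  have hmeas : ∀ (c : ℝ) {g : ℝ → ℝ}, Measurable g → Measurable fun y => if c ≤ |y| then g y else 0 :=
    fun c g hg => Measurable.ite (hms c) hg measurable_const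
  have hint2 : Integrable (fun y : ℝ => 1 + y ^ 2) (gaussianReal 0 1) :=
    (integrable_const 1).add (by
      have := (memLp_id_gaussianReal (μ := 0) (v := 1) 2).integrable_sq
      simpa using this)
  have hint : Integrable (fun y : ℝ => if r ≤ |y| then 1 + y ^ 2 else 0) (gaussianReal 0 1) := by
    refine hint2.mono (hmeas r (by fun_prop)).aestronglyMeasurable (ae_of_all _ fun y => ?_)
    split_ifs
    · exact le_rfl
    · rw [norm_zero]; exact norm_nonneg _
  have hcut : ∀ y : ℝ, b ≤ |ρ * y| → r ≤ |y| := fun y hy => by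
    rw [abs_mul, abs_of_pos hρ0] at hy
    have : r * ρ ≤ |y| * ρ := by linarith
    exact le_of_mul_le_mul_right this hρ0
  constructor
  · rw [integral_gaussian_form v w (g := fun y => if b ≤ |y| then 1 else 0)
      (hmeas b measurable_const), hlaw,
      integral_map (by fun_prop) (hmeas b measurable_const).aestronglyMeasurable]
    refine le_trans (integral_mono_of_nonneg (ae_of_all _ fun y => ?_) hint
      (ae_of_all _ fun y => ?_)) (gaussian_tail hr)
    · simp only [Pi.zero_apply]; split_ifs <;> norm_num
    · simp only
      by_cases h : b ≤ |ρ * y|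
      · rw [if_pos h, if_pos (hcut y h)]; nlinarith [sq_nonneg y]
      · rw [if_neg h]; split_ifs <;> positivity
  · rw [integral_gaussian_form v w (g := fun y => if b ≤ |y| then y ^ 2 else 0)
      (hmeas b (by fun_prop)), hlaw,
      integral_map (by fun_prop) (hmeas b (by fun_prop)).aestronglyMeasurable]
    refine le_trans (integral_mono_of_nonneg (ae_of_all _ fun y => ?_) (hint.const_mul V)
      (ae_of_all _ fun y => ?_)) ?_
    · simp only [Pi.zero_apply]; split_ifs <;> positivity
    · simp only
      by_cases h : b ≤ |ρ * y|
      · rw [if_pos h, if_pos (hcut y h), mul_pow, hρ2]; nlinarith [sq_nonneg y]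
      · rw [if_neg h]; split_ifs <;> positivity
    · rw [integral_const_mul]
      exact mul_le_left (gaussian_tail hr) hVpos.le

end

section

/-! ### Sparse i.i.d. features -/

/-- Quantitative form, for one index, of the sparse coding assumption on the law of a feature. -/
structure FeatureBounds (K k : ℝ) (d : ℕ) (law : Measure ℝ) : Prop where
  one_le_K : 1 ≤ K
  prob : IsProbabilityMeasure law
  symm : law.map (fun x => -x) = law
  range : ∀ᵐ x ∂law, x = 0 ∨ (1 / √k ≤ |x| ∧ |x| ≤ 1)
  one_le_k : 1 ≤ k
  k_le : k ≤ d
  active_lower : k / (K * d) ≤ law.real {x | x ≠ 0}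
  active_upper : law.real {x | x ≠ 0} ≤ K * k / d
  var_lower : 1 / (K * d) ≤ ∫ x, x ^ 2 ∂law
  var_upper : ∫ x, x ^ 2 ∂law ≤ K / d

/-- The law of a vector of i.i.d. features. -/
abbrev vecLaw (d : ℕ) (law : Measure ℝ) : Measure ℝ^d := Measure.pi fun _ => law

/-- The indicator that a feature is active. -/
def act (a : ℝ) : ℝ := if a = 0 then 0 else 1

/-- The number of active features. -/
def numAct {d : ℕ} (x : ℝ^d) : ℝ := ∑ i, act (x i)

theorem act_nonneg (a : ℝ) : 0 ≤ act a := by unfold act; split_ifs <;> norm_num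

theorem act_le_one (a : ℝ) : act a ≤ 1 := by unfold act; split_ifs <;> norm_num

theorem act_neg (a : ℝ) : act (-a) = act a := by simp [act]

theorem act_mul_self (a : ℝ) : act a * act a = act a := by unfold act; split_ifs <;> norm_num

theorem act_mul_coe (a : ℝ) : act a * a = a := by unfold act; split_ifs with h <;> simp [h]

theorem abs_le_act {a : ℝ} (h : |a| ≤ 1) : |a| ≤ act a := by
  unfold act; split_ifs with h' <;> simp [h', h]

theorem measurable_act : Measurable act :=
  Measurable.ite (measurableSet_singleton 0) measurable_const measurable_const

theorem numAct_nonneg {d : ℕ} (x : ℝ^d) : 0 ≤ numAct x := sum_nonneg fun _ _ => act_nonneg _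

theorem act_le_numAct {d : ℕ} (x : ℝ^d) (i : Fin d) : act (x i) ≤ numAct x :=
  single_le_sum (f := fun i => act (x i)) (fun _ _ => act_nonneg _) (mem_univ i)

/-- Measurable functions that are bounded on the cube `[-1, 1]^d`. -/
@[fun_prop]
def CubeBounded {d : ℕ} (F : ℝ^d → ℝ) : Prop :=
  Measurable F ∧ ∃ C : ℝ, ∀ x, (∀ i, |x i| ≤ 1) → |F x| ≤ C

section CubeBounded

variable {d : ℕ} {F G : ℝ^d → ℝ}

@[fun_prop]
theorem CubeBounded.const (c : ℝ) : CubeBounded fun _ : ℝ^d => c :=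
  ⟨measurable_const, |c|, fun _ _ => le_rfl⟩

@[fun_prop]
theorem CubeBounded.coord (i : Fin d) : CubeBounded fun x : ℝ^d => x i :=
  ⟨measurable_pi_apply i, 1, fun _ h => h i⟩

theorem CubeBounded.comp_continuous {g : ℝ → ℝ} (hg : Continuous g) (hF : CubeBounded F) :
    CubeBounded fun x => g (F x) := by
  obtain ⟨hm, C, hC⟩ := hF
  obtain ⟨B, hB⟩ := (isCompact_Icc (a := -C) (b := C)).exists_bound_of_continuousOn hg.continuousOn
  exact ⟨hg.measurable.comp hm, B, fun x hx => hB _ (abs_le.1 (hC x hx))⟩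

theorem CubeBounded.comp_continuous₂ {g : ℝ × ℝ → ℝ} (hg : Continuous g) (hF : CubeBounded F)
    (hG : CubeBounded G) : CubeBounded fun x => g (F x, G x) := by
  obtain ⟨hm, C, hC⟩ := hF
  obtain ⟨hm', C', hC'⟩ := hG
  obtain ⟨B, hB⟩ := ((isCompact_Icc (a := -C) (b := C)).prod
    (isCompact_Icc (a := -C') (b := C'))).exists_bound_of_continuousOn hg.continuousOn
  exact ⟨hg.measurable.comp (hm.prodMk hm'), B,
    fun x hx => hB _ ⟨abs_le.1 (hC x hx), abs_le.1 (hC' x hx)⟩⟩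

@[fun_prop]
theorem CubeBounded.add (hF : CubeBounded F) (hG : CubeBounded G) :
    CubeBounded fun x => F x + G x := hF.comp_continuous₂ (g := fun p => p.1 + p.2) (by fun_prop) hG

@[fun_prop]
theorem CubeBounded.sub (hF : CubeBounded F) (hG : CubeBounded G) :
    CubeBounded fun x => F x - G x := hF.comp_continuous₂ (g := fun p => p.1 - p.2) (by fun_prop) hG

@[fun_prop]
theorem CubeBounded.mul (hF : CubeBounded F) (hG : CubeBounded G) :
    CubeBounded fun x => F x * G x := hF.comp_continuous₂ (g := fun p => p.1 * p.2) (by fun_prop) hG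

@[fun_prop]
theorem CubeBounded.neg (hF : CubeBounded F) : CubeBounded fun x => -F x :=
  hF.comp_continuous (g := fun a => -a) (by fun_prop)

@[fun_prop]
theorem CubeBounded.abs (hF : CubeBounded F) : CubeBounded fun x => |F x| :=
  hF.comp_continuous (g := fun a => |a|) (by fun_prop)

@[fun_prop]
theorem CubeBounded.pow (hF : CubeBounded F) (n : ℕ) : CubeBounded fun x => F x ^ n :=
  hF.comp_continuous (g := fun a => a ^ n) (by fun_prop)

@[fun_prop]
theorem CubeBounded.div_const (hF : CubeBounded F) (c : ℝ) : CubeBounded fun x => F x / c :=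
  hF.comp_continuous (g := fun a => a / c) (by fun_prop)

@[fun_prop]
theorem CubeBounded.sqrt (hF : CubeBounded F) : CubeBounded fun x => √(F x) :=
  hF.comp_continuous (g := fun a => √a) (by fun_prop)

@[fun_prop]
theorem CubeBounded.exp (hF : CubeBounded F) : CubeBounded fun x => exp (F x) :=
  hF.comp_continuous (g := fun a => Real.exp a) (by fun_prop)

@[fun_prop]
theorem CubeBounded.sum {ι : Type*} (s : Finset ι) {f : ι → ℝ^d → ℝ}
    (hf : ∀ i, CubeBounded (f i)) : CubeBounded fun x => ∑ i ∈ s, f i x := by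
  classical
  induction s using Finset.induction_on with
  | empty => simpa using CubeBounded.const 0
  | insert a s ha ih =>
    simp only [Finset.sum_insert ha]
    exact (hf a).add ih

@[fun_prop]
theorem CubeBounded.act (hF : CubeBounded F) : CubeBounded fun x => act (F x) :=
  ⟨measurable_act.comp hF.1, 1, fun x _ => by rw [abs_of_nonneg (act_nonneg _)]; exact act_le_one _⟩

@[fun_prop]
theorem CubeBounded.numAct : CubeBounded fun x : ℝ^d => numAct x := by
  unfold FeaturePurification.numAct; fun_prop

theorem CubeBounded.indicator {p : ℝ^d → Prop} [DecidablePred p]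
    (hp : MeasurableSet {x | p x}) (hF : CubeBounded F) :
    CubeBounded fun x => if p x then F x else 0 := by
  obtain ⟨hm, C, hC⟩ := hF
  refine ⟨Measurable.ite hp hm measurable_const, C, fun x hx => ?_⟩
  beta_reduce
  split_ifs
  · exact hC x hx
  · rw [abs_zero]; exact (abs_nonneg _).trans (hC x hx)

theorem CubeBounded.mono (hG : CubeBounded G) (hm : Measurable F) (h : ∀ x, |F x| ≤ |G x|) :
    CubeBounded F := by
  obtain ⟨_, C, hC⟩ := hG
  exact ⟨hm, C, fun x hx => (h x).trans (hC x hx)⟩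

theorem CubeBounded.profile (τ : Task) (s : ℝ) {t : ℝ^d → ℝ} (ht : CubeBounded t)
    (hF : CubeBounded F) (hG : CubeBounded G) :
    CubeBounded fun x => profile τ s (t x) (F x) (G x) := by
  obtain ⟨hm, C, hC⟩ := ht
  obtain ⟨hm1, C1, hC1⟩ := hF
  obtain ⟨hm2, C2, hC2⟩ := hG
  obtain ⟨B, hB⟩ := ((isCompact_Icc (a := -C) (b := C)).prod
    ((isCompact_Icc (a := -C1) (b := C1)).prod
    (isCompact_Icc (a := -C2) (b := C2)))).exists_bound_of_continuousOn
    (continuous_profile τ s).continuousOn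
  exact ⟨(continuous_profile τ s).measurable.comp (hm.prodMk (hm1.prodMk hm2)), B,
    fun x hx => hB (t x, F x, G x) ⟨abs_le.1 (hC x hx), abs_le.1 (hC1 x hx), abs_le.1 (hC2 x hx)⟩⟩

end CubeBounded

variable {d : ℕ} {law : Measure ℝ}

theorem ae_vecLaw [IsProbabilityMeasure law] {p : ℝ → Prop} (h : ∀ᵐ x ∂law, p x) :
    ∀ᵐ x ∂vecLaw d law, ∀ i, p (x i) :=
  ae_all_iff.2 fun i => (Measure.quasiMeasurePreserving_eval (fun _ : Fin d => law) i).ae h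

theorem integral_coord_mul [IsProbabilityMeasure law] (i : Fin d) {φ : ℝ → ℝ} (hφ : Measurable φ)
    {F : ℝ^d → ℝ} (hm : Measurable F) (hF : ∀ x a, F (update x i a) = F x) :
    ∫ x, φ (x i) * F x ∂vecLaw d law = (∫ a, φ a ∂law) * ∫ x, F x ∂vecLaw d law := by
  classical
  have hind : iIndepFun (fun (j : Fin d) (x : ℝ^d) => x j) (vecLaw d law) :=
    iIndepFun_pi (X := fun _ a => a) fun _ => aemeasurable_id'
  have h1 := hind.indepFun_finset {i} {i}ᶜ disjoint_compl_right fun j => measurable_pi_apply j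
  -- Extension by zero at coordinate `i`, to which `F` is insensitive; it exhibits `F` as a function
  -- of the other coordinates.
  let e : ((({i}ᶜ : Finset (Fin d)) : Type _) → ℝ) → ℝ^d :=
    fun y j => if h : j ∈ ({i}ᶜ : Finset (Fin d)) then y ⟨j, h⟩ else 0
  have he : Measurable e := measurable_pi_lambda _ fun j => by
    by_cases h : j ∈ ({i}ᶜ : Finset (Fin d))
    · simp only [e, h, dite_true]; exact measurable_pi_apply _
    · simp only [e, h, dite_false]; exact measurable_const
  have h2 := h1.comp (φ := fun y => φ (y ⟨i, Finset.mem_singleton_self i⟩)) (ψ := fun y => F (e y))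
    (by fun_prop) (hm.comp he)
  have h3 : ∀ x : ℝ^d, F (e fun j => x j) = F x := fun x => by
    rw [← hF x 0]; congr 1
    funext j
    by_cases h : j = i
    · subst h; simp [e]
    · simp [e, h]
  have h4 := h2.integral_fun_mul_eq_mul_integral
    (Measurable.aestronglyMeasurable (by fun_prop))
    (Measurable.aestronglyMeasurable (by fun_prop))
  simp only [Function.comp_def, h3] at h4
  rw [h4, integral_comp_eval (μ := fun _ : Fin d => law) (f := φ) (i := i)
    hφ.aestronglyMeasurable]

theorem integral_flip [IsProbabilityMeasure law] (hs : law.map (fun x => -x) = law) (i : Fin d)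
    {F : ℝ^d → ℝ} (hm : Measurable F) :
    ∫ x, F (update x i (-x i)) ∂vecLaw d law = ∫ x, F x ∂vecLaw d law := by
  have hmp : MeasurePreserving (fun (x : ℝ^d) j => if j = i then -x j else x j)
      (vecLaw d law) (vecLaw d law) :=
    measurePreserving_pi (fun _ => law) (fun _ => law)
      (f := fun j a => if j = i then -a else a) fun j => by
        by_cases h : j = i
        · simp only [h, if_true]; exact ⟨measurable_neg, hs⟩
        · simp only [h, if_false]; exact MeasurePreserving.id _
  have e : ∀ x : ℝ^d, update x i (-x i) = fun j => if j = i then -x j else x j :=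
    fun x => by
      funext j
      by_cases h : j = i
      · subst h; simp
      · simp [h]
  simp only [e]
  rw [← hmp.map_eq, integral_map hmp.measurable.aemeasurable hm.aestronglyMeasurable, hmp.map_eq]

theorem integral_perm [IsProbabilityMeasure law] (σ : Equiv.Perm (Fin d))
    {F : ℝ^d → ℝ} (hm : Measurable F) :
    ∫ x, F (fun j => x (σ j)) ∂vecLaw d law = ∫ x, F x ∂vecLaw d law := by
  have hmp := measurePreserving_arrowCongr' (fun _ : Fin d => law) (fun _ : Fin d => law)
    σ.symm (MeasurableEquiv.refl ℝ) fun _ => MeasurePreserving.id _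
  have h2 : ∀ x : ℝ^d, MeasurableEquiv.arrowCongr' σ.symm (MeasurableEquiv.refl ℝ) x
      = fun j => x (σ j) := fun x => rfl
  have := integral_map hmp.measurable.aemeasurable
    (hm.aestronglyMeasurable (μ := Measure.map
      (MeasurableEquiv.arrowCongr' σ.symm (MeasurableEquiv.refl ℝ)) (vecLaw d law)))
  rw [hmp.map_eq] at this
  simp only [h2] at this
  exact this.symm

end

/-! ### Moments of sparse feature vectors. -/

/-- The probability that a feature is active. -/
def rate (law : Measure ℝ) : ℝ := law.real {x | x ≠ 0}

/-- The second moment of a feature. -/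
def energy (law : Measure ℝ) : ℝ := ∫ x, x ^ 2 ∂law

/-- The feature vectors in the support of the law: active features have size in `[1/√k, 1]`. -/
def IsFeature (k : ℝ) {d : ℕ} (x : ℝ^d) : Prop := ∀ i, x i = 0 ∨ (1 / √k ≤ |x i| ∧ |x i| ≤ 1)

theorem IsFeature.abs_le {k : ℝ} {d : ℕ} {x : ℝ^d} (h : IsFeature k x) (i : Fin d) :
    |x i| ≤ 1 := by
  rcases h i with h | h
  · simp [h]
  · exact h.2

section Moments

variable {K k : ℝ} {d : ℕ} {law : Measure ℝ} (hL : FeatureBounds K k d law)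

/-- The law of the features. -/
local notation "Λ" => vecLaw d law
include hL

theorem FeatureBounds.d_pos : (0 : ℝ) < d := by linarith [hL.one_le_k, hL.k_le]

theorem FeatureBounds.ae_isFeature : ∀ᵐ x ∂Λ, IsFeature k x :=
  haveI := hL.prob
  ae_vecLaw hL.range

theorem FeatureBounds.isProbabilityMeasure : IsProbabilityMeasure Λ :=
  haveI := hL.prob
  inferInstance

theorem FeatureBounds.integrable {F : ℝ^d → ℝ} (hF : CubeBounded F) : Integrable F Λ := by
  have := hL.isProbabilityMeasure
  obtain ⟨hm, C, hC⟩ := hF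
  refine Integrable.of_bound hm.aestronglyMeasurable C ?_
  filter_upwards [hL.ae_isFeature] with x hx
  exact hC x hx.abs_le

theorem FeatureBounds.integral_mono {F G : ℝ^d → ℝ} (h : ∀ x, IsFeature k x → F x ≤ G x)
    (hF : CubeBounded F := by fun_prop) (hG : CubeBounded G := by fun_prop) :
    ∫ x, F x ∂Λ ≤ ∫ x, G x ∂Λ :=
  integral_mono_ae (hL.integrable hF) (hL.integrable hG)
    (hL.ae_isFeature.mono h)

theorem FeatureBounds.integral_nonneg {F : ℝ^d → ℝ}
    (h : ∀ x, IsFeature k x → 0 ≤ F x) : 0 ≤ ∫ x, F x ∂Λ :=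
  integral_nonneg_of_ae (hL.ae_isFeature.mono h)

theorem FeatureBounds.integral_const (c : ℝ) : ∫ _, c ∂Λ = c := by
  have := hL.isProbabilityMeasure
  simp

theorem FeatureBounds.integral_add {F G : ℝ^d → ℝ} (hF : CubeBounded F := by fun_prop)
    (hG : CubeBounded G := by fun_prop) :
    ∫ x, (F x + G x) ∂Λ = ∫ x, F x ∂Λ + ∫ x, G x ∂Λ :=
  MeasureTheory.integral_add (hL.integrable hF) (hL.integrable hG)

theorem FeatureBounds.integral_sub {F G : ℝ^d → ℝ} (hF : CubeBounded F := by fun_prop)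
    (hG : CubeBounded G := by fun_prop) :
    ∫ x, (F x - G x) ∂Λ = ∫ x, F x ∂Λ - ∫ x, G x ∂Λ :=
  MeasureTheory.integral_sub (hL.integrable hF) (hL.integrable hG)

theorem FeatureBounds.integral_sum {ι : Type*} {s : Finset ι} {F : ι → ℝ^d → ℝ}
    (hF : ∀ i, CubeBounded (F i) := by intro _; fun_prop) :
    ∫ x, ∑ i ∈ s, F i x ∂Λ = ∑ i ∈ s, ∫ x, F i x ∂Λ :=
  integral_finsetSum _ fun i _ => hL.integrable (hF i)

/-- Cauchy–Schwarz. -/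
theorem FeatureBounds.integral_mul_le {F G : ℝ^d → ℝ} (hF : CubeBounded F)
    (hG : CubeBounded G) :
    ∫ x, F x * G x ∂Λ ≤ √(∫ x, F x ^ 2 ∂Λ) * √(∫ x, G x ^ 2 ∂Λ) := by
  set a := ∫ x, F x ^ 2 ∂Λ
  set b := ∫ x, G x ^ 2 ∂Λ
  set c := ∫ x, F x * G x ∂Λ
  have ha : 0 ≤ a := hL.integral_nonneg fun x _ => sq_nonneg _
  have hb : 0 ≤ b := hL.integral_nonneg fun x _ => sq_nonneg _
  have hq : ∀ r : ℝ, 0 ≤ a * (r * r) + (2 * c) * r + b := fun r => by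
    have h0 : 0 ≤ ∫ x, (r * F x + G x) ^ 2 ∂Λ := hL.integral_nonneg fun x _ => sq_nonneg _
    have e : ∀ x, (r * F x + G x) ^ 2 = r * r * F x ^ 2 + 2 * r * (F x * G x) + G x ^ 2 :=
      fun x => by ring
    simp only [e] at h0
    rw [hL.integral_add, hL.integral_add, integral_const_mul, integral_const_mul] at h0
    linarith
  have hd := discrim_le_zero hq
  rw [discrim] at hd
  rw [← sqrt_mul ha]
  refine le_sqrt_of_sq_le ?_
  nlinarith

theorem FeatureBounds.integral_abs_le {F : ℝ^d → ℝ} (hF : CubeBounded F) :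
    ∫ x, |F x| ∂Λ ≤ √(∫ x, F x ^ 2 ∂Λ) := by
  have := hL.integral_mul_le hF.abs (CubeBounded.const 1)
  simpa [hL.integral_const] using this

theorem FeatureBounds.rate_le : rate law ≤ K * k / d := hL.active_upper

theorem FeatureBounds.rate_ge : k / (K * d) ≤ rate law := hL.active_lower

theorem FeatureBounds.rate_pos : 0 < rate law := by
  have := hL.d_pos
  have := hL.one_le_K
  have := hL.one_le_k
  exact lt_of_lt_of_le (by positivity) hL.rate_ge

theorem FeatureBounds.d_mul_rate_le : d * rate law ≤ K * k := by
  have h := hL.rate_le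
  rwa [le_div_iff₀ hL.d_pos, mul_comm] at h

theorem FeatureBounds.energy_pos : 0 < energy law := by
  have := hL.d_pos
  have := hL.one_le_K
  exact lt_of_lt_of_le (by positivity) hL.var_lower

theorem FeatureBounds.integral_act_law : ∫ a, act a ∂law = rate law := by
  have := hL.prob
  have : act = Set.indicator {x : ℝ | x ≠ 0} fun _ => (1 : ℝ) := by
    funext a; by_cases h : a = 0 <;> simp [act, h]
  rw [this, integral_indicator_const (s := {x : ℝ | x ≠ 0}) _ (measurableSet_singleton (0 : ℝ)).compl]
  simp [rate]

theorem FeatureBounds.integral_id_law : ∫ a, a ∂law = 0 := by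
  have h := integral_map (μ := law) (φ := fun x => -x) (f := fun a : ℝ => a)
    measurable_neg.aemeasurable (by fun_prop)
  rw [hL.symm, integral_neg] at h
  linarith

theorem FeatureBounds.integral_coord_mul (i : Fin d) {φ : ℝ → ℝ} (hφ : Measurable φ)
    {F : ℝ^d → ℝ} (hm : Measurable F) (hF : ∀ x a, F (update x i a) = F x) :
    ∫ x, φ (x i) * F x ∂Λ = (∫ a, φ a ∂law) * ∫ x, F x ∂Λ :=
  haveI := hL.prob
  FeaturePurification.integral_coord_mul i hφ hm hF

theorem FeatureBounds.integral_coord (i : Fin d) {φ : ℝ → ℝ} (hφ : Measurable φ) :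
    ∫ x, φ (x i) ∂Λ = ∫ a, φ a ∂law := by
  have := hL.integral_coord_mul i hφ (F := fun _ => 1) measurable_const fun _ _ => rfl
  simpa [hL.integral_const] using this

theorem FeatureBounds.integral_act (i : Fin d) : ∫ x, act (x i) ∂Λ = rate law := by
  rw [hL.integral_coord i measurable_act, hL.integral_act_law]

theorem FeatureBounds.integral_act_mul {i j : Fin d} (h : i ≠ j) :
    ∫ x, act (x i) * act (x j) ∂Λ = rate law ^ 2 := by
  rw [hL.integral_coord_mul i measurable_act (F := fun x => act (x j))
    (CubeBounded.act (CubeBounded.coord j)).1, hL.integral_act, hL.integral_act_law, sq]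
  intro x a
  rw [update_of_ne h.symm]

theorem FeatureBounds.integral_act_mul_act_mul {i j l : Fin d} (h : i ≠ j) (h' : i ≠ l)
    (h'' : j ≠ l) :
    ∫ x, act (x i) * (act (x j) * act (x l)) ∂Λ = rate law ^ 3 := by
  rw [hL.integral_coord_mul i measurable_act (F := fun x => act (x j) * act (x l))
    (CubeBounded.mul (CubeBounded.act (CubeBounded.coord j)) (CubeBounded.act (CubeBounded.coord l))).1,
    hL.integral_act_mul h'', hL.integral_act_law]
  · ring
  intro x a
  rw [update_of_ne h.symm, update_of_ne h'.symm]

theorem FeatureBounds.integral_act_mul_numAct_le (i : Fin d) :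
    ∫ x, act (x i) * numAct x ∂Λ ≤ rate law * (1 + d * rate law) := by
  simp only [numAct, mul_sum]
  rw [hL.integral_sum]
  have hp := hL.rate_pos
  have : ∀ j, ∫ x, act (x i) * act (x j) ∂Λ ≤
      (if j = i then rate law else 0) + rate law ^ 2 := fun j => by
    by_cases h : j = i
    · subst h
      simp only [act_mul_self, if_true, hL.integral_act]
      nlinarith
    · rw [hL.integral_act_mul (Ne.symm h), if_neg h, zero_add]
  refine (sum_le_sum fun j _ => this j).trans ?_
  rw [sum_add_distrib]
  simp
  nlinarith

theorem FeatureBounds.integral_act_mul_act_mul_numAct_le {i j : Fin d} (h : i ≠ j) :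
    ∫ x, act (x i) * act (x j) * numAct x ∂Λ ≤ rate law ^ 2 * (2 + d * rate law) := by
  simp only [numAct, mul_sum]
  rw [hL.integral_sum]
  have hp := hL.rate_pos
  have : ∀ l, ∫ x, act (x i) * act (x j) * act (x l) ∂Λ ≤
      (if l = i then rate law ^ 2 else 0) + (if l = j then rate law ^ 2 else 0)
        + rate law ^ 3 := fun l => by
    have hp3 : 0 < rate law ^ 3 := by positivity
    by_cases h1 : l = i
    · subst h1
      rw [if_pos rfl, if_neg h]
      have e : ∀ x : ℝ^d, act (x l) * act (x j) * act (x l) = act (x l) * act (x j) :=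
        fun x => by rw [mul_right_comm, act_mul_self]
      simp only [e, hL.integral_act_mul h]
      linarith
    · by_cases h2 : l = j
      · subst h2
        rw [if_pos rfl, if_neg (Ne.symm h)]
        have e : ∀ x : ℝ^d, act (x i) * act (x l) * act (x l) = act (x i) * act (x l) :=
          fun x => by rw [mul_assoc, act_mul_self]
        simp only [e, hL.integral_act_mul h]
        linarith
      · simp only [mul_assoc]
        rw [hL.integral_act_mul_act_mul h (Ne.symm h1) (Ne.symm h2), if_neg h1, if_neg h2]
        linarith
  refine (sum_le_sum fun j _ => this j).trans ?_
  rw [sum_add_distrib, sum_add_distrib]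
  simp
  nlinarith

theorem FeatureBounds.integral_sq_coord_mul (i : Fin d) {F : ℝ^d → ℝ} (hm : Measurable F)
    (hF : ∀ x a, F (update x i a) = F x) :
    ∫ x, x i ^ 2 * F x ∂Λ = energy law * ∫ x, F x ∂Λ :=
  hL.integral_coord_mul i (φ := fun a => a ^ 2) (by fun_prop) hm hF

theorem FeatureBounds.integral_sq_form (a : ℝ^d) :
    ∫ x, (∑ i, a i * x i) ^ 2 ∂Λ = energy law * ∑ i, a i ^ 2 := by
  have e : ∀ x : ℝ^d, (∑ i, a i * x i) ^ 2 = ∑ i, ∑ j, a i * a j * (x i * x j) := fun x => by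
    rw [sq, Finset.sum_mul_sum]
    exact sum_congr rfl fun i _ => sum_congr rfl fun j _ => by ring
  simp only [e]
  rw [hL.integral_sum, mul_sum]
  refine sum_congr rfl fun i _ => ?_
  rw [hL.integral_sum, sum_eq_single i]
  · rw [integral_const_mul]
    have : ∫ x, x i * x i ∂Λ = energy law := by
      simp only [← sq]
      exact hL.integral_coord i (φ := fun a => a ^ 2) (by fun_prop)
    rw [this]; ring
  · intro j _ hj
    rw [integral_const_mul, hL.integral_coord_mul i (φ := fun a => a) measurable_id
      (measurable_pi_apply j), hL.integral_id_law, zero_mul, mul_zero]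
    intro x b
    rw [update_of_ne hj]
  · simp

/-- The coordinates are exchangeable, so the `d` expectations are equal, and the integrands add up
to at most one. -/
theorem FeatureBounds.integral_act_div_numAct_le (i : Fin d) :
    ∫ x, act (x i) / numAct x ∂Λ ≤ 1 / d := by
  have := hL.prob
  have hm : ∀ j, Measurable fun x : ℝ^d => act (x j) / numAct x := fun j =>
    (CubeBounded.act (CubeBounded.coord j)).1.div CubeBounded.numAct.1
  have hcb : ∀ j, CubeBounded fun x : ℝ^d => act (x j) / numAct x := fun j =>
    ⟨hm j, 1, fun x _ => by
      rw [abs_of_nonneg (div_nonneg (act_nonneg _) (numAct_nonneg _))]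
      exact div_le_one_of_le₀ (act_le_numAct x j) (numAct_nonneg _)⟩
  have heq : ∀ j, ∫ x, act (x j) / numAct x ∂Λ = ∫ x, act (x i) / numAct x ∂Λ := fun j => by
    rw [← integral_perm (Equiv.swap i j) (hm i)]
    have : ∀ x : ℝ^d, numAct (fun l => x (Equiv.swap i j l)) = numAct x := fun x =>
      Equiv.sum_comp (Equiv.swap i j) fun l => act (x l)
    simp only [this, Equiv.swap_apply_left]
  have hs : ∑ j, ∫ x, act (x j) / numAct x ∂Λ ≤ 1 := by
    rw [← hL.integral_sum hcb, ← hL.integral_const 1]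
    refine hL.integral_mono (hF := CubeBounded.sum _ hcb) (hG := CubeBounded.const 1) fun x _ => ?_
    rw [← sum_div]
    exact div_self_le_one _
  simp only [heq, sum_const, card_univ, Fintype.card_fin, nsmul_eq_mul] at hs
  rw [le_div_iff₀ hL.d_pos]
  linarith

/-- Coordinate `i` is split off the linear form: it contributes at most `a i ^ 2` when active, and
the rest is independent of its activity. -/
theorem FeatureBounds.integral_act_mul_sq_form_le (i : Fin d) (a : ℝ^d) :
    ∫ x, act (x i) * (∑ j, a j * x j) ^ 2 ∂Λ ≤
      2 * rate law * (a i ^ 2 + energy law * ∑ j, a j ^ 2) := by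
  set a' : ℝ^d := update a i 0 with ha'
  have hsplit : ∀ x : ℝ^d, ∑ j, a j * x j = a i * x i + ∑ j, a' j * x j := fun x => by
    rw [← add_sum_erase _ _ (mem_univ i), ← add_sum_erase _ (fun j => a' j * x j) (mem_univ i)]
    simp only [ha', update_self, zero_mul, zero_add]
    congr 1
    exact sum_congr rfl fun j hj => by rw [update_of_ne (Finset.ne_of_mem_erase hj)]
  have h1 : ∫ x, act (x i) * (∑ j, a j * x j) ^ 2 ∂Λ ≤
      ∫ x, (2 * a i ^ 2 * act (x i) + 2 * (act (x i) * (∑ j, a' j * x j) ^ 2)) ∂Λ := by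
    refine hL.integral_mono fun x hx => ?_
    rw [hsplit]
    have h2 := act_nonneg (x i)
    have h3 : x i ^ 2 ≤ 1 := by
      have := abs_le.1 (hx.abs_le i)
      nlinarith
    have h4 : (a i * x i + ∑ j, a' j * x j) ^ 2 ≤ 2 * a i ^ 2 + 2 * (∑ j, a' j * x j) ^ 2 := by
      nlinarith [sq_nonneg (a i * x i - ∑ j, a' j * x j), sq_nonneg (a i)]
    nlinarith
  refine h1.trans ?_
  rw [hL.integral_add, integral_const_mul, integral_const_mul,
    hL.integral_act, hL.integral_coord_mul i measurable_act
    (F := fun x => (∑ j, a' j * x j) ^ 2) (by fun_prop), hL.integral_act_law, hL.integral_sq_form]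
  · have h5 : ∑ j, a' j ^ 2 ≤ ∑ j, a j ^ 2 := by
      refine sum_le_sum fun j _ => ?_
      by_cases h : j = i
      · subst h; simp [ha', sq_nonneg]
      · rw [ha', update_of_ne h]
    have := mul_le_left h5 (mul_pos hL.rate_pos hL.energy_pos).le
    nlinarith
  · intro x b
    congr 1
    refine sum_congr rfl fun j _ => ?_
    by_cases h : j = i
    · subst h; simp [ha']
    · rw [update_of_ne h]

end Moments

/-! ### The robust risk of linear predictors of the features. -/

section

variable {d : ℕ}

/-- The linear form with coefficient vector `a`. -/
def dot (a x : ℝ^d) : ℝ := ∑ i, a i * x i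

/-- The Euclidean norm of the restriction of `T` to the active features of `x`. -/
def actNorm (T x : ℝ^d) : ℝ := √(∑ i, act (x i) * T i ^ 2)

@[fun_prop]
theorem CubeBounded.dot (a : ℝ^d) : CubeBounded fun x => dot a x := by
  unfold FeaturePurification.dot; fun_prop

@[fun_prop]
theorem CubeBounded.actNorm (T : ℝ^d) : CubeBounded fun x => actNorm T x := by
  unfold FeaturePurification.actNorm; fun_prop

theorem actNorm_nonneg (T x : ℝ^d) : 0 ≤ actNorm T x := sqrt_nonneg _

theorem sq_actNorm (T x : ℝ^d) : actNorm T x ^ 2 = ∑ i, act (x i) * T i ^ 2 :=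
  sq_sqrt (sum_nonneg fun _ _ => mul_nonneg (act_nonneg _) (sq_nonneg _))

theorem actNorm_eq_norm (T x : ℝ^d) :
    actNorm T x = ‖(WithLp.toLp 2 fun i => act (x i) * T i : 𝔼^d)‖ := by
  rw [EuclideanSpace.norm_eq, actNorm]
  congr 1
  refine sum_congr rfl fun i _ => ?_
  simp only [norm_eq_abs, sq_abs, mul_pow]
  rw [sq (act (x i)), act_mul_self]

theorem actNorm_add_le (T T' x : ℝ^d) {a b : ℝ} (ha : 0 ≤ a) (hb : 0 ≤ b) :
    actNorm (fun i => a * T i + b * T' i) x ≤ a * actNorm T x + b * actNorm T' x := by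
  simp only [actNorm_eq_norm]
  have : (WithLp.toLp 2 fun i => act (x i) * (a * T i + b * T' i) : 𝔼^d) =
      a • (WithLp.toLp 2 fun i => act (x i) * T i : 𝔼^d) +
      b • (WithLp.toLp 2 fun i => act (x i) * T' i : 𝔼^d) := by
    ext i; simp; ring
  rw [this]
  refine (norm_add_le _ _).trans ?_
  rw [norm_smul, norm_smul, norm_of_nonneg ha, norm_of_nonneg hb]

theorem actNorm_le {T : ℝ^d} {B : ℝ} (hB : 0 ≤ B) (h : ∀ i, |T i| ≤ B) (x : ℝ^d) :
    actNorm T x ≤ B * √(numAct x) := by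
  rw [actNorm, ← sqrt_sq hB, ← sqrt_mul (sq_nonneg B), numAct, mul_sum]
  refine sqrt_le_sqrt (sum_le_sum fun i _ => ?_)
  rw [mul_comm]
  exact mul_le_right (sq_le_sq' (by linarith [neg_abs_le (T i), h i])
    ((le_abs_self _).trans (h i))) (act_nonneg _)

theorem le_actNorm {T : ℝ^d} {B : ℝ} (hB : 0 ≤ B) (h : ∀ i, B ≤ |T i|) (x : ℝ^d) :
    B * √(numAct x) ≤ actNorm T x := by
  rw [actNorm, ← sqrt_sq hB, ← sqrt_mul (sq_nonneg B), numAct, mul_sum]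
  refine sqrt_le_sqrt (sum_le_sum fun i _ => ?_)
  rw [mul_comm, ← sq_abs (T i)]
  exact mul_le_left (pow_le_pow_left₀ hB (h i) 2) (act_nonneg _)

/-- The robust risk of the linear predictor `T` of the features, when the attacker can move the
prediction by `ε` times the norm of the active part of `T`. -/
def linRisk (τ : Task) (s ε : ℝ) (law : Measure ℝ) (θ T : ℝ^d) : ℝ :=
  ∫ x, profile τ s (dot θ x) (dot T x) (ε * actNorm T x) ∂vecLaw d law

theorem dot_add_mul (T T' x : ℝ^d) (a b : ℝ) :
    dot (fun i => a * T i + b * T' i) x = a * dot T x + b * dot T' x := by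
  simp only [dot, mul_sum, ← sum_add_distrib]
  exact sum_congr rfl fun i _ => by ring

theorem profile_comb_le (τ : Task) (s t : ℝ) {f f' G G' a b : ℝ} (ha : 0 ≤ a) (hb : 0 ≤ b)
    (hab : a + b = 1) :
    profile τ s t (a * f + b * f') (a * G + b * G') ≤
      a * profile τ s t f G + b * profile τ s t f' G' :=
  (profile_convex τ s t).2 (Set.mem_univ (f, G)) (Set.mem_univ (f', G')) ha hb hab

variable {K k : ℝ} {law : Measure ℝ}

/-- The law of the features. -/
local notation "Λ" => vecLaw d law

/-- The prediction is linear in `T`, the displacement is a seminorm of `T`, and the profile is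
jointly convex and increasing in the size of the displacement. -/
theorem FeatureBounds.convexOn_linRisk (hL : FeatureBounds K k d law) (τ : Task) (s : ℝ) {ε : ℝ}
    (hε : 0 ≤ ε) (θ : ℝ^d) : ConvexOn ℝ Set.univ (linRisk τ s ε law θ) := by
  refine ⟨convex_univ, fun T _ T' _ a b ha hb hab => ?_⟩
  have hc : ∀ T : ℝ^d, CubeBounded fun x =>
      profile τ s (dot θ x) (dot T x) (ε * actNorm T x) := fun T =>
    CubeBounded.profile τ s (by fun_prop) (by fun_prop) (by fun_prop)
  simp only [smul_eq_mul, linRisk]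
  rw [← integral_const_mul, ← integral_const_mul,
    ← hL.integral_add (by have := hc T; fun_prop) (by have := hc T'; fun_prop)]
  refine hL.integral_mono (hF := hc _) (hG := by have := hc T; have := hc T'; fun_prop) fun x _ => ?_
  have e : (a • T + b • T' : ℝ^d) = fun i => a * T i + b * T' i := by ext i; simp
  rw [e, dot_add_mul]
  refine le_trans (profile_mono τ s _ _ ?_) (profile_comb_le τ s _ ha hb hab)
  have h1 := actNorm_nonneg T x
  have h2 := actNorm_nonneg T' x
  rw [abs_of_nonneg (mul_nonneg hε (actNorm_nonneg _ _)), abs_of_nonneg (by positivity)]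
  calc ε * actNorm (fun i => a * T i + b * T' i) x ≤ ε * (a * actNorm T x + b * actNorm T' x) :=
        mul_le_left (actNorm_add_le T T' x ha hb) hε
    _ = _ := by ring

theorem FeatureBounds.continuous_linRisk (hL : FeatureBounds K k d law) (τ : Task) (s : ℝ) {ε : ℝ}
    (hε : 0 ≤ ε) (θ : ℝ^d) : Continuous (linRisk τ s ε law θ) :=
  continuousOn_univ.1 ((hL.convexOn_linRisk τ s hε θ).continuousOn isOpen_univ)

theorem FeatureBounds.integral_numAct_le (hL : FeatureBounds K k d law) :
    ∫ x, numAct x ∂Λ ≤ K * k := by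
  simp only [numAct]
  rw [hL.integral_sum]
  simp only [hL.integral_act, sum_const, card_univ, Fintype.card_fin, nsmul_eq_mul]
  exact hL.d_mul_rate_le

theorem FeatureBounds.integral_sq_dot_le (hL : FeatureBounds K k d law) {a : ℝ^d} {B : ℝ}
    (h : ∀ i, |a i| ≤ B) : ∫ x, dot a x ^ 2 ∂Λ ≤ K * B ^ 2 := by
  simp only [dot]
  rw [hL.integral_sq_form]
  have h1 : ∑ i, a i ^ 2 ≤ d * B ^ 2 := by
    refine (sum_le_sum fun i _ => (sq_le_sq' (by linarith [neg_abs_le (a i), h i])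
      ((le_abs_self _).trans (h i)) : a i ^ 2 ≤ B ^ 2)).trans ?_
    simp
  have h2 := hL.var_upper
  rw [le_div_iff₀ hL.d_pos] at h2
  calc energy law * ∑ i, a i ^ 2 ≤ energy law * (d * B ^ 2) :=
        mul_le_left h1 hL.energy_pos.le
    _ = (energy law * d) * B ^ 2 := by ring
    _ ≤ _ := mul_le_right h2 (sq_nonneg _)

/-- The risk of the Bayes predictor `θ · x` without attack. -/
def bayesRisk (τ : Task) (s : ℝ) (law : Measure ℝ) (θ : ℝ^d) : ℝ :=
  ∫ x, profile τ s (dot θ x) (dot θ x) 0 ∂vecLaw d law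

/-- The displacement at `θ` is at most `ε K √(numAct x)`, whose mean square is of order `ε ^ 2 k`;
the Lipschitz bound of the profile at `f = t` is linear plus quadratic in it. -/
theorem linRisk_self_le (τ : Task) (s K : ℝ) : ∃ C > 0, ∀ {k ε : ℝ} {d : ℕ} {law : Measure ℝ}
    {θ : ℝ^d}, FeatureBounds K k d law → (∀ i, |θ i| ≤ K) → 0 ≤ ε → ε * √k ≤ 1 →
    linRisk τ s ε law θ θ ≤ bayesRisk τ s law θ + C * (ε * √k) := by
  obtain ⟨C, hC, hlip⟩ := profile_lipschitz τ s
  refine ⟨C * (K ^ 2 + |K| ^ 3 + 1), by positivity, fun {k ε d law θ} hL hθ hε hεk => ?_⟩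
  have hK := hL.one_le_K
  rw [abs_of_nonneg (by linarith : 0 ≤ K)]
  have hk := hL.one_le_k
  set G := fun x : ℝ^d => ε * actNorm θ x with hG
  have hcG : CubeBounded G := by fun_prop
  have hcp : ∀ G : ℝ^d → ℝ, CubeBounded G → CubeBounded fun x =>
      profile τ s (dot θ x) (dot θ x) (G x) := fun G hG =>
    CubeBounded.profile τ s (by fun_prop) (by fun_prop) hG
  have hG2 : ∫ x, G x ^ 2 ∂vecLaw d law ≤ K ^ 3 * (ε * √k) ^ 2 := by
    calc ∫ x, G x ^ 2 ∂vecLaw d law ≤ ∫ x, (ε * K) ^ 2 * numAct x ∂vecLaw d law := by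
          refine hL.integral_mono fun x _ => ?_
          have h1 := actNorm_le (zero_le_one.trans hK) hθ x
          have h2 : actNorm θ x ^ 2 ≤ (K * √(numAct x)) ^ 2 :=
            pow_le_pow_left₀ (actNorm_nonneg _ _) h1 2
          rw [mul_pow, sq_sqrt (numAct_nonneg x)] at h2
          simp only [hG, mul_pow]
          have := mul_le_left h2 (sq_nonneg ε)
          linarith
      _ ≤ (ε * K) ^ 2 * (K * k) := by
          rw [integral_const_mul]
          exact mul_le_left hL.integral_numAct_le (sq_nonneg _)
      _ = _ := by rw [mul_pow, mul_pow, sq_sqrt (by linarith)]; ring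
  have hεk0 : 0 ≤ ε * √k := by positivity
  have hG1 : ∫ x, G x ∂vecLaw d law ≤ K ^ 2 * (ε * √k) := by
    have h1 := hL.integral_abs_le hcG
    have h2 : ∀ x, |G x| = G x := fun x => abs_of_nonneg (mul_nonneg hε (actNorm_nonneg _ _))
    simp only [h2] at h1
    refine h1.trans (sqrt_le_iff.2 ⟨by positivity, hG2.trans ?_⟩)
    rw [mul_pow (K ^ 2)]
    refine mul_le_right ?_ (sq_nonneg _)
    rw [← pow_mul]
    exact pow_le_pow_right₀ hK (by norm_num)
  have hG3 : ∫ x, G x ^ 2 ∂vecLaw d law ≤ K ^ 3 * (ε * √k) := by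
    refine hG2.trans (mul_le_left ?_)
    rw [sq]; exact mul_le_of_le_one_left hεk0 hεk
  have key : linRisk τ s ε law θ θ - bayesRisk τ s law θ ≤
      ∫ x, C * (G x + G x ^ 2) ∂vecLaw d law := by
    rw [linRisk, bayesRisk, ← hL.integral_sub (hcp _ hcG) (hcp _ (CubeBounded.const 0))]
    refine hL.integral_mono (hF := (hcp _ hcG).sub (hcp _ (CubeBounded.const 0)))
      fun x _ => ?_
    have h1 := (le_abs_self _).trans (hlip (dot θ x) (dot θ x) 0 (dot θ x) (G x))
    have h2 : 0 ≤ G x := mul_nonneg hε (actNorm_nonneg _ _)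
    simp only [sub_self, abs_zero, add_zero, sub_zero, zero_add, abs_of_nonneg h2] at h1
    refine h1.trans (le_of_eq (by ring))
  rw [integral_const_mul, hL.integral_add] at key
  have : C * (∫ x, G x ∂vecLaw d law + ∫ x, G x ^ 2 ∂vecLaw d law) ≤
      C * ((K ^ 2 + K ^ 3) * (ε * √k)) :=
    mul_le_left (by linarith) hC.le
  nlinarith [mul_nonneg hC.le hεk0]

/-- A predictor with nearly optimal risk is close to `θ · x` where `θ · x` is bounded. -/
theorem integral_abs_sub_le_of_risk_le (τ : Task) {s : ℝ} (hs : 0 < s) (B : ℝ) {η : ℝ}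
    (hη : 0 < η) : ∃ δ > 0, ∀ {K k : ℝ} {d : ℕ} {law : Measure ℝ} {θ : ℝ^d}
    {f : ℝ^d → ℝ}, FeatureBounds K k d law → CubeBounded f →
    ∫ x, profile τ s (dot θ x) (f x) 0 ∂vecLaw d law ≤ bayesRisk τ s law θ + δ →
    ∫ x, (if |dot θ x| ≤ B then |f x - dot θ x| else 0) ∂vecLaw d law ≤ η := by
  -- Half of `η` pays for the offset in `profile_closeness`, the other half for the excess risk.
  obtain ⟨c, hc, h⟩ := profile_closeness τ hs B (half_pos hη)
  refine ⟨c * (η / 2), by positivity, fun {K k d law θ f} hL hf hrisk => ?_⟩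
  have hm : MeasurableSet {x : ℝ^d | |dot θ x| ≤ B} :=
    measurableSet_le (CubeBounded.dot θ).abs.1 measurable_const
  have hcp : ∀ f : ℝ^d → ℝ, CubeBounded f → CubeBounded fun x =>
      profile τ s (dot θ x) (f x) 0 := fun f hf =>
    CubeBounded.profile τ s (by fun_prop) hf (by fun_prop)
  have hind : CubeBounded fun x => if |dot θ x| ≤ B then |f x - dot θ x| else 0 :=
    CubeBounded.indicator hm (by fun_prop)
  have h1 : ∫ x, c * ((if |dot θ x| ≤ B then |f x - dot θ x| else 0) - η / 2) ∂vecLaw d law ≤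
      ∫ x, (profile τ s (dot θ x) (f x) 0 - profile τ s (dot θ x) (dot θ x) 0) ∂vecLaw d law := by
    refine hL.integral_mono (hG := (hcp f hf).sub (hcp _ (CubeBounded.dot θ)))
      fun x _ => ?_
    split_ifs with hx
    · exact h _ _ hx
    · have := profile_bayes τ s (dot θ x) (f x)
      nlinarith [mul_pos hc hη]
  rw [integral_const_mul, hL.integral_sub hind, hL.integral_const,
    hL.integral_sub (hcp f hf) (hcp _ (CubeBounded.dot θ))] at h1
  rw [bayesRisk] at hrisk
  have h2 := h1.trans (show _ ≤ c * (η / 2) by linarith)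
  have := le_of_mul_le_mul_left h2 hc
  linarith

/-- The quotient `act (x i) / √(numAct x)` is the size of the effect of one coefficient on the
active norm, and the factor before it is the Lipschitz weight of the profile. The order `√k / d`
comes from Cauchy–Schwarz: the quotient has mean square at most `1 / d` by exchangeability, and it
is supported where feature `i` is active, where the weight has mean square of order `k / d`. For the
part with `ε` the root cancels and `ε √k ≤ 1` is used. -/
theorem integral_weight_act_le (K B : ℝ) : ∃ C > 0, ∀ {k ε : ℝ} {d : ℕ} {law : Measure ℝ}
    {a : ℝ^d}, FeatureBounds K k d law → (∀ i, |a i| ≤ B) → 0 ≤ ε → ε * √k ≤ 1 →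
    ∀ i, ∫ x, (1 + |dot a x| + ε * √(numAct x)) * (act (x i) / √(numAct x))
      ∂vecLaw d law ≤ C * (√k / d) := by
  refine ⟨(|K| + 1) + (2 * |K| * B ^ 2 * (1 + |K|) + 1) + |K| + 1, by positivity,
    fun {k ε d law a} hL ha hε hεk i => ?_⟩
  have hK := hL.one_le_K
  have hk := hL.one_le_k
  have hd := hL.d_pos
  rw [abs_of_nonneg (by linarith : 0 ≤ K)]
  set u := fun x : ℝ^d => act (x i) / √(numAct x) with hu
  have hun : ∀ x, 0 ≤ u x := fun x => div_nonneg (act_nonneg _) (sqrt_nonneg _)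
  have hsq1 : ∀ x : ℝ^d, act (x i) ≤ √(numAct x) := fun x => by
    by_cases h : x i = 0
    · simp only [act, h, if_true]; exact sqrt_nonneg _
    · have h1 : act (x i) = 1 := if_neg h
      have := act_le_numAct x i
      rw [h1] at this ⊢
      exact one_le_sqrt.2 this
  have hcu : CubeBounded u :=
    ⟨(CubeBounded.act (CubeBounded.coord i)).1.div (CubeBounded.sqrt CubeBounded.numAct).1, 1,
      fun x _ => by
        rw [abs_of_nonneg (hun x)]
        exact div_le_one_of_le₀ (hsq1 x) (sqrt_nonneg _)⟩
  have hu2 : ∫ x, u x ^ 2 ∂vecLaw d law ≤ 1 / d := by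
    refine le_trans (le_of_eq ?_) (hL.integral_act_div_numAct_le i)
    congr 1; funext x
    simp only [hu, div_pow, sq (act (x i)), act_mul_self, sq_sqrt (numAct_nonneg x)]
  have hact : ∀ x, act (x i) * u x = u x := fun x => by
    simp only [hu, ← mul_div_assoc, act_mul_self]
  have hsd : √k / d = √(k / d) * √(1 / d) := by
    rw [← sqrt_mul (by positivity), show k / d * (1 / d) = k / (d : ℝ) ^ 2 by ring,
      sqrt_div (by linarith), sqrt_sq hd.le]
  have hcs : ∀ (F : ℝ^d → ℝ) (M : ℝ), 0 ≤ M → CubeBounded F →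
      ∫ x, F x ^ 2 ∂vecLaw d law ≤ M * (k / d) →
      ∫ x, F x * u x ∂vecLaw d law ≤ (M + 1) * (√k / d) := fun F M hM hF h => by
    refine (hL.integral_mul_le hF hcu).trans ?_
    have h1 : √(∫ x, F x ^ 2 ∂vecLaw d law) ≤ (M + 1) * √(k / d) := by
      refine (sqrt_le_sqrt h).trans ?_
      rw [sqrt_mul hM]
      refine mul_le_right ?_ (sqrt_nonneg _)
      exact sqrt_le_iff.2 ⟨by linarith, by nlinarith⟩
    calc _ ≤ (M + 1) * √(k / d) * √(1 / d) :=
          mul_le_mul h1 (sqrt_le_sqrt hu2) (sqrt_nonneg _) (by positivity)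
      _ = _ := by rw [hsd]; ring
  have hrate := hL.rate_le
  have i1 : ∫ x, act (x i) * u x ∂vecLaw d law ≤ (K + 1) * (√k / d) := by
    refine hcs (fun x => act (x i)) K (by linarith) (by fun_prop) ?_
    simp only [sq, act_mul_self, hL.integral_act]
    rwa [← mul_div_assoc]
  have i2 : ∫ x, (act (x i) * |dot a x|) * u x ∂vecLaw d law ≤
      (2 * K * B ^ 2 * (1 + K) + 1) * (√k / d) := by
    refine hcs (fun x => act (x i) * |dot a x|) _ (by positivity) (by fun_prop) ?_
    simp only [mul_pow, sq_abs, sq (act _), act_mul_self]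
    refine (hL.integral_act_mul_sq_form_le i a).trans ?_
    have h1 : energy law * ∑ j, a j ^ 2 ≤ K * B ^ 2 := by
      have := hL.integral_sq_dot_le ha
      simp only [dot] at this
      rwa [hL.integral_sq_form] at this
    have h2 : a i ^ 2 ≤ B ^ 2 := sq_le_of_abs_le (ha i)
    calc 2 * rate law * (a i ^ 2 + energy law * ∑ j, a j ^ 2)
        ≤ 2 * (K * k / d) * (B ^ 2 + K * B ^ 2) := by
          refine mul_le_mul (by linarith) (by linarith) ?_ (by positivity)
          exact add_nonneg (sq_nonneg _) (mul_nonneg hL.energy_pos.le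
            (sum_nonneg fun i _ => sq_nonneg _))
      _ = _ := by ring
  have i3 : ∫ x, ε * act (x i) ∂vecLaw d law ≤ K * (√k / d) := by
    rw [integral_const_mul, hL.integral_act]
    calc ε * rate law ≤ ε * (K * k / d) := mul_le_left hrate hε
      _ = (ε * √k) * (K * (√k / d)) := by
          have : k = √k * √k := (mul_self_sqrt (by linarith)).symm
          nth_rewrite 1 [this]; ring
      _ ≤ 1 * (K * (√k / d)) := mul_le_right hεk
      _ = _ := one_mul _
  have hle : ∫ x, (1 + |dot a x| + ε * √(numAct x)) * u x ∂vecLaw d law ≤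
      ∫ x, (act (x i) * u x + (act (x i) * |dot a x|) * u x + ε * act (x i)) ∂vecLaw d law := by
    refine hL.integral_mono fun x _ => ?_
    have h1 : √(numAct x) * u x ≤ act (x i) := by
      simp only [hu]
      by_cases h : √(numAct x) = 0
      · rw [h, zero_mul]; exact act_nonneg _
      · rw [mul_div_cancel₀ _ h]
    have h2 := mul_le_left h1 hε
    have h3 := hact x
    have h4 : act (x i) * |dot a x| * u x = |dot a x| * u x := by rw [mul_right_comm, h3, mul_comm]
    rw [h3, h4]
    nlinarith
  rw [hL.integral_add, hL.integral_add]
    at hle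
  have hpos : 0 ≤ √k / d := by positivity
  linarith

end

/-! ### The minimiser of the linear robust risk. -/

section

variable {d : ℕ} {K k : ℝ} {law : Measure ℝ}

/-- The law of the features. -/
local notation "Λ" => vecLaw d law

theorem FeatureBounds.integral_sq_mul_numAct_le (hL : FeatureBounds K k d law) (i : Fin d) :
    ∫ x, x i ^ 2 * numAct x ∂Λ ≤ energy law * (1 + K * k) := by
  have hp := hL.rate_pos
  have he := hL.energy_pos
  simp only [numAct, mul_sum]
  rw [hL.integral_sum]
  have : ∀ j, ∫ x, x i ^ 2 * act (x j) ∂Λ ≤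
      (if j = i then energy law else 0) + energy law * rate law := fun j => by
    by_cases h : j = i
    · subst h
      rw [if_pos rfl]
      have e : ∀ x : ℝ^d, x j ^ 2 * act (x j) = x j ^ 2 * 1 := fun x => by
        rw [sq, mul_assoc, mul_comm (x j) (act (x j)), act_mul_coe, mul_one]
      simp only [e]
      rw [hL.integral_sq_coord_mul j measurable_const fun _ _ => rfl, hL.integral_const, mul_one]
      nlinarith
    · rw [if_neg h, zero_add, hL.integral_sq_coord_mul i
        (CubeBounded.act (CubeBounded.coord j)).1, hL.integral_act]
      intro x a
      rw [update_of_ne h]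
  refine (sum_le_sum fun j _ => this j).trans ?_
  rw [sum_add_distrib]
  simp
  have := hL.d_mul_rate_le
  nlinarith

theorem dot_update (T x : ℝ^d) (i : Fin d) (b : ℝ) :
    dot (update T i b) x = dot (update T i 0) x + b * x i := by
  simp only [dot]
  rw [← add_sum_erase _ _ (mem_univ i),
    ← add_sum_erase _ (fun j => update T i 0 j * x j) (mem_univ i)]
  simp only [update_self, zero_mul, zero_add]
  rw [add_comm]
  congr 1
  exact sum_congr rfl fun j hj => by
    rw [update_of_ne (Finset.ne_of_mem_erase hj), update_of_ne (Finset.ne_of_mem_erase hj)]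

theorem dot_eq_add (T x : ℝ^d) (i : Fin d) : dot T x = dot (update T i 0) x + T i * x i := by
  rw [← dot_update, Function.update_eq_self]

theorem dot_update_zero_update (T x : ℝ^d) (i : Fin d) (a : ℝ) :
    dot (update T i 0) (update x i a) = dot (update T i 0) x := by
  simp only [dot]
  refine sum_congr rfl fun j _ => ?_
  by_cases h : j = i
  · subst h; simp
  · rw [update_of_ne h, update_of_ne h]

theorem actNorm_flip (T x : ℝ^d) (i : Fin d) : actNorm T (update x i (-x i)) = actNorm T x := by
  simp only [actNorm]
  congr 1
  refine sum_congr rfl fun j _ => ?_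
  by_cases h : j = i
  · subst h; simp [act_neg]
  · rw [update_of_ne h]

/-- A difference of norms is the difference of their squares, here the single term of index `i`,
divided by their sum, and this sum is at least `B₀ √(numAct x)`. -/
theorem abs_actNorm_update_sub_le {T : ℝ^d} {B B₀ : ℝ} (hB₀ : 0 < B₀) (hT : ∀ j, B₀ ≤ |T j|)
    {i : Fin d} (hi : |T i| ≤ B) {b : ℝ} (hb : |b| ≤ B) (x : ℝ^d) :
    |actNorm (update T i b) x - actNorm T x| ≤ B ^ 2 / B₀ * (act (x i) / √(numAct x)) := by
  set u := actNorm (update T i b) x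
  set v := actNorm T x
  have huv : u ^ 2 - v ^ 2 = act (x i) * (b ^ 2 - T i ^ 2) := by
    simp only [u, v, sq_actNorm, ← sum_sub_distrib]
    rw [sum_eq_single i]
    · rw [update_self]; ring
    · intro j _ hj; rw [update_of_ne hj, sub_self]
    · simp
  by_cases h : x i = 0
  · have h0 : act (x i) = 0 := if_pos h
    rw [h0, zero_mul, sub_eq_zero, sq_eq_sq₀ (actNorm_nonneg _ _) (actNorm_nonneg _ _)] at huv
    have huv' : u = v := huv
    rw [huv', h0]; simp
  · have h1 : act (x i) = 1 := if_neg h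
    have hn : 1 ≤ numAct x := by rw [← h1]; exact act_le_numAct x i
    have hs : 0 < √(numAct x) := sqrt_pos.2 (by linarith)
    have hv : B₀ * √(numAct x) ≤ v := le_actNorm hB₀.le hT x
    have hu : 0 ≤ u := actNorm_nonneg _ _
    have hsum : 0 < u + v := by nlinarith
    have h2 : |u - v| * (u + v) ≤ B ^ 2 := by
      rw [← abs_of_pos hsum, ← abs_mul, show (u - v) * (u + v) = u ^ 2 - v ^ 2 by ring, huv, h1,
        one_mul, abs_le]
      have e1 : T i ^ 2 ≤ B ^ 2 := sq_le_of_abs_le hi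
      have e2 : b ^ 2 ≤ B ^ 2 := sq_le_of_abs_le hb
      constructor <;> nlinarith [sq_nonneg b, sq_nonneg (T i)]
    rw [h1, div_mul_div_comm, mul_one, le_div_iff₀ (mul_pos hB₀ hs)]
    refine le_trans (mul_le_left ?_ (abs_nonneg _)) h2
    linarith

theorem dot_sub (a b x : ℝ^d) : dot a x - dot b x = dot (fun i => a i - b i) x := by
  simp only [dot, ← sum_sub_distrib]
  exact sum_congr rfl fun i _ => by ring

/-- The arithmetic–geometric mean inequality. It replaces `√(numAct x)` by an affine function of
`numAct x`, whose mean against `x i ^ 2` is explicit. -/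
theorem sqrt_le_half_add {a k : ℝ} (ha : 0 ≤ a) (hk : 0 < k) : √a ≤ (√k + a / √k) / 2 := by
  have hk' := sqrt_pos.2 hk
  have : √a * √k ≤ (k + a) / 2 := by nlinarith [sq_nonneg (√a - √k), sq_sqrt ha, sq_sqrt hk.le]
  rw [← mul_le_mul_iff_of_pos_right hk']
  refine this.trans (le_of_eq ?_)
  field_simp
  rw [sq_sqrt hk.le]

theorem cubeBounded_act_div_sqrt (i : Fin d) :
    CubeBounded fun x : ℝ^d => act (x i) / √(numAct x) := by
  refine (CubeBounded.const 1).mono ((CubeBounded.act (CubeBounded.coord i)).1.div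
    (CubeBounded.sqrt CubeBounded.numAct).1) fun x => ?_
  rw [abs_one, abs_of_nonneg (div_nonneg (act_nonneg _) (sqrt_nonneg _))]
  refine div_le_one_of_le₀ (le_sqrt_of_sq_le ?_) (sqrt_nonneg _)
  rw [sq, act_mul_self]; exact act_le_numAct x i

/-- A quadratic minorant of an indicator, so that second moments suffice to integrate it. -/
theorem mul_one_sub_le_ite {q R : ℝ} (hq : 0 ≤ q) (hR : 0 < R) (a b : ℝ) :
    q * (1 - (a ^ 2 + b ^ 2) / R ^ 2) ≤ if |a| ≤ R ∧ |b| ≤ R then q else 0 := by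
  split_ifs with h
  · have : 0 ≤ (a ^ 2 + b ^ 2) / R ^ 2 := by positivity
    nlinarith
  · have : 1 ≤ (a ^ 2 + b ^ 2) / R ^ 2 := by
      rw [le_div_iff₀ (by positivity), one_mul]
      rw [not_and_or, not_le, not_le] at h
      rcases h with h | h
      · have := pow_le_pow_left₀ hR.le h.le 2
        rw [sq_abs] at this; nlinarith [sq_nonneg b]
      · have := pow_le_pow_left₀ hR.le h.le 2
        rw [sq_abs] at this; nlinarith [sq_nonneg a]
    nlinarith

set_option maxHeartbeats 1000000 in
/-- Moving an extreme coefficient of the predictor inwards lowers the risk. -/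
theorem linRisk_update_lt (τ : Task) {s K : ℝ} (hs : 0 < s) (hK : 1 ≤ K) :
    ∃ η > 0, ∀ {k ε : ℝ} {d : ℕ} {law : Measure ℝ} {θ T : ℝ^d}, FeatureBounds K k d law →
    (∀ i, 1 / K ≤ |θ i| ∧ |θ i| ≤ K) → 0 ≤ ε → ε * √k ≤ η → 1 / (d : ℝ) ≤ η →
    (∀ i, |T i - θ i| ≤ |θ i| / 2) → ∫ x, |dot T x - dot θ x| ∂vecLaw d law ≤ η →
    ∀ (i : Fin d) (r r' : ℝ), ((r = 1 / 2 ∧ r' = 3 / 4) ∨ (r = 3 / 2 ∧ r' = 5 / 4)) →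
    T i = r * θ i →
    linRisk τ s ε law θ (update T i (r' * θ i)) < linRisk τ s ε law θ T := by
  have hK0 : 0 < K := by linarith
  -- The second moments of the two linear forms below are at most `4 K ^ 3` and `K ^ 3`, so that a
  -- quarter is lost in the quadratic minorant of the indicator of `|A|, |B| ≤ R`.
  set R := √(20 * K ^ 3) with hR
  have hR2 : R ^ 2 = 20 * K ^ 3 := sq_sqrt (by positivity)
  obtain ⟨c, hc, hflip⟩ := profile_flip_decrease τ (s := s) (K := K) (R := R) hs hK
    (sqrt_nonneg _)
  obtain ⟨C₁, hC₁, hlip⟩ := profile_lipschitz τ s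
  obtain ⟨C₂, hC₂, hW⟩ := integral_weight_act_le K (2 * K)
  set C₃ : ℝ := C₁ * (4 * K) * ((2 * K) ^ 2 / (1 / (2 * K))) * C₂ with hC₃
  have hC₃0 : 0 < C₃ := by positivity
  set D : ℝ := C₃ * K + K ^ 2 * (1 + K ^ 2) + 2 * K ^ 3 * (1 + K) with hD
  have hD0 : 0 < D := by positivity
  -- `D` collects the constants of the three error terms `t1`, `t2`, `t3`. This `δ` keeps their sum
  -- below a third of the gain, which is at least `3 c / (8 K ^ 2)` times the energy.
  set δ : ℝ := min 1 (c / (8 * K ^ 2 * D)) with hδ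
  have hδ0 : 0 < δ := lt_min one_pos (by positivity)
  have hδ1 : δ ≤ 1 := min_le_left _ _
  have hδD : D * δ ≤ c / (8 * K ^ 2) := by
    have : δ ≤ c / (8 * K ^ 2 * D) := min_le_right _ _
    calc D * δ ≤ D * (c / (8 * K ^ 2 * D)) := mul_le_left this hD0.le
      _ = _ := by field_simp
  -- The square is needed because `1 / d` bounds the mean of `|x i|` only through its root.
  refine ⟨δ ^ 2, by positivity, fun {k ε d law θ T} hL hθ hε hεk hd hT hclose i r r' hr hTi => ?_⟩
  have hδδ : δ ^ 2 ≤ δ := pow_le_of_le_one hδ0.le hδ1 two_ne_zero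
  have hk := hL.one_le_k
  have hdp := hL.d_pos
  have he := hL.energy_pos
  have hTub : ∀ j, |T j| ≤ 2 * K := fun j => by
    have h1 := abs_sub_abs_le_abs_sub (T j) (θ j)
    linarith [hT j, (hθ j).2]
  have hTlb : ∀ j, 1 / (2 * K) ≤ |T j| := fun j => by
    have h1 := abs_sub_abs_le_abs_sub (θ j) (T j)
    rw [abs_sub_comm] at h1
    have h2 : 1 / (2 * K) = 1 / K / 2 := by field_simp
    linarith [hT j, (hθ j).1]
  set b := r' * θ i with hb
  have hbb : |b| ≤ 2 * K := by
    have hr' : |r'| ≤ 2 := by rcases hr with ⟨_, rfl⟩ | ⟨_, rfl⟩ <;> norm_num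
    rw [hb, abs_mul]
    exact mul_le_mul hr' (hθ i).2 (abs_nonneg _) (by norm_num)
  set T' := update T i b with hT'
  have hT'ub : ∀ j, |T' j| ≤ 2 * K := fun j => by
    by_cases h : j = i
    · subst h; rw [hT', update_self]; exact hbb
    · rw [hT', update_of_ne h]; exact hTub j
  have hdist : ∀ j, |T' j - θ j| ≤ 2 * K := fun j => by
    by_cases h : j = i
    · subst h
      rw [hT', update_self, hb, show r' * θ j - θ j = (r' - 1) * θ j by ring, abs_mul]
      have hr' : |r' - 1| ≤ 2 := by rcases hr with ⟨_, rfl⟩ | ⟨_, rfl⟩ <;> norm_num [abs_le]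
      exact mul_le_mul hr' (hθ j).2 (abs_nonneg _) (by norm_num)
    · rw [hT', update_of_ne h]
      linarith [hT j, (hθ j).2]
  set G := fun x : ℝ^d => ε * actNorm T x with hG
  set G' := fun x : ℝ^d => ε * actNorm T' x with hG'
  have hG0 : ∀ x, 0 ≤ G x := fun x => mul_nonneg hε (actNorm_nonneg _ _)
  have hG'0 : ∀ x, 0 ≤ G' x := fun x => mul_nonneg hε (actNorm_nonneg _ _)
  set u := fun x : ℝ^d => act (x i) / √(numAct x) with hu
  have hGn : ∀ x, G x ≤ 2 * K * (ε * √(numAct x)) := fun x => by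
    have := mul_le_left (actNorm_le (by positivity) hTub x) hε
    simp only [hG]; linarith
  have hG'n : ∀ x, G' x ≤ 2 * K * (ε * √(numAct x)) := fun x => by
    have := mul_le_left (actNorm_le (by positivity) hT'ub x) hε
    simp only [hG']; linarith
  have hcu : CubeBounded u := cubeBounded_act_div_sqrt i
  have hcp : ∀ (f G : ℝ^d → ℝ), CubeBounded f → CubeBounded G → CubeBounded fun x =>
      profile τ s (dot θ x) (f x) (G x) := fun f G hf hG =>
    CubeBounded.profile τ s (by fun_prop) hf hG
  have c0 := hcp (dot T) G (by fun_prop) (by fun_prop)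
  have c1 := hcp (dot T') G (by fun_prop) (by fun_prop)
  have c2 := hcp (dot T') G' (by fun_prop) (by fun_prop)
  -- the cost of the change of the attack
  have I1 : ∫ x, (profile τ s (dot θ x) (dot T' x) (G' x) - profile τ s (dot θ x) (dot T' x) (G x))
      ∂vecLaw d law ≤ C₃ * (ε * √k / d) := by
    have h1 : ∫ x, (profile τ s (dot θ x) (dot T' x) (G' x) -
        profile τ s (dot θ x) (dot T' x) (G x)) ∂vecLaw d law ≤
        ∫ x, C₁ * (4 * K) * ((2 * K) ^ 2 / (1 / (2 * K))) * ε *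
          ((1 + |dot (fun j => T' j - θ j) x| + ε * √(numAct x)) * u x)
          ∂vecLaw d law := by
      refine hL.integral_mono (hF := c2.sub c1) fun x _ => ?_
      refine ((le_abs_self _).trans (hlip (dot θ x) (dot T' x) (G x) (dot T' x) (G' x))).trans ?_
      rw [sub_self, abs_zero, zero_add, dot_sub, abs_of_nonneg (hG0 x), abs_of_nonneg (hG'0 x)]
      have h2 : |G' x - G x| ≤ ε * ((2 * K) ^ 2 / (1 / (2 * K)) * u x) := by
        simp only [hG, hG']
        rw [← mul_sub, abs_mul, abs_of_nonneg hε]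
        exact mul_le_left
          (abs_actNorm_update_sub_le (by positivity) hTlb (hTub i) hbb x) hε
      set D' := |dot (fun j => T' j - θ j) x| with hD'
      have hD'0 : 0 ≤ D' := abs_nonneg _
      have hsn : 0 ≤ ε * √(numAct x) := by positivity
      have h3 : 1 + D' + G x + D' + G' x ≤ 4 * K * (1 + D' + ε * √(numAct x)) := by
        have e1 := hGn x
        have e2 := hG'n x
        have e3 := mul_nonneg (sub_nonneg.2 hK) hD'0
        linarith
      have hu0 : 0 ≤ u x := div_nonneg (act_nonneg _) (sqrt_nonneg _)
      calc C₁ * (1 + D' + G x + D' + G' x) * |G' x - G x|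
          ≤ C₁ * (4 * K * (1 + D' + ε * √(numAct x))) * (ε * ((2 * K) ^ 2 / (1 / (2 * K)) * u x)) :=
            mul_le_mul (mul_le_left h3 hC₁.le) h2 (abs_nonneg _) (by positivity)
        _ = _ := by ring
    refine h1.trans ?_
    rw [integral_const_mul]
    have h4 := hW hL hdist hε (by linarith : ε * √k ≤ 1) i
    calc _ ≤ C₁ * (4 * K) * ((2 * K) ^ 2 / (1 / (2 * K))) * ε * (C₂ * (√k / d)) :=
          mul_le_left h4
      _ = _ := by rw [hC₃]; ring
  -- the gain of the move
  set A := fun x : ℝ^d => dot (update T i 0) x with hA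
  set B := fun x : ℝ^d => dot (update θ i 0) x with hB
  have hcA : CubeBounded A := by fun_prop
  have hcB : CubeBounded B := by fun_prop
  have hAinv : ∀ x a, A (update x i a) = A x := fun x a => dot_update_zero_update T x i a
  have hBinv : ∀ x a, B (update x i a) = B x := fun x a => dot_update_zero_update θ x i a
  have hdT : ∀ x, dot T x = A x + r * (θ i * x i) := fun x => by rw [dot_eq_add T x i, hTi]; ring
  have hdT' : ∀ x, dot T' x = A x + r' * (θ i * x i) := fun x => by rw [hT', dot_update, hb]; ring
  have hdθ : ∀ x, dot θ x = B x + θ i * x i := fun x => dot_eq_add θ x i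
  have I2 : ∫ x, (profile τ s (dot θ x) (dot T' x) (G x) - profile τ s (dot θ x) (dot T x) (G x))
      ∂vecLaw d law ≤ energy law * (θ i ^ 2 * (∫ x, |A x - B x| ∂vecLaw d law)) +
        K ^ 2 * (∫ x, x i ^ 2 * G x ∂vecLaw d law) - energy law * (3 / 8 * (c * θ i ^ 2)) := by
    set g := fun x => profile τ s (dot θ x) (dot T' x) (G x) -
      profile τ s (dot θ x) (dot T x) (G x) with hg
    have hcg : CubeBounded g := c1.sub c0
    have := hL.prob
    -- Reversing the sign of `x i` preserves the law, the active norm and the remaining coordinates,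
    -- so `g` may be averaged with its reflection, to which `profile_flip_decrease` applies.
    have hfl := integral_flip (law := law) hL.symm i hcg.1
    have hgf : ∀ x, g (update x i (-x i)) =
        profile τ s (B x - θ i * x i) (A x - r' * (θ i * x i)) (G x) -
          profile τ s (B x - θ i * x i) (A x - r * (θ i * x i)) (G x) := fun x => by
      simp only [hg, hG, actNorm_flip, hdθ, hdT, hdT', hAinv, hBinv, update_self, mul_neg,
        ← sub_eq_add_neg]
    have hcgf : CubeBounded fun x => g (update x i (-x i)) := by
      simp only [hgf]
      exact (CubeBounded.profile τ s (by fun_prop) (by fun_prop) (by fun_prop)).sub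
        (CubeBounded.profile τ s (by fun_prop) (by fun_prop) (by fun_prop))
    have h1 : ∫ x, (g x + g (update x i (-x i))) ∂vecLaw d law ≤
        ∫ x, (2 * θ i ^ 2 * (x i ^ 2 * |A x - B x|) + 2 * K ^ 2 * (x i ^ 2 * G x)
          - c * θ i ^ 2 * (x i ^ 2 * (1 - (A x ^ 2 + B x ^ 2) / R ^ 2))) ∂vecLaw d law := by
      refine hL.integral_mono (hF := hcg.add hcgf) fun x hx => ?_
      rw [hgf]
      simp only [hg, hdθ, hdT, hdT']
      have hw : |θ i * x i| ≤ K := by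
        rw [abs_mul]
        exact (mul_le_of_le_one_right (abs_nonneg _) (hx.abs_le i)).trans (hθ i).2
      have h2 := hflip (A x) (B x) (θ i * x i) (G x) r r' hw (hG0 x) hr
      have h3 : c * θ i ^ 2 * (x i ^ 2 * (1 - (A x ^ 2 + B x ^ 2) / R ^ 2)) ≤
          if |A x| ≤ R ∧ |B x| ≤ R then c * (θ i * x i) ^ 2 else 0 := by
        have hq : 0 ≤ c * θ i ^ 2 * x i ^ 2 := by positivity
        have := mul_one_sub_le_ite hq (sqrt_pos.2 (by positivity : 0 < 20 * K ^ 3)) (A x) (B x)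
        rw [show c * (θ i * x i) ^ 2 = c * θ i ^ 2 * x i ^ 2 by ring]
        exact (mul_assoc _ _ _).symm.le.trans this
      have h4 : θ i ^ 2 ≤ K ^ 2 := sq_le_of_abs_le (hθ i).2
      have h5 : θ i ^ 2 * (x i ^ 2 * G x) ≤ K ^ 2 * (x i ^ 2 * G x) :=
        mul_le_right h4 (mul_nonneg (sq_nonneg _) (hG0 x))
      linarith
    have hrhs : ∫ x, (2 * θ i ^ 2 * (x i ^ 2 * |A x - B x|) + 2 * K ^ 2 * (x i ^ 2 * G x)
          - c * θ i ^ 2 * (x i ^ 2 * (1 - (A x ^ 2 + B x ^ 2) / R ^ 2))) ∂vecLaw d law =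
        2 * θ i ^ 2 * (energy law * ∫ x, |A x - B x| ∂vecLaw d law) +
          2 * K ^ 2 * ∫ x, x i ^ 2 * G x ∂vecLaw d law - c * θ i ^ 2 * (energy law *
          (1 - (∫ x, A x ^ 2 ∂vecLaw d law + ∫ x, B x ^ 2 ∂vecLaw d law) / R ^ 2)) := by
      rw [hL.integral_sub, hL.integral_add, integral_const_mul, integral_const_mul,
        integral_const_mul, hL.integral_sq_coord_mul i (F := fun x => |A x - B x|)
        (hcA.sub hcB).abs.1 (fun x a => by simp only [hAinv, hBinv]),
        hL.integral_sq_coord_mul i (F := fun x => 1 - (A x ^ 2 + B x ^ 2) / R ^ 2)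
        (CubeBounded.sub (CubeBounded.const 1) (by fun_prop)).1
        (fun x a => by simp only [hAinv, hBinv]),
        hL.integral_sub, hL.integral_const, integral_div,
        hL.integral_add]
    rw [hL.integral_add hcg hcgf, hfl, hrhs] at h1
    have hA2 : ∫ x, A x ^ 2 ∂vecLaw d law ≤ K * (2 * K) ^ 2 := hL.integral_sq_dot_le fun j => by
      by_cases h : j = i
      · subst h; rw [update_self, abs_zero]; positivity
      · rw [update_of_ne h]; exact hTub j
    have hB2 : ∫ x, B x ^ 2 ∂vecLaw d law ≤ K * K ^ 2 := hL.integral_sq_dot_le fun j => by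
      by_cases h : j = i
      · subst h; rw [update_self, abs_zero]; positivity
      · rw [update_of_ne h]; exact (hθ j).2
    have h6 : 3 / 4 ≤ 1 - (∫ x, A x ^ 2 ∂vecLaw d law + ∫ x, B x ^ 2 ∂vecLaw d law) / R ^ 2 := by
      have : (∫ x, A x ^ 2 ∂vecLaw d law + ∫ x, B x ^ 2 ∂vecLaw d law) / R ^ 2 ≤ 1 / 4 := by
        rw [hR2, div_le_iff₀ (by positivity)]
        linarith
      linarith
    have h7 := mul_le_left (a := c * θ i ^ 2 * energy law) h6
    linarith
  have hGm : ∫ x, x i ^ 2 * G x ∂vecLaw d law ≤ energy law * (2 * K * (1 + K) * (ε * √k)) := by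
    have hsk : 0 < √k := sqrt_pos.2 (by linarith)
    have h1 : ∫ x, x i ^ 2 * G x ∂vecLaw d law ≤
        ∫ x, (K * ε * √k * (x i ^ 2 * 1) + K * ε / √k * (x i ^ 2 * numAct x))
          ∂vecLaw d law := by
      refine hL.integral_mono fun x _ => ?_
      have h2 := sqrt_le_half_add (numAct_nonneg x) (by linarith : 0 < k)
      have h3 := (hGn x).trans (mul_le_left (mul_le_left h2 hε))
      refine (mul_le_left h3 (sq_nonneg _)).trans (le_of_eq ?_)
      ring
    rw [hL.integral_add, integral_const_mul, integral_const_mul,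
      hL.integral_sq_coord_mul i measurable_const fun _ _ => rfl, hL.integral_const, mul_one] at h1
    refine h1.trans ?_
    have h4 := mul_le_left (a := K * ε / √k) (hL.integral_sq_mul_numAct_le i)
    have h5 : K * ε / √k * (energy law * (1 + K * k)) ≤ energy law * (K * (1 + K) * (ε * √k)) := by
      have : (1 + K * k) / √k ≤ (1 + K) * √k := by
        rw [div_le_iff₀ hsk, mul_assoc, mul_self_sqrt (by linarith)]
        linarith
      calc K * ε / √k * (energy law * (1 + K * k))
          = K * ε * energy law * ((1 + K * k) / √k) := by ring
        _ ≤ K * ε * energy law * ((1 + K) * √k) := mul_le_left this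
        _ = _ := by ring
    have h6 : K * ε * √k * energy law ≤ energy law * (K * (1 + K) * (ε * √k)) := by
      have h7 : 0 ≤ K * ε * √k * energy law := by positivity
      have h8 := mul_nonneg hK0.le h7
      linarith
    linarith
  have hAB : ∫ x, |A x - B x| ∂vecLaw d law ≤ (1 + K ^ 2) * δ := by
    have h1 : ∫ x, |A x - B x| ∂vecLaw d law ≤
        ∫ x, (|dot T x - dot θ x| + K * |x i|) ∂vecLaw d law := by
      refine hL.integral_mono fun x _ => ?_
      have e : A x - B x = (dot T x - dot θ x) - (r - 1) * θ i * x i := by rw [hdT, hdθ]; ring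
      rw [e]
      refine (abs_sub _ _).trans (add_le_add le_rfl ?_)
      rw [abs_mul, abs_mul]
      refine mul_le_right ?_ (abs_nonneg _)
      have hr1 : |r - 1| ≤ 1 := by rcases hr with ⟨rfl, _⟩ | ⟨rfl, _⟩ <;> norm_num [abs_le]
      exact (mul_le_of_le_one_left (abs_nonneg _) hr1).trans (hθ i).2
    rw [hL.integral_add, integral_const_mul] at h1
    have h2 : ∫ x, |x i| ∂vecLaw d law ≤ K * δ := by
      refine (hL.integral_abs_le (CubeBounded.coord i)).trans ?_
      rw [hL.integral_coord i (φ := fun a => a ^ 2) (by fun_prop)]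
      refine sqrt_le_iff.2 ⟨by positivity, hL.var_upper.trans ?_⟩
      rw [div_eq_mul_one_div, mul_pow]
      exact mul_le_mul (le_self_pow₀ hK two_ne_zero) hd (by positivity) (by positivity)
    have h3 := mul_le_left h2 hK0.le
    linarith
  have hfinal : linRisk τ s ε law θ T' - linRisk τ s ε law θ T =
      ∫ x, (profile τ s (dot θ x) (dot T' x) (G' x) - profile τ s (dot θ x) (dot T' x) (G x))
      ∂vecLaw d law + ∫ x, (profile τ s (dot θ x) (dot T' x) (G x) -
        profile τ s (dot θ x) (dot T x) (G x)) ∂vecLaw d law := by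
    rw [hL.integral_sub c2 c1, hL.integral_sub c1 c0]
    simp only [linRisk, hG, hG']; ring
  -- The gain is measured in units of `energy law`, of order `1 / d`. This converts the cost of the
  -- changed attack, of order `ε √k / d`, to the same unit.
  have hd' : 1 / (d : ℝ) ≤ K * energy law := by
    have := hL.var_lower
    rw [div_le_iff₀ (by positivity)] at this ⊢
    unfold energy; linarith
  have hεδ : ε * √k ≤ δ := hεk.trans hδδ
  have hek0 : 0 ≤ ε * √k := by positivity
  have t1 : C₃ * (ε * √k / d) ≤ energy law * (C₃ * K * δ) := by
    rw [div_eq_mul_one_div]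
    have := mul_le_mul hεδ hd' (by positivity) hδ0.le
    calc _ ≤ C₃ * (δ * (K * energy law)) := mul_le_left this hC₃0.le
      _ = _ := by ring
  have hθ2u : θ i ^ 2 ≤ K ^ 2 := sq_le_of_abs_le (hθ i).2
  have hθ2l : (1 / K) ^ 2 ≤ θ i ^ 2 := by
    rw [← sq_abs (θ i)]; exact pow_le_pow_left₀ (by positivity) (hθ i).1 2
  have t2 : energy law * (θ i ^ 2 * (∫ x, |A x - B x| ∂vecLaw d law)) ≤
      energy law * (K ^ 2 * (1 + K ^ 2) * δ) := by
    refine mul_le_left ?_ he.le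
    rw [mul_assoc]
    exact mul_le_mul hθ2u hAB (hL.integral_nonneg fun x _ => abs_nonneg _) (by positivity)
  have t3 : K ^ 2 * (∫ x, x i ^ 2 * G x ∂vecLaw d law) ≤
      energy law * (2 * K ^ 3 * (1 + K) * δ) := by
    calc _ ≤ K ^ 2 * (energy law * (2 * K * (1 + K) * (ε * √k))) :=
          mul_le_left hGm
      _ ≤ K ^ 2 * (energy law * (2 * K * (1 + K) * δ)) := by gcongr
      _ = _ := by ring
  have t4 : energy law * (3 / 8 * (c / K ^ 2)) ≤ energy law * (3 / 8 * (c * θ i ^ 2)) := by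
    have : c / K ^ 2 = c * (1 / K) ^ 2 := by field_simp
    rw [this]
    gcongr
  have t5 : energy law * (D * δ) ≤ energy law * (c / (8 * K ^ 2)) := mul_le_left hδD he.le
  have t6 : energy law * (c / (8 * K ^ 2)) < energy law * (3 / 8 * (c / K ^ 2)) := by
    refine mul_lt_mul_of_pos_left ?_ he
    have : c / (8 * K ^ 2) = 1 / 8 * (c / K ^ 2) := by field_simp
    have h : 0 < c / K ^ 2 := by positivity
    rw [this]; linarith
  have t7 : energy law * (D * δ) = energy law * (C₃ * K * δ) +
      energy law * (K ^ 2 * (1 + K ^ 2) * δ) + energy law * (2 * K ^ 3 * (1 + K) * δ) := by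
    rw [hD]; ring
  linarith

/-- For a weak attack the risk has a global minimiser with all coefficients comparable to those
of `θ`. -/
theorem exists_minimizer_linRisk (τ : Task) {s K : ℝ} (hs : 0 < s) (hK : 1 ≤ K) :
    ∃ η > 0, ∀ {k ε : ℝ} {d : ℕ} {law : Measure ℝ} {θ : ℝ^d}, FeatureBounds K k d law →
    (∀ i, 1 / K ≤ |θ i| ∧ |θ i| ≤ K) → 0 ≤ ε → ε * √k ≤ η → 1 / (d : ℝ) ≤ η →
    ∃ T : ℝ^d, (∀ i, |T i - θ i| ≤ |θ i| / 2) ∧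
      ∀ T', linRisk τ s ε law θ T ≤ linRisk τ s ε law θ T' := by
  have hK0 : 0 < K := by linarith
  obtain ⟨η, hη, hlt⟩ := linRisk_update_lt τ hs hK
  -- Where the signal exceeds this bound, Cauchy–Schwarz is used: the product of the signal and the
  -- discrepancy has mean at most `K ^ 4`, and division by the bound leaves `η / 2`.
  obtain ⟨δ, hδ, hclose⟩ := integral_abs_sub_le_of_risk_le τ hs (2 * K ^ 4 / η) (half_pos hη)
  obtain ⟨C, hC, hself⟩ := linRisk_self_le τ s K
  refine ⟨min (min η 1) (δ / C), by positivity, fun {k ε d law θ} hL hθ hε hεk hd => ?_⟩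
  have hεη : ε * √k ≤ η := hεk.trans ((min_le_left _ _).trans (min_le_left _ _))
  have hε1 : ε * √k ≤ 1 := hεk.trans ((min_le_left _ _).trans (min_le_right _ _))
  have hεδ : C * (ε * √k) ≤ δ := by
    have : ε * √k ≤ δ / C := hεk.trans (min_le_right _ _)
    rw [le_div_iff₀ hC] at this; linarith
  have hd' : 1 / (d : ℝ) ≤ η := hd.trans ((min_le_left _ _).trans (min_le_left _ _))
  set box : Set ℝ^d := Set.Icc (fun i => θ i - |θ i| / 2) (fun i => θ i + |θ i| / 2) with hbox
  have hmem : ∀ T, T ∈ box ↔ ∀ i, |T i - θ i| ≤ |θ i| / 2 := fun T => by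
    simp only [hbox, Set.mem_Icc, Pi.le_def, abs_le, ← forall_and]
    refine forall_congr' fun i => ?_
    constructor <;> rintro ⟨h1, h2⟩ <;> constructor <;> linarith
  have hθbox : θ ∈ box := (hmem θ).2 fun i => by rw [sub_self, abs_zero]; positivity
  obtain ⟨T, hT, hmin⟩ := (isCompact_Icc : IsCompact box).exists_isMinOn ⟨θ, hθbox⟩
    (hL.continuous_linRisk τ s hε θ).continuousOn
  have hTb := (hmem T).1 hT
  have hcl : ∫ x, |dot T x - dot θ x| ∂vecLaw d law ≤ η := by
    have h1 : ∫ x, profile τ s (dot θ x) (dot T x) 0 ∂vecLaw d law ≤ bayesRisk τ s law θ + δ := by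
      have e1 : ∫ x, profile τ s (dot θ x) (dot T x) 0 ∂vecLaw d law ≤ linRisk τ s ε law θ T :=
        hL.integral_mono (hF := CubeBounded.profile τ s (by fun_prop) (by fun_prop) (by fun_prop)) (hG := CubeBounded.profile τ s (by fun_prop) (by fun_prop) (by fun_prop)) fun x _ =>
          profile_mono τ s _ _ (by rw [abs_zero]; exact abs_nonneg _)
      have e2 := hmin hθbox
      have e3 := hself hL (fun i => (hθ i).2) hε hε1
      simp only [Set.mem_ofPred_eq] at e2
      linarith
    have h2 := hclose hL (by fun_prop) h1
    set B := 2 * K ^ 4 / η with hB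
    have hB0 : 0 < B := by positivity
    have hm : MeasurableSet {x : ℝ^d | |dot θ x| ≤ B} :=
      measurableSet_le (CubeBounded.dot θ).abs.1 measurable_const
    have h3 : ∫ x, |dot T x - dot θ x| ∂vecLaw d law ≤
        ∫ x, ((if |dot θ x| ≤ B then |dot T x - dot θ x| else 0) +
          (|dot θ x| * |dot (fun i => T i - θ i) x|) / B) ∂vecLaw d law := by
      refine hL.integral_mono (hG := (CubeBounded.indicator hm (by fun_prop)).add (by fun_prop)) fun x _ => ?_
      split_ifs with h
      · have : 0 ≤ (|dot θ x| * |dot (fun i => T i - θ i) x|) / B := by positivity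
        linarith
      · rw [zero_add, dot_sub, le_div_iff₀ hB0, mul_comm]
        exact mul_le_right (not_le.1 h).le (abs_nonneg _)
    rw [hL.integral_add (CubeBounded.indicator hm (by fun_prop)), integral_div] at h3
    have h4 := hL.integral_mul_le (F := fun x => |dot θ x|)
      (G := fun x => |dot (fun i => T i - θ i) x|) (by fun_prop) (by fun_prop)
    simp only [sq_abs] at h4
    have h5 : √(∫ x, dot θ x ^ 2 ∂vecLaw d law) ≤ K ^ 2 := by
      refine sqrt_le_iff.2 ⟨by positivity, (hL.integral_sq_dot_le fun i => (hθ i).2).trans ?_⟩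
      nlinarith [pow_pos hK0 3]
    have h6 : √(∫ x, dot (fun i => T i - θ i) x ^ 2 ∂vecLaw d law) ≤ K ^ 2 := by
      refine sqrt_le_iff.2 ⟨by positivity, (hL.integral_sq_dot_le (B := K)
        fun i => ?_).trans ?_⟩
      · linarith [hTb i, (hθ i).2, abs_nonneg (θ i)]
      · nlinarith [pow_pos hK0 3]
    have h7 : (∫ x, |dot θ x| * |dot (fun i => T i - θ i) x| ∂vecLaw d law) / B ≤ η / 2 := by
      rw [div_le_iff₀ hB0]
      have : η / 2 * B = K ^ 2 * K ^ 2 := by rw [hB]; field_simp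
      rw [this]
      exact h4.trans (mul_le_mul h5 h6 (sqrt_nonneg _) (by positivity))
    linarith
  -- On the boundary of the box a coefficient is `θ i / 2` or `3 θ i / 2`. Moving it to `3 θ i / 4`
  -- or `5 θ i / 4` stays in the box and strictly lowers the risk, against minimality there.
  have hint : ∀ i, |T i - θ i| < |θ i| / 2 := fun i => by
    refine lt_of_le_of_ne (hTb i) fun heq => ?_
    have hcase : ∃ r r' : ℝ, ((r = 1 / 2 ∧ r' = 3 / 4) ∨ (r = 3 / 2 ∧ r' = 5 / 4)) ∧
        T i = r * θ i := by
      have h1 : (T i - θ i) ^ 2 = (θ i / 2) ^ 2 := by rw [← sq_abs, heq, div_pow, sq_abs, div_pow]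
      rcases sq_eq_sq_iff_eq_or_eq_neg.1 h1 with h | h
      · exact ⟨3 / 2, 5 / 4, Or.inr ⟨rfl, rfl⟩, by linarith⟩
      · exact ⟨1 / 2, 3 / 4, Or.inl ⟨rfl, rfl⟩, by linarith⟩
    obtain ⟨r, r', hr, hTi⟩ := hcase
    have h2 := hlt hL hθ hε hεη hd' hTb hcl i r r' hr hTi
    have h3 : update T i (r' * θ i) ∈ box := (hmem _).2 fun j => by
      by_cases h : j = i
      · subst h
        rw [update_self, show r' * θ j - θ j = (r' - 1) * θ j by ring, abs_mul]
        have : |r' - 1| ≤ 1 / 2 := by rcases hr with ⟨_, rfl⟩ | ⟨_, rfl⟩ <;> norm_num [abs_le]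
        nlinarith [abs_nonneg (θ j)]
      · rw [update_of_ne h]; exact hTb j
    exact absurd (hmin h3) (not_le.2 h2)
  refine ⟨T, hTb, fun T' => ?_⟩
  -- An interior minimiser over the box is a local minimiser, hence a global one by convexity.
  have hopen : ∀ᶠ T'' in 𝓝 T, T'' ∈ box := by
    have : ∀ᶠ T'' in 𝓝 T, ∀ i, |T'' i - θ i| < |θ i| / 2 := by
      rw [eventually_all]
      intro i
      have hc : ContinuousAt (fun T'' : ℝ^d => |T'' i - θ i|) T :=
        ((continuous_apply i).sub continuous_const).abs.continuousAt
      exact hc.eventually_lt_const (hint i)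
    filter_upwards [this] with T'' h
    exact (hmem T'').2 fun i => (h i).le
  have hloc : IsLocalMin (linRisk τ s ε law θ) T := by
    filter_upwards [hopen] with T'' h
    exact hmin h
  exact IsMinOn.of_isLocalMin_of_convex_univ hloc (hL.convexOn_linRisk τ s hε θ) T'

end

section

/-! ### A lower bound for the risk near the minimiser -/

/-- One step of size `μ` from the predictor `(f, ε N)` towards a network with prediction `f + D + e`
and displacement `ε (sl + g - r)`. Convexity bounds the profile at the convex combination. The
perturbations `μ e` and `μ ε r` are then removed by the Lipschitz bound, at first order in `μ`; the
surplus `μ ε g` is removed by `profile_growth`, with profit; and the linearised norm `(1 - μ) N + μ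
sl` is replaced by the true norm `n` at the cost of a term in `μ ^ 2`. -/
theorem profile_directional_le (τ : Task) {s c C : ℝ}
    (hgrow : ∀ t f G G' : ℝ, 0 ≤ G → G ≤ G' →
      c * exp (-|t|) * (G' - G) ≤ profile τ s t f G' - profile τ s t f G)
    (hC : 0 ≤ C) (hlip : ∀ t f G f' G' : ℝ, |profile τ s t f' G' - profile τ s t f G| ≤
      C * (1 + |f - t| + |G| + |f' - t| + |G'|) * (|f' - f| + |G' - G|))
    {t f N D e g r sl n ε μ Q : ℝ} (hμ : 0 ≤ μ) (hμ1 : μ ≤ 1) (hε : 0 ≤ ε) (hg : 0 ≤ g)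
    (hN : 0 ≤ N) (ha : 0 ≤ (1 - μ) * N + μ * sl) (hn : (1 - μ) * N + μ * sl ≤ n)
    (hn' : n ≤ (1 - μ) * N + μ * sl + μ ^ 2 * Q) (hD : |D| ≤ Q) (he : |e| ≤ Q) (hgQ : g ≤ Q)
    (hr : |r| ≤ Q) (hsl : |sl| ≤ Q) (hf : |f - t| ≤ Q) (hNQ : N ≤ Q) :
    profile τ s t (f + μ * D) (ε * n) + μ * (c * ε * (exp (-|t|) * g)) ≤
      (1 - μ) * profile τ s t f (ε * N) + μ * profile τ s t (f + D + e) (ε * (sl + g - r)) +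
      μ * (2 * C * ((1 + |f - t| + ε * N) * (|e| + ε * |r|))) +
      μ ^ 2 * (C * (5 * (1 + ε) * Q) ^ 2 + C * (1 + 4 * Q + 5 * ε * Q) * (ε * Q)) := by
  have hQ : 0 ≤ Q := (abs_nonneg _).trans hD
  set a := (1 - μ) * N + μ * sl with hadef
  have hμ2 : μ ^ 2 ≤ 1 := pow_le_one₀ hμ hμ1
  have hμQ : μ * Q ≤ Q := mul_le_of_le_one_left hQ hμ1
  have haN : a ≤ N + μ * Q := by
    have h1 := mul_le_left ((le_abs_self _).trans hsl) hμ
    have h2 := mul_nonneg hμ hN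
    rw [hadef]; linarith
  have h1 := profile_comb_le τ s t (f := f) (f' := f + D + e) (G := ε * N)
    (G' := ε * (sl + g - r)) (a := 1 - μ) (b := μ) (by linarith) hμ (by ring)
  rw [show (1 - μ) * f + μ * (f + D + e) = f + μ * D + μ * e by ring,
    show (1 - μ) * (ε * N) + μ * (ε * (sl + g - r)) = ε * (a + μ * g) - μ * (ε * r) by
      rw [hadef]; ring] at h1
  have h2 := (abs_le.1 (hlip t (f + μ * D) (ε * (a + μ * g)) (f + μ * D + μ * e)
    (ε * (a + μ * g) - μ * (ε * r)))).1
  have hμg := mul_nonneg hμ hg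
  have h3 := hgrow t (f + μ * D) (ε * a) (ε * (a + μ * g)) (mul_nonneg hε ha)
    (mul_le_left (by linarith) hε)
  have h4 := (abs_le.1 (hlip t (f + μ * D) (ε * n) (f + μ * D) (ε * a))).1
  have bD : |f + μ * D - t| ≤ |f - t| + μ * Q := by
    rw [show f + μ * D - t = (f - t) + μ * D by ring]
    refine (abs_add_le _ _).trans (add_le_add le_rfl ?_)
    rw [abs_mul, abs_of_nonneg hμ]; exact mul_le_left hD hμ
  have bDe : |f + μ * D + μ * e - t| ≤ |f - t| + 2 * (μ * Q) := by
    rw [show f + μ * D + μ * e - t = (f + μ * D - t) + μ * e by ring]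
    refine (abs_add_le _ _).trans ?_
    rw [abs_mul, abs_of_nonneg hμ]
    have := mul_le_left he hμ
    linarith
  have bg : |ε * (a + μ * g)| ≤ ε * N + 2 * (ε * (μ * Q)) := by
    rw [abs_of_nonneg (mul_nonneg hε (by linarith))]
    have h5 := mul_le_left hgQ hμ
    have := mul_le_left (by linarith : a + μ * g ≤ N + 2 * (μ * Q)) hε
    linarith
  have br : |μ * (ε * r)| ≤ ε * (μ * Q) := by
    rw [abs_mul, abs_mul, abs_of_nonneg hμ, abs_of_nonneg hε]
    have := mul_le_left hr (mul_nonneg hε hμ)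
    linarith
  have bgr : |ε * (a + μ * g) - μ * (ε * r)| ≤ ε * N + 3 * (ε * (μ * Q)) :=
    (abs_sub _ _).trans (by linarith)
  have e1 : |f + μ * D + μ * e - (f + μ * D)| + |ε * (a + μ * g) - μ * (ε * r) - ε * (a + μ * g)| =
      μ * (|e| + ε * |r|) := by
    rw [show f + μ * D + μ * e - (f + μ * D) = μ * e by ring,
      show ε * (a + μ * g) - μ * (ε * r) - ε * (a + μ * g) = -(μ * (ε * r)) by ring, abs_neg,
      abs_mul, abs_mul, abs_mul, abs_of_nonneg hμ, abs_of_nonneg hε]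
    ring
  rw [e1] at h2
  have hz : 0 ≤ |e| + ε * |r| := add_nonneg (abs_nonneg _) (mul_nonneg hε (abs_nonneg _))
  have hzQ : |e| + ε * |r| ≤ (1 + ε) * Q := by
    have := mul_le_left hr hε
    linarith
  have h5 : C * (1 + |f + μ * D - t| + |ε * (a + μ * g)| + |f + μ * D + μ * e - t| +
      |ε * (a + μ * g) - μ * (ε * r)|) * (μ * (|e| + ε * |r|)) ≤
      μ * (2 * C * ((1 + |f - t| + ε * N) * (|e| + ε * |r|))) +
      μ ^ 2 * (C * (5 * (1 + ε) * Q) ^ 2) := by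
    have h6 : 1 + |f + μ * D - t| + |ε * (a + μ * g)| + |f + μ * D + μ * e - t| +
        |ε * (a + μ * g) - μ * (ε * r)| ≤
        2 * (1 + |f - t| + ε * N) + μ * (5 * (1 + ε) * Q) := by
      have := mul_nonneg hμ hQ
      linarith
    have h7 := mul_le_right (mul_le_left h6 hC)
      (mul_nonneg hμ hz)
    refine h7.trans ?_
    have h8 : C * (μ ^ 2 * (5 * (1 + ε) * Q)) * (|e| + ε * |r|) ≤
        C * (μ ^ 2 * (5 * (1 + ε) * Q)) * (5 * (1 + ε) * Q) := by
      refine mul_le_left (hzQ.trans ?_)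
      have : 0 ≤ (1 + ε) * Q := by positivity
      linarith
    linarith
  have e2 : |f + μ * D - (f + μ * D)| + |ε * a - ε * n| ≤ μ ^ 2 * (ε * Q) := by
    rw [sub_self, abs_zero, zero_add, ← mul_sub, abs_mul, abs_of_nonneg hε, abs_sub_comm,
      abs_of_nonneg (by linarith)]
    have := mul_le_left (by linarith : n - a ≤ μ ^ 2 * Q) hε
    linarith
  have h9 : C * (1 + |f + μ * D - t| + |ε * n| + |f + μ * D - t| + |ε * a|) *
      (|f + μ * D - (f + μ * D)| + |ε * a - ε * n|) ≤
      μ ^ 2 * (C * (1 + 4 * Q + 5 * ε * Q) * (ε * Q)) := by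
    have h10 : 1 + |f + μ * D - t| + |ε * n| + |f + μ * D - t| + |ε * a| ≤
        1 + 4 * Q + 5 * ε * Q := by
      rw [abs_of_nonneg (mul_nonneg hε (ha.trans hn)), abs_of_nonneg (mul_nonneg hε ha)]
      have i1 : a ≤ 2 * Q := by linarith
      have i2 : n ≤ 3 * Q := by
        have := mul_le_of_le_one_left hQ hμ2
        linarith
      have i3 := mul_le_left i1 hε
      have i4 := mul_le_left i2 hε
      linarith
    have h11 : 0 ≤ 1 + 4 * Q + 5 * ε * Q := by positivity
    refine (mul_le_mul (mul_le_left h10 hC) e2 (by positivity) (by positivity)).trans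
      (le_of_eq (by ring))
  have e3 : c * exp (-|t|) * (ε * (a + μ * g) - ε * a) = μ * (c * ε * (exp (-|t|) * g)) := by ring
  rw [e3] at h3
  linarith

variable {d : ℕ}

/-- The derivative of `actNorm` at `T₀` in direction `T`. -/
def slopeAlong (T₀ T x : ℝ^d) : ℝ := (∑ i, act (x i) * (T₀ i * T i)) / actNorm T₀ x

theorem abs_sum_act_mul_le (T₀ T x : ℝ^d) :
    |∑ i, act (x i) * (T₀ i * T i)| ≤ actNorm T₀ x * actNorm T x := by
  rw [actNorm_eq_norm, actNorm_eq_norm]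
  have := abs_real_inner_le_norm (WithLp.toLp 2 fun i => act (x i) * T i : 𝔼^d)
    (WithLp.toLp 2 fun i => act (x i) * T₀ i)
  rw [PiLp.inner_apply, mul_comm] at this
  convert this using 2
  refine sum_congr rfl fun i _ => ?_
  simp only [RCLike.inner_apply, conj_trivial]
  nth_rewrite 1 [← act_mul_self (x i)]
  ring

theorem abs_slopeAlong_le (T₀ T x : ℝ^d) : |slopeAlong T₀ T x| ≤ actNorm T x := by
  rw [slopeAlong, abs_div, abs_of_nonneg (actNorm_nonneg T₀ x)]
  exact div_le_of_le_mul₀ (actNorm_nonneg _ _) (actNorm_nonneg _ _)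
    ((abs_sum_act_mul_le T₀ T x).trans (le_of_eq (mul_comm _ _)))

theorem actNorm_mul_slopeAlong (T₀ T x : ℝ^d) :
    actNorm T₀ x * slopeAlong T₀ T x = ∑ i, act (x i) * (T₀ i * T i) := by
  by_cases h : actNorm T₀ x = 0
  · have := abs_sum_act_mul_le T₀ T x
    rw [h, zero_mul] at this
    rw [h, zero_mul, abs_nonpos_iff.1 this]
  · rw [slopeAlong, mul_div_cancel₀ _ h]

@[fun_prop]
theorem CubeBounded.slopeAlong (T₀ T : ℝ^d) : CubeBounded fun x => slopeAlong T₀ T x := by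
  refine CubeBounded.mono (CubeBounded.actNorm T) ?_ fun x => ?_
  · unfold FeaturePurification.slopeAlong
    exact (CubeBounded.sum _ fun i => by fun_prop : CubeBounded fun x : ℝ^d =>
        ∑ i, FeaturePurification.act (x i) * (T₀ i * T i)).1.div (CubeBounded.actNorm _).1
  · rw [abs_of_nonneg (actNorm_nonneg T x)]; exact abs_slopeAlong_le T₀ T x

theorem sq_actNorm_segment (T₀ T x : ℝ^d) (μ : ℝ) :
    actNorm (fun i => (1 - μ) * T₀ i + μ * T i) x ^ 2 =
      ((1 - μ) * actNorm T₀ x + μ * slopeAlong T₀ T x) ^ 2 +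
        μ ^ 2 * (actNorm T x ^ 2 - slopeAlong T₀ T x ^ 2) := by
  have h : ((1 - μ) * actNorm T₀ x + μ * slopeAlong T₀ T x) ^ 2 +
        μ ^ 2 * (actNorm T x ^ 2 - slopeAlong T₀ T x ^ 2) =
      (1 - μ) ^ 2 * actNorm T₀ x ^ 2 +
        2 * μ * (1 - μ) * (actNorm T₀ x * slopeAlong T₀ T x) + μ ^ 2 * actNorm T x ^ 2 := by ring
  rw [h, actNorm_mul_slopeAlong, sq_actNorm, sq_actNorm, sq_actNorm, mul_sum, mul_sum,
    mul_sum, ← sum_add_distrib, ← sum_add_distrib]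
  exact sum_congr rfl fun i _ => by ring

/-- The squared norm along the segment is the square of its linearisation plus `μ ^ 2` times a
nonnegative remainder. Division by the norm is harmless: with at least one active feature the norm
at `T₀` is at least `B`, and with none every term vanishes. The error is thus quadratic in `μ`
uniformly in `x`. -/
theorem actNorm_segment_bounds {T₀ T x : ℝ^d} {B Q μ : ℝ} (hB : 0 < B)
    (hT₀ : ∀ i, B ≤ |T₀ i|) (hQ : actNorm T x ≤ Q) (hμ : 0 ≤ μ) (hμ1 : μ ≤ 1 / 4)
    (hμQ : μ * Q ≤ B / 4) :
    0 ≤ (1 - μ) * actNorm T₀ x + μ * slopeAlong T₀ T x ∧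
    (1 - μ) * actNorm T₀ x + μ * slopeAlong T₀ T x ≤ actNorm (fun i => (1 - μ) * T₀ i + μ * T i) x ∧
    actNorm (fun i => (1 - μ) * T₀ i + μ * T i) x ≤
      (1 - μ) * actNorm T₀ x + μ * slopeAlong T₀ T x + μ ^ 2 * (2 * Q ^ 2 / B) := by
  set N := actNorm T₀ x
  set sl := slopeAlong T₀ T x
  set n := actNorm (fun i => (1 - μ) * T₀ i + μ * T i) x
  set a := (1 - μ) * N + μ * sl with ha
  have hn0 : 0 ≤ n := actNorm_nonneg _ _
  have hsq : n ^ 2 = a ^ 2 + μ ^ 2 * (actNorm T x ^ 2 - sl ^ 2) := sq_actNorm_segment T₀ T x μ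
  have hsl := abs_slopeAlong_le T₀ T x
  have hT0 := actNorm_nonneg T x
  have hsl2 : sl ^ 2 ≤ actNorm T x ^ 2 := sq_le_of_abs_le hsl
  have hQ0 : 0 ≤ Q := hT0.trans hQ
  have han : a ≤ n := by
    refine le_of_sq_le_sq ?_ hn0
    nlinarith [sq_nonneg μ, mul_nonneg (sq_nonneg μ) (sub_nonneg.2 hsl2)]
  have hTQ : actNorm T x ^ 2 ≤ Q ^ 2 := pow_le_pow_left₀ hT0 hQ 2
  have hsq' : n ^ 2 ≤ a ^ 2 + μ ^ 2 * Q ^ 2 := by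
    rw [hsq]
    have := mul_le_left (by nlinarith [sq_nonneg sl] :
      actNorm T x ^ 2 - sl ^ 2 ≤ Q ^ 2) (sq_nonneg μ)
    linarith
  by_cases h0 : numAct x = 0
  · have hz : ∀ S : ℝ^d, actNorm S x = 0 := fun S => by
      have h1 : ∀ i, act (x i) = 0 := fun i =>
        le_antisymm ((act_le_numAct x i).trans h0.le) (act_nonneg _)
      simp [actNorm, h1]
    have e1 : N = 0 := hz _
    have e2 : n = 0 := hz _
    have e3 : sl = 0 := by have := hsl; rw [hz T] at this; exact abs_nonpos_iff.1 this
    have e4 : a = 0 := by rw [ha, e1, e3]; ring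
    rw [e2, e4]
    exact ⟨le_rfl, le_rfl, by positivity⟩
  · have h1 : 1 ≤ numAct x := by
      by_contra hlt
      refine h0 (sum_eq_zero fun i _ => ?_)
      by_contra hne
      have : act (x i) = 1 := by unfold act at hne ⊢; split_ifs at hne ⊢ <;> simp_all
      have := act_le_numAct x i
      linarith
    have hN : B ≤ N := by
      have h2 := le_actNorm hB.le hT₀ x
      have h3 : 1 ≤ √(numAct x) := one_le_sqrt.2 h1
      nlinarith
    have hμsl : -(B / 4) ≤ μ * sl := by
      have := mul_le_left ((abs_le.1 (hsl.trans hQ)).1) hμ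
      linarith
    have haB : B / 2 ≤ a := by
      have := mul_le_right hμ1 (hB.le.trans hN)
      rw [ha]; nlinarith
    refine ⟨by linarith, han, ?_⟩
    have h4 : (n - a) * B ≤ μ ^ 2 * Q ^ 2 := by
      have : (n - a) * B ≤ (n - a) * (n + a) := mul_le_left (by linarith) (by linarith)
      nlinarith
    have h5 : n - a ≤ μ ^ 2 * Q ^ 2 / B := by rwa [le_div_iff₀ hB]
    have h6 : 0 ≤ μ ^ 2 * Q ^ 2 / B := by positivity
    have h7 : μ ^ 2 * (2 * Q ^ 2 / B) = 2 * (μ ^ 2 * Q ^ 2 / B) := by ring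
    linarith

theorem le_of_forall_small_le_add {X Y b μ₀ : ℝ} (hμ₀ : 0 < μ₀)
    (h : ∀ μ, 0 < μ → μ ≤ μ₀ → μ * X ≤ μ * Y + μ ^ 2 * b) : X ≤ Y := by
  refine le_of_forall_pos_le_add fun δ hδ => ?_
  set μ := min μ₀ (δ / (|b| + 1)) with hμ
  have hpos : 0 < μ := lt_min hμ₀ (by positivity)
  have h1 := h μ hpos (min_le_left _ _)
  have h2 : μ * (|b| + 1) ≤ δ := by
    have : μ ≤ δ / (|b| + 1) := min_le_right _ _
    rwa [le_div_iff₀ (by positivity)] at this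
  have h3 : X ≤ Y + μ * b := by
    refine le_of_mul_le_mul_left ?_ hpos
    linarith
  have h4 : μ * b ≤ μ * (|b| + 1) := mul_le_left (by linarith [le_abs_self b]) hpos.le
  linarith

/-- First order lower bound for the risk of a perturbation of the linear predictor `T`, when `T₀`
is a global minimiser of `linRisk`. -/
theorem linRisk_add_gain_le (τ : Task) {s : ℝ} (hs : 0 < s) :
    ∃ c > 0, ∃ C > 0, ∀ {K k ε B : ℝ} {d : ℕ} {law : Measure ℝ} {θ T₀ T : ℝ^d}
    {e g r : ℝ^d → ℝ}, FeatureBounds K k d law → 0 ≤ ε → 0 < B → (∀ i, B ≤ |T₀ i|) →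
    (∀ T', linRisk τ s ε law θ T₀ ≤ linRisk τ s ε law θ T') →
    CubeBounded e → CubeBounded g → CubeBounded r → (∀ x, 0 ≤ g x) →
    linRisk τ s ε law θ T₀ + c * ε * ∫ x, exp (-|dot θ x|) * g x ∂vecLaw d law ≤
      ∫ x, profile τ s (dot θ x) (dot T x + e x) (ε * (slopeAlong T₀ T x + g x - r x))
        ∂vecLaw d law +
      C * ∫ x, (1 + |dot T₀ x - dot θ x| + ε * actNorm T₀ x) * (|e x| + ε * |r x|)
        ∂vecLaw d law := by
  obtain ⟨c, hc, hgrow⟩ := profile_growth τ hs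
  obtain ⟨C, hC, hlip⟩ := profile_lipschitz τ s
  refine ⟨c, hc, 2 * C, by positivity, fun {K k ε B d law θ T₀ T e g r} hL hε hB hT₀ hmin he hg hr
    hg0 => ?_⟩
  obtain ⟨Q, hQ⟩ : ∃ Q, ∀ x : ℝ^d, (∀ i, |x i| ≤ 1) →
      |dot T x - dot T₀ x| ≤ Q ∧ |e x| ≤ Q ∧ |g x| ≤ Q ∧ |r x| ≤ Q ∧ |actNorm T x| ≤ Q ∧
      |dot T₀ x - dot θ x| ≤ Q ∧ |actNorm T₀ x| ≤ Q := by
    obtain ⟨_, q1, h1⟩ : CubeBounded fun x : ℝ^d =>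
      |dot T x - dot T₀ x| + |e x| + |g x| + |r x| + |actNorm T x| + |dot T₀ x - dot θ x| +
        |actNorm T₀ x| := by fun_prop
    refine ⟨q1, fun x hx => ?_⟩
    have h2 := (le_abs_self _).trans (h1 x hx)
    have := abs_nonneg (dot T x - dot T₀ x)
    have := abs_nonneg (e x)
    have := abs_nonneg (g x)
    have := abs_nonneg (r x)
    have := abs_nonneg (actNorm T x)
    have := abs_nonneg (dot T₀ x - dot θ x)
    have := abs_nonneg (actNorm T₀ x)
    refine ⟨?_, ?_, ?_, ?_, ?_, ?_, ?_⟩ <;> linarith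
  set Q' := max 0 Q with hQ'
  have hQ'0 : 0 ≤ Q' := le_max_left _ _
  have hQQ' : Q ≤ Q' := le_max_right _ _
  set P := max Q' (2 * Q' ^ 2 / B) with hP
  have hQP : Q' ≤ P := le_max_left _ _
  set b := C * (5 * (1 + ε) * P) ^ 2 + C * (1 + 4 * P + 5 * ε * P) * (ε * P) with hb
  -- The point at parameter `μ` on the segment from `T₀` to `T` has risk no smaller than `T₀`; the
  -- inequality left after cancellation is divided by `μ`, which then tends to zero.
  refine le_of_forall_small_le_add (b := b) (μ₀ := min (1 / 4) (B / 4 / (Q' + 1)))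
    (by positivity) fun μ hμ hμle => ?_
  have hμ1 : μ ≤ 1 / 4 := hμle.trans (min_le_left _ _)
  have hμQ : μ * Q' ≤ B / 4 := by
    have h1 : μ ≤ B / 4 / (Q' + 1) := hμle.trans (min_le_right _ _)
    rw [le_div_iff₀ (by positivity)] at h1
    linarith
  set Tμ := fun i => (1 - μ) * T₀ i + μ * T i with hTμ
  have hcp : ∀ (f G : ℝ^d → ℝ), CubeBounded f → CubeBounded G → CubeBounded fun x =>
      profile τ s (dot θ x) (f x) (G x) := fun f G hf hG =>
    CubeBounded.profile τ s (by fun_prop) hf hG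
  have c0 := hcp (dot T₀) (fun x => ε * actNorm T₀ x) (by fun_prop) (by fun_prop)
  have c1 := hcp (dot Tμ) (fun x => ε * actNorm Tμ x) (by fun_prop) (by fun_prop)
  have c2 := hcp (fun x => dot T x + e x) (fun x => ε * (slopeAlong T₀ T x + g x - r x))
    (by fun_prop) (by fun_prop)
  have key : ∫ x, (profile τ s (dot θ x) (dot Tμ x) (ε * actNorm Tμ x) +
        μ * (c * ε * (exp (-|dot θ x|) * g x))) ∂vecLaw d law ≤
      ∫ x, ((1 - μ) * profile τ s (dot θ x) (dot T₀ x) (ε * actNorm T₀ x) +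
        μ * profile τ s (dot θ x) (dot T x + e x) (ε * (slopeAlong T₀ T x + g x - r x)) +
        μ * (2 * C * ((1 + |dot T₀ x - dot θ x| + ε * actNorm T₀ x) * (|e x| + ε * |r x|))) +
        μ ^ 2 * b) ∂vecLaw d law := by
    refine hL.integral_mono fun x hx => ?_
    obtain ⟨q1, q2, q3, q4, q5, q6, q7⟩ := hQ x hx.abs_le
    have q5' := (le_abs_self _).trans (q5.trans hQQ')
    obtain ⟨b1, b2, b3⟩ := actNorm_segment_bounds hB hT₀ q5' hμ.le hμ1 hμQ
    have := profile_directional_le τ hgrow hC.le hlip (t := dot θ x) (f := dot T₀ x)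
      (N := actNorm T₀ x) (D := dot T x - dot T₀ x) (e := e x) (g := g x) (r := r x)
      (sl := slopeAlong T₀ T x) (n := actNorm Tμ x) (Q := P) hμ.le (by linarith) hε (hg0 x)
      (actNorm_nonneg _ _) b1 b2
      (b3.trans (add_le_add le_rfl (mul_le_left (le_max_right _ _) (sq_nonneg _))))
      (by linarith) (by linarith) (by linarith [le_abs_self (g x)]) (by linarith)
      ((abs_slopeAlong_le T₀ T x).trans (by linarith)) (by linarith)
      (by linarith [le_abs_self (actNorm T₀ x)])
    have e1 : dot Tμ x = dot T₀ x + μ * (dot T x - dot T₀ x) := by rw [hTμ, dot_add_mul]; ring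
    have e2 : dot T₀ x + (dot T x - dot T₀ x) + e x = dot T x + e x := by ring
    rw [e2] at this
    rw [e1]
    exact this
  rw [hL.integral_add c1, hL.integral_add, hL.integral_add, hL.integral_add,
    hL.integral_const, integral_const_mul, integral_const_mul, integral_const_mul,
    integral_const_mul, integral_const_mul, integral_const_mul] at key
  have hm := hmin Tμ
  simp only [linRisk] at hm ⊢
  linarith

end

/-! ### Risks of networks at a fixed index. -/

/-- Quantitative form, at the index `n`, of the assumptions on the model. -/
structure Model.BoundsAt (P : Model) (K : ℝ) (n : ℕ) : Prop where
  feature : FeatureBounds K (P.k n) (P.d n) (P.law n)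
  orthogonal : P.M n ∈ Matrix.orthogonalGroup (Fin (P.d n)) ℝ
  noise_pos : 0 < P.ζ
  regression_noise_pos : 0 < P.s
  coeff : ∀ i, 1 / K ≤ |P.θ₀ n i| ∧ |P.θ₀ n i| ≤ K
  attack_nonneg : 0 ≤ P.ε n

/-- The networks considered at the index `n`. -/
abbrev Model.Net (P : Model) (n : ℕ) := Network (P.d n) (P.H n)

/-- The law of the features. -/
abbrev Model.vecLaw (P : Model) (n : ℕ) : Measure ℝ^(P.d n) :=
  FeaturePurification.vecLaw (P.d n) (P.law n)

/-- The robust risk of a linear predictor of the features. -/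
abbrev Model.linRisk (P : Model) (τ : Task) (n : ℕ) (T : ℝ^(P.d n)) : ℝ :=
  FeaturePurification.linRisk τ P.s (P.ε n) (P.law n) (P.θ₀ n) T

/-- The joint law of the features and the noise. -/
abbrev Model.pairLaw (P : Model) (n : ℕ) : Measure (ℝ^(P.d n) × ℝ^(P.d n)) :=
  (P.vecLaw n).prod (P.noiseLaw n)

/-- The conditional robust risk of a network given the features and the noise. -/
def Model.robustRisk (P : Model) (τ : Task) (n : ℕ) (N : P.Net n)
    (w : ℝ^(P.d n) × ℝ^(P.d n)) : ℝ :=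
  ∫ y, τ.robustLoss (N.eval (P.input n w.1 w.2)) (N.up (P.ε n) (P.input n w.1 w.2))
    (N.down (P.ε n) (P.input n w.1 w.2)) y ∂τ.response P.s (dot (P.θ₀ n) w.1)

section

variable {P : Model} {K : ℝ} {n : ℕ} (hB : P.BoundsAt K n)

instance (P : Model) (n : ℕ) : IsProbabilityMeasure (P.noiseLaw n) := by
  unfold Model.noiseLaw; infer_instance

theorem Model.continuous_input (P : Model) (n : ℕ) :
    Continuous fun w : ℝ^(P.d n) × ℝ^(P.d n) => P.input n w.1 w.2 := by
  unfold Model.input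
  refine (PiLp.continuous_toLp 2 _).comp ?_
  exact (Continuous.matrix_mulVec continuous_const continuous_fst).add continuous_snd

theorem Model.measurable_input (P : Model) (n : ℕ) :
    Measurable fun w : ℝ^(P.d n) × ℝ^(P.d n) => P.input n w.1 w.2 :=
  (P.continuous_input n).measurable

include hB

theorem Model.BoundsAt.isProbabilityMeasure_pairLaw : IsProbabilityMeasure (P.pairLaw n) :=
  haveI := hB.feature.isProbabilityMeasure
  inferInstance

theorem Model.BoundsAt.gram_eq (N : P.Net n) (h h' : Fin (P.H n)) :
    ∑ i, N.W i h * N.W i h' = ∑ i, Φ N i h * Φ N i h' := by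
  have h1 : (N.W)ᵀ * N.W = (Φ N)ᵀ * Φ N := by
    rw [Model.features, Matrix.transpose_mul, Matrix.transpose_transpose, Matrix.mul_assoc,
      ← Matrix.mul_assoc (P.M n), (Matrix.mem_orthogonalGroup_iff _ _).1 hB.orthogonal,
      Matrix.one_mul]
  have := congrFun (congrFun h1 h) h'
  simpa [Matrix.mul_apply] using this

theorem Model.BoundsAt.colNorm_eq (N : P.Net n) (h : Fin (P.H n)) :
    colNorm N.W h = colNorm Φ N h := by
  have := hB.gram_eq N h h
  simp only [← sq] at this
  rw [colNorm, colNorm, this]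

omit hB in
theorem Model.pre_input (P : Model) (n : ℕ) (N : P.Net n) (x ξ : ℝ^(P.d n))
    (h : Fin (P.H n)) :
    N.pre (P.input n x ξ) h = dot (fun i => Φ N i h) x + ∑ i, ξ i * N.W i h := by
  have e : ∀ i, (P.input n x ξ) i = (P.M n *ᵥ x) i + ξ i := fun i => rfl
  simp only [Network.pre, e, add_mul, sum_add_distrib]
  congr 1
  have : (P.M n *ᵥ x) ⬝ᵥ (fun i => N.W i h) = (fun i => Φ N i h) ⬝ᵥ x := by
    have h2 : (fun i => Φ N i h) = (fun i => N.W i h) ᵥ* P.M n := by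
      funext j
      simp [Model.features, Matrix.mul_apply, Matrix.vecMul, dotProduct, mul_comm]
    rw [h2, dotProduct_comm, Matrix.dotProduct_mulVec]
  simpa [dotProduct, dot] using this

theorem Model.BoundsAt.noise_var_ne_zero : (P.ζ ^ 2 / P.d n).toNNReal ≠ 0 := by
  have h1 := hB.noise_pos
  have h2 := hB.feature.d_pos
  simpa using (by positivity : 0 < P.ζ ^ 2 / P.d n)

/-- Given the features, a preactivation is a nondegenerate Gaussian, so it almost surely misses the
two threshold values. Hence the attack is almost surely given by the slope. -/
theorem Model.BoundsAt.ae_pre_ne (N : P.Net n) (hW : ∀ h, ∃ i, N.W i h ≠ 0) :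
    ∀ᵐ w ∂P.pairLaw n, ∀ h, |N.pre (P.input n w.1 w.2) h| ≠ N.b h := by
  have := hB.feature.isProbabilityMeasure
  rw [ae_all_iff]
  intro h
  have hm : MeasurableSet {w : ℝ^(P.d n) × ℝ^(P.d n) |
      |N.pre (P.input n w.1 w.2) h| = N.b h} :=
    measurableSet_eq_fun (((N.continuous_pre h).comp (P.continuous_input n)).abs.measurable)
      measurable_const
  rw [ae_iff]
  simp only [not_not]
  refine Measure.measure_prod_null_of_ae_null hm (ae_of_all _ fun x => ?_)
  have h0 : ∀ c, P.noiseLaw n {ξ | ∑ i, ξ i * N.W i h = c} = 0 :=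
    measure_gaussian_form_eq _ _ hB.noise_var_ne_zero (hW h)
  refine measure_mono_null ?_ (measure_union_null
    (h0 (N.b h - dot (fun i => Φ N i h) x))
    (h0 (-N.b h - dot (fun i => Φ N i h) x)))
  intro ξ hξ
  have hξ' : |N.pre (P.input n x ξ) h| = N.b h := hξ
  rw [P.pre_input n] at hξ'
  rcases eq_or_eq_neg_of_abs_eq hξ' with h1 | h1
  · exact Or.inl (by show _ = _; linarith)
  · exact Or.inr (by show _ = _; linarith)

theorem Model.BoundsAt.advRisk_eq (τ : Task) (N : P.Net n)
    (hW : ∀ h, ∃ i, N.W i h ≠ 0) :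
    P.advRisk τ n N = ∫ w, P.robustRisk τ n N w ∂P.pairLaw n := by
  refine integral_congr_ae ?_
  filter_upwards [hB.ae_pre_ne N hW] with w hw
  refine integral_congr_ae ?_
  filter_upwards [ae_regular τ hB.regression_noise_pos (dot (P.θ₀ n) w.1)
    (N.eval (P.input n w.1 w.2))] with y hy
  exact N.attackedLoss_eq τ _ hw hy

omit hB in
theorem Model.cleanRisk_eq (P : Model) (n : ℕ) (τ : Task) (N : P.Net n) :
    P.cleanRisk τ n N = ∫ w, profile τ P.s (dot (P.θ₀ n) w.1) (N.eval (P.input n w.1 w.2)) 0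
      ∂P.pairLaw n := by
  refine integral_congr_ae (ae_of_all _ fun w => ?_)
  simp only [attackedLoss_zero]
  exact integral_loss_eq τ P.s _ _

omit hB in
theorem Model.oracleRisk_eq (P : Model) (n : ℕ) (τ : Task) :
    P.oracleRisk τ n = bayesRisk τ P.s (P.law n) (P.θ₀ n) :=
  integral_congr_ae (ae_of_all _ fun _ => integral_loss_eq τ P.s _ _)

theorem Model.BoundsAt.integrable_fst {F : ℝ^(P.d n) → ℝ} (hF : CubeBounded F) :
    Integrable (fun w => F w.1) (P.pairLaw n) :=
  (hB.feature.integrable hF).comp_fst _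

theorem Model.BoundsAt.integrable_sq_norm_input :
    Integrable (fun w => ‖P.input n w.1 w.2‖ ^ 2) (P.pairLaw n) := by
  have := hB.feature.isProbabilityMeasure
  have h1 : Integrable (fun w : ℝ^(P.d n) × ℝ^(P.d n) =>
      ∑ i, (2 * (P.M n *ᵥ w.1) i ^ 2 + 2 * w.2 i ^ 2)) (P.pairLaw n) := by
    refine integrable_finsetSum _ fun i _ => Integrable.add ?_ ?_
    · refine hB.integrable_fst (F := fun x => 2 * (P.M n *ᵥ x) i ^ 2) ?_
      simp only [Matrix.mulVec, dotProduct]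
      fun_prop
    · have h2 := integrable_sq_gaussian_form (d := P.d n) (P.ζ ^ 2 / P.d n).toNNReal (Pi.single i 1)
      have h3 : Integrable (fun ξ : ℝ^(P.d n) => 2 * ξ i ^ 2) (P.noiseLaw n) := by
        refine Integrable.const_mul ?_ 2
        unfold Model.noiseLaw
        simpa [Pi.single_apply] using h2
      exact h3.comp_snd _
  refine h1.mono' ((P.measurable_input n).norm.pow_const 2).aestronglyMeasurable
    (ae_of_all _ fun w => ?_)
  rw [norm_of_nonneg (sq_nonneg _), EuclideanSpace.norm_eq,
    sq_sqrt (sum_nonneg fun i _ => sq_nonneg _)]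
  refine sum_le_sum fun i _ => ?_
  have e : (P.input n w.1 w.2) i = (P.M n *ᵥ w.1) i + w.2 i := rfl
  rw [norm_eq_abs, sq_abs, e]
  nlinarith [sq_nonneg ((P.M n *ᵥ w.1) i - w.2 i)]

omit hB in
theorem Model.measurable_robustRisk (P : Model) (n : ℕ) (τ : Task) (N : P.Net n) :
    Measurable (P.robustRisk τ n N) :=
  measurable_integral_robustLoss τ P.s ((CubeBounded.dot _).1.comp measurable_fst)
    (N.measurable_eval.comp (P.measurable_input n))
    ((N.measurable_up _).comp (P.measurable_input n))
    ((N.measurable_down _).comp (P.measurable_input n))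

omit hB in
theorem Model.robustRisk_nonneg (P : Model) (n : ℕ) (τ : Task) (N : P.Net n)
    (w : ℝ^(P.d n) × ℝ^(P.d n)) : 0 ≤ P.robustRisk τ n N w :=
  integral_robustLoss_nonneg _ _ _ _ _ _

/-- Before and after the attack the network grows at most linearly in the input, which is square
integrable, and the conditional loss grows at most quadratically in the prediction. -/
theorem Model.BoundsAt.integrable_robustRisk (τ : Task) (N : P.Net n) :
    Integrable (P.robustRisk τ n N) (P.pairLaw n) := by
  have := hB.isProbabilityMeasure_pairLaw
  obtain ⟨C, hC, hle⟩ := integral_robustLoss_le τ P.s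
  set S := ∑ h, colNorm N.W h
  have hS : 0 ≤ S := sum_nonneg fun h _ => sqrt_nonneg _
  have hε := hB.attack_nonneg
  set Z := fun w : ℝ^(P.d n) × ℝ^(P.d n) => P.input n w.1 w.2
  set t := fun w : ℝ^(P.d n) × ℝ^(P.d n) => dot (P.θ₀ n) w.1
  have ht1 : Integrable (fun w => |t w|) (P.pairLaw n) :=
    hB.integrable_fst (F := fun x => |dot (P.θ₀ n) x|) (by fun_prop)
  have ht2 : Integrable (fun w => t w ^ 2) (P.pairLaw n) :=
    hB.integrable_fst (F := fun x => dot (P.θ₀ n) x ^ 2) (by fun_prop)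
  have hz := hB.integrable_sq_norm_input
  have hdom : Integrable (fun w => (1 + P.s ^ 2 + absMean P.s 0 + |t w|) +
      C * (1 + 2 * ((16 * S ^ 2) * ‖Z w‖ ^ 2 + 16 * P.ε n ^ 2 * S ^ 2 + 8 * t w ^ 2)))
      (P.pairLaw n) :=
    ((integrable_const _).add ht1).add (((integrable_const _).add ((((hz.const_mul _).add
      (integrable_const _)).add (ht2.const_mul 8)).const_mul 2)).const_mul C)
  refine hdom.mono' (P.measurable_robustRisk n τ N).aestronglyMeasurable (ae_of_all _ fun w => ?_)
  rw [norm_of_nonneg (P.robustRisk_nonneg n τ N w)]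
  have hup : ∀ v : 𝔼^(P.d n), ‖v‖ ≤ ‖Z w‖ + P.ε n →
      |N.eval v - t w| ≤ (‖Z w‖ + P.ε n) * S + |t w| := fun v hv =>
    (abs_sub _ _).trans (add_le_add ((N.abs_eval_le v).trans
      (mul_le_right hv hS)) le_rfl)
  have hdir : ‖P.ε n • N.dir (Z w)‖ ≤ P.ε n := by
    rw [norm_smul, norm_of_nonneg hε]
    exact mul_le_of_le_one_right hε (N.norm_dir_le _)
  set e := (‖Z w‖ + P.ε n) * S + |t w| with he
  have he0 : 0 ≤ e := by positivity
  have h1 := hle (t w) (N.eval (Z w)) (N.up (P.ε n) (Z w)) (N.down (P.ε n) (Z w)) (t w) 0 e le_rfl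
    he0 (by
      rw [add_zero]; exact hup _ ((norm_add_le _ _).trans (add_le_add le_rfl hdir))) (by
      rw [sub_zero]; exact hup _ ((norm_sub_le _ _).trans (add_le_add le_rfl hdir)))
  have h2 := profile_self_le τ P.s (t w)
  rw [sub_self, abs_zero, add_zero, add_zero, mul_one] at h1
  have h3 : e ^ 2 ≤ (16 * S ^ 2) * ‖Z w‖ ^ 2 + 16 * P.ε n ^ 2 * S ^ 2 + 8 * t w ^ 2 := by
    have a1 : e ^ 2 ≤ 2 * ((‖Z w‖ + P.ε n) * S) ^ 2 + 2 * |t w| ^ 2 := by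
      rw [he]; nlinarith [sq_nonneg ((‖Z w‖ + P.ε n) * S - |t w|)]
    have a2 : (‖Z w‖ + P.ε n) ^ 2 ≤ 2 * ‖Z w‖ ^ 2 + 2 * P.ε n ^ 2 := by
      nlinarith [sq_nonneg (‖Z w‖ - P.ε n)]
    rw [sq_abs, mul_pow] at a1
    have a3 := mul_le_right a2 (sq_nonneg S)
    have a4 : 0 ≤ ‖Z w‖ ^ 2 * S ^ 2 := by positivity
    have a5 : 0 ≤ P.ε n ^ 2 * S ^ 2 := by positivity
    linarith [sq_nonneg (t w)]
  have h4 : C * e + C * e ^ 2 ≤ C * (1 + 2 * e ^ 2) := by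
    have : e ≤ 1 + e ^ 2 := by nlinarith [sq_nonneg (e - 1)]
    have := mul_le_left this hC.le
    linarith
  have h5 := mul_le_left (a := 2 * C) h3
  show P.robustRisk τ n N w ≤ _
  have h6 : P.robustRisk τ n N w ≤ profile τ P.s (t w) (t w) 0 + C * e + C * e ^ 2 := h1
  linarith

theorem Model.BoundsAt.integral_fst (F : ℝ^(P.d n) → ℝ) :
    ∫ w, F w.1 ∂P.pairLaw n = ∫ x, F x ∂P.vecLaw n := by
  have := hB.feature.isProbabilityMeasure
  simpa using integral_fun_fst (μ := P.vecLaw n) (ν := P.noiseLaw n) F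

variable (τ : Task) (N : P.Net n) (hpos : ∀ i h h', 0 ≤ Φ N i h * Φ N i h')
  (hsmall : ∀ h, P.ε n * colNorm Φ N h ≤ N.b h)
include hpos hsmall

theorem Model.BoundsAt.profile_le_robustRisk (w : ℝ^(P.d n) × ℝ^(P.d n)) :
    profile τ P.s (dot (P.θ₀ n) w.1) (N.eval (P.input n w.1 w.2))
      (P.ε n * ‖N.slope (P.input n w.1 w.2)‖) ≤ P.robustRisk τ n N w := by
  have h1 : ∀ h h', 0 ≤ ∑ i, N.W i h * N.W i h' := fun h h' => by
    rw [hB.gram_eq]; exact sum_nonneg fun i _ => hpos i h h'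
  have h2 : ∀ h, P.ε n * colNorm N.W h ≤ N.b h := fun h => by rw [hB.colNorm_eq]; exact hsmall h
  exact profile_le_integral_robustLoss τ P.s _ (mul_nonneg hB.attack_nonneg (norm_nonneg _))
    (N.eval_add_slope_le_up hB.attack_nonneg h1 h2 _)
    (N.down_le_eval_sub_slope hB.attack_nonneg h1 h2 _)

theorem Model.BoundsAt.integrable_clean : Integrable (fun w =>
    profile τ P.s (dot (P.θ₀ n) w.1) (N.eval (P.input n w.1 w.2)) 0) (P.pairLaw n) := by
  refine (hB.integrable_robustRisk τ N).mono' ?_ (ae_of_all _ fun w => ?_)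
  · exact ((continuous_profile τ P.s).measurable.comp
      (((CubeBounded.dot _).1.comp measurable_fst).prodMk
      ((N.measurable_eval.comp (P.measurable_input n)).prodMk
        measurable_const))).aestronglyMeasurable
  · rw [norm_of_nonneg (profile_nonneg _ _ _ _ _)]
    refine le_trans (profile_mono τ P.s _ _ ?_) (hB.profile_le_robustRisk τ N hpos hsmall w)
    rw [abs_zero]; exact abs_nonneg _

theorem Model.BoundsAt.cleanRisk_le_advRisk (hW : ∀ h, ∃ i, N.W i h ≠ 0) :
    P.cleanRisk τ n N ≤ P.advRisk τ n N := by
  rw [P.cleanRisk_eq n, hB.advRisk_eq τ N hW]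
  refine integral_mono (hB.integrable_clean τ N hpos hsmall) (hB.integrable_robustRisk τ N)
    fun w => ?_
  refine le_trans (profile_mono τ P.s _ _ ?_) (hB.profile_le_robustRisk τ N hpos hsmall w)
  rw [abs_zero]; exact abs_nonneg _

theorem Model.BoundsAt.bayesRisk_le_cleanRisk :
    bayesRisk τ P.s (P.law n) (P.θ₀ n) ≤ P.cleanRisk τ n N := by
  have hc : CubeBounded fun x => profile τ P.s (dot (P.θ₀ n) x) (dot (P.θ₀ n) x) 0 :=
    CubeBounded.profile τ _ (by fun_prop) (by fun_prop) (by fun_prop)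
  rw [bayesRisk, P.cleanRisk_eq n,
    ← hB.integral_fst fun x => profile τ P.s (dot (P.θ₀ n) x) (dot (P.θ₀ n) x) 0]
  exact integral_mono (hB.integrable_fst hc) (hB.integrable_clean τ N hpos hsmall)
    fun w => profile_bayes _ _ _ _

end

/-! ### Purified networks -/

section Vector

variable {d : ℕ}

theorem sqrt_sum_sq_act_mul (T x : ℝ^d) : √(∑ i, (act (x i) * T i) ^ 2) = actNorm T x := by
  rw [actNorm]; congr 1
  refine sum_congr rfl fun i _ => ?_
  rw [mul_pow, sq (act (x i)), act_mul_self]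

theorem gate_mul {c : ℝ} (hc : c ≠ 0) (v e : ℝ) : gate (c * v) (e * |c|) = c * gate v e := by
  unfold gate
  have : e * |c| ≤ |c * v| ↔ e ≤ |v| := by
    rw [abs_mul, mul_comm e]
    exact mul_le_mul_iff_of_pos_left (abs_pos.2 hc)
  simp only [this]; split_ifs <;> simp

/-- The vector `a` divided by its Euclidean norm. -/
def unitize (a : ℝ^d) (i : Fin d) : ℝ := a i / √(∑ j, a j ^ 2)

theorem abs_unitize_le_one (a : ℝ^d) (i : Fin d) : |unitize a i| ≤ 1 := by
  rw [unitize, abs_div, abs_of_nonneg (sqrt_nonneg _)]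
  refine div_le_one_of_le₀ (Real.abs_le_sqrt ?_) (sqrt_nonneg _)
  exact single_le_sum (f := fun j => a j ^ 2) (fun _ _ => sq_nonneg _) (mem_univ i)

theorem sum_sq_unitize_le_one (a : ℝ^d) : ∑ i, unitize a i ^ 2 ≤ 1 := by
  have h : 0 ≤ ∑ j, a j ^ 2 := sum_nonneg fun _ _ => sq_nonneg _
  simp only [unitize, div_pow, sq_sqrt h, ← sum_div]
  exact div_self_le_one _

theorem sum_unitize_mul_self (a : ℝ^d) : ∑ i, unitize a i * a i = √(∑ j, a j ^ 2) := by
  have h : 0 ≤ ∑ j, a j ^ 2 := sum_nonneg fun _ _ => sq_nonneg _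
  simp only [unitize, div_mul_eq_mul_div, ← sq, ← sum_div, Real.div_sqrt]

/-- The normalised direction of steepest ascent of `u ↦ ∑ i, T i * gate (u i) β`. -/
def gateDir (T u : ℝ^d) (β : ℝ) : ℝ^d := unitize fun i => if β ≤ |u i| then T i else 0

theorem sum_mul_gateDir (T u : ℝ^d) (β : ℝ) :
    ∑ i, T i * gateDir T u β i = √(∑ j, (if β ≤ |u j| then T j else 0) ^ 2) := by
  rw [← sum_unitize_mul_self]
  refine sum_congr rfl fun i _ => ?_
  by_cases e : β ≤ |u i| <;> simp [gateDir, unitize, e, mul_comm]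

theorem abs_sqrt_sum_sq_sub_le (a b : ℝ^d) :
    |√(∑ i, a i ^ 2) - √(∑ i, b i ^ 2)| ≤ ∑ i, |a i - b i| := by
  have h1 := abs_norm_sub_norm_le (WithLp.toLp 2 a : 𝔼^d) (WithLp.toLp 2 b)
  have h2 : ‖(WithLp.toLp 2 a : 𝔼^d) - WithLp.toLp 2 b‖ ≤ ∑ i, |a i - b i| := by
    rw [EuclideanSpace.norm_eq]
    refine sqrt_le_iff.2 ⟨sum_nonneg fun _ _ => abs_nonneg _, ?_⟩
    refine Finset.sum_sq_le_sq_sum_of_nonneg fun i _ => ?_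
    exact abs_nonneg _
  rw [EuclideanSpace.norm_eq, EuclideanSpace.norm_eq] at h1
  simp only [norm_eq_abs, sq_abs] at h1
  exact h1.trans h2

/-- Where the noise is below `β` the gate identifies its feature without error. An inactive feature
gives `0` and is not attacked; an active one has size at least `3 β`, hence stays above `β` after
noise and attack, each at most `β`. Such coordinates leave only the noise on active features. A
coordinate with larger noise costs at most `2 B |ξ i|` in the gates and `B |ξ i|` in the norm of the
attack direction, since `ε` and `β` are both at most `|ξ i|` there. -/
theorem abs_gate_shift_sub_le {k β ε B : ℝ} {T x ξ : ℝ^d} (hx : IsFeature k x)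
    (hβ : 0 < β) (hε : 0 ≤ ε) (hεβ : ε ≤ β) (hβk : 3 * β ≤ 1 / √k)
    (hT : ∀ i, |T i| ≤ B) :
    |∑ i, T i * gate (x i + ξ i + ε * gateDir T (fun j => x j + ξ j) β i) β -
      (dot T x + ε * actNorm T x)| ≤
      |∑ i, act (x i) * T i * ξ i| + 3 * B * ∑ i, (if β ≤ |ξ i| then |ξ i| else 0) := by
  set u := fun j => x j + ξ j with hu
  set p := gateDir T u β with hp
  set S := ∑ i, (if β ≤ |ξ i| then |ξ i| else 0) with hS
  have hcoord : ∀ i, |T i * gate (u i + ε * p i) β - T i * x i - act (x i) * T i * ξ i -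
      ε * (T i * p i)| ≤ 2 * B * (if β ≤ |ξ i| then |ξ i| else 0) := fun i => by
    have hpi : |ε * p i| ≤ ε := by
      rw [abs_mul, abs_of_nonneg hε]
      exact mul_le_of_le_one_right hε (abs_unitize_le_one _ i)
    by_cases hbad : β ≤ |ξ i|
    · rw [if_pos hbad]
      have h1 := abs_gate_sub_le (u i + ε * p i) β
      have h2 : |gate (u i + ε * p i) β - (u i + ε * p i)| ≤ β :=
        h1.trans (by split_ifs <;> linarith)
      have h3 : T i * gate (u i + ε * p i) β - T i * x i - act (x i) * T i * ξ i -
          ε * (T i * p i) = T i * ((gate (u i + ε * p i) β - (u i + ε * p i)) +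
            (1 - act (x i)) * ξ i) := by simp only [hu]; ring
      rw [h3, abs_mul]
      have h4 : |gate (u i + ε * p i) β - (u i + ε * p i) + (1 - act (x i)) * ξ i| ≤ 2 * |ξ i| := by
        refine (abs_add_le _ _).trans ?_
        have : |(1 - act (x i)) * ξ i| ≤ |ξ i| := by
          rw [abs_mul]
          refine mul_le_of_le_one_left (abs_nonneg _) ?_
          rw [abs_le]; constructor <;> linarith [act_nonneg (x i), act_le_one (x i)]
        linarith
      calc _ ≤ B * (2 * |ξ i|) :=
            mul_le_mul (hT i) h4 (abs_nonneg _) ((abs_nonneg _).trans (hT i))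
        _ = _ := by ring
    · rw [if_neg hbad, mul_zero]
      rw [not_le] at hbad
      refine le_of_eq (abs_eq_zero.2 ?_)
      rcases hx i with h0 | ⟨h1, h2⟩
      · have hui : u i = ξ i := by simp [hu, h0]
        have hpi0 : p i = 0 := by
          rw [hp, gateDir, unitize, if_neg (by rw [hui]; exact not_le.2 hbad), zero_div]
        have hg : gate (u i + ε * p i) β = 0 := by
          rw [hpi0, mul_zero, add_zero, hui]; exact if_neg (not_le.2 hbad)
        rw [hg, hpi0, h0]; simp [act]
      · have hxi : x i ≠ 0 := by
          intro h0
          rw [h0, abs_zero] at h1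
          linarith
        have hact : act (x i) = 1 := if_neg hxi
        have hg : gate (u i + ε * p i) β = u i + ε * p i := by
          refine if_pos ?_
          have e1 : |x i| ≤ |u i + ε * p i| + |ξ i| + |ε * p i| := by
            have : x i = (u i + ε * p i) - ξ i - ε * p i := by simp only [hu]; ring
            nth_rewrite 1 [this]
            exact (abs_sub _ _).trans (add_le_add (abs_sub _ _) le_rfl)
          linarith
        rw [hg, hact]; simp only [hu]; ring
  have hnorm : |√(∑ j, (if β ≤ |u j| then T j else 0) ^ 2) - actNorm T x| * ε ≤ B * S := by
    rw [← sqrt_sum_sq_act_mul]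
    refine (mul_le_right (abs_sqrt_sum_sq_sub_le _ _) hε).trans ?_
    rw [sum_mul, hS, mul_sum]
    refine sum_le_sum fun i _ => ?_
    by_cases hbad : β ≤ |ξ i|
    · rw [if_pos hbad]
      refine mul_le_mul ?_ (hεβ.trans hbad) hε ((abs_nonneg _).trans (hT i))
      refine le_trans ?_ (hT i)
      unfold act
      split_ifs <;> simp
    · rw [if_neg hbad, mul_zero]
      rw [not_le] at hbad
      refine le_of_eq ?_
      rcases hx i with h0 | ⟨h1, h2⟩
      · have hui : u i = ξ i := by simp [hu, h0]
        rw [if_neg (by rw [hui]; exact not_le.2 hbad)]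
        simp [act, h0]
      · have hxi : x i ≠ 0 := by
          intro h0
          rw [h0, abs_zero] at h1
          linarith
        have : β ≤ |u i| := by
          have e1 : |x i| ≤ |u i| + |ξ i| := by
            have : x i = u i - ξ i := by simp only [hu]; ring
            nth_rewrite 1 [this]
            exact abs_sub _ _
          linarith
        rw [if_pos this]
        simp [act, hxi]
  have hdecomp : ∑ i, T i * gate (u i + ε * p i) β - (dot T x + ε * actNorm T x) =
      ∑ i, (T i * gate (u i + ε * p i) β - T i * x i - act (x i) * T i * ξ i - ε * (T i * p i)) +
      ∑ i, act (x i) * T i * ξ i +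
      (√(∑ j, (if β ≤ |u j| then T j else 0) ^ 2) - actNorm T x) * ε := by
    rw [← sum_mul_gateDir]
    simp only [sum_sub_distrib, ← mul_sum, dot, hp]
    ring
  rw [hdecomp]
  refine (abs_add_le _ _).trans ?_
  have h5 : |∑ i, (T i * gate (u i + ε * p i) β - T i * x i - act (x i) * T i * ξ i -
      ε * (T i * p i))| ≤ 2 * B * S := by
    rw [hS, mul_sum]
    exact (abs_sum_le_sum_abs _ _).trans (sum_le_sum fun i _ => hcoord i)
  have h6 := abs_add_le (∑ i, (T i * gate (u i + ε * p i) β - T i * x i -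
    act (x i) * T i * ξ i - ε * (T i * p i))) (∑ i, act (x i) * T i * ξ i)
  have h7 : |(√(∑ j, (if β ≤ |u j| then T j else 0) ^ 2) - actNorm T x) * ε| ≤ B * S := by
    rwa [abs_mul, abs_of_nonneg hε]
  linarith

end Vector

/-- The number of nodes `h` with `h % d = i`. -/
def copies (d H : ℕ) (i : Fin d) : ℕ := (Finset.univ.filter fun h : Fin H => (h : ℕ) % d = i).card

/-- Feature matrix of a purified network: node `h` carries the feature `h % d` only, and the strengths
of feature `i` add up to `T i`. -/
def pureFeatures (d H : ℕ) (T : ℝ^d) : Matrix (Fin d) (Fin H) ℝ :=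
  fun i h => if (h : ℕ) % d = i then T i / copies d H i else 0

theorem copies_bounds {d H : ℕ} (i : Fin d) : H / d ≤ copies d H i ∧ copies d H i ≤ H / d + 1 := by
  have hd : 0 < d := i.pos
  have h1 : copies d H i = Nat.count (· ≡ i [MOD d]) H := by
    rw [Nat.count_eq_card_filter_range, copies]
    refine Finset.card_bij (fun h _ => (h : ℕ)) ?_ ?_ ?_
    · intro h hh
      simp only [mem_filter, mem_univ, true_and] at hh
      simp only [mem_filter, Finset.mem_range]
      exact ⟨h.2, by rw [Nat.ModEq, hh, Nat.mod_eq_of_lt i.2]⟩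
    · intro a _ b _ hab; exact Fin.ext hab
    · intro b hb
      simp only [mem_filter, Finset.mem_range] at hb
      refine ⟨⟨b, hb.1⟩, ?_, rfl⟩
      simp only [mem_filter, mem_univ, true_and]
      have := hb.2
      rwa [Nat.ModEq, Nat.mod_eq_of_lt i.2] at this
  rw [h1, Nat.count_modEq_card _ hd]
  split_ifs <;> omega

theorem sum_pureFeatures {d H : ℕ} (hH : d ≤ H) (T : ℝ^d) (i : Fin d) :
    ∑ h, pureFeatures d H T i h = T i := by
  have hd : 0 < d := i.pos
  have hc : 0 < copies d H i := lt_of_lt_of_le (Nat.div_pos hH hd) (copies_bounds i).1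
  simp only [pureFeatures]
  rw [← Finset.sum_filter, sum_const, nsmul_eq_mul]
  rw [show ((Finset.univ.filter fun h : Fin H => (h : ℕ) % d = i).card : ℝ) = copies d H i from rfl]
  field_simp

theorem pureFeatures_of_ne {d H : ℕ} {T : ℝ^d} {i : Fin d} {h : Fin H}
    (hne : (h : ℕ) % d ≠ i) : pureFeatures d H T i h = 0 := if_neg hne

/-- The feature carried by the node `h` of a purified network. -/
abbrev residue {d : ℕ} (hd : 0 < d) (h : ℕ) : Fin d := ⟨h % d, Nat.mod_lt _ hd⟩

theorem sum_mul_pureFeatures {d H : ℕ} (hd : 0 < d) (T u : ℝ^d) (h : Fin H) :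
    ∑ i, u i * pureFeatures d H T i h = u (residue hd h) * pureFeatures d H T (residue hd h) h := by
  rw [sum_eq_single (residue hd h)]
  · intro i _ hi
    rw [pureFeatures_of_ne (fun e => hi (Fin.ext e.symm)), mul_zero]
  · simp

theorem colNorm_pureFeatures {d H : ℕ} (hd : 0 < d) (T : ℝ^d) (h : Fin H) :
    colNorm (pureFeatures d H T) h = |pureFeatures d H T (residue hd h) h| := by
  rw [colNorm, sum_eq_single (residue hd h), Real.sqrt_sq_eq_abs]
  · intro i _ hi
    rw [pureFeatures_of_ne (fun e => hi (Fin.ext e.symm))]; simp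
  · simp

theorem pureFeatures_ne_zero {d H : ℕ} (hH : d ≤ H) {T : ℝ^d} (hT : ∀ i, T i ≠ 0) {i : Fin d}
    {h : Fin H} (hi : (h : ℕ) % d = i) : pureFeatures d H T i h ≠ 0 := by
  have hc : 0 < copies d H i := lt_of_lt_of_le (Nat.div_pos hH i.pos) (copies_bounds i).1
  rw [pureFeatures, if_pos hi]
  exact div_ne_zero (hT i) (by positivity)

/-- The coordinates of the input in the feature basis. -/
def coords {d : ℕ} (M : Matrix (Fin d) (Fin d) ℝ) (z : 𝔼^d) : ℝ^d := fun j => ∑ i, z i * M i j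

theorem sum_mul_matrix_mul {d H : ℕ} (M : Matrix (Fin d) (Fin d) ℝ) (U : Matrix (Fin d) (Fin H) ℝ)
    (z : 𝔼^d) (h : Fin H) :
    ∑ i, z i * (M * U) i h = ∑ j, coords M z j * U j h := by
  simp only [Matrix.mul_apply, mul_sum, coords, sum_mul]
  rw [sum_comm]
  exact sum_congr rfl fun j _ => sum_congr rfl fun i _ => by ring

/-- The purified network with total strengths `T` and relative intercept `β`. -/
def pureNetwork {d : ℕ} (M : Matrix (Fin d) (Fin d) ℝ) (H : ℕ) (T : ℝ^d) (β : ℝ) : Network d H where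
  W := M * pureFeatures d H T
  b h := β * colNorm (pureFeatures d H T) h

section Pure

variable {d H : ℕ} {M : Matrix (Fin d) (Fin d) ℝ} {T : ℝ^d} {β : ℝ}

theorem sum_comp_pureFeatures (hd : 0 < d) (hH : d ≤ H) (F : ℝ^d) (i : Fin d) :
    ∑ h, pureFeatures d H T i h * F (residue hd h) = T i * F i := by
  rw [← sum_pureFeatures hH T i, sum_mul]
  refine sum_congr rfl fun h _ => ?_
  by_cases e : (h : ℕ) % d = i
  · have : residue hd h = i := Fin.ext e
    rw [this]
  · rw [pureFeatures_of_ne e]; simp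

theorem pureNetwork_pre (hd : 0 < d) (z : 𝔼^d) (h : Fin H) :
    (pureNetwork M H T β).pre z h = pureFeatures d H T (residue hd h) h *
      coords M z (residue hd h) := by
  rw [Network.pre]
  show ∑ i, z i * (M * pureFeatures d H T) i h = _
  rw [sum_mul_matrix_mul, sum_mul_pureFeatures hd, mul_comm]

/-- Intercepts are proportional to weights, so by `gate_mul` all nodes that carry feature `i` fire
together, when the `i`-th coordinate reaches `β`, and their weights add up to `T i`. -/
theorem pureNetwork_eval (hd : 0 < d) (hH : d ≤ H) (hT : ∀ i, T i ≠ 0)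
    (z : 𝔼^d) :
    (pureNetwork M H T β).eval z = ∑ i, T i * gate (coords M z i) β := by
  rw [Network.eval_eq]
  have h1 : ∀ h : Fin H, gate ((pureNetwork M H T β).pre z h) ((pureNetwork M H T β).b h) =
      ∑ i, pureFeatures d H T i h * gate (coords M z (residue hd h)) β := fun h => by
    rw [pureNetwork_pre hd]
    show gate _ (β * colNorm (pureFeatures d H T) h) = _
    rw [colNorm_pureFeatures hd, gate_mul (pureFeatures_ne_zero hH hT rfl), ← sum_mul]
    congr 1
    rw [sum_eq_single (residue hd h)]
    · intro i _ hi
      rw [pureFeatures_of_ne (fun e => hi (Fin.ext e.symm))]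
    · simp
  simp only [h1]
  rw [sum_comm]
  exact sum_congr rfl fun i _ => sum_comp_pureFeatures hd hH (fun j => gate (coords M z j) β) i

theorem coords_add (M : Matrix (Fin d) (Fin d) ℝ) (z w : 𝔼^d) (j : Fin d) :
    coords M (z + w) j = coords M z j + coords M w j := by
  simp [coords, add_mul, sum_add_distrib]

theorem coords_smul (M : Matrix (Fin d) (Fin d) ℝ) (c : ℝ) (z : 𝔼^d)
    (j : Fin d) : coords M (c • z) j = c * coords M z j := by
  simp [coords, mul_sum, mul_assoc]

theorem sum_sq_coords (hM : M ∈ Matrix.orthogonalGroup (Fin d) ℝ) (z : 𝔼^d) :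
    ∑ j, coords M z j ^ 2 = ‖z‖ ^ 2 := by
  rw [EuclideanSpace.norm_eq, sq_sqrt (sum_nonneg fun i _ => sq_nonneg _)]
  have h1 : (coords M z : ℝ^d) = (fun i => z i) ᵥ* M := by
    funext j; simp [coords, Matrix.vecMul, dotProduct]
  have h2 : ((fun i => z i) ᵥ* M) ⬝ᵥ ((fun i => z i) ᵥ* M) = (fun i => z i) ⬝ᵥ (fun i => z i) := by
    have hMM : M * Mᵀ = 1 := (Matrix.mem_orthogonalGroup_iff _ _).1 hM
    rw [← Matrix.dotProduct_mulVec, ← Matrix.mulVec_transpose, Matrix.mulVec_mulVec, hMM,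
      Matrix.one_mulVec]
  rw [h1]
  simp only [norm_eq_abs, sq_abs]
  simpa [dotProduct, ← sq] using h2

theorem coords_pureNetwork_slope (hM : M ∈ Matrix.orthogonalGroup (Fin d) ℝ) (hd : 0 < d)
    (hH : d ≤ H) (hT : ∀ i, T i ≠ 0) (z : 𝔼^d) (i : Fin d) :
    coords M ((pureNetwork M H T β).slope z) i = if β ≤ |coords M z i| then T i else 0 := by
  have hMM := (Matrix.mem_orthogonalGroup_iff' _ _).1 hM
  have hact : ∀ h : Fin H, (pureNetwork M H T β).b h ≤ |(pureNetwork M H T β).pre z h| ↔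
      β ≤ |coords M z (residue hd h)| := fun h => by
    rw [pureNetwork_pre hd, abs_mul]
    show β * colNorm (pureFeatures d H T) h ≤ _ ↔ _
    rw [colNorm_pureFeatures hd, mul_comm]
    exact mul_le_mul_iff_of_pos_left (abs_pos.2 (pureFeatures_ne_zero hH hT rfl))
  have hU : ∀ h, ∑ j, (M * pureFeatures d H T) j h * M j i = pureFeatures d H T i h := fun h => by
    have : Mᵀ * (M * pureFeatures d H T) = pureFeatures d H T := by
      rw [← Matrix.mul_assoc]
      have : Mᵀ * M = 1 := hMM
      rw [this, Matrix.one_mul]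
    have h2 := congrFun (congrFun this i) h
    rw [Matrix.mul_apply] at h2
    rw [← h2]
    exact sum_congr rfl fun j _ => by rw [Matrix.transpose_apply, mul_comm]
  simp only [coords, Network.slope, hact]
  simp only [sum_mul, ite_mul, zero_mul]
  rw [sum_comm]
  have h3 : ∀ h : Fin H, ∑ j, (if β ≤ |∑ i, z i * M i (residue hd h)| then
      (pureNetwork M H T β).W j h * M j i else 0) = pureFeatures d H T i h *
        (if β ≤ |∑ i, z i * M i (residue hd h)| then 1 else 0) := fun h => by
    split_ifs
    · rw [mul_one]; exact hU h
    · simp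
  simp only [h3]
  rw [sum_comp_pureFeatures hd hH (fun j => if β ≤ |∑ i, z i * M i j| then (1 : ℝ) else 0) i]
  split_ifs <;> simp

theorem coords_pureNetwork_dir (hM : M ∈ Matrix.orthogonalGroup (Fin d) ℝ) (hd : 0 < d)
    (hH : d ≤ H) (hT : ∀ i, T i ≠ 0) (z : 𝔼^d) (i : Fin d) :
    coords M ((pureNetwork M H T β).dir z) i = gateDir T (coords M z) β i := by
  rw [Network.dir, coords_smul, coords_pureNetwork_slope hM hd hH hT, gateDir, unitize, inv_mul_eq_div]
  congr 1
  rw [← sqrt_sq (norm_nonneg ((pureNetwork M H T β).slope z)), ← sum_sq_coords hM]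
  simp only [coords_pureNetwork_slope hM hd hH hT]

end Pure

section

variable {d : ℕ}

/-- The previous bound at `(-x, -ξ)`: gates are odd, while the attack direction and the active norm
are even. -/
theorem abs_gate_shift_neg_le {k β ε B : ℝ} {T x ξ : ℝ^d} (hx : IsFeature k x)
    (hβ : 0 < β) (hε : 0 ≤ ε) (hεβ : ε ≤ β) (hβk : 3 * β ≤ 1 / √k)
    (hT : ∀ i, |T i| ≤ B) :
    |∑ i, T i * gate (x i + ξ i - ε * gateDir T (fun j => x j + ξ j) β i) β -
      (dot T x - ε * actNorm T x)| ≤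
      |∑ i, act (x i) * T i * ξ i| + 3 * B * ∑ i, (if β ≤ |ξ i| then |ξ i| else 0) := by
  have hx' : IsFeature k fun i => -x i := fun i => by simpa using hx i
  have h := abs_gate_shift_sub_le (ξ := fun i => -ξ i) hx' hβ hε hεβ hβk hT
  have e1 : ∀ i, gateDir T (fun j => -x j + -ξ j) β i = gateDir T (fun j => x j + ξ j) β i :=
    fun i => by
      have : ∀ j, |-x j + -ξ j| = |x j + ξ j| := fun j => by rw [← neg_add, abs_neg]
      simp only [gateDir, unitize, this]
  have e2 : ∀ i, gate (-x i + -ξ i + ε * gateDir T (fun j => x j + ξ j) β i) β =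
      -gate (x i + ξ i - ε * gateDir T (fun j => x j + ξ j) β i) β := fun i => by
    rw [← gate_neg]; congr 1; ring
  have e3 : dot T (fun i => -x i) = -dot T x := by simp [dot]
  have e4 : actNorm T (fun i => -x i) = actNorm T x := by simp [actNorm, act_neg]
  simp only [e1, e2, e3, e4, act_neg, abs_neg, mul_neg, sum_neg_distrib] at h
  rw [show -∑ i, T i * gate (x i + ξ i - ε * gateDir T (fun j => x j + ξ j) β i) β -
    (-dot T x + ε * actNorm T x) = -(∑ i, T i * gate (x i + ξ i - ε *
      gateDir T (fun j => x j + ξ j) β i) β - (dot T x - ε * actNorm T x)) by ring, abs_neg] at h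
  exact h

theorem coords_input (M : Matrix (Fin d) (Fin d) ℝ) (hM : M ∈ Matrix.orthogonalGroup (Fin d) ℝ)
    (x ξ : ℝ^d) (j : Fin d) :
    coords M (WithLp.toLp 2 (M *ᵥ x + ξ)) j = x j + ∑ i, ξ i * M i j := by
  have hMM : Mᵀ * M = 1 := (Matrix.mem_orthogonalGroup_iff' _ _).1 hM
  have h1 : ∑ i, (M *ᵥ x) i * M i j = x j := by
    have : Mᵀ *ᵥ (M *ᵥ x) = x := by rw [Matrix.mulVec_mulVec, hMM, Matrix.one_mulVec]
    have h2 := congrFun this j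
    simp only [Matrix.mulVec, dotProduct, Matrix.transpose_apply] at h2 ⊢
    rw [← h2]
    exact sum_congr rfl fun i _ => mul_comm _ _
  simp only [coords, Pi.add_apply, add_mul, sum_add_distrib, h1]

theorem sum_sq_col (M : Matrix (Fin d) (Fin d) ℝ) (hM : M ∈ Matrix.orthogonalGroup (Fin d) ℝ)
    (j : Fin d) : ∑ i, M i j ^ 2 = 1 := by
  have hMM : Mᵀ * M = 1 := (Matrix.mem_orthogonalGroup_iff' _ _).1 hM
  have := congrFun (congrFun hMM j) j
  rw [Matrix.mul_apply] at this
  simpa [sq] using this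

theorem sum_sq_mulVec (M : Matrix (Fin d) (Fin d) ℝ) (hM : M ∈ Matrix.orthogonalGroup (Fin d) ℝ)
    (u : ℝ^d) : ∑ i, (∑ j, M i j * u j) ^ 2 = ∑ j, u j ^ 2 := by
  have hMM : Mᵀ * M = 1 := (Matrix.mem_orthogonalGroup_iff' _ _).1 hM
  have : (M *ᵥ u) ⬝ᵥ (M *ᵥ u) = u ⬝ᵥ u := by
    rw [Matrix.dotProduct_mulVec, ← Matrix.mulVec_transpose, Matrix.mulVec_mulVec, hMM,
      Matrix.one_mulVec]
  simpa [dotProduct, Matrix.mulVec, ← sq] using this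

end

/-! ### Purified networks attain the linear risk. -/

/-- The linear form of the noise seen by the active features. -/
def noiseForm {d : ℕ} (M : Matrix (Fin d) (Fin d) ℝ) (T : ℝ^d)
    (w : ℝ^d × ℝ^d) : ℝ :=
  ∑ j, act (w.1 j) * T j * ∑ i, w.2 i * M i j

/-- The total size of the noise coordinates exceeding `β`. -/
def noiseExcess {d : ℕ} (M : Matrix (Fin d) (Fin d) ℝ) (β : ℝ) (w : ℝ^d × ℝ^d) : ℝ :=
  ∑ j, if β ≤ |∑ i, w.2 i * M i j| then |∑ i, w.2 i * M i j| else 0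

section

variable {P : Model} {K : ℝ} {n : ℕ} (hB : P.BoundsAt K n)
include hB

theorem Model.BoundsAt.noise_var_eq : (((P.ζ ^ 2 / P.d n).toNNReal : NNReal) : ℝ) = P.ζ ^ 2 / P.d n := by
  have h2 := hB.feature.d_pos
  exact Real.coe_toNNReal _ (by positivity)

/-- Given the features this is a centred Gaussian. Orthogonality of `M` makes its variance `ζ ^ 2 /
d` times the sum of `T j ^ 2` over the active features, whose number has mean at most `K k`. -/
theorem Model.BoundsAt.integral_sq_noiseForm {T : ℝ^(P.d n)} {B : ℝ} (hT : ∀ i, |T i| ≤ B) :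
    Integrable (fun w => noiseForm (P.M n) T w ^ 2) (P.pairLaw n) ∧
    ∫ w, noiseForm (P.M n) T w ^ 2 ∂P.pairLaw n ≤ P.ζ ^ 2 * B ^ 2 * K * (P.k n / P.d n) := by
  have := hB.feature.isProbabilityMeasure
  have hd := hB.feature.d_pos
  have hB0 : ∀ i : Fin (P.d n), T i ^ 2 ≤ B ^ 2 := fun i => sq_le_of_abs_le (hT i)
  have hmeas : Measurable fun w => noiseForm (P.M n) T w := by
    refine measurable_sum _ fun j _ => Measurable.mul ?_ (by fun_prop)
    have h1 : Measurable fun w : ℝ^(P.d n) × ℝ^(P.d n) => act (w.1 j) :=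
      measurable_act.comp ((measurable_pi_apply j).comp measurable_fst)
    exact h1.mul_const _
  have hform : ∀ x ξ, noiseForm (P.M n) T (x, ξ) =
      ∑ i, ξ i * ∑ j, P.M n i j * (act (x j) * T j) := fun x ξ => by
    simp only [noiseForm, mul_sum]
    rw [sum_comm]
    exact sum_congr rfl fun i _ => sum_congr rfl fun j _ => by ring
  have hint : Integrable (fun w => noiseForm (P.M n) T w ^ 2) (P.pairLaw n) := by
    have h1 : Integrable (fun w : ℝ^(P.d n) × ℝ^(P.d n) =>
        (P.d n : ℝ) * ∑ j, B ^ 2 * (∑ i, w.2 i * P.M n i j) ^ 2) (P.pairLaw n) := by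
      refine Integrable.const_mul (integrable_finsetSum _ fun j _ => Integrable.const_mul ?_ _) _
      exact Integrable.comp_snd (f := fun ξ : ℝ^(P.d n) => (∑ i, ξ i * P.M n i j) ^ 2)
        (integrable_sq_gaussian_form _ _) _
    refine h1.mono' (hmeas.pow_const 2).aestronglyMeasurable (ae_of_all _ fun w => ?_)
    rw [norm_of_nonneg (sq_nonneg _)]
    refine (sq_sum_le_card_mul_sum_sq).trans ?_
    rw [card_univ, Fintype.card_fin]
    refine mul_le_left (sum_le_sum fun j _ => ?_) hd.le
    rw [mul_pow, mul_pow, sq (act _), act_mul_self]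
    refine mul_le_right ?_ (sq_nonneg _)
    exact (mul_le_of_le_one_left (sq_nonneg _) (act_le_one _)).trans (hB0 j)
  refine ⟨hint, ?_⟩
  rw [integral_prod _ hint]
  have h2 : ∀ x : ℝ^(P.d n), ∫ ξ, noiseForm (P.M n) T (x, ξ) ^ 2 ∂P.noiseLaw n ≤
      P.ζ ^ 2 / P.d n * B ^ 2 * numAct x := fun x => by
    simp only [hform]
    have h3 := integral_sq_gaussian_form (P.ζ ^ 2 / P.d n).toNNReal
      fun i => ∑ j, P.M n i j * (act (x j) * T j)
    rw [sum_sq_mulVec _ hB.orthogonal, hB.noise_var_eq] at h3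
    refine h3.le.trans ?_
    have h6 : ∑ j, (act (x j) * T j) ^ 2 ≤ ∑ j, B ^ 2 * act (x j) := sum_le_sum fun j _ => by
      rw [mul_pow, sq (act _), act_mul_self, mul_comm]
      exact mul_le_right (hB0 j) (act_nonneg _)
    rw [← mul_sum] at h6
    rw [mul_assoc]
    exact mul_le_left h6
  have h4 : ∫ x, ∫ ξ, noiseForm (P.M n) T (x, ξ) ^ 2 ∂P.noiseLaw n ∂P.vecLaw n ≤
      ∫ x, P.ζ ^ 2 / P.d n * B ^ 2 * numAct x ∂P.vecLaw n :=
    integral_mono hint.integral_prod_left (hB.feature.integrable (by fun_prop)) h2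
  refine h4.trans ?_
  rw [integral_const_mul]
  have h5 := mul_le_left (a := P.ζ ^ 2 / P.d n * B ^ 2) hB.feature.integral_numAct_le
  refine h5.trans (le_of_eq (by ring))

/-- By Cauchy–Schwarz the square of the sum is at most `d` times the sum of squares. Each of the `d`
truncated second moments is at most `12 ζ ^ 2 / d` times the tail `1 / d ^ 2`, so the total is of
order `1 / d`, which is at most `k / d`. -/
theorem Model.BoundsAt.integral_sq_noiseExcess {β : ℝ}
    (hr : 1 ≤ β * √(P.d n) / P.ζ)
    (htail : exp (-(β * √(P.d n) / P.ζ) ^ 2 / 4) ≤ 1 / (P.d n : ℝ) ^ 2) :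
    Integrable (fun w => noiseExcess (P.M n) β w ^ 2) (P.pairLaw n) ∧
    ∫ w, noiseExcess (P.M n) β w ^ 2 ∂P.pairLaw n ≤ 12 * P.ζ ^ 2 * (P.k n / P.d n) := by
  have := hB.feature.isProbabilityMeasure
  have hd := hB.feature.d_pos
  have hk := hB.feature.one_le_k
  have hζ := hB.noise_pos
  have hms : ∀ j, MeasurableSet {ξ : ℝ^(P.d n) | β ≤ |∑ i, ξ i * P.M n i j|} := fun j =>
    measurableSet_le measurable_const (by fun_prop)
  have hterm : ∀ j, Measurable fun ξ : ℝ^(P.d n) =>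
      if β ≤ |∑ i, ξ i * P.M n i j| then |∑ i, ξ i * P.M n i j| else 0 := fun j =>
    Measurable.ite (hms j) (by fun_prop) measurable_const
  have hmeas : Measurable fun w => noiseExcess (P.M n) β w :=
    measurable_sum _ fun j _ => (hterm j).comp measurable_snd
  set D := fun ξ : ℝ^(P.d n) => (P.d n : ℝ) *
    ∑ j, (if β ≤ |∑ i, ξ i * P.M n i j| then (∑ i, ξ i * P.M n i j) ^ 2 else 0) with hD
  have hDi : ∀ j, Integrable (fun ξ : ℝ^(P.d n) =>
      if β ≤ |∑ i, ξ i * P.M n i j| then (∑ i, ξ i * P.M n i j) ^ 2 else 0) (P.noiseLaw n) := by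
    intro j
    refine (integrable_sq_gaussian_form (P.ζ ^ 2 / P.d n).toNNReal fun i => P.M n i j).mono'
      (Measurable.ite (hms j) (by fun_prop) measurable_const).aestronglyMeasurable
      (ae_of_all _ fun ξ => ?_)
    split_ifs
    · rw [norm_of_nonneg (sq_nonneg _)]
    · rw [norm_zero]; exact sq_nonneg _
  have hDint : Integrable D (P.noiseLaw n) := (integrable_finsetSum _ fun j _ => hDi j).const_mul _
  have hle : ∀ w, noiseExcess (P.M n) β w ^ 2 ≤ D w.2 := fun w => by
    refine (sq_sum_le_card_mul_sum_sq).trans ?_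
    rw [card_univ, Fintype.card_fin]
    refine mul_le_left (sum_le_sum fun j _ => ?_) hd.le
    split_ifs
    · rw [sq_abs]
    · simp
  have hint : Integrable (fun w => noiseExcess (P.M n) β w ^ 2) (P.pairLaw n) :=
    (hDint.comp_snd _).mono' (hmeas.pow_const 2).aestronglyMeasurable (ae_of_all _ fun w => by
      rw [norm_of_nonneg (sq_nonneg _)]; exact hle w)
  refine ⟨hint, ?_⟩
  have h1 : ∫ w, noiseExcess (P.M n) β w ^ 2 ∂P.pairLaw n ≤ ∫ w, D w.2 ∂P.pairLaw n :=
    integral_mono hint (hDint.comp_snd _) hle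
  have h2 := integral_fun_snd (μ := P.vecLaw n) (ν := P.noiseLaw n) D
  rw [probReal_univ, one_smul] at h2
  rw [h2] at h1
  refine h1.trans ?_
  rw [hD, integral_const_mul, integral_finsetSum _ fun j _ => hDi j]
  have h3 : ∀ j, ∫ ξ, (if β ≤ |∑ i, ξ i * P.M n i j| then (∑ i, ξ i * P.M n i j) ^ 2 else 0)
      ∂P.noiseLaw n ≤ P.ζ ^ 2 / P.d n * (12 * (1 / (P.d n : ℝ) ^ 2)) := fun j => by
    have hne : ∃ i, P.M n i j ≠ 0 := by
      by_contra hall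
      push Not at hall
      have := sum_sq_col _ hB.orthogonal j
      simp [hall] at this
    have h4 := (gaussian_form_tail (P.ζ ^ 2 / P.d n).toNNReal (fun i => P.M n i j) (b := β) hr
      hB.noise_var_ne_zero hne (by
        rw [sum_sq_col _ hB.orthogonal, mul_one, hB.noise_var_eq, sqrt_div (sq_nonneg _),
          sqrt_sq hζ.le]
        have : 0 < √(P.d n) := sqrt_pos.2 hd
        refine le_of_eq ?_
        field_simp)).2
    rw [sum_sq_col _ hB.orthogonal, mul_one, hB.noise_var_eq] at h4
    refine h4.trans ?_
    gcongr
  refine (mul_le_left (sum_le_sum fun j _ => h3 j) hd.le).trans ?_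
  rw [sum_const, card_univ, Fintype.card_fin, nsmul_eq_mul]
  have h5 : (P.d n : ℝ) * (P.d n * (P.ζ ^ 2 / P.d n * (12 * (1 / (P.d n : ℝ) ^ 2)))) =
      12 * P.ζ ^ 2 * (1 / P.d n) := by field_simp
  rw [h5]
  gcongr

end

/-- Up and down predictions differ from those of the attacked linear predictor by an error `E` with
mean square of order `k / d`. Its effect on the risk is at most of the form `A E + E ^ 2` with `A`
bounded in mean square, hence of order `√(k / d)`. -/
theorem Model.exists_pureNetwork_advRisk_le (P : Model) (τ : Task) {K : ℝ} (hK : 1 ≤ K) :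
    ∃ C > 0, ∀ n, P.BoundsAt K n → P.d n ≤ P.H n → P.ε n * √(P.k n) ≤ 1 → ∀ β : ℝ, 0 < β →
    P.ε n ≤ β → 3 * β ≤ 1 / √(P.k n) → 1 ≤ β * √(P.d n) / P.ζ →
    exp (-(β * √(P.d n) / P.ζ) ^ 2 / 4) ≤ 1 / (P.d n : ℝ) ^ 2 →
    ∀ T : ℝ^(P.d n), (∀ i, T i ≠ 0) → (∀ i, |T i| ≤ 2 * K) →
    P.advRisk τ n (pureNetwork (P.M n) (P.H n) T β) ≤ P.linRisk τ n T + C * √(P.k n / P.d n) := by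
  obtain ⟨C, hC, hle⟩ := integral_robustLoss_le τ P.s
  set CE : ℝ := 2 * (P.ζ ^ 2 * (2 * K) ^ 2 * K) + 2 * (6 * K) ^ 2 * (12 * P.ζ ^ 2) with hCE
  set CA : ℝ := 3 * (1 + K * (3 * K) ^ 2 + 4 * K ^ 3) with hCA
  have hK0 : 0 < K := by linarith
  have hCE0 : 0 ≤ CE := by positivity
  have hCA0 : 0 < CA := by positivity
  refine ⟨C * CA + 2 * C * CE, by positivity, fun n hB hdH hεk β hβ hεβ hβk hr htail T hT0 hT => ?_⟩
  have hL := hB.feature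
  have := hL.isProbabilityMeasure
  have hdp := hL.d_pos
  have hk := hL.one_le_k
  have hd : 0 < P.d n := by exact_mod_cast hdp
  have hε := hB.attack_nonneg
  set N := pureNetwork (P.M n) (P.H n) T β with hN
  have hW : ∀ h, ∃ i, N.W i h ≠ 0 := fun h => by
    by_contra hall
    push Not at hall
    have h1 := N.abs_pre_le (WithLp.toLp 2 fun i => P.M n i ⟨h % P.d n, Nat.mod_lt _ hd⟩) h
    have h2 : colNorm N.W h = 0 := by simp [colNorm, hall]
    rw [h2, mul_zero, hN, pureNetwork_pre hd, abs_nonpos_iff, mul_eq_zero] at h1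
    rcases h1 with h1 | h1
    · exact pureFeatures_ne_zero hdH hT0 rfl h1
    · simp only [coords, ← sq] at h1
      rw [sum_sq_col _ hB.orthogonal] at h1
      exact one_ne_zero h1
  rw [hB.advRisk_eq τ N hW]
  set A := fun x : ℝ^(P.d n) => 1 + |dot (fun i => T i - P.θ₀ n i) x| + P.ε n * actNorm T x with hA
  have hcA : CubeBounded A := by fun_prop
  set E := fun w => |noiseForm (P.M n) T w| + 6 * K * noiseExcess (P.M n) β w with hE
  have hpt : ∀ w : ℝ^(P.d n) × ℝ^(P.d n), IsFeature (P.k n) w.1 →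
      P.robustRisk τ n N w ≤ profile τ P.s (dot (P.θ₀ n) w.1) (dot T w.1) (P.ε n * actNorm T w.1) +
        C * A w.1 * E w + C * E w ^ 2 := fun w hx => by
    set ξ' := fun j => ∑ i, w.2 i * P.M n i j with hξ'
    have hco : ∀ j, coords (P.M n) (P.input n w.1 w.2) j = w.1 j + ξ' j :=
      coords_input _ hB.orthogonal _ _
    have hco' : coords (P.M n) (P.input n w.1 w.2) = fun j => w.1 j + ξ' j := funext hco
    have hup : N.up (P.ε n) (P.input n w.1 w.2) = ∑ i, T i * gate (w.1 i + ξ' i + P.ε n *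
        gateDir T (fun j => w.1 j + ξ' j) β i) β := by
      rw [Network.up, hN, pureNetwork_eval hd hdH hT0]
      refine sum_congr rfl fun i _ => ?_
      rw [coords_add, coords_smul, coords_pureNetwork_dir hB.orthogonal hd hdH hT0, hco, hco']
    have hdown : N.down (P.ε n) (P.input n w.1 w.2) = ∑ i, T i * gate (w.1 i + ξ' i - P.ε n *
        gateDir T (fun j => w.1 j + ξ' j) β i) β := by
      rw [Network.down, hN, pureNetwork_eval hd hdH hT0]
      refine sum_congr rfl fun i _ => ?_
      rw [sub_eq_add_neg, ← neg_smul, coords_add, coords_smul,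
        coords_pureNetwork_dir hB.orthogonal hd hdH hT0, hco, hco', neg_mul, ← sub_eq_add_neg]
    have h1 := abs_gate_shift_sub_le (ξ := ξ') hx hβ hε hεβ hβk hT
    have h2 := abs_gate_shift_neg_le (ξ := ξ') hx hβ hε hεβ hβk hT
    rw [← hup] at h1
    rw [← hdown] at h2
    have e1 : |∑ i, act (w.1 i) * T i * ξ' i| + 3 * (2 * K) *
        ∑ i, (if β ≤ |ξ' i| then |ξ' i| else 0) = E w := by
      simp only [hE, noiseForm, noiseExcess, hξ']; ring
    rw [e1] at h1 h2
    have hEn : 0 ≤ E w := (abs_nonneg _).trans h1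
    have h3 := hle (dot (P.θ₀ n) w.1) (N.eval (P.input n w.1 w.2)) _ _ (dot T w.1)
      (P.ε n * actNorm T w.1) (E w) (mul_nonneg hε (actNorm_nonneg _ _)) hEn h1 h2
    rw [dot_sub] at h3
    exact h3
  -- The weight that balances `A E ≤ κ A ^ 2 + E ^ 2 / κ`, given that `E` has mean square of order
  -- `κ ^ 2`.
  set κ := √(P.k n / P.d n) with hκ
  have hκ0 : 0 < κ := sqrt_pos.2 (by positivity)
  have hκ2 : κ ^ 2 = P.k n / P.d n := sq_sqrt (by positivity)
  have hκ1 : κ ≤ 1 := sqrt_le_one.2 ((div_le_one hdp).2 hL.k_le)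
  obtain ⟨iF, bF⟩ := hB.integral_sq_noiseForm hT
  obtain ⟨iX, bX⟩ := hB.integral_sq_noiseExcess hr htail
  have hcp : CubeBounded fun x => profile τ P.s (dot (P.θ₀ n) x) (dot T x) (P.ε n * actNorm T x) :=
    CubeBounded.profile τ _ (by fun_prop) (by fun_prop) (by fun_prop)
  have ip := hB.integrable_fst hcp
  have iA := hB.integrable_fst (hcA.pow 2)
  have hdomle : ∀ w : ℝ^(P.d n) × ℝ^(P.d n), IsFeature (P.k n) w.1 →
      P.robustRisk τ n N w ≤ profile τ P.s (dot (P.θ₀ n) w.1) (dot T w.1) (P.ε n * actNorm T w.1) +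
        (C * κ * A w.1 ^ 2 + 2 * C / κ * (2 * noiseForm (P.M n) T w ^ 2 +
          2 * (6 * K) ^ 2 * noiseExcess (P.M n) β w ^ 2)) := fun w hx => by
    refine (hpt w hx).trans ?_
    have h1 : E w ^ 2 ≤ 2 * noiseForm (P.M n) T w ^ 2 +
        2 * (6 * K) ^ 2 * noiseExcess (P.M n) β w ^ 2 := by
      have := sq_nonneg (|noiseForm (P.M n) T w| - 6 * K * noiseExcess (P.M n) β w)
      have h2 := sq_abs (noiseForm (P.M n) T w)
      simp only [hE]; linarith
    have h3 : A w.1 * E w ≤ κ * A w.1 ^ 2 + 1 / κ * E w ^ 2 := by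
      have h4 : 0 ≤ (κ * A w.1 - E w) ^ 2 / κ := by positivity
      have h5 : (κ * A w.1 - E w) ^ 2 / κ = κ * A w.1 ^ 2 - 2 * (A w.1 * E w) + 1 / κ * E w ^ 2 := by
        field_simp; ring
      have h6 : 0 ≤ κ * A w.1 ^ 2 := by positivity
      have h7 : 0 ≤ 1 / κ * E w ^ 2 := by positivity
      linarith
    have h8 : E w ^ 2 ≤ 1 / κ * E w ^ 2 :=
      le_mul_of_one_le_left (sq_nonneg _) ((one_le_div hκ0).2 hκ1)
    have h9 := mul_le_left h3 hC.le
    have h10 := mul_le_left h8 hC.le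
    have h11 := mul_le_left (a := 2 * C / κ) h1
    have h12 : 2 * C / κ * E w ^ 2 = 2 * (C * (1 / κ * E w ^ 2)) := by ring
    linarith
  have hae : ∀ᵐ w ∂P.pairLaw n, IsFeature (P.k n) w.1 :=
    Measure.quasiMeasurePreserving_fst.ae hL.ae_isFeature
  have hmain := integral_mono_ae (hB.integrable_robustRisk τ N)
    (ip.add ((iA.const_mul (C * κ)).add (((iF.const_mul 2).add
      (iX.const_mul (2 * (6 * K) ^ 2))).const_mul (2 * C / κ)))) (hae.mono hdomle)
  refine hmain.trans ?_
  have hsum : ∫ w, (profile τ P.s (dot (P.θ₀ n) w.1) (dot T w.1) (P.ε n * actNorm T w.1) +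
        (C * κ * A w.1 ^ 2 + 2 * C / κ * (2 * noiseForm (P.M n) T w ^ 2 +
          2 * (6 * K) ^ 2 * noiseExcess (P.M n) β w ^ 2))) ∂P.pairLaw n =
      P.linRisk τ n T + (C * κ * ∫ x, A x ^ 2 ∂P.vecLaw n +
        2 * C / κ * (2 * ∫ w, noiseForm (P.M n) T w ^ 2 ∂P.pairLaw n +
          2 * (6 * K) ^ 2 * ∫ w, noiseExcess (P.M n) β w ^ 2 ∂P.pairLaw n)) := by
    have i1 : Integrable (fun w => 2 * noiseForm (P.M n) T w ^ 2 +
        2 * (6 * K) ^ 2 * noiseExcess (P.M n) β w ^ 2) (P.pairLaw n) :=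
      (iF.const_mul 2).add (iX.const_mul (2 * (6 * K) ^ 2))
    have i2 : Integrable (fun w => C * κ * A w.1 ^ 2 + 2 * C / κ * (2 * noiseForm (P.M n) T w ^ 2 +
        2 * (6 * K) ^ 2 * noiseExcess (P.M n) β w ^ 2)) (P.pairLaw n) :=
      (iA.const_mul (C * κ)).add (i1.const_mul (2 * C / κ))
    rw [integral_add ip i2, integral_add (iA.const_mul (C * κ)) (i1.const_mul (2 * C / κ)),
      integral_const_mul,
      integral_const_mul, integral_add (iF.const_mul 2) (iX.const_mul (2 * (6 * K) ^ 2)),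
      integral_const_mul, integral_const_mul, linRisk, FeaturePurification.linRisk,
      hB.integral_fst (fun x => profile τ P.s (dot (P.θ₀ n) x) (dot T x) (P.ε n * actNorm T x)),
      hB.integral_fst (fun x => A x ^ 2)]
  refine hsum.le.trans ?_
  have hA2 : ∫ x, A x ^ 2 ∂P.vecLaw n ≤ CA := by
    have h1 : ∫ x, A x ^ 2 ∂P.vecLaw n ≤ ∫ x, (3 * (1 + dot (fun i => T i - P.θ₀ n i) x ^ 2 +
          (2 * K) ^ 2 * P.ε n ^ 2 * numAct x)) ∂P.vecLaw n := by
      refine hL.integral_mono fun x _ => ?_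
      have h2 := pow_le_pow_left₀ (actNorm_nonneg T x) (actNorm_le (by positivity) hT x) 2
      rw [mul_pow, sq_sqrt (numAct_nonneg x)] at h2
      have h3 := mul_le_left h2 (sq_nonneg (P.ε n))
      have h4 : ∀ a b : ℝ, (1 + a + b) ^ 2 ≤ 3 * (1 + a ^ 2 + b ^ 2) := fun a b => by
        nlinarith [sq_nonneg (a - b), sq_nonneg (1 - a), sq_nonneg (1 - b)]
      have h5 := h4 (|dot (fun i => T i - P.θ₀ n i) x|) (P.ε n * actNorm T x)
      rw [sq_abs, mul_pow] at h5
      simp only [hA]; linarith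
    refine h1.trans ?_
    rw [integral_const_mul, hL.integral_add,
      hL.integral_add, hL.integral_const, integral_const_mul, hCA]
    refine mul_le_left (add_le_add (add_le_add le_rfl ?_) ?_) (by norm_num)
    · refine hL.integral_sq_dot_le fun i => ?_
      have := abs_sub (T i) (P.θ₀ n i)
      linarith [hT i, (hB.coeff i).2]
    · have h2 := mul_le_left (a := (2 * K) ^ 2 * P.ε n ^ 2) hL.integral_numAct_le
      refine h2.trans ?_
      have h3 : (P.ε n * √(P.k n)) ^ 2 ≤ 1 := pow_le_one₀ (by positivity) hεk
      rw [mul_pow, sq_sqrt (by linarith)] at h3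
      have h4 := mul_le_left (a := 4 * K ^ 3) h3
      linarith
  have t1 := mul_le_left (a := C * κ) hA2
  have t2 : 2 * ∫ w, noiseForm (P.M n) T w ^ 2 ∂P.pairLaw n +
          2 * (6 * K) ^ 2 * ∫ w, noiseExcess (P.M n) β w ^ 2 ∂P.pairLaw n ≤ CE * κ ^ 2 := by
    rw [hκ2]
    have := mul_le_left (a := 2 * (6 * K) ^ 2) bX
    rw [hCE]; linarith
  have t3 := mul_le_left (a := 2 * C / κ) t2
  have t4 : 2 * C / κ * (CE * κ ^ 2) = 2 * C * CE * κ := by field_simp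
  rw [t4] at t3
  linarith

/-! ### From asymptotic relations to conditions at one index. -/

/-- The relations between the parameters at the index `n`, with constants `K` and small ratios `c`. -/
structure Model.RegimeAt (P : Model) (K c : ℝ) (n : ℕ) : Prop extends P.BoundsAt K n where
  one_le_log : 1 ≤ c * log (P.d n)
  one_le_m : 1 ≤ P.m n
  screened : √(P.k n * P.m n) * log (P.d n) ≤ c * √(P.d n)
  attack_upper : P.ε n * (√(P.k n * P.m n) * log (P.d n)) ≤ K
  wide : (P.d n : ℝ) ≤ c * P.H n
  narrow : (P.H n : ℝ) ≤ c * (P.ε n * (P.d n * √(P.d n)))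

/-- Membership in the class at the index `n`, with constants `K` and small ratios `c`. -/
structure Model.ClassAt (P : Model) (K c : ℝ) (n : ℕ) (N : P.Net n) (γ : ℝ) : Prop where
  scale_pos : 0 < γ
  few_features : ∀ h, colSupp Φ N h ≤ P.m n
  nonzero : ∀ h, ∃ i, Φ N i h ≠ 0
  same_sign : ∀ i h h', 0 ≤ Φ N i h * Φ N i h'
  same_size : ∀ i h, Φ N i h ≠ 0 → γ / K ≤ |Φ N i h| ∧ |Φ N i h| ≤ K * γ
  intercept_upper : ∀ h, N.b h * √(P.k n * colSupp Φ N h) ≤ c * colNorm Φ N h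
  intercept_lower : ∀ h, colNorm Φ N h ≤ c * (N.b h * (√(P.k n * colSupp Φ N h) * log (P.d n)))

theorem one_le_colSupp {d H : ℕ} {U : Matrix (Fin d) (Fin H) ℝ} {h : Fin H} (hU : ∃ i, U i h ≠ 0) :
    1 ≤ colSupp U h := by
  obtain ⟨i, hi⟩ := hU
  exact (Set.ncard_pos (Set.toFinite _)).2 ⟨i, hi⟩

theorem colNorm_pos {d H : ℕ} {U : Matrix (Fin d) (Fin H) ℝ} {h : Fin H} (hU : ∃ i, U i h ≠ 0) :
    0 < colNorm U h := by
  obtain ⟨i, hi⟩ := hU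
  exact sqrt_pos.2 (lt_of_lt_of_le (by positivity)
    (single_le_sum (f := fun i => U i h ^ 2) (fun _ _ => sq_nonneg _) (mem_univ i)))

section

variable {P : Model}

theorem Model.SparseCoding.tendsto_d (hP : P.SparseCoding) :
    Tendsto (fun n => (P.d n : ℝ)) atTop atTop := tendsto_natCast_atTop_atTop.comp hP.dim

theorem Model.SparseCoding.tendsto_log (hP : P.SparseCoding) :
    Tendsto (fun n => log (P.d n)) atTop atTop := Real.tendsto_log_atTop.comp hP.tendsto_d

theorem Model.SparseCoding.exists_boundsAt (hP : P.SparseCoding) (hε : ∀ᶠ n in atTop, 0 ≤ P.ε n) :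
    ∃ K₀ ≥ 1, ∀ K ≥ K₀, ∀ᶠ n in atTop, P.BoundsAt K n := by
  obtain ⟨a₁, ha₁, A₁, -, h₁⟩ := hP.active
  obtain ⟨a₂, ha₂, A₂, -, h₂⟩ := hP.moment_two
  obtain ⟨a₃, ha₃, A₃, -, h₃⟩ := hP.coeff
  refine ⟨max 1 (max (max (1 / a₁) A₁) (max (max (1 / a₂) A₂) (max (1 / a₃) A₃))), le_max_left _ _,
    fun K hK => ?_⟩
  simp only [ge_iff_le, max_le_iff] at hK
  obtain ⟨hK1, ⟨b₁, B₁⟩, ⟨b₂, B₂⟩, b₃, B₃⟩ := hK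
  have hK0 : 0 < K := by linarith
  have inv : ∀ a : ℝ, 0 < a → 1 / a ≤ K → 1 / K ≤ a := fun a ha h => by
    rw [div_le_iff₀ ha] at h; rw [div_le_iff₀ hK0]; linarith
  filter_upwards [h₁, h₂, h₃, hε, hP.k_small.bound one_pos, hP.tendsto_d.eventually_gt_atTop 0]
    with n e₁ e₂ e₃ e₄ e₅ e₆
  have hk := hP.one_le_k n
  refine ⟨⟨hK1, hP.prob n, hP.symm n, hP.range n, hk, ?_, ?_, ?_, ?_, ?_⟩, hP.orthogonal n,
    hP.noise_pos, hP.regression_noise_pos,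
    fun i => ⟨(inv _ ha₃ b₃).trans (e₃ i).1, (e₃ i).2.trans B₃⟩, e₄⟩
  · rwa [one_mul, norm_of_nonneg (by linarith), norm_of_nonneg e₆.le] at e₅
  · refine le_trans ?_ e₁.1
    rw [show P.k n / (K * P.d n) = 1 / K * (P.k n / P.d n) by field_simp]
    exact mul_le_right (inv _ ha₁ b₁)
  · refine e₁.2.trans ?_
    rw [mul_div_assoc]
    exact mul_le_right B₁
  · refine le_trans ?_ e₂.1
    rw [show 1 / (K * P.d n) = 1 / K * (1 / P.d n : ℝ) by field_simp]
    exact mul_le_right (inv _ ha₂ b₂)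
  · refine e₂.2.trans ?_
    rw [show K / P.d n = K * (1 / P.d n : ℝ) by field_simp]
    exact mul_le_right B₂

variable {N : ∀ n, P.Net n}

theorem Model.InClass.exists_regimeAt (hP : P.SparseCoding) (hN : P.InClass N)
    (hε : IsOrder P.ε fun n => 1 / (√(P.k n * P.m n) * log (P.d n)))
    (hH : (fun n => (P.H n : ℝ)) =o[atTop] fun n => P.ε n * (P.d n : ℝ) ^ (3 / 2 : ℝ)) :
    ∃ K₀ ≥ 1, ∀ K ≥ K₀, ∀ c > 0, ∀ᶠ n in atTop, P.RegimeAt K c n := by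
  obtain ⟨a, ha, A, hA, hε⟩ := hε
  have hlog := hP.tendsto_log.eventually_gt_atTop 0
  have hd := hP.tendsto_d.eventually_gt_atTop 0
  have hm : ∀ᶠ n in atTop, 1 ≤ P.m n := by
    filter_upwards [hN.few_features, hN.nonzero, hN.wide.bound one_pos, hd] with n h1 h2 h3 h4
    have h5 : 0 < P.H n := by
      by_contra h
      rw [Nat.eq_zero_of_not_pos h] at h3
      simp only [Nat.cast_zero, norm_zero, mul_zero, norm_le_zero_iff] at h3
      exact h4.ne' h3
    exact (one_le_colSupp (h2 ⟨0, h5⟩)).trans (h1 _)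
  have hR : ∀ᶠ n in atTop, 0 < √(P.k n * P.m n) * log (P.d n) := by
    filter_upwards [hm, hlog] with n h1 h2
    have := hP.one_le_k n
    have : (1 : ℝ) ≤ P.m n := by exact_mod_cast h1
    positivity
  have hεpos : ∀ᶠ n in atTop, 0 < P.ε n := by
    filter_upwards [hε, hR] with n h1 h2
    exact lt_of_lt_of_le (by positivity) h1.1
  obtain ⟨K₀, hK₀, hK⟩ := hP.exists_boundsAt (hεpos.mono fun n h => h.le)
  refine ⟨max K₀ A, hK₀.le.trans (le_max_left _ _), fun K hK' c hc => ?_⟩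
  obtain ⟨hK1, hKA⟩ := max_le_iff.1 hK'
  have hc' : 0 < c / (A + 1) := by positivity
  filter_upwards [hK K hK1, hP.tendsto_log.eventually_ge_atTop (1 / c), hm, hR, hεpos, hε,
    hN.wide.bound hc, hN.wide.bound one_pos, hH.bound hc', hd] with n h1 h2 h3 h4 h5 h6 h7 h8 h9 h10
  rw [norm_of_nonneg (Nat.cast_nonneg _), norm_of_nonneg (Nat.cast_nonneg _)] at h7 h8
  have e : (P.d n : ℝ) ^ (3 / 2 : ℝ) = P.d n * √(P.d n) := by
    rw [show (3 / 2 : ℝ) = 1 + 1 / 2 by norm_num, Real.rpow_add h10, Real.rpow_one,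
      Real.sqrt_eq_rpow]
  rw [norm_of_nonneg (Nat.cast_nonneg _), e, norm_of_nonneg (by positivity)] at h9
  set R := √(P.k n * P.m n) * log (P.d n) with hRdef
  have hup : P.ε n * R ≤ A := by
    have := mul_le_right h6.2 h4.le
    rwa [mul_assoc, one_div_mul_cancel h4.ne', mul_one] at this
  have hsd : 0 < √(P.d n) := sqrt_pos.2 h10
  have hcA : c / (A + 1) ≤ c := div_le_self hc.le (by linarith)
  -- From `d ≤ H` and `H = o(ε d^{3/2})`. Multiplied by `R`, together with `ε R ≤ A`, it yields the
  -- screening bound `R ≤ c √d`; the divisor `A + 1` makes room for the factor `A`.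
  have h11 : 1 ≤ c / (A + 1) * (P.ε n * √(P.d n)) := by
    have : (P.d n : ℝ) * 1 ≤ P.d n * (c / (A + 1) * (P.ε n * √(P.d n))) := by
      rw [mul_one]; refine (h8.trans ((one_mul _).le.trans h9)).trans (le_of_eq (by ring))
    exact le_of_mul_le_mul_left this h10
  refine ⟨h1, ?_, h3, ?_, hup.trans hKA, h7, h9.trans ?_⟩
  · rwa [div_le_iff₀' hc] at h2
  · have h12 : R * 1 ≤ c / (A + 1) * (P.ε n * R) * √(P.d n) := by
      refine (mul_le_left h11 h4.le).trans (le_of_eq (by ring))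
    rw [mul_one] at h12
    refine h12.trans (mul_le_right ?_ hsd.le)
    refine (mul_le_left hup hc'.le).trans ?_
    rw [div_mul_eq_mul_div, div_le_iff₀ (by linarith)]
    exact mul_le_left (by linarith) hc.le
  · exact mul_le_right hcA

theorem Model.InClass.exists_classAt (hP : P.SparseCoding) (hN : P.InClass N) :
    ∃ γ : ℕ → ℝ, ∃ K₀ ≥ 1, ∀ K ≥ K₀, ∀ c > 0, ∀ᶠ n in atTop, P.ClassAt K c n (N n) (γ n) := by
  obtain ⟨γ, hγ, a, ha, A, hA, hs⟩ := hN.same_size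
  refine ⟨γ, max 1 (max A (1 / a)), le_max_left _ _, fun K hK c hc => ?_⟩
  simp only [ge_iff_le, max_le_iff] at hK
  obtain ⟨hK1, hKA, hKa⟩ := hK
  have hK0 : 0 < K := by linarith
  have h13 : 1 / K ≤ a := by rw [div_le_iff₀ ha] at hKa; rw [div_le_iff₀ hK0]; linarith
  filter_upwards [hN.intercept_small c hc, hN.intercept_large (1 / c) (by positivity),
    hN.few_features, hN.nonzero, hN.same_sign, hs, hP.tendsto_log.eventually_gt_atTop 0]
    with n h1 h2 h3 h4 h5 h6 h7
  have hk := hP.one_le_k n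
  have hr : ∀ h, 0 < √(P.k n * colSupp (P.features n (N n)) h) := fun h => by
    have : (1 : ℝ) ≤ colSupp (P.features n (N n)) h := by exact_mod_cast one_le_colSupp (h4 h)
    positivity
  refine ⟨hγ n, h3, h4, h5, fun i h hne => ⟨le_trans ?_ (h6 i h hne).1, (h6 i h hne).2.trans ?_⟩,
    fun h => ?_, fun h => ?_⟩
  · rw [div_eq_mul_one_div, mul_comm]
    exact mul_le_right h13 (hγ n).le
  · exact mul_le_right hKA (hγ n).le
  · have := h1 h
    rwa [← mul_div_assoc, le_div_iff₀ (hr h)] at this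
  · have := h2 h
    rw [div_div, ← mul_div_assoc, div_le_iff₀ (mul_pos (hr h) h7), one_div, inv_mul_le_iff₀ hc] at this
    exact this

theorem Model.features_pureNetwork {K : ℝ} {n : ℕ} (hB : P.BoundsAt K n) (T : ℝ^(P.d n))
    (β : ℝ) : P.features n (pureNetwork (P.M n) (P.H n) T β) = pureFeatures (P.d n) (P.H n) T := by
  rw [Model.features, pureNetwork, ← Matrix.mul_assoc,
    (Matrix.mem_orthogonalGroup_iff' _ _).1 hB.orthogonal, Matrix.one_mul]

theorem colSupp_pureFeatures {d H : ℕ} (hH : d ≤ H) (hd : 0 < d) {T : ℝ^d} (hT : ∀ i, T i ≠ 0)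
    (h : Fin H) : colSupp (pureFeatures d H T) h = 1 := by
  rw [colSupp, Set.ncard_eq_one]
  refine ⟨⟨h % d, Nat.mod_lt _ hd⟩, Set.ext fun i => ⟨fun hi => ?_, fun hi => ?_⟩⟩
  · by_contra hne
    exact hi (pureFeatures_of_ne fun e => hne (Fin.ext e.symm))
  · exact pureFeatures_ne_zero hH hT (by rw [hi])

/-- The relative intercept of the purified networks used for comparison. -/
def Model.pureIntercept (P : Model) (n : ℕ) : ℝ := 1 / (√(P.k n) * √(log (P.d n)))

/-- Purified networks with total strengths comparable to the true coefficient belong to the class. -/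
theorem Model.InClass.pureNetwork (hP : P.SparseCoding)
    (hR : ∃ K : ℝ, ∀ c > 0, ∀ᶠ n in atTop, P.RegimeAt K c n) (hN : P.InClass N)
    {T : ∀ n, ℝ^(P.d n)} (hT : ∀ᶠ n in atTop, ∀ i, |T n i - P.θ₀ n i| ≤ |P.θ₀ n i| / 2) :
    P.InClass fun n => pureNetwork (P.M n) (P.H n) (T n) (P.pureIntercept n) := by
  obtain ⟨K, hR⟩ := hR
  have hbase : ∀ᶠ n in atTop, P.BoundsAt K n ∧ 0 < P.d n ∧ P.d n ≤ P.H n ∧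
      0 < log (P.d n) ∧ ∀ i, 1 / (2 * K) ≤ |T n i| ∧ |T n i| ≤ 2 * K := by
    filter_upwards [hR 1 one_pos, hT] with n h1 h2
    have hd := h1.feature.d_pos
    have hK := h1.feature.one_le_K
    refine ⟨h1.toBoundsAt, by exact_mod_cast hd, ?_, ?_, fun i => ?_⟩
    · have := h1.wide
      rw [one_mul] at this
      exact_mod_cast this
    · have := h1.one_le_log; linarith
    · have h3 := h1.coeff i
      have h4 := abs_sub_abs_le_abs_sub (T n i) (P.θ₀ n i)
      have h5 := abs_sub_abs_le_abs_sub (P.θ₀ n i) (T n i)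
      rw [abs_sub_comm] at h5
      have e : 1 / (2 * K) = 1 / K / 2 := by ring
      constructor <;> linarith [h2 i]
  have hne : ∀ n, (∀ i, 1 / (2 * K) ≤ |T n i| ∧ |T n i| ≤ 2 * K) → 1 ≤ K → ∀ i, T n i ≠ 0 :=
    fun n h hK i h0 => by
      have := (h i).1
      rw [h0, abs_zero] at this
      have : 0 < 1 / (2 * K) := by positivity
      linarith
  -- The relative intercept `1 / (√k √(log d))` is the geometric mean of the two bounds required by
  -- the class, a factor `√(log d)` away from each.
  have hsqrt := Real.tendsto_sqrt_atTop.comp hP.tendsto_log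
  refine ⟨fun c hc => ?_, fun C hC => ?_, fun C hC => ?_, ?_, hN.m_small, ?_, hN.wide, ?_, ?_⟩
  · filter_upwards [hbase, hsqrt.eventually_ge_atTop (1 / c)] with n ⟨hB, hd, hdH, hl, hTn⟩ h1 h
    have hk := hB.feature.one_le_k
    have hT0 := hne n hTn hB.feature.one_le_K
    rw [Model.features_pureNetwork hB, colSupp_pureFeatures hdH hd hT0, Nat.cast_one, mul_one]
    show P.pureIntercept n * colNorm (pureFeatures (P.d n) (P.H n) (T n)) h ≤ _
    rw [← mul_div_assoc, le_div_iff₀ (by positivity), Model.pureIntercept]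
    have h2 : 0 < √(log (P.d n)) := sqrt_pos.2 hl
    have h3 : 1 / √(log (P.d n)) ≤ c := by
      rw [div_le_iff₀ h2]; simp only [Function.comp_apply] at h1
      rwa [div_le_iff₀' hc] at h1
    have h4 : 0 ≤ colNorm (pureFeatures (P.d n) (P.H n) (T n)) h := sqrt_nonneg _
    have h5 := mul_le_right h3 h4
    refine le_trans (le_of_eq ?_) h5
    field_simp
  · filter_upwards [hbase, hsqrt.eventually_ge_atTop C] with n ⟨hB, hd, hdH, hl, hTn⟩ h1 h
    have hk := hB.feature.one_le_k
    have hT0 := hne n hTn hB.feature.one_le_K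
    rw [Model.features_pureNetwork hB, colSupp_pureFeatures hdH hd hT0, Nat.cast_one, mul_one]
    show _ ≤ P.pureIntercept n * colNorm (pureFeatures (P.d n) (P.H n) (T n)) h
    have h2 : 0 < √(log (P.d n)) := sqrt_pos.2 hl
    have h4 : 0 ≤ colNorm (pureFeatures (P.d n) (P.H n) (T n)) h := sqrt_nonneg _
    set ν := colNorm (pureFeatures (P.d n) (P.H n) (T n)) h
    have h5 := mul_le_right (a := ν / √(P.k n) / log (P.d n)) h1
    refine h5.trans (le_of_eq ?_)
    rw [Model.pureIntercept]
    simp only [Function.comp_apply]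
    nth_rewrite 2 [← sq_sqrt hl.le]
    field_simp
  · filter_upwards [hbase, hR (1 / C) (by positivity)] with n ⟨hB, hd, hdH, hl, hTn⟩ h1 h
    have hk := hB.feature.one_le_k
    have hT0 := hne n hTn hB.feature.one_le_K
    rw [Model.features_pureNetwork hB, colSupp_pureFeatures hdH hd hT0, Nat.cast_one, mul_one]
    have h4 : 0 ≤ colNorm (pureFeatures (P.d n) (P.H n) (T n)) h := sqrt_nonneg _
    set ν := colNorm (pureFeatures (P.d n) (P.H n) (T n)) h
    have hsd : 0 < √(P.d n) := sqrt_pos.2 h1.feature.d_pos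
    have h2 : √(P.k n) * log (P.d n) ≤ 1 / C * √(P.d n) := by
      refine le_trans ?_ h1.screened
      refine mul_le_right (sqrt_le_sqrt ?_) hl.le
      have : (1 : ℝ) ≤ P.m n := by exact_mod_cast h1.one_le_m
      exact le_mul_of_one_le_right (by linarith) this
    rw [div_div, ← mul_div_assoc, div_le_div_iff₀ hsd (by positivity)]
    have h3 := mul_le_left (a := C * ν) h2
    refine h3.trans (le_of_eq ?_)
    field_simp
  · filter_upwards [hbase, hR 1 one_pos] with n ⟨hB, hd, hdH, hl, hTn⟩ h1 h
    rw [Model.features_pureNetwork hB, colSupp_pureFeatures hdH hd (hne n hTn hB.feature.one_le_K)]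
    exact h1.one_le_m
  · filter_upwards [hbase] with n ⟨hB, hd, hdH, hl, hTn⟩ h
    rw [Model.features_pureNetwork hB]
    exact ⟨⟨h % P.d n, Nat.mod_lt _ hd⟩,
      pureFeatures_ne_zero hdH (hne n hTn hB.feature.one_le_K) rfl⟩
  · filter_upwards [hbase] with n ⟨hB, hd, hdH, hl, hTn⟩ i h h'
    rw [Model.features_pureNetwork hB]
    unfold pureFeatures
    split_ifs <;> simp [mul_self_nonneg]
  -- The bounds at each index contain `1 ≤ K`, so the other case is contradictory for large indices
  -- and any scale serves.
  · by_cases hK : 1 ≤ K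
    swap
    · refine ⟨1, fun _ => one_pos, 1, one_pos, 1, one_pos, ?_⟩
      filter_upwards [hbase] with n hn
      exact absurd hn.1.feature.one_le_K hK
    -- Each feature is shared by about `H / d` nodes, so a node has strength of order `d / H`;
    -- adding one keeps the scale positive at every index.
    refine ⟨fun n => (P.d n + 1) / (P.H n + 1), fun n => by positivity, 1 / (8 * K), by positivity,
      4 * K, by positivity, ?_⟩
    filter_upwards [hbase] with n ⟨hB, hd, hdH, hl, hTn⟩ i h hi
    rw [Model.features_pureNetwork hB] at hi ⊢
    have hmod : (h : ℕ) % P.d n = i := by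
      by_contra hc
      exact hi (pureFeatures_of_ne hc)
    obtain ⟨q1, q2⟩ := copies_bounds (H := P.H n) i
    have q0 : 0 < P.H n / P.d n := Nat.div_pos hdH hd
    have q3 := Nat.div_mul_le_self (P.H n) (P.d n)
    have q4 : P.H n < P.d n * (P.H n / P.d n) + P.d n := by
      have := Nat.lt_div_mul_add hd (a := P.H n)
      rwa [mul_comm] at this
    have q5 : P.H n ≤ 2 * (P.d n * copies (P.d n) (P.H n) i) := by
      have : P.d n * (P.H n / P.d n) ≤ P.d n * copies (P.d n) (P.H n) i := Nat.mul_le_mul_left _ q1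
      have : P.d n * 1 ≤ P.d n * (P.H n / P.d n) := Nat.mul_le_mul_left _ q0
      omega
    have q6 : P.d n * copies (P.d n) (P.H n) i ≤ 2 * P.H n := by
      have : P.d n * copies (P.d n) (P.H n) i ≤ P.d n * (P.H n / P.d n + 1) :=
        Nat.mul_le_mul_left _ q2
      rw [mul_comm] at q3
      have e : P.d n * (P.H n / P.d n + 1) = P.d n * (P.H n / P.d n) + P.d n := by ring
      omega
    have hc : 0 < copies (P.d n) (P.H n) i := by omega
    rw [pureFeatures, if_pos hmod, abs_div, abs_of_pos (by exact_mod_cast hc :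
      (0 : ℝ) < copies (P.d n) (P.H n) i)]
    have q5' : (P.H n : ℝ) ≤ 2 * (P.d n * copies (P.d n) (P.H n) i) := by exact_mod_cast q5
    have q6' : (P.d n : ℝ) * copies (P.d n) (P.H n) i ≤ 2 * P.H n := by exact_mod_cast q6
    have hc' : (1 : ℝ) ≤ copies (P.d n) (P.H n) i := by exact_mod_cast hc
    have hd' : (1 : ℝ) ≤ P.d n := by exact_mod_cast hd
    have hdH' : (P.d n : ℝ) ≤ P.H n := by exact_mod_cast hdH
    set q : ℝ := ((copies (P.d n) (P.H n) i : ℕ) : ℝ)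
    obtain ⟨t1, t2⟩ := hTn i
    constructor
    · rw [div_mul_div_comm, div_le_div_iff₀ (by positivity) (by linarith)]
      rw [div_le_iff₀ (by positivity)] at t1
      have r1 : 1 * (P.d n + 1 : ℝ) * q ≤ 4 * (P.H n + 1) := by
        have := mul_le_right (by linarith : (P.d n : ℝ) + 1 ≤ 2 * P.d n)
          (by linarith : 0 ≤ q)
        linarith
      have r2 := mul_le_right (a := 4 * ((P.H n : ℝ) + 1)) t1
      linarith
    · rw [← mul_div_assoc, div_le_div_iff₀ (by linarith) (by positivity)]
      have r1 : (P.H n + 1 : ℝ) ≤ 2 * ((P.d n + 1) * q) := by linarith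
      have r2 := mul_le_mul t2 r1 (by positivity) (by positivity)
      linarith

end

/-! ### Near-minimisers against linear predictors, and the clean risk. -/

theorem Model.RegimeAt.attack_le {P : Model} {K c : ℝ} {n : ℕ} (h : P.RegimeAt K c n) :
    P.ε n * (√(P.k n) * log (P.d n)) ≤ K ∧ √(P.k n) * log (P.d n) ≤ c * √(P.d n) := by
  have hm : (1 : ℝ) ≤ P.m n := by exact_mod_cast h.one_le_m
  have hk := h.feature.one_le_k
  have hl : 0 ≤ log (P.d n) := log_natCast_nonneg _
  have h1 : √(P.k n) * log (P.d n) ≤ √(P.k n * P.m n) * log (P.d n) :=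
    mul_le_right (sqrt_le_sqrt (le_mul_of_one_le_right (by linarith) hm)) hl
  exact ⟨(mul_le_left h1 h.attack_nonneg).trans h.attack_upper, h1.trans h.screened⟩

theorem Model.RegimeAt.attack_mul_sqrt_le {P : Model} {K c : ℝ} {n : ℕ} (h : P.RegimeAt K c n)
    (hc : 0 ≤ c) : P.ε n * √(P.k n) ≤ c * K := by
  have h1 := h.one_le_log
  have h2 : 0 ≤ P.ε n * √(P.k n) := mul_nonneg h.attack_nonneg (sqrt_nonneg _)
  have h3 := mul_le_left h.attack_le.1 hc
  have h4 := mul_le_left h1 h2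
  linarith

/-- The chosen intercept meets the requirements of `Model.exists_pureNetwork_advRisk_le`. It exceeds
the attack and is small against `1 / √k`, since `3 K ≤ √(log d)`; it is at least `3 √(log d)` noise
standard deviations, so the tail factor is at most `exp (-(9 / 4) log d)`, below `1 / d ^ 2`. -/
theorem Model.exists_advRisk_pureNetwork_le (P : Model) (hζ : 0 < P.ζ) (τ : Task) {K : ℝ} (hK : 1 ≤ K) :
    ∃ c > 0, ∃ C > 0, ∀ n, P.RegimeAt K c n → ∀ T : ℝ^(P.d n),
      (∀ i, |T i - P.θ₀ n i| ≤ |P.θ₀ n i| / 2) →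
      P.advRisk τ n (pureNetwork (P.M n) (P.H n) T (P.pureIntercept n)) ≤
        P.linRisk τ n T + C * √(P.k n / P.d n) := by
  obtain ⟨C, hC, h⟩ := P.exists_pureNetwork_advRisk_le τ hK
  set c : ℝ := 1 / (9 * K ^ 2 * (1 + P.ζ)) with hc
  have hc0 : 0 < c := by positivity
  have hcK : c * K ^ 2 ≤ 1 / 9 := by
    rw [hc, div_mul_eq_mul_div, one_mul, div_le_div_iff₀ (by positivity) (by norm_num)]
    have : 0 < K ^ 2 * P.ζ := by positivity
    linarith
  have hK2 : 1 ≤ K ^ 2 := one_le_pow₀ hK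
  have hc9 : c ≤ 1 / 9 := (le_mul_of_one_le_right hc0.le hK2).trans hcK
  have hcζ : c * P.ζ ≤ 1 / 9 := by
    rw [hc, div_mul_eq_mul_div, one_mul, div_le_div_iff₀ (by positivity) (by norm_num)]
    have := mul_le_right hK2 hζ.le
    linarith
  refine ⟨c, hc0, C, hC, fun n hR T hT => ?_⟩
  have hk := hR.feature.one_le_k
  have hd := hR.feature.d_pos
  obtain ⟨hA, hS⟩ := hR.attack_le
  set L := log (P.d n) with hL
  have hL1 : 9 * K ^ 2 ≤ L := by
    have h1 := hR.one_le_log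
    have h2 := mul_le_right hcK (by linarith [hR.one_le_log] : (0:ℝ) ≤ 1)
    have h3 : c * (9 * K ^ 2) ≤ c * L := by linarith
    exact le_of_mul_le_mul_left h3 hc0
  have hL9 : 9 ≤ L := by linarith
  have hL0 : 0 < L := by linarith
  have hsk : 0 < √(P.k n) := sqrt_pos.2 (by linarith)
  have hsL : 0 < √L := sqrt_pos.2 hL0
  have hsd : 0 < √(P.d n) := sqrt_pos.2 hd
  have hLL : √L * √L = L := mul_self_sqrt hL0.le
  have hsK : 3 * K ≤ √L := le_sqrt_of_sq_le (by rw [mul_pow]; linarith)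
  have hβ : P.pureIntercept n = 1 / (√(P.k n) * √L) := rfl
  have hζk : P.ζ * (√(P.k n) * L) ≤ 1 / 9 * √(P.d n) := by
    have h1 := mul_le_left hS hζ.le
    have h2 := mul_le_right hcζ hsd.le
    linarith
  have hratio : 3 * L ≤ (P.pureIntercept n * √(P.d n) / P.ζ) * √L := by
    rw [hβ, show 1 / (√(P.k n) * √L) * √(P.d n) / P.ζ * √L =
      √(P.d n) / (P.ζ * √(P.k n)) by field_simp, le_div_iff₀ (by positivity)]
    linarith
  have hρ : 3 * √L ≤ P.pureIntercept n * √(P.d n) / P.ζ := by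
    refine le_of_mul_le_mul_right ?_ hsL
    rw [mul_assoc, hLL]; exact hratio
  refine h n hR.toBoundsAt ?_ ?_ _ ?_ ?_ ?_ ?_ ?_ T ?_ ?_
  · have h1 := hR.wide
    have h2 : c * (P.H n : ℝ) ≤ 1 * P.H n := mul_le_right (by linarith) (Nat.cast_nonneg _)
    rw [one_mul] at h2
    exact_mod_cast h1.trans h2
  · refine (hR.attack_mul_sqrt_le hc0.le).trans ?_
    have : c * K ≤ c * K ^ 2 := mul_le_left (by nlinarith) hc0.le
    linarith
  · rw [hβ]; positivity
  · rw [hβ, le_div_iff₀ (by positivity)]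
    have h1 : P.ε n * (√(P.k n) * √L) * √L ≤ K := by
      rw [show P.ε n * (√(P.k n) * √L) * √L = P.ε n * (√(P.k n) * (√L * √L)) by ring, hLL]
      exact hA
    refine le_of_mul_le_mul_right (h1.trans ?_) hsL
    linarith
  · rw [hβ, mul_one_div, div_le_div_iff₀ (by positivity) hsk]
    have := mul_le_right (by linarith : 3 ≤ √L) hsk.le
    linarith
  · linarith
  · have h1 : 2 * L ≤ (P.pureIntercept n * √(P.d n) / P.ζ) ^ 2 / 4 := by
      have h2 := pow_le_pow_left₀ (by positivity) hρ 2
      rw [mul_pow, sq_sqrt hL0.le] at h2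
      linarith
    have h2 : 1 / (P.d n : ℝ) ^ 2 = exp (-(2 * L)) := by
      rw [exp_neg, two_mul, exp_add, hL, Real.exp_log hd, one_div, sq]
    rw [h2, neg_div]
    exact exp_le_exp.2 (by linarith)
  · intro i h0
    have h1 := hT i
    have h2 := (hR.coeff i).1
    have h3 : 0 < 1 / K := by positivity
    rw [h0, zero_sub, abs_neg] at h1
    linarith
  · intro i
    have h1 := hT i
    have h2 := (hR.coeff i).2
    have h3 := abs_sub_abs_le_abs_sub (T i) (P.θ₀ n i)
    linarith

theorem Model.sqrt_le_ψ (P : Model) {n : ℕ} (hk : 1 ≤ P.k n) : √(P.k n / P.d n) ≤ P.ψ n := by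
  unfold Model.ψ
  have : 0 ≤ P.H n * (P.m n : ℝ) ^ 3 * P.k n ^ 3 * log (P.k n) ^ 2 / (P.d n : ℝ) ^ 2 := by
    positivity
  linarith

theorem Model.ψ_nonneg (P : Model) {n : ℕ} (hk : 1 ≤ P.k n) : 0 ≤ P.ψ n :=
  (sqrt_nonneg _).trans (P.sqrt_le_ψ hk)

theorem Model.ClassAt.weights_ne_zero {P : Model} {K K' c γ : ℝ} {n : ℕ}
    {N : P.Net n} (hC : P.ClassAt K c n N γ) (hB : P.BoundsAt K' n) (h : Fin (P.H n)) :
    ∃ i, N.W i h ≠ 0 := by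
  by_contra hall
  push Not at hall
  have h1 := hB.colNorm_eq N h
  have h2 := colNorm_pos (hC.nonzero h)
  rw [← h1] at h2
  simp [colNorm, hall] at h2

/-- The class bounds the norm of a column by `c b √(k s) log d`, with `s` the number of features of
the node, and the attack satisfies `ε √(k m) log d ≤ K` with `s ≤ m`. Hence the shift caused by the
attack stays below every threshold. -/
theorem Model.ClassAt.attack_mul_colNorm_le {P : Model} {K c γ : ℝ} {n : ℕ}
    {N : P.Net n} (hC : P.ClassAt K c n N γ) (hR : P.RegimeAt K c n) (hc : 0 ≤ c)
    (hcK : c * K ≤ 1) (h : Fin (P.H n)) : P.ε n * colNorm Φ N h ≤ N.b h := by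
  have h1 := hC.intercept_lower h
  have hs : (colSupp Φ N h : ℝ) ≤ P.m n := by exact_mod_cast hC.few_features h
  have hk := hR.feature.one_le_k
  have hl : 0 ≤ log (P.d n) := log_natCast_nonneg _
  have hε := hR.attack_nonneg
  set r := √(P.k n * colSupp Φ N h) * log (P.d n) with hr
  have hr0 : 0 ≤ r := by positivity
  have hν := colNorm_pos (hC.nonzero h)
  have hb : 0 ≤ N.b h := by
    by_contra hb
    have : c * (N.b h * r) ≤ 0 :=
      mul_nonpos_of_nonneg_of_nonpos hc (mul_nonpos_of_nonpos_of_nonneg (by linarith) hr0)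
    linarith
  have h2 : P.ε n * r ≤ K := by
    refine le_trans (mul_le_left ?_ hε) hR.attack_upper
    exact mul_le_right
      (sqrt_le_sqrt (mul_le_left hs (by linarith))) hl
  calc P.ε n * colNorm Φ N h ≤ P.ε n * (c * (N.b h * r)) :=
        mul_le_left h1 hε
    _ = c * (P.ε n * r) * N.b h := by ring
    _ ≤ c * K * N.b h := by gcongr
    _ ≤ N.b h := mul_le_of_le_one_left hb hcK

section

variable {P : Model} {N : ∀ n, P.Net n} {τ : Task} {K : ℝ} {γ : ℕ → ℝ}

/-- A near-minimiser of the adversarial risk does nearly as well as every linear predictor of the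
features. -/
theorem Model.InClass.exists_advRisk_le (hP : P.SparseCoding) (hN : P.InClass N) (hK : 1 ≤ K)
    (hR : ∀ c > 0, ∀ᶠ n in atTop, P.RegimeAt K c n)
    (hmin : ∀ N' : ∀ n, P.Net n, P.InClass N' →
      ∃ C : ℝ, ∀ᶠ n in atTop, P.advRisk τ n (N n) ≤ P.advRisk τ n (N' n) + C * P.ψ n)
    {T : ∀ n, ℝ^(P.d n)} (hT : ∀ᶠ n in atTop, ∀ i, |T n i - P.θ₀ n i| ≤ |P.θ₀ n i| / 2) :
    ∃ C > 0, ∀ᶠ n in atTop, P.advRisk τ n (N n) ≤ P.linRisk τ n (T n) + C * P.ψ n := by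
  obtain ⟨C, hC⟩ := hmin _ (hN.pureNetwork hP ⟨K, hR⟩ hT)
  obtain ⟨c, hc, C', hC', h⟩ := P.exists_advRisk_pureNetwork_le hP.noise_pos τ hK
  refine ⟨|C| + C', by positivity, ?_⟩
  filter_upwards [hC, hR c hc, hT] with n h1 h2 h3
  have h4 := h n h2 (T n) h3
  have h5 := P.sqrt_le_ψ (hP.one_le_k n)
  have h6 := mul_le_left h5 hC'.le
  have h7 := mul_le_right (le_abs_self C) (P.ψ_nonneg (hP.one_le_k n))
  linarith

/-- The chain Bayes risk, clean risk, adversarial risk, `linRisk` at `θ₀` plus `O(ψ)`, Bayes risk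
plus `O(ψ + ε √k)` is closed at both ends, and the oracle risk is the Bayes risk. -/
theorem Model.InClass.cleanRisk_sub_oracleRisk_isBigO (hP : P.SparseCoding) (hN : P.InClass N)
    (hK : 1 ≤ K) (hR : ∀ c > 0, ∀ᶠ n in atTop, P.RegimeAt K c n)
    (hC : ∀ c > 0, ∀ᶠ n in atTop, P.ClassAt K c n (N n) (γ n))
    (hmin : ∀ N' : ∀ n, P.Net n, P.InClass N' →
      ∃ C : ℝ, ∀ᶠ n in atTop, P.advRisk τ n (N n) ≤ P.advRisk τ n (N' n) + C * P.ψ n) :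
    (fun n => P.cleanRisk τ n (N n) - P.oracleRisk τ n) =O[atTop]
      fun n => P.ψ n + P.ε n * √(P.k n) := by
  obtain ⟨C, hC0, h1⟩ := hN.exists_advRisk_le hP hK hR hmin (T := P.θ₀)
    (Eventually.of_forall fun n i => by rw [sub_self, abs_zero]; positivity)
  obtain ⟨C', hC', h2⟩ := linRisk_self_le τ P.s K
  have hcK : 1 / K * K ≤ 1 := by rw [one_div_mul_cancel (by linarith)]
  refine IsBigO.of_bound (C + C') ?_
  filter_upwards [h1, hR (1 / K) (by positivity), hC (1 / K) (by positivity)] with n a1 a2 a3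
  have hW := a3.weights_ne_zero a2.toBoundsAt
  have hsmall := a3.attack_mul_colNorm_le a2 (by positivity) hcK
  have a4 := a2.cleanRisk_le_advRisk τ (N n) a3.same_sign hsmall hW
  have a5 := a2.bayesRisk_le_cleanRisk τ (N n) a3.same_sign hsmall
  have hεk : 0 ≤ P.ε n * √(P.k n) := mul_nonneg a2.attack_nonneg (sqrt_nonneg _)
  have a6 := h2 a2.feature (fun i => (a2.coeff i).2) a2.attack_nonneg
    ((a2.attack_mul_sqrt_le (by positivity)).trans hcK)
  have hψ := P.ψ_nonneg (hP.one_le_k n)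
  rw [P.oracleRisk_eq, norm_of_nonneg (by linarith), norm_of_nonneg (by positivity)]
  have := mul_nonneg hC0.le hεk
  have := mul_nonneg hC'.le hψ
  linarith

end

/-! ### Averaging a network over the input noise. -/

/-- The probability, over the noise, that a node is inactive. -/
def Model.miss (P : Model) (n : ℕ) (N : P.Net n) (h : Fin (P.H n))
    (x : ℝ^(P.d n)) : ℝ :=
  ∫ ξ, (if |N.pre (P.input n x ξ) h| < N.b h then 1 else 0) ∂P.noiseLaw n

/-- The output of a network, averaged over the noise. -/
def Model.meanEval (P : Model) (n : ℕ) (N : P.Net n) (x : ℝ^(P.d n)) : ℝ :=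
  ∫ ξ, N.eval (P.input n x ξ) ∂P.noiseLaw n

/-- The slope of a network in the feature basis, averaged over the noise. -/
def Model.meanSlope (P : Model) (n : ℕ) (N : P.Net n) (i : Fin (P.d n))
    (x : ℝ^(P.d n)) : ℝ :=
  ∑ h, Φ N i h * (1 - P.miss n N h x)

/-- The total strengths of the features. -/
def Model.strength (P : Model) (n : ℕ) (N : P.Net n) (i : Fin (P.d n)) : ℝ := ∑ h, Φ N i h

section

variable {P : Model} {n : ℕ} (N : P.Net n)

theorem Model.measurable_inactive (h : Fin (P.H n)) : Measurable fun w : ℝ^(P.d n) × ℝ^(P.d n) =>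
      (if |N.pre (P.input n w.1 w.2) h| < N.b h then 1 else 0 : ℝ) :=
  Measurable.ite (measurableSet_lt
    (((N.continuous_pre h).comp (P.continuous_input n)).abs.measurable) measurable_const)
    measurable_const measurable_const

theorem Model.integrable_inactive (h : Fin (P.H n)) (x : ℝ^(P.d n)) :
    Integrable (fun ξ => (if |N.pre (P.input n x ξ) h| < N.b h then 1 else 0 : ℝ)) (P.noiseLaw n) :=
  Integrable.of_bound ((Model.measurable_inactive N h).comp
    (measurable_const.prodMk measurable_id)).aestronglyMeasurable 1 (ae_of_all _ fun ξ => by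
      split_ifs <;> simp)

theorem Model.miss_nonneg (h : Fin (P.H n)) (x : ℝ^(P.d n)) : 0 ≤ P.miss n N h x :=
  integral_nonneg fun ξ => by dsimp only; split_ifs <;> norm_num

theorem Model.miss_le_one (h : Fin (P.H n)) (x : ℝ^(P.d n)) : P.miss n N h x ≤ 1 := by
  refine (integral_mono (Model.integrable_inactive N h x) (integrable_const 1) fun ξ => ?_).trans
    (by simp)
  dsimp only; split_ifs <;> norm_num

theorem Model.cubeBounded_miss (h : Fin (P.H n)) : CubeBounded (P.miss n N h) :=
  ⟨(StronglyMeasurable.integral_prod_right'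
    (Model.measurable_inactive N h).stronglyMeasurable).measurable, 1, fun x _ => by
      rw [abs_of_nonneg (Model.miss_nonneg N h x)]; exact Model.miss_le_one N h x⟩

theorem Model.cubeBounded_meanSlope (i : Fin (P.d n)) : CubeBounded (P.meanSlope n N i) := by
  unfold Model.meanSlope
  exact CubeBounded.sum _ fun h => (CubeBounded.const _).mul
    ((CubeBounded.const 1).sub (Model.cubeBounded_miss N h))

theorem Model.integrable_pre (h : Fin (P.H n)) (x : ℝ^(P.d n)) :
    Integrable (fun ξ => N.pre (P.input n x ξ) h) (P.noiseLaw n) := by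
  simp only [P.pre_input n]
  refine (integrable_const _).add ?_
  exact integrable_gaussian_form _ _ (g := fun y => y)
    (memLp_id_gaussianReal (μ := 0) 1 |>.integrable le_rfl)

theorem Model.integral_pre (h : Fin (P.H n)) (x : ℝ^(P.d n)) :
    ∫ ξ, N.pre (P.input n x ξ) h ∂P.noiseLaw n = dot (fun i => Φ N i h) x := by
  have h1 : ∫ ξ, (∑ i, ξ i * N.W i h) ∂P.noiseLaw n = 0 :=
    integral_odd_gaussian_form _ (fun i => N.W i h) (g := fun y => y) fun y => rfl
  have h2 : Integrable (fun ξ : ℝ^(P.d n) => ∑ i, ξ i * N.W i h) (P.noiseLaw n) :=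
    integrable_gaussian_form _ _ (g := fun y => y)
      (memLp_id_gaussianReal (μ := 0) 1 |>.integrable le_rfl)
  simp only [P.pre_input n]
  rw [integral_add (integrable_const _) h2, h1]
  simp

theorem Model.integrable_gate (h : Fin (P.H n)) (x : ℝ^(P.d n)) :
    Integrable (fun ξ => gate (N.pre (P.input n x ξ) h) (N.b h)) (P.noiseLaw n) := by
  refine (Model.integrable_pre N h x).abs.mono' ?_ (ae_of_all _ fun ξ => abs_gate_le _ _)
  exact ((measurable_gate _).comp (((N.continuous_pre h).measurable.comp
    (P.measurable_input n)).comp (measurable_const.prodMk measurable_id))).aestronglyMeasurable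

/-- The noise is centred, and the gate alters the preactivation only when the node is inactive, by
at most the intercept. -/
theorem Model.abs_integral_gate_sub_le (h : Fin (P.H n)) (x : ℝ^(P.d n)) :
    |∫ ξ, gate (N.pre (P.input n x ξ) h) (N.b h) ∂P.noiseLaw n -
      dot (fun i => Φ N i h) x| ≤ N.b h * P.miss n N h x := by
  rw [← Model.integral_pre N h x, ← integral_sub (Model.integrable_gate N h x)
    (Model.integrable_pre N h x), Model.miss, ← integral_const_mul]
  refine (abs_integral_le_integral_abs).trans (integral_mono ((Model.integrable_gate N h x).sub
    (Model.integrable_pre N h x)).abs ((Model.integrable_inactive N h x).const_mul _) fun ξ => ?_)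
  refine (abs_gate_sub_le _ _).trans ?_
  split_ifs <;> simp

/-- The gate is odd and the noise symmetric. Thus a node without active features contributes exactly
nothing on average, even though it is usually inactive; this is why only nodes with active features
enter the errors below. -/
theorem Model.integral_gate_eq_zero (h : Fin (P.H n)) {x : ℝ^(P.d n)}
    (hx : dot (fun i => Φ N i h) x = 0) :
    ∫ ξ, gate (N.pre (P.input n x ξ) h) (N.b h) ∂P.noiseLaw n = 0 := by
  simp only [P.pre_input n, hx, zero_add]
  exact integral_odd_gaussian_form _ (fun i => N.W i h) (g := fun y => gate y (N.b h))
    fun y => gate_neg y _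

/-- A node whose clean preactivation exceeds the intercept by `r` noise standard deviations is
inactive only if the noise itself exceeds that margin. -/
theorem Model.miss_le {K : ℝ} (hB : P.BoundsAt K n) {h : Fin (P.H n)} (hW : ∃ i, N.W i h ≠ 0)
    {x : ℝ^(P.d n)} {r : ℝ} (hr : 1 ≤ r)
    (hx : N.b h + r * (P.ζ * colNorm Φ N h / √(P.d n)) ≤
      |dot (fun i => Φ N i h) x|) :
    P.miss n N h x ≤ 12 * exp (-r ^ 2 / 4) := by
  have hd := hB.feature.d_pos
  have e : √(((P.ζ ^ 2 / P.d n).toNNReal : NNReal) * ∑ i, N.W i h ^ 2) =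
      P.ζ * colNorm Φ N h / √(P.d n) := by
    rw [hB.noise_var_eq, sqrt_mul (by positivity), sqrt_div (sq_nonneg _),
      sqrt_sq hB.noise_pos.le, ← hB.colNorm_eq]
    simp only [colNorm]; ring
  refine le_trans ?_ (gaussian_form_tail _ (fun i => N.W i h) hr hB.noise_var_ne_zero hW
    (e.symm ▸ le_rfl : r * √(((P.ζ ^ 2 / P.d n).toNNReal : NNReal) * ∑ i, N.W i h ^ 2) ≤
      r * (P.ζ * colNorm Φ N h / √(P.d n)))).1
  refine integral_mono (Model.integrable_inactive N h x) ?_ fun ξ => ?_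
  · refine Integrable.of_bound (Measurable.aestronglyMeasurable (Measurable.ite
      (measurableSet_le measurable_const (by fun_prop)) measurable_const measurable_const)) 1
      (ae_of_all _ fun ξ => ?_)
    split_ifs <;> simp
  · dsimp only
    by_cases hin : |N.pre (P.input n x ξ) h| < N.b h
    · rw [if_pos hin, if_pos]
      rw [P.pre_input n] at hin
      have := abs_sub_abs_le_abs_sub (dot (fun i => Φ N i h) x)
        (-∑ i, ξ i * N.W i h)
      rw [sub_neg_eq_add, abs_neg] at this
      linarith
    · rw [if_neg hin]; split_ifs <;> norm_num

theorem Model.meanEval_eq (x : ℝ^(P.d n)) : P.meanEval n N x =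
    ∑ h, ∫ ξ, gate (N.pre (P.input n x ξ) h) (N.b h) ∂P.noiseLaw n := by
  rw [Model.meanEval, ← integral_finsetSum _ fun h _ => Model.integrable_gate N h x]
  rfl

theorem Model.integrable_eval (x : ℝ^(P.d n)) :
    Integrable (fun ξ => N.eval (P.input n x ξ)) (P.noiseLaw n) :=
  integrable_finsetSum _ fun h _ => Model.integrable_gate N h x

theorem Model.dot_strength (x : ℝ^(P.d n)) :
    dot (P.strength n N) x = ∑ h, dot (fun i => Φ N i h) x := by
  simp only [dot, Model.strength, sum_mul]
  exact sum_comm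

theorem Model.cubeBounded_meanEval : CubeBounded (P.meanEval n N) := by
  obtain ⟨-, C, hC⟩ := CubeBounded.dot (P.strength n N)
  refine ⟨(StronglyMeasurable.integral_prod_right' (N.measurable_eval.comp
    (P.measurable_input n)).stronglyMeasurable).measurable, C + ∑ h, |N.b h|, fun x hx => ?_⟩
  have h1 : |P.meanEval n N x - dot (P.strength n N) x| ≤ ∑ h, |N.b h| := by
    rw [Model.meanEval_eq, Model.dot_strength, ← sum_sub_distrib]
    refine (abs_sum_le_sum_abs _ _).trans (sum_le_sum fun h _ => ?_)
    refine (Model.abs_integral_gate_sub_le N h x).trans ?_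
    refine (mul_le_right (le_abs_self _) (Model.miss_nonneg N h x)).trans ?_
    exact mul_le_of_le_one_right (abs_nonneg _) (Model.miss_le_one N h x)
  have h2 := abs_sub_abs_le_abs_sub (P.meanEval n N x) (dot (P.strength n N) x)
  linarith [hC x hx]

/-- The rotated test vector `M w` pairs with the slope through the matrix `Φ N`, and node `h` is
active with probability `1 - miss`. -/
theorem Model.integral_inner_slope (w x : ℝ^(P.d n)) :
    Integrable (fun ξ => inner ℝ (N.slope (P.input n x ξ))
      (WithLp.toLp 2 (P.M n *ᵥ w) : 𝔼^(P.d n))) (P.noiseLaw n) ∧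
    ∫ ξ, inner ℝ (N.slope (P.input n x ξ))
      (WithLp.toLp 2 (P.M n *ᵥ w) : 𝔼^(P.d n)) ∂P.noiseLaw n =
    ∑ i, w i * P.meanSlope n N i x := by
  have hpre : ∀ h, N.pre (WithLp.toLp 2 (P.M n *ᵥ w)) h = ∑ i, w i * Φ N i h := fun h => by
    have := P.pre_input n N w 0 h
    simp only [Model.input, add_zero, Pi.zero_apply, zero_mul, Finset.sum_const_zero] at this
    rw [this, dot]
    exact sum_congr rfl fun i _ => mul_comm _ _
  have e : ∀ ξ, inner ℝ (N.slope (P.input n x ξ))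
      (WithLp.toLp 2 (P.M n *ᵥ w) : 𝔼^(P.d n)) =
      ∑ h, (∑ i, w i * Φ N i h) *
        (1 - if |N.pre (P.input n x ξ) h| < N.b h then 1 else 0) := fun ξ => by
    rw [N.inner_slope]
    refine sum_congr rfl fun h _ => ?_
    rw [hpre]
    by_cases hc : N.b h ≤ |N.pre (P.input n x ξ) h|
    · rw [if_pos hc, if_neg (not_lt.2 hc)]; ring
    · rw [if_neg hc, if_pos (not_le.1 hc)]; ring
  have hi : ∀ h, Integrable (fun ξ => (∑ i, w i * Φ N i h) *
        (1 - if |N.pre (P.input n x ξ) h| < N.b h then 1 else 0)) (P.noiseLaw n) := fun h =>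
    ((integrable_const 1).sub (Model.integrable_inactive N h x)).const_mul _
  simp only [e]
  refine ⟨integrable_finsetSum _ fun h _ => hi h, ?_⟩
  rw [integral_finsetSum _ fun h _ => hi h]
  have h1 : ∀ h, ∫ ξ, (∑ i, w i * Φ N i h) *
      (1 - if |N.pre (P.input n x ξ) h| < N.b h then 1 else 0) ∂P.noiseLaw n =
      (∑ i, w i * Φ N i h) * (1 - P.miss n N h x) := fun h => by
    rw [integral_const_mul, integral_sub (integrable_const 1) (Model.integrable_inactive N h x)]
    simp [Model.miss]
  rw [sum_congr rfl fun h _ => h1 h]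
  simp only [Model.meanSlope, mul_sum, sum_mul]
  rw [sum_comm]
  exact sum_congr rfl fun i _ => sum_congr rfl fun h _ => by ring

/-- Averaging over the noise inside the convex risk profile. -/
theorem Model.BoundsAt.integral_profile_mean_le_advRisk {K : ℝ} (hB : P.BoundsAt K n) (τ : Task)
    (hW : ∀ h, ∃ i, N.W i h ≠ 0)
    (hpos : ∀ i h h', 0 ≤ Φ N i h * Φ N i h')
    (hsmall : ∀ h, P.ε n * colNorm Φ N h ≤ N.b h)
    {w : Fin (P.d n) → ℝ^(P.d n) → ℝ} (hw : ∀ i, CubeBounded (w i))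
    (hw1 : ∀ x, ∑ i, w i x ^ 2 ≤ 1) :
    ∫ x, profile τ P.s (dot (P.θ₀ n) x) (P.meanEval n N x)
      (P.ε n * ∑ i, w i x * P.meanSlope n N i x) ∂P.vecLaw n ≤ P.advRisk τ n N := by
  have hprob := hB.feature.isProbabilityMeasure
  have hint := hB.integrable_robustRisk τ N
  rw [hB.advRisk_eq τ N hW, integral_prod _ hint]
  refine integral_mono_ae (hB.feature.integrable ?_) hint.integral_prod_left ?_
  · exact CubeBounded.profile τ _ (by fun_prop) (Model.cubeBounded_meanEval N)
      ((CubeBounded.const _).mul (CubeBounded.sum _ fun i =>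
        (hw i).mul (Model.cubeBounded_meanSlope N i)))
  filter_upwards [hint.prod_right_ae] with x hx
  -- A test vector that depends on the features only. Replacing the norm of the slope by the inner
  -- product with it lowers the profile and makes its arguments affine in quantities whose noise
  -- means are known.
  set v : 𝔼^(P.d n) := WithLp.toLp 2 (P.M n *ᵥ fun i => w i x) with hv
  have hv1 : ‖v‖ ≤ 1 := by
    rw [EuclideanSpace.norm_eq]
    refine sqrt_le_one.2 ?_
    simp only [norm_eq_abs, sq_abs, hv]
    exact (sum_sq_mulVec _ hB.orthogonal fun i => w i x).le.trans (hw1 x)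
  obtain ⟨hi, he⟩ := Model.integral_inner_slope N (fun i => w i x) x
  have hpair : Integrable (fun ξ => (N.eval (P.input n x ξ),
      P.ε n * inner ℝ (N.slope (P.input n x ξ)) v)) (P.noiseLaw n) :=
    (Model.integrable_eval N x).prodMk (hi.const_mul _)
  have hle : ∀ ξ, profile τ P.s (dot (P.θ₀ n) x) (N.eval (P.input n x ξ))
      (P.ε n * inner ℝ (N.slope (P.input n x ξ)) v) ≤ P.robustRisk τ n N (x, ξ) := fun ξ => by
    refine le_trans (profile_mono _ _ _ _ ?_) (hB.profile_le_robustRisk τ N hpos hsmall (x, ξ))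
    rw [abs_mul, abs_mul, abs_norm]
    refine mul_le_left ?_ (abs_nonneg _)
    refine (abs_real_inner_le_norm _ _).trans (mul_le_of_le_one_right (norm_nonneg _) hv1)
  obtain ⟨g, hg⟩ : ∃ g : ℝ × ℝ → ℝ, g = fun p => profile τ P.s (dot (P.θ₀ n) x) p.1 p.2 := ⟨_, rfl⟩
  have hgv : ∀ a b, profile τ P.s (dot (P.θ₀ n) x) a b = g (a, b) := fun a b => by rw [hg]
  have hcont : Continuous g := by
    rw [hg]
    exact (continuous_profile τ P.s).comp (continuous_const.prodMk continuous_id)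
  have hconv : ConvexOn ℝ Set.univ g := by rw [hg]; exact profile_convex τ P.s _
  have hg0 : ∀ p, 0 ≤ g p := fun p => by rw [hg]; exact profile_nonneg _ _ _ _ _
  simp only [hgv] at hle ⊢
  have hgm : AEStronglyMeasurable (fun ξ => g (N.eval (P.input n x ξ),
      P.ε n * inner ℝ (N.slope (P.input n x ξ)) v)) (P.noiseLaw n) :=
    hcont.comp_aestronglyMeasurable hpair.aestronglyMeasurable
  have hgi : Integrable (fun ξ => g (N.eval (P.input n x ξ),
      P.ε n * inner ℝ (N.slope (P.input n x ξ)) v)) (P.noiseLaw n) :=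
    hx.mono' hgm (ae_of_all _ fun ξ => by rw [norm_of_nonneg (hg0 _)]; exact hle ξ)
  -- Jensen's inequality for the pair of prediction and displacement.
  have hj := hconv.map_integral_le (μ := P.noiseLaw n)
    hcont.continuousOn isClosed_univ (ae_of_all _ fun _ => Set.mem_univ _) hpair hgi
  rw [integral_pair (Model.integrable_eval N x) (hi.const_mul _), integral_const_mul, he] at hj
  exact hj.trans (integral_mono hgi hx hle)

end

/-! ### Nodes with several active features. -/

section

variable {d H : ℕ}

/-- The number of active features in the support of a node. -/
def hits (U : Matrix (Fin d) (Fin H) ℝ) (h : Fin H) (x : ℝ^d) : ℝ := ∑ i, act (U i h) * act (x i)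

/-- A bound for the effect of noise and of superposed features on a node. -/
def overlap (q : ℝ) (U : Matrix (Fin d) (Fin H) ℝ) (h : Fin H) (x : ℝ^d) : ℝ :=
  hits U h x * (hits U h x - 1) + q * hits U h x

theorem act_of_ne {a : ℝ} (h : a ≠ 0) : act a = 1 := if_neg h

theorem act_zero : act 0 = 0 := if_pos rfl

theorem colSupp_eq (U : Matrix (Fin d) (Fin H) ℝ) (h : Fin H) :
    (colSupp U h : ℝ) = ∑ i, act (U i h) := by
  classical
  have e : ∀ i, act (U i h) = if U i h ≠ 0 then 1 else 0 := fun i => by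
    unfold act; split_ifs <;> simp_all
  simp only [e, sum_boole, colSupp]
  rw [Set.ncard_eq_toFinset_card']
  congr 2
  ext i; simp

@[fun_prop]
theorem cubeBounded_hits (U : Matrix (Fin d) (Fin H) ℝ) (h : Fin H) :
    CubeBounded (fun x => hits U h x) := by
  unfold hits; fun_prop

@[fun_prop]
theorem cubeBounded_overlap (q : ℝ) (U : Matrix (Fin d) (Fin H) ℝ) (h : Fin H) :
    CubeBounded (fun x => overlap q U h x) := by
  unfold overlap; fun_prop

theorem hits_cases (U : Matrix (Fin d) (Fin H) ℝ) (h : Fin H) (x : ℝ^d) :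
    (hits U h x = 0 ∧ dot (fun i => U i h) x = 0) ∨
    (hits U h x = 1 ∧ ∃ i, U i h ≠ 0 ∧ x i ≠ 0 ∧ dot (fun i => U i h) x = U i h * x i) ∨
    2 ≤ hits U h x := by
  classical
  set s := Finset.univ.filter fun i => U i h ≠ 0 ∧ x i ≠ 0 with hs
  have e : hits U h x = s.card := by
    have : ∀ i, act (U i h) * act (x i) = if U i h ≠ 0 ∧ x i ≠ 0 then 1 else 0 := fun i => by
      unfold act; split_ifs <;> simp_all
    simp only [hits, this, sum_boole, hs]
  have hout : ∀ i, i ∉ s → U i h * x i = 0 := fun i hi => by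
    simp only [hs, mem_filter, mem_univ, true_and, not_and_or, not_not] at hi
    rcases hi with hi | hi <;> simp [hi]
  rcases Nat.lt_or_ge s.card 2 with h2 | h2
  · interval_cases hcard : s.card
    · left
      rw [Finset.card_eq_zero] at hcard
      exact ⟨by rw [e]; simp, sum_eq_zero fun i _ => hout i (by simp [hcard])⟩
    · right; left
      obtain ⟨i, hi⟩ := Finset.card_eq_one.1 hcard
      have his : i ∈ s := by simp [hi]
      simp only [hs, mem_filter, mem_univ, true_and] at his
      refine ⟨by rw [e]; simp, i, his.1, his.2, ?_⟩
      exact sum_eq_single i (fun j _ hj => hout j (by simp [hi, hj])) (by simp)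
  · right; right
    rw [e]; exact_mod_cast h2

theorem hits_nonneg (U : Matrix (Fin d) (Fin H) ℝ) (h : Fin H) (x : ℝ^d) : 0 ≤ hits U h x :=
  sum_nonneg fun _ _ => mul_nonneg (act_nonneg _) (act_nonneg _)

theorem overlap_nonneg {q : ℝ} (hq : 0 ≤ q) (U : Matrix (Fin d) (Fin H) ℝ) (h : Fin H)
    (x : ℝ^d) : 0 ≤ overlap q U h x := by
  have h0 := mul_nonneg hq (hits_nonneg U h x)
  unfold overlap
  rcases hits_cases U h x with ⟨h1, -⟩ | ⟨h1, -⟩ | h1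
  · rw [h1]; simp
  · rw [h1] at h0 ⊢; linarith
  · have : 0 ≤ hits U h x * (hits U h x - 1) := mul_nonneg (by linarith) (by linarith)
    linarith

theorem hits_mul_sub_eq (U : Matrix (Fin d) (Fin H) ℝ) (h : Fin H) (x : ℝ^d) :
    hits U h x * (hits U h x - 1) = ∑ i, ∑ j, if i = j then 0 else
      act (U i h) * act (U j h) * (act (x i) * act (x j)) := by
  have h1 : hits U h x * hits U h x = ∑ i, ∑ j,
      act (U i h) * act (U j h) * (act (x i) * act (x j)) := by
    rw [hits, Finset.sum_mul_sum]
    exact sum_congr rfl fun i _ => sum_congr rfl fun j _ => by ring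
  have h2 : hits U h x = ∑ i, ∑ j, if i = j then act (U i h) * act (U j h) *
      (act (x i) * act (x j)) else 0 := by
    simp only [Finset.sum_ite_eq, mem_univ, if_true, act_mul_self, hits]
  rw [mul_sub, mul_one, h1, h2, ← sum_sub_distrib]
  refine sum_congr rfl fun i _ => ?_
  rw [← sum_sub_distrib]
  refine sum_congr rfl fun j _ => ?_
  split_ifs <;> simp

theorem sum_offdiag_act (U : Matrix (Fin d) (Fin H) ℝ) (h : Fin H) :
    ∑ i, ∑ j, (if i = j then 0 else act (U i h) * act (U j h)) =
      (colSupp U h : ℝ) * (colSupp U h - 1) := by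
  have := hits_mul_sub_eq U h fun _ => 1
  simp only [hits, act_of_ne one_ne_zero, mul_one] at this
  rw [colSupp_eq, this]

/-- The expected number of ordered pairs of active features in the support is `s (s - 1)` times the
squared rate. The factor `1 + numAct x` dominates the Lipschitz weight of the risk and costs one
further power of `k`, which turns `k ^ 2 / d ^ 2` into `k ^ 3 / d ^ 2` for pairs and `k / d` into `k
^ 2 / d` for single hits. -/
theorem FeatureBounds.integral_overlap_le {K k : ℝ} {law : Measure ℝ}
    (hL : FeatureBounds K k d law) {q : ℝ} (hq : 0 ≤ q) (U : Matrix (Fin d) (Fin H) ℝ) (h : Fin H)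
    (hU : ∃ i, U i h ≠ 0) :
    ∫ x, (1 + numAct x) * overlap q U h x ∂vecLaw d law ≤
      (3 + K) * K ^ 2 * (colSupp U h * (colSupp U h - 1) * k ^ 3 / d ^ 2 +
        q * (colSupp U h * k ^ 2 / d)) := by
  have hK := hL.one_le_K
  have hk := hL.one_le_k
  have hd := hL.d_pos
  have hp := hL.rate_pos
  have hdp := hL.d_mul_rate_le
  have hpk := hL.rate_le
  have hs1 : (1 : ℝ) ≤ colSupp U h := by exact_mod_cast one_le_colSupp hU
  set s : ℝ := ((colSupp U h : ℕ) : ℝ)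
  have hKk : 1 ≤ K * k := one_le_mul_of_one_le_of_one_le hK hk
  have e : ∀ x : ℝ^d, (1 + numAct x) * overlap q U h x =
      (∑ i, ∑ j, (if i = j then 0 else act (U i h) * act (U j h)) *
        (act (x i) * act (x j) + act (x i) * act (x j) * numAct x)) +
      q * ∑ i, act (U i h) * (act (x i) + act (x i) * numAct x) := fun x => by
    rw [overlap, hits_mul_sub_eq, mul_add, mul_sum]
    congr 1
    · refine sum_congr rfl fun i _ => ?_
      rw [mul_sum]
      refine sum_congr rfl fun j _ => ?_
      split_ifs <;> ring
    · rw [mul_left_comm, hits, mul_sum]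
      congr 1
      exact sum_congr rfl fun i _ => by ring
  simp only [e]
  rw [hL.integral_add, hL.integral_sum, integral_const_mul, hL.integral_sum]
  have h1 : ∀ i j, ∫ x, (if i = j then 0 else act (U i h) * act (U j h)) *
      (act (x i) * act (x j) + act (x i) * act (x j) * numAct x) ∂vecLaw d law ≤
      (if i = j then 0 else act (U i h) * act (U j h)) * ((3 + K) * K ^ 2 * (k ^ 3 / d ^ 2)) :=
    fun i j => by
      by_cases hij : i = j
      · simp [hij]
      rw [if_neg hij, integral_const_mul, hL.integral_add, hL.integral_act_mul hij]
      refine mul_le_left ?_ (mul_nonneg (act_nonneg _) (act_nonneg _))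
      have h2 := hL.integral_act_mul_act_mul_numAct_le hij
      have h3 : rate law ^ 2 ≤ (K * k / d) ^ 2 := pow_le_pow_left₀ hp.le hpk 2
      calc _ ≤ rate law ^ 2 * (3 + d * rate law) := by linarith
        _ ≤ (K * k / d) ^ 2 * ((3 + K) * k) := by
            refine mul_le_mul h3 ?_ (by positivity) (by positivity)
            linarith
        _ = _ := by ring
  have h4 : ∀ i, ∫ x, act (U i h) * (act (x i) + act (x i) * numAct x) ∂vecLaw d law ≤
      act (U i h) * ((3 + K) * K ^ 2 * (k ^ 2 / d)) := fun i => by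
    rw [integral_const_mul, hL.integral_add, hL.integral_act]
    refine mul_le_left ?_ (act_nonneg _)
    have h2 := hL.integral_act_mul_numAct_le i
    calc _ ≤ rate law * (2 + d * rate law) := by linarith
      _ ≤ K * k / d * ((3 + K) * k) := by
          refine mul_le_mul hpk ?_ (by positivity) (by positivity)
          linarith
      _ = (3 + K) * (K * 1) * (k ^ 2 / d) := by ring
      _ ≤ (3 + K) * (K * K) * (k ^ 2 / d) := by gcongr
      _ = _ := by ring
  have h5 : ∑ i, ∫ x, (∑ j, (if i = j then 0 else act (U i h) * act (U j h)) *
      (act (x i) * act (x j) + act (x i) * act (x j) * numAct x)) ∂vecLaw d law ≤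
      s * (s - 1) * ((3 + K) * K ^ 2 * (k ^ 3 / d ^ 2)) := by
    rw [← sum_offdiag_act, sum_mul]
    refine sum_le_sum fun i _ => ?_
    rw [hL.integral_sum, sum_mul]
    exact sum_le_sum fun j _ => h1 i j
  have h6 : ∑ i, ∫ x, act (U i h) * (act (x i) + act (x i) * numAct x) ∂vecLaw d law ≤
      s * ((3 + K) * K ^ 2 * (k ^ 2 / d)) := by
    rw [show s = ∑ i, act (U i h) from colSupp_eq U h, sum_mul]
    exact sum_le_sum fun i _ => h4 i
  have h7 := mul_le_left h6 hq
  refine (add_le_add h5 h7).trans (le_of_eq (by ring))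

end

section

variable {P : Model} {K c γ : ℝ} {n : ℕ} {N : P.Net n}

theorem Model.ClassAt.colNorm_le (hC : P.ClassAt K c n N γ) (hK : 0 ≤ K) (h : Fin (P.H n)) :
    colNorm Φ N h ≤ K * γ * √(colSupp Φ N h) := by
  have hγ := hC.scale_pos
  rw [colNorm, ← sqrt_sq (by positivity : 0 ≤ K * γ), ← sqrt_mul (sq_nonneg _), colSupp_eq, mul_sum]
  refine sqrt_le_sqrt (sum_le_sum fun i _ => ?_)
  by_cases hi : Φ N i h = 0
  · simp [hi, act_zero]
  · rw [act_of_ne hi, mul_one, ← sq_abs]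
    exact pow_le_pow_left₀ (abs_nonneg _) (hC.same_size i h hi).2 2

theorem Model.ClassAt.intercept_le (hC : P.ClassAt K c n N γ) (hB : P.BoundsAt K n) (hc : 0 ≤ c)
    (h : Fin (P.H n)) : N.b h ≤ c * K * γ / √(P.k n) := by
  have hk := hB.feature.one_le_k
  have hK := hB.feature.one_le_K
  have hs : (1 : ℝ) ≤ colSupp Φ N h := by exact_mod_cast one_le_colSupp (hC.nonzero h)
  have h1 := (hC.intercept_upper h).trans
    (mul_le_left (hC.colNorm_le (by linarith) h) hc)
  rw [sqrt_mul (by linarith)] at h1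
  have h2 : 0 < √(colSupp Φ N h) := sqrt_pos.2 (by linarith)
  rw [le_div_iff₀ (sqrt_pos.2 (by linarith))]
  refine le_of_mul_le_mul_right ?_ h2
  linarith

/-- Smallness of the ratio `c` that makes the noise harmless for isolated features. -/
structure SmallRatio (K ζ c : ℝ) : Prop where
  pos : 0 < c
  le_half : c ≤ 1 / 2
  size : c * K ^ 2 ≤ 1 / 2
  noise : 12 * ζ * K ^ 2 * c ≤ 1

theorem exists_smallRatio (K : ℝ) {ζ : ℝ} (hζ : 0 < ζ) :
    ∃ c₀ > 0, ∀ c, 0 < c → c ≤ c₀ → SmallRatio K ζ c := by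
  refine ⟨1 / (2 + 2 * K ^ 2 + 12 * ζ * K ^ 2), by positivity, fun c hc h => ?_⟩
  rw [le_div_iff₀ (by positivity)] at h
  have h1 : 0 ≤ c * K ^ 2 := by positivity
  have h2 : 0 ≤ c * (ζ * K ^ 2) := by positivity
  exact ⟨hc, by linarith, by linarith, by linarith⟩

theorem Model.ClassAt.intercept_pos (hC : P.ClassAt K c n N γ) (hc : 0 ≤ c) (h : Fin (P.H n)) :
    0 ≤ N.b h := by
  by_contra hb
  have h1 := hC.intercept_lower h
  have h2 := colNorm_pos (hC.nonzero h)
  have h3 : 0 ≤ √(P.k n * colSupp Φ N h) * log (P.d n) :=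
    mul_nonneg (sqrt_nonneg _) (log_natCast_nonneg _)
  have := mul_nonpos_of_nonneg_of_nonpos hc (mul_nonpos_of_nonpos_of_nonneg (not_le.1 hb).le h3)
  linarith

variable (hC : P.ClassAt K c n N γ) (hR : P.RegimeAt K c n) (hc : SmallRatio K P.ζ c)
include hC hR hc

/-- A single active feature produces a preactivation of size at least `γ / (K √k)`. For a small
ratio `c` the intercept takes at most half of it, and `6 log d` standard deviations of the noise at
most the other half; the resulting tail `12 exp (-9 (log d) ^ 2)` is below `1 / d ^ 2`. -/
theorem Model.ClassAt.miss_le {h : Fin (P.H n)} {x : ℝ^(P.d n)} (hx : IsFeature (P.k n) x)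
    {i : Fin (P.d n)} (hU : Φ N i h ≠ 0) (hxi : x i ≠ 0)
    (hdot : dot (fun i => Φ N i h) x = Φ N i h * x i) :
    P.miss n N h x ≤ 1 / (P.d n : ℝ) ^ 2 := by
  have hk := hR.feature.one_le_k
  have hK := hR.feature.one_le_K
  have hd := hR.feature.d_pos
  have hζ := hR.noise_pos
  have hγ := hC.scale_pos
  have hc0 := hc.pos
  set L := log (P.d n) with hL
  have hL2 : 2 ≤ L := by
    have := hR.one_le_log
    have := mul_le_right hc.le_half (by
      by_contra hneg
      push Not at hneg
      have := mul_nonpos_of_nonneg_of_nonpos hc0.le hneg.le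
      linarith : 0 ≤ L)
    linarith
  have hsk : 0 < √(P.k n) := sqrt_pos.2 (by linarith)
  have hsd : 0 < √(P.d n) := sqrt_pos.2 hd
  have hsm : √(colSupp Φ N h) ≤ √(P.m n) := sqrt_le_sqrt (by exact_mod_cast hC.few_features h)
  refine (Model.miss_le N hR.toBoundsAt (hC.weights_ne_zero hR.toBoundsAt h) (r := 6 * L)
    (by linarith) ?_).trans ?_
  · have h1 : γ / K * (1 / √(P.k n)) ≤ |dot (fun i => Φ N i h) x| := by
      rw [hdot, abs_mul]
      rcases hx i with h0 | h0
      · exact absurd h0 hxi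
      · exact mul_le_mul (hC.same_size i h hU).1 h0.1 (by positivity) (abs_nonneg _)
    refine le_trans ?_ h1
    have h2 : N.b h ≤ γ / K * (1 / √(P.k n)) / 2 := by
      refine (hC.intercept_le hR.toBoundsAt hc0.le h).trans ?_
      rw [div_mul_div_comm, mul_one, div_div, div_le_div_iff₀ hsk (by positivity)]
      have := mul_le_right (a := 2 * γ * √(P.k n)) hc.size
      linarith
    have h3 : 6 * L * (P.ζ * colNorm Φ N h / √(P.d n)) ≤ γ / K * (1 / √(P.k n)) / 2 := by
      rw [div_mul_div_comm, mul_one, div_div, ← mul_div_assoc, div_le_div_iff₀ hsd (by positivity)]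
      have h4 := (hC.colNorm_le (by linarith) h).trans
        (mul_le_left (a := K * γ) hsm)
      have h5 := hR.screened
      rw [sqrt_mul (by linarith)] at h5
      calc 6 * L * (P.ζ * colNorm Φ N h) * (K * √(P.k n) * 2)
          ≤ 6 * L * (P.ζ * (K * γ * √(P.m n))) * (K * √(P.k n) * 2) := by gcongr
        _ = 12 * P.ζ * K ^ 2 * γ * (√(P.k n) * √(P.m n) * L) := by ring
        _ ≤ 12 * P.ζ * K ^ 2 * γ * (c * √(P.d n)) := by gcongr
        _ = 12 * P.ζ * K ^ 2 * c * (γ * √(P.d n)) := by ring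
        _ ≤ 1 * (γ * √(P.d n)) := mul_le_right hc.noise
        _ = γ * √(P.d n) := one_mul _
    linarith
  · have h2 : 1 / (P.d n : ℝ) ^ 2 = exp (-(2 * L)) := by
      rw [exp_neg, two_mul, exp_add, hL, Real.exp_log hd, one_div, sq]
    have h3 : 12 ≤ exp (9 * L ^ 2 - 2 * L) := by
      have := Real.add_one_le_exp (9 * L ^ 2 - 2 * L)
      nlinarith
    calc 12 * exp (-(6 * L) ^ 2 / 4)
        ≤ exp (9 * L ^ 2 - 2 * L) * exp (-(6 * L) ^ 2 / 4) := by gcongr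
      _ = _ := by rw [h2, ← exp_add]; congr 1; ring

/-- With one hit the node is missed with probability at most `1 / d ^ 2`; with two or more the
trivial bound on `miss` suffices, since then `hits ≤ hits (hits - 1)`. -/
theorem Model.ClassAt.hits_mul_miss_le (h : Fin (P.H n)) {x : ℝ^(P.d n)} (hx : IsFeature (P.k n) x) :
    hits Φ N h x * P.miss n N h x ≤ overlap (1 / (P.d n : ℝ) ^ 2) Φ N h x := by
  have h0 := Model.miss_nonneg N h x
  have h1 := Model.miss_le_one N h x
  have hq : 0 ≤ 1 / (P.d n : ℝ) ^ 2 := by positivity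
  unfold overlap
  rcases hits_cases Φ N h x with ⟨e, -⟩ | ⟨e, i, hi, hxi, hdot⟩ | e
  · rw [e]; simp
  · rw [e]
    have := hC.miss_le hR hc hx hi hxi hdot
    linarith
  · have h2 := mul_le_left h1 (by linarith : 0 ≤ hits Φ N h x)
    have h3 := mul_le_left (by linarith : 1 ≤ hits Φ N h x - 1)
      (by linarith : 0 ≤ hits Φ N h x)
    have h4 := mul_nonneg hq (by linarith : 0 ≤ hits Φ N h x)
    linarith

/-- Nodes without hits contribute exactly zero by symmetry. Each other node errs by at most its
intercept times its probability of being missed, and intercepts are at most `c K γ / √k`. -/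
theorem Model.ClassAt.abs_meanEval_sub_le {x : ℝ^(P.d n)} (hx : IsFeature (P.k n) x) :
    |P.meanEval n N x - dot (P.strength n N) x| ≤ c * K * γ / √(P.k n) *
      ∑ h, overlap (1 / (P.d n : ℝ) ^ 2) Φ N h x := by
  rw [Model.meanEval_eq, Model.dot_strength, ← sum_sub_distrib, mul_sum]
  refine (abs_sum_le_sum_abs _ _).trans (sum_le_sum fun h _ => ?_)
  have hov := overlap_nonneg (by positivity : 0 ≤ 1 / (P.d n : ℝ) ^ 2) Φ N h x
  have hb := hC.intercept_pos hc.pos.le h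
  refine le_trans ?_ (mul_le_right
    (hC.intercept_le hR.toBoundsAt hc.pos.le h) hov)
  have h2 := Model.abs_integral_gate_sub_le N h x
  have h3 := hC.hits_mul_miss_le hR hc h hx
  have h0 := Model.miss_nonneg N h x
  rcases hits_cases Φ N h x with ⟨-, e⟩ | ⟨e, -⟩ | e
  · rw [Model.integral_gate_eq_zero N h e, e, sub_zero, abs_zero]
    exact mul_nonneg hb hov
  · rw [e, one_mul] at h3
    exact h2.trans (mul_le_left h3 hb)
  · refine h2.trans (mul_le_left (le_trans ?_ h3) hb)
    exact le_mul_of_one_le_left h0 (by linarith)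

/-- The test vector lives on active features, so summing over them counts, for each node, the hits
weighted by the probability of a miss. -/
theorem Model.ClassAt.abs_sum_meanSlope_sub_le {x : ℝ^(P.d n)} (hx : IsFeature (P.k n) x)
    {w : ℝ^(P.d n)} (hw : ∀ i, |w i| ≤ act (x i)) :
    |∑ i, w i * (P.meanSlope n N i x - P.strength n N i)| ≤ K * γ *
      ∑ h, overlap (1 / (P.d n : ℝ) ^ 2) Φ N h x := by
  have hγ := hC.scale_pos
  have hK := hR.feature.one_le_K
  have e : ∀ i, w i * (P.meanSlope n N i x - P.strength n N i) =
      ∑ h, -(w i * Φ N i h * P.miss n N h x) := fun i => by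
    rw [Model.meanSlope, Model.strength, ← sum_sub_distrib, mul_sum]
    exact sum_congr rfl fun h _ => by ring
  simp only [e]
  rw [sum_comm, mul_sum]
  refine (abs_sum_le_sum_abs _ _).trans (sum_le_sum fun h _ => ?_)
  refine le_trans ?_ (mul_le_left (a := K * γ) (hC.hits_mul_miss_le hR hc h hx))
  rw [hits, sum_mul, mul_sum]
  refine (abs_sum_le_sum_abs _ _).trans (sum_le_sum fun i _ => ?_)
  have h0 := Model.miss_nonneg N h x
  rw [abs_neg, abs_mul, abs_mul, abs_of_nonneg h0]
  by_cases hi : Φ N i h = 0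
  · simp [hi, act_zero]
  · rw [act_of_ne hi, one_mul, ← mul_assoc]
    refine mul_le_right ?_ h0
    rw [mul_comm (K * γ)]
    exact mul_le_mul (hw i) (hC.same_size i h hi).2 (abs_nonneg _) (act_nonneg _)

end

/-! ### The price of the averaged slope outside the active features. -/

section

variable {d : ℕ}

theorem CubeBounded.unitize {a : Fin d → ℝ^d → ℝ} (ha : ∀ i, CubeBounded (a i)) (i : Fin d) :
    CubeBounded fun x => unitize (fun j => a j x) i := by
  refine (CubeBounded.const 1).mono ?_ fun x => by rw [abs_one]; exact abs_unitize_le_one _ _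
  have h : CubeBounded fun x => √(∑ j, a j x ^ 2) :=
    CubeBounded.sqrt (CubeBounded.sum _ fun j => (ha j).pow 2)
  exact (ha i).1.div h.1

theorem slopeAlong_eq (T₀ T x : ℝ^d) :
    slopeAlong T₀ T x = ∑ i, unitize (fun j => act (x j) * T₀ j) i * T i := by
  simp only [unitize, sqrt_sum_sq_act_mul, slopeAlong, sum_div]
  exact sum_congr rfl fun i _ => by ring

/-- An upper bound for `1 + |(T₀ - θ) x| + ε ‖(T₀)_A‖` in terms of the number of active features. -/
theorem weight_le {ε B : ℝ} {a T₀ x : ℝ^d} (hx : ∀ i, |x i| ≤ 1) (hε1 : ε ≤ 1)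
    (hB : 1 ≤ B) (ha : ∀ i, |a i| ≤ B) (hT₀ : ∀ i, |T₀ i| ≤ B) :
    1 + |dot a x| + ε * actNorm T₀ x ≤ 2 * B * (1 + numAct x) := by
  have hn := numAct_nonneg x
  have h1 : |dot a x| ≤ B * numAct x := by
    rw [dot, numAct, mul_sum]
    refine (abs_sum_le_sum_abs _ _).trans (sum_le_sum fun i _ => ?_)
    rw [abs_mul]
    exact mul_le_mul (ha i) (abs_le_act (hx i)) (abs_nonneg _) (by linarith)
  have h2 := actNorm_le (by linarith) hT₀ x
  have h3 : √(numAct x) ≤ 1 + numAct x := sqrt_le_iff.2 ⟨by linarith, by nlinarith⟩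
  have h4 : ε * actNorm T₀ x ≤ actNorm T₀ x := mul_le_of_le_one_left (actNorm_nonneg _ _) hε1
  have h5 := mul_le_left h3 (by linarith : 0 ≤ B)
  have h6 := mul_nonneg (by linarith : 0 ≤ B) hn
  linarith

/-- The unit vector along the active part of `T₀` has entries of size at most `B / B'` times `act (x
i) / √(numAct x)`, because the coefficients of `T₀` are comparable. This brings the second-order
cost into the form treated by `integral_weight_act_le`. -/
theorem weight_mul_unitize_le {ε B B' : ℝ} {a T₀ x : ℝ^d} (hε : 0 ≤ ε)
    (hB : 1 ≤ B) (hB' : 0 < B') (hT₀ : ∀ i, |T₀ i| ≤ B) (hT₀' : ∀ i, B' ≤ |T₀ i|) (i : Fin d) :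
    (1 + |dot a x| + ε * actNorm T₀ x) * |unitize (fun j => act (x j) * T₀ j) i| ≤
      B ^ 2 / B' * ((1 + |dot a x| + ε * √(numAct x)) * (act (x i) / √(numAct x))) := by
  have hs := sqrt_nonneg (numAct x)
  have h2 := mul_le_left (actNorm_le (by linarith) hT₀ x) hε
  have h3 : 1 + |dot a x| + ε * actNorm T₀ x ≤ B * (1 + |dot a x| + ε * √(numAct x)) := by
    have := mul_le_right (a := 1 + |dot a x|) hB
    linarith
  have h4 : |unitize (fun j => act (x j) * T₀ j) i| ≤ B / B' * (act (x i) / √(numAct x)) := by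
    rw [unitize, sqrt_sum_sq_act_mul, abs_div, abs_mul, abs_of_nonneg (act_nonneg _),
      abs_of_nonneg (actNorm_nonneg _ _)]
    by_cases h0 : x i = 0
    · simp [h0, act_zero]
    · have h5 : 0 < √(numAct x) := by
        refine sqrt_pos.2 ?_
        have := act_le_numAct x i
        rw [act_of_ne h0] at this
        linarith
      have h6 := le_actNorm hB'.le hT₀' x
      rw [div_mul_div_comm, div_le_div_iff₀ (lt_of_lt_of_le (by positivity) h6) (by positivity)]
      have h7 := mul_le_mul (hT₀ i) h6 (by positivity) (by linarith)
      have h8 := mul_le_left h7 (act_nonneg (x i))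
      linarith
  refine (mul_le_mul h3 h4 (abs_nonneg _) (by positivity)).trans (le_of_eq ?_)
  ring

end

/-- The norm of the averaged slope outside the active features. -/
def Model.offNorm (P : Model) (n : ℕ) (N : P.Net n) (x : ℝ^(P.d n)) : ℝ :=
  √(∑ i, ((1 - act (x i)) * P.meanSlope n N i x) ^ 2)

/-- The loss caused by superposed features. -/
def Model.overlapLoss (P : Model) (n : ℕ) (N : P.Net n) (γ : ℝ) : ℝ :=
  γ / √(P.k n) * ∑ h, ((colSupp Φ N h : ℝ) * (colSupp Φ N h - 1) * P.k n ^ 3 / (P.d n : ℝ) ^ 2 +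
    1 / (P.d n : ℝ) ^ 2 * (colSupp Φ N h * P.k n ^ 2 / P.d n))

theorem Model.cubeBounded_offNorm (P : Model) (n : ℕ) (N : P.Net n) :
    CubeBounded (P.offNorm n N) := by
  unfold Model.offNorm
  exact CubeBounded.sqrt (CubeBounded.sum _ fun i => (CubeBounded.mul (by fun_prop)
    (Model.cubeBounded_meanSlope N i)).pow 2)

section

variable {P : Model} {K c γ : ℝ} {n : ℕ} {N : P.Net n}

theorem Model.ClassAt.integral_sum_overlap_le (hC : P.ClassAt K c n N γ) (hB : P.BoundsAt K n) :
    γ / √(P.k n) * ∫ x, (1 + numAct x) * ∑ h, overlap (1 / (P.d n : ℝ) ^ 2) Φ N h x ∂P.vecLaw n ≤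
      (3 + K) * K ^ 2 * P.overlapLoss n N γ := by
  have hγ := hC.scale_pos
  simp only [mul_sum]
  rw [hB.feature.integral_sum, Model.overlapLoss, mul_left_comm]
  refine mul_le_left ?_
  rw [mul_sum]
  exact sum_le_sum fun h _ => hB.feature.integral_overlap_le (by positivity) _ h (hC.nonzero h)

theorem Model.RegimeAt.attack_le_ratio (hR : P.RegimeAt K c n) (hc : 0 ≤ c) :
    P.ε n ≤ c * K / √(P.k n) := by
  rw [le_div_iff₀ (sqrt_pos.2 (by linarith [hR.feature.one_le_k]))]
  exact hR.attack_mul_sqrt_le hc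

end

/-- The adversarial risk exceeds the best linear risk by the price of the averaged slope outside the
active features, up to the loss caused by superposed features. -/
theorem Model.exists_gain_le (P : Model) (hs : 0 < P.s) (τ : Task) {K : ℝ} (hK : 1 ≤ K) :
    ∃ c₁ > 0, ∃ C₁ > 0, ∀ (n : ℕ) (c γ : ℝ) (N : P.Net n), P.RegimeAt K c n →
    P.ClassAt K c n N γ → SmallRatio K P.ζ c → ∀ T₀ : ℝ^(P.d n),
    (∀ i, |T₀ i - P.θ₀ n i| ≤ |P.θ₀ n i| / 2) →
    (∀ T', P.linRisk τ n T₀ ≤ P.linRisk τ n T') → ∀ l, 0 ≤ l → l ≤ 1 →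
    P.linRisk τ n T₀ + c₁ * (P.ε n * l * ∫ x, exp (-|dot (P.θ₀ n) x|) * P.offNorm n N x
        ∂P.vecLaw n) ≤
    P.advRisk τ n N + C₁ * (P.ε n * l ^ 2 * (√(P.k n) / P.d n) *
      (∑ i, |P.strength n N i|) + c * P.overlapLoss n N γ) := by
  obtain ⟨c₁, hc₁, C, hC0, hmain⟩ := linRisk_add_gain_le τ hs
  obtain ⟨C₂, hC₂, hquad⟩ := integral_weight_act_le K K
  refine ⟨c₁, hc₁, C * ((2 * K) ^ 2 / (1 / (2 * K)) * C₂ +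
    2 * (2 * K) * (K + K ^ 2) * ((3 + K) * K ^ 2)), by positivity,
    fun n c γ N hR hC hc T₀ hT hmin l hl hl1 => ?_⟩
  have hL := hR.feature
  have hε := hR.attack_nonneg
  have hγ := hC.scale_pos
  have hc0 := hc.pos
  have hk := hL.one_le_k
  have hd := hL.d_pos
  have hcK : c * K ≤ 1 := by
    have : c * K ≤ c * K ^ 2 := mul_le_left (by nlinarith) hc0.le
    linarith [hc.size]
  have hsk1 : 1 ≤ √(P.k n) := one_le_sqrt.2 hk
  have hεk : P.ε n * √(P.k n) ≤ 1 := (hR.attack_mul_sqrt_le hc0.le).trans hcK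
  have hε1 : P.ε n ≤ 1 := (le_mul_of_one_le_right hε hsk1).trans hεk
  have hT1 : ∀ i, 1 / (2 * K) ≤ |T₀ i| := fun i => by
    have h1 := hT i
    have h2 := (hR.coeff i).1
    have h3 := abs_sub_abs_le_abs_sub (P.θ₀ n i) (T₀ i)
    rw [abs_sub_comm] at h3
    rw [show 1 / (2 * K) = 1 / K / 2 by ring]
    linarith
  have hT2 : ∀ i, |T₀ i| ≤ 2 * K := fun i => by
    have h1 := hT i
    have h2 := (hR.coeff i).2
    have h3 := abs_sub_abs_le_abs_sub (T₀ i) (P.θ₀ n i)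
    linarith
  have hTK : ∀ i, |T₀ i - P.θ₀ n i| ≤ K := fun i => by linarith [hT i, (hR.coeff i).2]
  set T := P.strength n N with hTdef
  set u := fun (i : Fin (P.d n)) (x : ℝ^(P.d n)) => unitize (fun j => act (x j) * T₀ j) i
    with hu
  set v := fun (i : Fin (P.d n)) (x : ℝ^(P.d n)) =>
    unitize (fun j => (1 - act (x j)) * P.meanSlope n N j x) i with hv
  have hms := Model.cubeBounded_meanSlope N
  have hcu : ∀ i, CubeBounded (u i) := fun i => CubeBounded.unitize (fun j => by fun_prop) i
  have hcv : ∀ i, CubeBounded (v i) := fun i =>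
    CubeBounded.unitize (fun j => CubeBounded.mul (by fun_prop) (hms j)) i
  have hoff := P.cubeBounded_offNorm n N
  have hl2 : l ^ 2 ≤ 1 := pow_le_one₀ hl hl1
  -- The vectors `u` and `v` have disjoint supports, the active and the inactive features, so the
  -- squared norm of `w` is at most `(1 - l ^ 2) ^ 2 + l ^ 2 ≤ 1`. Sacrificing `l ^ 2` of the active
  -- direction buys `l` of the inactive one.
  set w := fun (i : Fin (P.d n)) (x : ℝ^(P.d n)) => (1 - l ^ 2) * u i x + l * v i x with hw
  have hu0 : ∀ i x, u i x = act (x i) * u i x := fun i x => by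
    simp only [hu, unitize]; rw [← mul_div_assoc, ← mul_assoc, act_mul_self]
  have hv0 : ∀ i x, v i x = (1 - act (x i)) * v i x := fun i x => by
    have := act_mul_self (x i)
    have e : (1 - act (x i)) * (1 - act (x i)) = 1 - act (x i) := by linarith
    simp only [hv, unitize]; rw [← mul_div_assoc, ← mul_assoc, e]
  have huv : ∀ i x, u i x * v i x = 0 := fun i x => by
    have e : act (x i) * (1 - act (x i)) = 0 := by rw [mul_sub, act_mul_self]; ring
    rw [hu0, hv0, mul_mul_mul_comm, e, zero_mul]
  have hw1 : ∀ x, ∑ i, w i x ^ 2 ≤ 1 := fun x => by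
    have e : ∀ i, w i x ^ 2 = (1 - l ^ 2) ^ 2 * u i x ^ 2 + l ^ 2 * v i x ^ 2 := fun i => by
      have := huv i x
      simp only [hw]
      linear_combination (2 * (1 - l ^ 2) * l) * this
    simp only [e, sum_add_distrib, ← mul_sum]
    have h1 := sum_sq_unitize_le_one fun j => act (x j) * T₀ j
    have h2 := sum_sq_unitize_le_one fun j => (1 - act (x j)) * P.meanSlope n N j x
    have h3 := mul_le_left h1 (sq_nonneg (1 - l ^ 2))
    have h4 := mul_le_left h2 (sq_nonneg l)
    have h5 : 0 ≤ l ^ 2 * (1 - l ^ 2) := mul_nonneg (sq_nonneg _) (by linarith)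
    refine (add_le_add h3 h4).trans ?_
    linarith
  set Q := fun x => ∑ i, u i x * (P.meanSlope n N i x - T i) with hQ
  set e := fun x => P.meanEval n N x - dot T x with he
  set g := fun x => l * P.offNorm n N x with hg
  -- The deficit: the share of the active direction that was given up, and the difference `Q`
  -- between averaged slope and total strengths on the active features.
  set r := fun x => l ^ 2 * slopeAlong T₀ T x - (1 - l ^ 2) * Q x with hr
  have hcQ : CubeBounded Q := CubeBounded.sum _ fun i => (hcu i).mul ((hms i).sub (CubeBounded.const _))
  have hce : CubeBounded e := (Model.cubeBounded_meanEval N).sub (CubeBounded.dot T)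
  have hcg : CubeBounded g := (CubeBounded.const l).mul hoff
  have hcr : CubeBounded r := by fun_prop
  have hinner : ∀ x, ∑ i, w i x * P.meanSlope n N i x = slopeAlong T₀ T x + g x - r x := fun x => by
    have h1 : ∑ i, v i x * P.meanSlope n N i x = P.offNorm n N x := by
      rw [Model.offNorm, ← sum_unitize_mul_self]
      refine sum_congr rfl fun i _ => ?_
      rw [hv0]; simp only [hv]; ring
    have h2 : ∑ i, u i x * P.meanSlope n N i x = slopeAlong T₀ T x + Q x := by
      rw [slopeAlong_eq, hQ, ← sum_add_distrib]
      exact sum_congr rfl fun i _ => by simp only [hu]; ring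
    simp only [hw, add_mul, mul_assoc, sum_add_distrib, ← mul_sum, h1, h2, hg, hr]
    ring
  have hstart := hmain (T := T) hL hε (by positivity : 0 < 1 / (2 * K)) hT1 hmin hce hcg hcr
    fun x => mul_nonneg hl (sqrt_nonneg _)
  have hadv := hR.integral_profile_mean_le_advRisk N τ (hC.weights_ne_zero hR.toBoundsAt)
    hC.same_sign (hC.attack_mul_colNorm_le hR hc0.le hcK)
    (w := w) (fun i => ((CubeBounded.const _).mul (hcu i)).add ((CubeBounded.const _).mul (hcv i)))
    hw1
  have e1 : ∀ x, dot T x + e x = P.meanEval n N x := fun x => by simp only [he]; ring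
  simp only [e1, ← hinner] at hstart
  have e2 : ∫ x, exp (-|dot (P.θ₀ n) x|) * g x ∂P.vecLaw n =
      l * ∫ x, exp (-|dot (P.θ₀ n) x|) * P.offNorm n N x ∂P.vecLaw n := by
    rw [← integral_const_mul]
    refine integral_congr_ae (ae_of_all _ fun x => ?_)
    simp only [hg]; ring
  rw [e2] at hstart
  set Ov := fun x => ∑ h, overlap (1 / (P.d n : ℝ) ^ 2) Φ N h x with hOv
  have hcOv : CubeBounded Ov := by fun_prop
  set G := fun (i : Fin (P.d n)) (x : ℝ^(P.d n)) =>
    (1 + |dot (fun i => T₀ i - P.θ₀ n i) x| + P.ε n * √(numAct x)) *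
      (act (x i) / √(numAct x)) with hG
  have hcG : ∀ i, CubeBounded (G i) := fun i =>
    CubeBounded.mul (by fun_prop) (cubeBounded_act_div_sqrt i)
  set A := c * (K + K ^ 2) * (γ / √(P.k n)) with hA
  have hA0 : 0 ≤ A := by positivity
  have hpt : ∀ x, IsFeature (P.k n) x →
      (1 + |dot T₀ x - dot (P.θ₀ n) x| + P.ε n * actNorm T₀ x) * (|e x| + P.ε n * |r x|) ≤
      2 * (2 * K) * A * ((1 + numAct x) * Ov x) +
      P.ε n * l ^ 2 * ((2 * K) ^ 2 / (1 / (2 * K))) * ∑ i, |T i| * G i x := fun x hx => by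
    rw [dot_sub]
    set W := 1 + |dot (fun i => T₀ i - P.θ₀ n i) x| + P.ε n * actNorm T₀ x with hW
    have hW0 : 0 ≤ W := by
      have := mul_nonneg hε (actNorm_nonneg T₀ x)
      positivity
    have hOv0 : 0 ≤ Ov x := sum_nonneg fun h _ => overlap_nonneg (by positivity) _ _ _
    have h1 := hC.abs_meanEval_sub_le hR hc hx
    have h2 : |Q x| ≤ K * γ * Ov x := hC.abs_sum_meanSlope_sub_le hR hc hx fun i => by
      show |u i x| ≤ _
      rw [hu0, abs_mul, abs_of_nonneg (act_nonneg _)]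
      exact mul_le_of_le_one_right (act_nonneg _) (abs_unitize_le_one _ _)
    have h3 : |r x| ≤ l ^ 2 * |slopeAlong T₀ T x| + |Q x| := by
      refine (abs_sub _ _).trans ?_
      rw [abs_mul, abs_mul, abs_of_nonneg (sq_nonneg l), abs_of_nonneg (by linarith : 0 ≤ 1 - l ^ 2)]
      have := mul_le_of_le_one_left (abs_nonneg (Q x)) (by linarith [sq_nonneg l] : 1 - l ^ 2 ≤ 1)
      linarith
    -- The attack is at most `c K / √k`, which gives the slope error the same scale `c γ / √k` as
    -- the error of the prediction.
    have h4 : P.ε n * (K * γ * Ov x) ≤ c * K / √(P.k n) * (K * γ * Ov x) :=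
      mul_le_right (hR.attack_le_ratio hc0.le)
    have h5 : |e x| + P.ε n * |r x| ≤ A * Ov x + P.ε n * l ^ 2 * |slopeAlong T₀ T x| := by
      have h6 := mul_le_left (h3.trans (add_le_add le_rfl h2)) hε
      have h7 : c * K * γ / √(P.k n) * Ov x + c * K / √(P.k n) * (K * γ * Ov x) =
        A * Ov x := by rw [hA]; ring
      have h8 : |e x| ≤ c * K * γ / √(P.k n) * Ov x := h1
      linarith
    refine (mul_le_left h5 hW0).trans ?_
    have h9 : W ≤ 2 * (2 * K) * (1 + numAct x) := weight_le hx.abs_le hε1 (by linarith)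
      (fun i => (hTK i).trans (by linarith)) hT2
    have h10 : W * |slopeAlong T₀ T x| ≤ (2 * K) ^ 2 / (1 / (2 * K)) * ∑ i, |T i| * G i x := by
      rw [slopeAlong_eq, mul_sum]
      refine (mul_le_left (abs_sum_le_sum_abs _ _) hW0).trans ?_
      rw [mul_sum]
      refine sum_le_sum fun i _ => ?_
      rw [abs_mul, ← mul_assoc, mul_left_comm, mul_comm _ |T i|]
      exact mul_le_left (weight_mul_unitize_le hε (by linarith) (by positivity) hT2 hT1
        i) (abs_nonneg _)
    have h11 := mul_le_right h9 (mul_nonneg hA0 hOv0)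
    have h12 := mul_le_left (a := P.ε n * l ^ 2) h10
    linarith
  have hint : ∫ x, (1 + |dot T₀ x - dot (P.θ₀ n) x| + P.ε n * actNorm T₀ x) *
      (|e x| + P.ε n * |r x|) ∂P.vecLaw n ≤
      2 * (2 * K) * A * ∫ x, (1 + numAct x) * Ov x ∂P.vecLaw n +
      P.ε n * l ^ 2 * ((2 * K) ^ 2 / (1 / (2 * K))) * ∑ i, |T i| * ∫ x, G i x ∂P.vecLaw n := by
    refine (hL.integral_mono hpt).trans (le_of_eq ?_)
    rw [hL.integral_add, integral_const_mul, integral_const_mul, hL.integral_sum]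
    simp only [integral_const_mul]
  have hOvI := hC.integral_sum_overlap_le hR.toBoundsAt
  have hGI : ∑ i, |T i| * ∫ x, G i x ∂P.vecLaw n ≤ C₂ * (√(P.k n) / P.d n) * ∑ i, |T i| := by
    rw [mul_sum]
    refine sum_le_sum fun i _ => ?_
    rw [mul_comm]
    exact mul_le_right (hquad hL hTK hε hεk i) (abs_nonneg _)
  have b1 := mul_le_left (a := 2 * (2 * K) * (c * (K + K ^ 2))) hOvI
  have b2 := mul_le_left (a := P.ε n * l ^ 2 * ((2 * K) ^ 2 / (1 / (2 * K)))) hGI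
  have b3 : ∫ x, (1 + |dot T₀ x - dot (P.θ₀ n) x| + P.ε n * actNorm T₀ x) *
      (|e x| + P.ε n * |r x|) ∂P.vecLaw n ≤
      2 * (2 * K) * (K + K ^ 2) * ((3 + K) * K ^ 2) * (c * P.overlapLoss n N γ) +
      (2 * K) ^ 2 / (1 / (2 * K)) * C₂ * (P.ε n * l ^ 2 * (√(P.k n) / P.d n) * ∑ i, |T i|) := by
    refine hint.trans ?_
    rw [hA]
    linarith
  have hOL : 0 ≤ c * P.overlapLoss n N γ := by
    refine mul_nonneg hc0.le (mul_nonneg (by positivity) (sum_nonneg fun h _ => ?_))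
    have : (1 : ℝ) ≤ colSupp Φ N h := by exact_mod_cast one_le_colSupp (hC.nonzero h)
    have : 0 ≤ (colSupp Φ N h : ℝ) - 1 := by linarith
    positivity
  have hQT : 0 ≤ P.ε n * l ^ 2 * (√(P.k n) / P.d n) * ∑ i, |T i| :=
    mul_nonneg (by positivity) (sum_nonneg fun i _ => abs_nonneg _)
  have b4 := mul_le_left b3 hC0.le
  set c2 := (2 * K) ^ 2 / (1 / (2 * K)) * C₂
  set c3 := 2 * (2 * K) * (K + K ^ 2) * ((3 + K) * K ^ 2)
  have hc2 : 0 ≤ c2 := by positivity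
  have hc3 : 0 ≤ c3 := by positivity
  have b5 := mul_nonneg (mul_nonneg hC0.le hc2) hOL
  have b6 := mul_nonneg (mul_nonneg hC0.le hc3) hQT
  refine le_trans (le_of_eq ?_) (hstart.trans ((add_le_add hadv b4).trans ?_))
  · ring
  · linarith

/-! ### Lower bounds for the slope outside the active features. -/

theorem abs_sum_mul_of_same_sign {ι : Type*} [Fintype ι] {a c : ι → ℝ}
    (ha : ∀ h h', 0 ≤ a h * a h') (hc : ∀ h, 0 ≤ c h) : |∑ h, a h * c h| = ∑ h, |a h| * c h := by
  by_cases hneg : ∃ h, a h < 0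
  · obtain ⟨h₀, h₀neg⟩ := hneg
    have hle : ∀ h, a h ≤ 0 := fun h => by
      by_contra hp
      have := mul_neg_of_neg_of_pos h₀neg (not_le.1 hp)
      linarith [ha h₀ h]
    rw [abs_of_nonpos (Finset.sum_nonpos fun h _ => mul_nonpos_of_nonpos_of_nonneg (hle h) (hc h)),
      ← sum_neg_distrib]
    exact sum_congr rfl fun h _ => by rw [abs_of_nonpos (hle h)]; ring
  · push Not at hneg
    rw [abs_of_nonneg (sum_nonneg fun h _ => mul_nonneg (hneg h) (hc h))]
    exact sum_congr rfl fun h _ => by rw [abs_of_nonneg (hneg h)]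

theorem exists_nat_eq_sum {ι : Type*} [Fintype ι] {a : ι → ℝ} (h : ∀ i, a i = 0 ∨ a i = 1) :
    ∃ m : ℕ, ∑ i, a i = m := by
  classical
  refine ⟨(Finset.univ.filter fun i => a i = 1).card, ?_⟩
  rw [← sum_boole]
  refine sum_congr rfl fun i _ => ?_
  rcases h i with h | h <;> simp [h]

theorem act_eq (a : ℝ) : act a = 0 ∨ act a = 1 := by unfold act; split_ifs <;> simp

section

variable {P : Model} {K c γ : ℝ} {n : ℕ} {N : P.Net n}

theorem Model.ClassAt.abs_strength_eq (hC : P.ClassAt K c n N γ) (i : Fin (P.d n)) :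
    |P.strength n N i| = ∑ h, |Φ N i h| := by
  have := abs_sum_mul_of_same_sign (hC.same_sign i) (c := fun _ => 1) fun _ => zero_le_one
  simpa [Model.strength] using this

theorem Model.ClassAt.colSupp_bounds (hC : P.ClassAt K c n N γ) (hK : 0 < K) :
    γ * ∑ h, (colSupp Φ N h : ℝ) ≤ K * ∑ i, |P.strength n N i| ∧
    ∑ i, |P.strength n N i| ≤ K * (γ * ∑ h, (colSupp Φ N h : ℝ)) := by
  have hγ := hC.scale_pos
  simp only [hC.abs_strength_eq, colSupp_eq]
  rw [sum_comm (f := fun i h => |Φ N i h|)]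
  simp only [mul_sum]
  constructor
  · refine sum_le_sum fun h _ => sum_le_sum fun i _ => ?_
    by_cases hi : Φ N i h = 0
    · simp [hi, act_zero]
    · have := (hC.same_size i h hi).1
      rw [act_of_ne hi, mul_one]
      rwa [div_le_iff₀' hK] at this
  · refine sum_le_sum fun h _ => sum_le_sum fun i _ => ?_
    by_cases hi : Φ N i h = 0
    · simp [hi, act_zero]
    · rw [act_of_ne hi, mul_one]
      exact (hC.same_size i h hi).2

/-- A node with exactly one hit is active with probability at least one half, and equal signs
exclude cancellation between nodes. So coordinate `i` of the off-support slope is at least `γ / (2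
K)` times `q i`, the number of selected nodes containing the inactive feature `i`; these numbers add
up to the sum of `s - 1` over the selected nodes. The former bound compares the `ℓ²` and `ℓ¹` norms
of `q` in dimension `d`, the latter uses that the `q i` are integers, so `q i ≤ q i ^ 2`. -/
theorem Model.ClassAt.le_offNorm (hC : P.ClassAt K c n N γ) (hR : P.RegimeAt K c n)
    (hc : SmallRatio K P.ζ c) {x : ℝ^(P.d n)} (hx : IsFeature (P.k n) x)
    {σ : ℝ^(P.H n)} (hσ : ∀ h, σ h = 0 ∨ (σ h = 1 ∧ hits Φ N h x = 1)) :
    γ / (2 * K) * ((∑ h, ((colSupp Φ N h : ℝ) - 1) * σ h) / √(P.d n)) ≤ P.offNorm n N x ∧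
    γ / (2 * K) * √(∑ h, ((colSupp Φ N h : ℝ) - 1) * σ h) ≤ P.offNorm n N x := by
  have hγ := hC.scale_pos
  have hK := hR.feature.one_le_K
  have hd := hR.feature.d_pos
  set U := Φ N with hU
  have hmiss : ∀ h, σ h ≤ 2 * (1 - P.miss n N h x) := fun h => by
    rcases hσ h with h0 | ⟨h1, h2⟩
    · rw [h0]; linarith [Model.miss_le_one N h x]
    · have h3 := hC.hits_mul_miss_le hR hc h hx
      rw [overlap, h2] at h3
      -- Dimension one is excluded because `log d` is positive.
      have h4 : 2 ≤ P.d n := by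
        by_contra hlt
        have h5 : P.d n = 1 := by
          have : 0 < P.d n := by exact_mod_cast hd
          omega
        have := hR.one_le_log
        rw [h5] at this
        norm_num at this
      have h5 : (2 : ℝ) ≤ P.d n := by exact_mod_cast h4
      have h6 : 1 / (P.d n : ℝ) ^ 2 ≤ 1 / 2 := one_div_le_one_div_of_le (by norm_num) (by nlinarith)
      rw [h1]; linarith
  have hσ0 : ∀ h, 0 ≤ σ h := fun h => by rcases hσ h with h0 | ⟨h0, -⟩ <;> rw [h0]; norm_num
  set q := fun i => (1 - act (x i)) * ∑ h, act (U i h) * σ h with hq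
  have hact : ∀ i, 0 ≤ 1 - act (x i) := fun i => by linarith [act_le_one (x i)]
  have hq0 : ∀ i, 0 ≤ q i := fun i => mul_nonneg (hact i)
    (sum_nonneg fun h _ => mul_nonneg (act_nonneg _) (hσ0 h))
  have hqs : ∀ i, γ / (2 * K) * q i ≤ |(1 - act (x i)) * P.meanSlope n N i x| := fun i => by
    rw [abs_mul, abs_of_nonneg (hact i), hq, mul_left_comm]
    refine mul_le_left ?_ (hact i)
    rw [Model.meanSlope, abs_sum_mul_of_same_sign (hC.same_sign i)
      fun h => by linarith [Model.miss_le_one N h x], mul_sum]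
    refine sum_le_sum fun h _ => ?_
    by_cases hi : U i h = 0
    · rw [hi, act_zero, zero_mul, mul_zero]
      exact mul_nonneg (abs_nonneg _) (by linarith [Model.miss_le_one N h x])
    · rw [act_of_ne hi, one_mul]
      have h1 := mul_le_mul (hC.same_size i h hi).1 (hmiss h) (hσ0 h) (abs_nonneg _)
      have e : γ / (2 * K) * σ h = γ / K * σ h / 2 := by field_simp
      rw [e]; linarith
  have hsum : ∑ i, q i = ∑ h, ((colSupp U h : ℝ) - 1) * σ h := by
    simp only [hq, mul_sum]
    rw [sum_comm]
    refine sum_congr rfl fun h _ => ?_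
    have e : ∑ i, (1 - act (x i)) * (act (U i h) * σ h) = ((colSupp U h : ℝ) - hits U h x) * σ h := by
      rw [colSupp_eq, hits, ← sum_sub_distrib, sum_mul]
      exact sum_congr rfl fun i _ => by ring
    rw [e]
    rcases hσ h with h0 | ⟨-, h2⟩
    · rw [h0]; simp
    · rw [h2]
  have hsq : (γ / (2 * K)) ^ 2 * ∑ i, q i ^ 2 ≤
      ∑ i, ((1 - act (x i)) * P.meanSlope n N i x) ^ 2 := by
    rw [mul_sum]
    refine sum_le_sum fun i _ => ?_
    rw [← mul_pow, ← sq_abs ((1 - act (x i)) * _)]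
    exact pow_le_pow_left₀ (mul_nonneg (by positivity) (hq0 i)) (hqs i) 2
  rw [← hsum, Model.offNorm]
  constructor
  · refine le_sqrt_of_sq_le (le_trans ?_ hsq)
    rw [mul_pow, div_pow _ (Real.sqrt _), sq_sqrt hd.le]
    refine mul_le_left ?_
    rw [div_le_iff₀' hd]
    have := sq_sum_le_card_mul_sum_sq (s := (univ : Finset (Fin (P.d n)))) (f := q)
    rwa [card_univ, Fintype.card_fin] at this
  · refine le_sqrt_of_sq_le (le_trans ?_ hsq)
    rw [mul_pow, sq_sqrt (sum_nonneg fun i _ => hq0 i)]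
    refine mul_le_left (sum_le_sum fun i _ => ?_)
    obtain ⟨m, hm⟩ : ∃ m : ℕ, q i = m := by
      simp only [hq, mul_sum]
      refine exists_nat_eq_sum fun h => ?_
      rcases act_eq (x i) with h1 | h1 <;> rcases act_eq (U i h) with h2 | h2 <;>
        rcases hσ h with h3 | ⟨h3, -⟩ <;> simp [h1, h2, h3]
    rw [hm, sq]
    exact_mod_cast Nat.le_mul_self m

end

/-! ### Nodes that see exactly one active feature. -/

section

variable {d H : ℕ}

/-- Feature vectors with a typical number of active features and a bounded signal. -/
def calm (K k : ℝ) (θ x : ℝ^d) : Prop := numAct x ≤ 16 * K * k ∧ |dot θ x| ≤ 16 * K ^ 2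

open Classical in
/-- The indicator that node `h` sees exactly one active feature, for a calm feature vector. -/
def solo (K k : ℝ) (θ : ℝ^d) (U : Matrix (Fin d) (Fin H) ℝ) (h : Fin H) (x : ℝ^d) : ℝ :=
  if hits U h x = 1 ∧ calm K k θ x then 1 else 0

@[fun_prop]
theorem cubeBounded_solo (K k : ℝ) (θ : ℝ^d) (U : Matrix (Fin d) (Fin H) ℝ) (h : Fin H) :
    CubeBounded (fun x => solo K k θ U h x) := by
  classical
  have h1 : MeasurableSet {x : ℝ^d | hits U h x = 1} :=
    measurableSet_eq_fun (cubeBounded_hits U h).1 measurable_const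
  have h2 : MeasurableSet {x : ℝ^d | numAct x ≤ 16 * K * k} :=
    measurableSet_le CubeBounded.numAct.1 measurable_const
  have h3 : MeasurableSet {x : ℝ^d | |dot θ x| ≤ 16 * K ^ 2} :=
    measurableSet_le (CubeBounded.dot θ).abs.1 measurable_const
  exact CubeBounded.indicator (h1.inter (h2.inter h3)) (CubeBounded.const 1)

/-- A union bound on the event that feature `i` is active. A second hit costs at most `1 / 4` of the
rate, too many active features at most `1 / 8` by Markov's inequality, and a large signal at most `1
/ 64` by Chebyshev's. -/
theorem FeatureBounds.le_integral_act_mul_solo {K k : ℝ} {law : Measure ℝ}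
    (hL : FeatureBounds K k d law) {θ : ℝ^d} (hθ : ∀ i, |θ i| ≤ K)
    {U : Matrix (Fin d) (Fin H) ℝ} {h : Fin H} (hp : (colSupp U h : ℝ) * rate law ≤ 1 / 4)
    {i : Fin d} (hi : U i h ≠ 0) :
    rate law / 2 ≤ ∫ x, act (x i) * solo K k θ U h x ∂vecLaw d law := by
  have hK := hL.one_le_K
  have hk := hL.one_le_k
  have hd := hL.d_pos
  have hr := hL.rate_pos
  set F := fun x : ℝ^d => act (x i) - (∑ j, if j = i then 0 else act (U j h) * (act (x i) * act (x j))) -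
    act (x i) * numAct x / (16 * K * k) - act (x i) * dot θ x ^ 2 / (16 * K ^ 2) ^ 2 with hF
  have hsplit : ∀ j, CubeBounded fun x : ℝ^d =>
      if j = i then 0 else act (U j h) * (act (x i) * act (x j)) := fun j => by
    split_ifs <;> fun_prop
  have hcF : CubeBounded F := by
    refine CubeBounded.sub (CubeBounded.sub (CubeBounded.sub (by fun_prop) ?_) (by fun_prop))
      (by fun_prop)
    exact CubeBounded.sum _ hsplit
  have h1 : ∫ x, F x ∂vecLaw d law ≤ ∫ x, act (x i) * solo K k θ U h x ∂vecLaw d law := by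
    refine hL.integral_mono (hF := hcF) fun x _ => ?_
    have hn := numAct_nonneg x
    have a1 : 0 ≤ ∑ j, if j = i then 0 else act (U j h) * (act (x i) * act (x j)) :=
      sum_nonneg fun j _ => by
        split_ifs
        · exact le_rfl
        · exact mul_nonneg (act_nonneg _) (mul_nonneg (act_nonneg _) (act_nonneg _))
    have a2 : 0 ≤ act (x i) * numAct x / (16 * K * k) :=
      div_nonneg (mul_nonneg (act_nonneg _) hn) (by positivity)
    have a3 : 0 ≤ act (x i) * dot θ x ^ 2 / (16 * K ^ 2) ^ 2 :=
      div_nonneg (mul_nonneg (act_nonneg _) (sq_nonneg _)) (by positivity)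
    rcases act_eq (x i) with e | e
    · simp only [hF, e]; simp
    by_cases hs : hits U h x = 1 ∧ calm K k θ x
    · rw [solo, if_pos hs, mul_one]
      simp only [hF]; linarith
    rw [solo, if_neg hs, mul_zero]
    by_cases hh : hits U h x = 1
    · by_cases hnum : numAct x ≤ 16 * K * k
      · have ht : 16 * K ^ 2 < |dot θ x| := by
          by_contra hle
          exact hs ⟨hh, hnum, not_lt.1 hle⟩
        have : 1 ≤ act (x i) * dot θ x ^ 2 / (16 * K ^ 2) ^ 2 := by
          rw [e, one_mul, one_le_div (by positivity), ← sq_abs (dot θ x)]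
          exact pow_le_pow_left₀ (by positivity) ht.le 2
        simp only [hF]; linarith
      · have : 1 ≤ act (x i) * numAct x / (16 * K * k) := by
          rw [e, one_mul, one_le_div (by positivity)]
          exact (not_le.1 hnum).le
        simp only [hF]; linarith
    · have hval : hits U h x = 1 + ∑ j, if j = i then 0 else act (U j h) * (act (x i) * act (x j)) := by
        have : (1 : ℝ) = ∑ j, if j = i then act (U j h) * act (x j) else 0 := by
          simp [act_of_ne hi, e]
        rw [this, ← sum_add_distrib, hits]
        refine sum_congr rfl fun j _ => ?_
        rw [e]; split_ifs <;> simp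
      have : 2 ≤ hits U h x := by
        rcases hits_cases U h x with ⟨h0, -⟩ | ⟨h0, -⟩ | h0
        · linarith
        · exact absurd h0 hh
        · exact h0
      simp only [hF]; linarith
  refine le_trans ?_ h1
  have e1 : ∫ x, F x ∂vecLaw d law = rate law -
      (∑ j, ∫ x, (if j = i then 0 else act (U j h) * (act (x i) * act (x j))) ∂vecLaw d law) -
      (∫ x, act (x i) * numAct x ∂vecLaw d law) / (16 * K * k) -
      (∫ x, act (x i) * dot θ x ^ 2 ∂vecLaw d law) / (16 * K ^ 2) ^ 2 := by
    simp only [hF]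
    rw [hL.integral_sub (CubeBounded.sub (CubeBounded.sub (by fun_prop) (CubeBounded.sum _ hsplit))
      (by fun_prop)), hL.integral_sub (CubeBounded.sub (by fun_prop)
      (CubeBounded.sum _ hsplit)), hL.integral_sub (hG := CubeBounded.sum _ hsplit), hL.integral_act, hL.integral_sum hsplit, integral_div,
      integral_div]
  have e2 : ∑ j, ∫ x, (if j = i then 0 else act (U j h) * (act (x i) * act (x j))) ∂vecLaw d law ≤
      rate law * (1 / 4) := by
    refine le_trans ?_ (mul_le_left hp hr.le)
    rw [colSupp_eq, sum_mul, mul_sum]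
    refine sum_le_sum fun j _ => ?_
    by_cases hj : j = i
    · simp only [hj, if_true, integral_zero]
      exact mul_nonneg hr.le (mul_nonneg (act_nonneg _) hr.le)
    · simp only [if_neg hj]
      rw [integral_const_mul, hL.integral_act_mul (Ne.symm hj)]
      exact le_of_eq (by ring)
  have e3 : (∫ x, act (x i) * numAct x ∂vecLaw d law) / (16 * K * k) ≤ rate law * (1 / 8) := by
    rw [div_le_iff₀ (by positivity)]
    refine (hL.integral_act_mul_numAct_le i).trans ?_
    have h2 := hL.d_mul_rate_le
    have h3 : 1 ≤ K * k := one_le_mul_of_one_le_of_one_le hK hk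
    have := mul_le_left (by linarith : 1 + d * rate law ≤ 2 * (K * k)) hr.le
    linarith
  have e4 : (∫ x, act (x i) * dot θ x ^ 2 ∂vecLaw d law) / (16 * K ^ 2) ^ 2 ≤ rate law * (1 / 64) := by
    rw [div_le_iff₀ (by positivity)]
    refine (hL.integral_act_mul_sq_form_le i θ).trans ?_
    have h2 := hL.integral_sq_dot_le hθ
    simp only [dot] at h2
    rw [hL.integral_sq_form] at h2
    have h3 : θ i ^ 2 ≤ K ^ 2 := sq_le_of_abs_le (hθ i)
    have h4 : K ^ 2 ≤ K ^ 4 := pow_le_pow_right₀ hK (by norm_num)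
    have h5 : K ^ 3 ≤ K ^ 4 := pow_le_pow_right₀ hK (by norm_num)
    have := mul_le_left (a := 2 * rate law) (by linarith : θ i ^ 2 + energy law * ∑ j, θ j ^ 2 ≤ 2 * K ^ 4)
    linarith
  rw [e1]
  linarith

end

/-! ### Total strengths of networks with nearly optimal risk. -/

section

/-- The truncation of `s / Q` to `[-1, 1]`. -/
def clip (Q s : ℝ) : ℝ := max (-1) (min 1 (s / Q))

/-- A tent of height one supported on `[-B, B]`. -/
def tent (B t : ℝ) : ℝ := max (1 - |t| / B) 0

theorem abs_clip_le_one (Q s : ℝ) : |clip Q s| ≤ 1 :=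
  abs_le.2 ⟨le_max_left _ _, max_le (by norm_num) (min_le_left _ _)⟩

theorem clip_mono {Q : ℝ} (hQ : 0 < Q) : Monotone (clip Q) := fun a b h => by unfold clip; gcongr

theorem clip_eq {Q s : ℝ} (hQ : 0 < Q) (hs : |s| ≤ Q) : clip Q s = s / Q := by
  have h := abs_le.1 hs
  rw [clip, min_eq_right ((div_le_one hQ).2 h.2), max_eq_right]
  rw [le_div_iff₀ hQ]; linarith

/-- The test function `clip (b · x) * tent (θ · x)` is to correlate with each coordinate of `x`;
here one coordinate adds `u` to the former form and `v` to the latter. The clip gains `u / Q` where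
`|s| ≤ Q - 1` and never moves against `u`, whereas the tent changes by at most `K |u| / B`.
Indicators of bounded `s` and `t` are replaced by quadratic minorants, so that second moments
suffice. -/
theorem clip_mul_tent_ge {Q B K s t u v : ℝ} (hQ : 1 < Q) (hB : 0 < B) (hu : |u| ≤ 1)
    (hv : |v| ≤ K * |u|) :
    u * (clip Q s * tent B t) + u ^ 2 * ((3 / 4 - s ^ 2 / (Q - 1) ^ 2 - t ^ 2 / B ^ 2) / Q - K / B) ≤
      u * (clip Q (s + u) * tent B (t + v)) := by
  have hQ0 : 0 < Q := by linarith
  have ht0 : 0 ≤ tent B t := le_max_right _ _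
  have h1 : |tent B (t + v) - tent B t| ≤ K * |u| / B := by
    refine (abs_max_sub_max_le_abs _ _ _).trans ?_
    rw [show 1 - |t + v| / B - (1 - |t| / B) = (|t| - |t + v|) / B by ring, abs_div, abs_of_pos hB]
    refine div_le_div_of_nonneg_right ((abs_abs_sub_abs_le _ _).trans ?_) hB.le
    rwa [show t - (t + v) = -v by ring, abs_neg]
  have h2 : -(u ^ 2 * (K / B)) ≤ u * clip Q (s + u) * (tent B (t + v) - tent B t) := by
    refine (abs_le.1 (?_ : |_| ≤ _)).1
    rw [abs_mul, abs_mul]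
    have h3 := mul_le_mul (mul_le_of_le_one_right (abs_nonneg u) (abs_clip_le_one Q (s + u))) h1
      (abs_nonneg _) (abs_nonneg _)
    refine h3.trans (le_of_eq ?_)
    rw [← sq_abs u]; ring
  have h4 : 0 ≤ u * (clip Q (s + u) - clip Q s) := by
    rcases le_total 0 u with h | h
    · exact mul_nonneg h (sub_nonneg.2 (clip_mono hQ0 (by linarith)))
    · exact mul_nonneg_of_nonpos_of_nonpos h (sub_nonpos.2 (clip_mono hQ0 (by linarith)))
  have h5 : u ^ 2 * ((3 / 4 - s ^ 2 / (Q - 1) ^ 2 - t ^ 2 / B ^ 2) / Q) ≤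
      u * (clip Q (s + u) - clip Q s) * tent B t := by
    have hu2 : 0 ≤ u ^ 2 / Q := by positivity
    have ht2 : 0 ≤ t ^ 2 / B ^ 2 := by positivity
    rw [show u ^ 2 * ((3 / 4 - s ^ 2 / (Q - 1) ^ 2 - t ^ 2 / B ^ 2) / Q) =
      u ^ 2 / Q * (3 / 4 - s ^ 2 / (Q - 1) ^ 2 - t ^ 2 / B ^ 2) by ring]
    by_cases hs : |s| ≤ Q - 1
    · rw [clip_eq hQ0 (hs.trans (by linarith)), clip_eq hQ0 ((abs_add_le _ _).trans (by linarith)),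
        show u * ((s + u) / Q - s / Q) = u ^ 2 / Q by ring]
      refine mul_le_left ?_ hu2
      have h6 : |t| / B ≤ 1 / 4 + t ^ 2 / B ^ 2 := by
        rw [← sq_abs t, ← div_pow]
        nlinarith [sq_nonneg (|t| / B - 1 / 2)]
      have h7 : 1 - |t| / B ≤ tent B t := le_max_left _ _
      have h8 : 0 ≤ s ^ 2 / (Q - 1) ^ 2 := by positivity
      linarith
    · refine le_trans (mul_nonpos_of_nonneg_of_nonpos hu2 ?_) (mul_nonneg h4 ht0)
      have : 1 ≤ s ^ 2 / (Q - 1) ^ 2 := by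
        rw [one_le_div (by nlinarith), ← sq_abs s]
        exact pow_le_pow_left₀ (by linarith) (not_le.1 hs).le 2
      linarith
  linarith

variable {d : ℕ}

/-- A linear form of the features that is small where the signal is bounded has small coefficients. -/
theorem FeatureBounds.sum_abs_le_integral {K k : ℝ} {law : Measure ℝ} (hL : FeatureBounds K k d law)
    {θ : ℝ^d} (hθ : ∀ i, |θ i| ≤ K) (a : ℝ^d) :
    1 / (2 * (1 + 4 * K) * K * d) * ∑ i, |a i| ≤
      ∫ x, (if |dot θ x| ≤ 8 * K * (1 + 4 * K) then |dot a x| else 0) ∂vecLaw d law := by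
  classical
  have hK := hL.one_le_K
  have hd := hL.d_pos
  -- With these values the two normalised second moments are at most `1 / 16` each and `K / B = 1 /
  -- (8 Q)`, so that of `3 / 4` at least `1 / 2` remains.
  set Q := 1 + 4 * K with hQ
  set B := 8 * K * Q with hB
  have hQ1 : 1 < Q := by linarith
  have hQ0 : 0 < Q := by linarith
  have hB0 : 0 < B := by positivity
  -- The signs of `a`: every term of the linear form then correlates positively with the test
  -- function, and the contributions `|a i|` add up. The value at zero is immaterial but must have
  -- modulus one.
  set b : ℝ^d := fun i => if 0 ≤ a i then 1 else -1 with hb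
  have hb1 : ∀ i, |b i| = 1 := fun i => by simp only [hb]; split_ifs <;> simp
  have hab : ∀ i, a i = |a i| * b i := fun i => by
    simp only [hb]
    split_ifs with h
    · rw [abs_of_nonneg h, mul_one]
    · rw [abs_of_neg (not_le.1 h)]; ring
  have hcc : Continuous (clip Q) := by unfold clip; fun_prop
  have hct : Continuous (tent B) := by unfold tent; fun_prop
  have hcw : ∀ b θ : ℝ^d, CubeBounded fun x => clip Q (dot b x) * tent B (dot θ x) :=
    fun b θ => ((CubeBounded.dot b).comp_continuous hcc).mul ((CubeBounded.dot θ).comp_continuous hct)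
  have hi : ∀ i, 1 / (2 * Q * K * d) ≤
      ∫ x, b i * x i * (clip Q (dot b x) * tent B (dot θ x)) ∂vecLaw d law := fun i => by
    set b' := update b i 0 with hb'
    set θ' := update θ i 0 with hθ'
    have hle : ∫ x, (b i * (x i * (clip Q (dot b' x) * tent B (dot θ' x))) +
        x i ^ 2 * ((3 / 4 - dot b' x ^ 2 / (Q - 1) ^ 2 - dot θ' x ^ 2 / B ^ 2) / Q - K / B))
        ∂vecLaw d law ≤ ∫ x, b i * x i * (clip Q (dot b x) * tent B (dot θ x)) ∂vecLaw d law := by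
      refine hL.integral_mono (hF := (CubeBounded.mul (by fun_prop) ((CubeBounded.coord i).mul
        (hcw b' θ'))).add (by fun_prop)) (hG := CubeBounded.mul (by fun_prop) (hcw b θ)) fun x hx => ?_
      have h1 : |b i * x i| ≤ 1 := by rw [abs_mul, hb1, one_mul]; exact hx.abs_le i
      have h2 : |θ i * x i| ≤ K * |b i * x i| := by
        rw [abs_mul, abs_mul, hb1, one_mul]
        exact mul_le_right (hθ i) (abs_nonneg _)
      have h3 := clip_mul_tent_ge (s := dot b' x) (t := dot θ' x) hQ1 hB0 h1 h2
      rw [← dot_eq_add, ← dot_eq_add, mul_pow, ← sq_abs (b i), hb1] at h3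
      linarith
    refine le_trans ?_ hle
    rw [hL.integral_add (CubeBounded.mul (by fun_prop) ((CubeBounded.coord i).mul (hcw b' θ'))), integral_const_mul]
    -- Once coordinate `i` is removed from the test function, the first-order term has mean zero,
    -- and only the second-order term remains.
    have e1 := hL.integral_coord_mul i (φ := fun y => y) measurable_id (hcw b' θ').1 fun x y => by
      rw [dot_update_zero_update, dot_update_zero_update]
    rw [hL.integral_id_law, zero_mul] at e1
    rw [e1, hL.integral_sq_coord_mul i (CubeBounded.sub (CubeBounded.div_const (by fun_prop) _)
      (by fun_prop)).1 fun x y => by rw [dot_update_zero_update, dot_update_zero_update],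
      hL.integral_sub, integral_div,
      hL.integral_sub, hL.integral_sub,
      hL.integral_const, hL.integral_const, integral_div, integral_div, mul_zero, zero_add]
    have hupd : ∀ (T : ℝ^d) (M : ℝ), (∀ j, |T j| ≤ M) → ∀ j, |update T i 0 j| ≤ M :=
      fun T M h j => by
        by_cases hj : j = i
        · subst hj; rw [update_self, abs_zero]; exact (abs_nonneg _).trans (h j)
        · rw [update_of_ne hj]; exact h j
    have q1 : (∫ x, dot b' x ^ 2 ∂vecLaw d law) / (Q - 1) ^ 2 ≤ 1 / 16 := by
      rw [div_le_iff₀ (by nlinarith)]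
      refine (hL.integral_sq_dot_le (hupd b 1 fun j => (hb1 j).le)).trans ?_
      rw [hQ]; nlinarith
    have q2 : (∫ x, dot θ' x ^ 2 ∂vecLaw d law) / B ^ 2 ≤ 1 / 16 := by
      rw [div_le_iff₀ (by positivity)]
      refine (hL.integral_sq_dot_le (hupd θ K hθ)).trans ?_
      have h1 : K ^ 3 ≤ K ^ 4 := pow_le_pow_right₀ hK (by norm_num)
      have h2 : (32 * K ^ 2) ^ 2 ≤ B ^ 2 :=
        pow_le_pow_left₀ (by positivity) (by rw [hB, hQ]; nlinarith) 2
      have h3 : (32 * K ^ 2) ^ 2 = 1024 * K ^ 4 := by ring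
      have h4 : K * K ^ 2 = K ^ 3 := by ring
      have h5 : 0 ≤ K ^ 4 := by positivity
      linarith
    have q3 : K / B = 1 / 8 / Q := by rw [hB]; field_simp
    have q4 : 1 / 2 / Q ≤ (3 / 4 - (∫ x, dot b' x ^ 2 ∂vecLaw d law) / (Q - 1) ^ 2 -
        (∫ x, dot θ' x ^ 2 ∂vecLaw d law) / B ^ 2) / Q - K / B := by
      rw [q3, ← sub_div]
      exact div_le_div_of_nonneg_right (by linarith) hQ0.le
    have q5 := mul_le_mul hL.var_lower q4 (by positivity) hL.energy_pos.le
    refine le_trans (le_of_eq ?_) q5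
    field_simp
  have hsum : ∫ x, dot a x * (clip Q (dot b x) * tent B (dot θ x)) ∂vecLaw d law =
      ∑ i, |a i| * ∫ x, b i * x i * (clip Q (dot b x) * tent B (dot θ x)) ∂vecLaw d law := by
    simp only [← integral_const_mul]
    rw [← hL.integral_sum fun i => CubeBounded.mul (by fun_prop) (CubeBounded.mul (by fun_prop)
      (hcw b θ))]
    refine integral_congr_ae (ae_of_all _ fun x => ?_)
    simp only [dot, sum_mul]
    refine sum_congr rfl fun i _ => ?_
    nth_rewrite 1 [hab i]; ring
  refine le_trans (?_ : _ ≤ ∫ x, dot a x * (clip Q (dot b x) * tent B (dot θ x)) ∂vecLaw d law) ?_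
  · rw [hsum, mul_sum]
    refine sum_le_sum fun i _ => ?_
    rw [mul_comm]
    exact mul_le_left (hi i) (abs_nonneg _)
  · have hms : MeasurableSet {x : ℝ^d | |dot θ x| ≤ B} :=
      measurableSet_le (CubeBounded.dot θ).abs.1 measurable_const
    refine hL.integral_mono (hF := CubeBounded.mul (by fun_prop) (hcw b θ)) (hG := CubeBounded.indicator hms (by fun_prop)) fun x _ => ?_
    have ht1 : tent B (dot θ x) ≤ 1 := max_le (by
      have : 0 ≤ |dot θ x| / B := by positivity
      linarith) zero_le_one
    split_ifs with h
    · refine (le_abs_self _).trans ?_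
      have ht0 : 0 ≤ tent B (dot θ x) := le_max_right _ _
      rw [abs_mul, abs_mul, abs_of_nonneg ht0]
      exact mul_le_of_le_one_right (abs_nonneg _) (mul_le_one₀ (abs_clip_le_one _ _)
        (le_max_right _ _) ht1)
    · have : tent B (dot θ x) = 0 := max_eq_right (by
        have := (one_le_div hB0).2 (not_le.1 h).le
        linarith)
      rw [this, mul_zero, mul_zero]

section

variable {P : Model} {K c γ : ℝ} {n : ℕ} {N : P.Net n}

theorem Model.overlapLoss_eq (hk : 0 < P.k n) : P.overlapLoss n N γ =
    P.k n ^ 2 * √(P.k n) / (P.d n : ℝ) ^ 2 * (γ * ∑ h, (colSupp Φ N h : ℝ) *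
      (colSupp Φ N h - 1)) + P.k n * √(P.k n) / (P.d n : ℝ) ^ 3 *
      (γ * ∑ h, (colSupp Φ N h : ℝ)) := by
  have hs := sqrt_pos.2 hk
  have e : P.k n = √(P.k n) * √(P.k n) := (mul_self_sqrt hk.le).symm
  rw [Model.overlapLoss]
  simp only [mul_sum, ← sum_add_distrib]
  refine sum_congr rfl fun h _ => ?_
  set r := √(P.k n)
  rw [e]
  field_simp

theorem Model.ClassAt.sum_colSupp_mul_le (hC : P.ClassAt K c n N γ) :
    γ * ∑ h, (colSupp Φ N h : ℝ) * (colSupp Φ N h - 1) ≤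
      P.m n * (γ * ∑ h, (colSupp Φ N h : ℝ)) := by
  have hγ := hC.scale_pos
  rw [mul_left_comm]
  refine mul_le_left ?_ hγ.le
  rw [mul_sum]
  refine sum_le_sum fun h _ => ?_
  rw [mul_comm]
  have : (colSupp Φ N h : ℝ) ≤ P.m n := by exact_mod_cast hC.few_features h
  exact mul_le_right (by linarith) (Nat.cast_nonneg _)

end

/-- The total strengths of a network with nearly optimal risk are close to the true coefficient. -/
theorem Model.exists_sum_abs_sub_le (P : Model) (hs : 0 < P.s) (τ : Task) {K : ℝ} (hK : 1 ≤ K) {η : ℝ}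
    (hη : 0 < η) : ∃ c₀ > 0, ∃ δ > 0, ∀ (n : ℕ) (c γ : ℝ) (N : P.Net n),
    P.RegimeAt K c n → P.ClassAt K c n N γ → SmallRatio K P.ζ c → c ≤ c₀ →
    P.m n * (P.k n ^ 2 * √(P.k n)) ≤ 6 * P.d n →
    P.advRisk τ n N ≤ bayesRisk τ P.s (P.law n) (P.θ₀ n) + δ →
    ∑ i, |P.strength n N i - P.θ₀ n i| ≤ η * P.d n := by
  set B := 8 * K * (1 + 4 * K) with hB
  set w : ℝ := 1 / (2 * (1 + 4 * K) * K) with hw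
  have hw0 : 0 < w := by positivity
  obtain ⟨δ, hδ, hclose⟩ := integral_abs_sub_le_of_risk_le τ hs B (η := w * η / 4) (by positivity)
  set C₃ : ℝ := K * ((3 + K) * K ^ 2) * (7 * K) with hC₃
  have hC₃0 : 0 < C₃ := by positivity
  refine ⟨min (w / (2 * C₃)) (w * η / (4 * (C₃ * K))), by positivity, δ, hδ,
    fun n c γ N hR hC hc hcc hmk hrisk => ?_⟩
  have hL := hR.feature
  have hd := hL.d_pos
  have hk := hL.one_le_k
  have hγ := hC.scale_pos
  have hc0 := hc.pos
  have hcK : c * K ≤ 1 := by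
    have : c * K ≤ c * K ^ 2 := mul_le_left (by nlinarith) hc0.le
    linarith [hc.size]
  set T := P.strength n N with hT
  set S := ∑ i, |T i - P.θ₀ n i| with hS
  have hcE := Model.cubeBounded_meanEval N
  have h1 : ∫ x, (if |dot (P.θ₀ n) x| ≤ B then |P.meanEval n N x - dot (P.θ₀ n) x| else 0)
      ∂P.vecLaw n ≤ w * η / 4 := by
    -- The zero test vector is used: only the averaged prediction matters here, not the
    -- displacement.
    refine hclose hL hcE (le_trans (le_of_eq ?_) ((hR.integral_profile_mean_le_advRisk N τ
      (hC.weights_ne_zero hR.toBoundsAt) hC.same_sign (hC.attack_mul_colNorm_le hR hc0.le hcK)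
      (w := fun _ _ => 0) (fun i => CubeBounded.const 0) fun x => by simp).trans hrisk))
    simp
  set Ov := fun x => ∑ h, overlap (1 / (P.d n : ℝ) ^ 2) Φ N h x with hOv
  have hcOv : CubeBounded Ov := by fun_prop
  have h2 := hL.sum_abs_le_integral (fun i => (hR.coeff i).2) fun i => T i - P.θ₀ n i
  have hms : MeasurableSet {x : ℝ^(P.d n) | |dot (P.θ₀ n) x| ≤ B} :=
    measurableSet_le (CubeBounded.dot _).abs.1 measurable_const
  have hc1 : CubeBounded fun x => if |dot (P.θ₀ n) x| ≤ B then
      |P.meanEval n N x - dot (P.θ₀ n) x| else 0 := CubeBounded.indicator hms (by fun_prop)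
  have h3 : ∫ x, (if |dot (P.θ₀ n) x| ≤ B then |dot (fun i => T i - P.θ₀ n i) x| else 0)
      ∂P.vecLaw n ≤
      ∫ x, ((if |dot (P.θ₀ n) x| ≤ B then |P.meanEval n N x - dot (P.θ₀ n) x| else 0) +
        c * K * (γ / √(P.k n)) * ((1 + numAct x) * Ov x)) ∂P.vecLaw n := by
    refine hL.integral_mono (hF := CubeBounded.indicator hms (by fun_prop)) (hG := hc1.add (by fun_prop))
      fun x hx => ?_
    have hOv0 : 0 ≤ Ov x := sum_nonneg fun h _ => overlap_nonneg (by positivity) _ _ _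
    have a1 := hC.abs_meanEval_sub_le hR hc hx
    have a2 : Ov x ≤ (1 + numAct x) * Ov x :=
      le_mul_of_one_le_left hOv0 (by linarith [numAct_nonneg x])
    have a3 := mul_le_left (a := c * K * (γ / √(P.k n))) a2
    have e : c * K * γ / √(P.k n) = c * K * (γ / √(P.k n)) := by ring
    rw [e] at a1
    have a0 := (abs_nonneg _).trans a1
    split_ifs
    · rw [← dot_sub]
      have a4 := abs_sub_le (dot T x) (P.meanEval n N x) (dot (P.θ₀ n) x)
      rw [abs_sub_comm (dot T x) (P.meanEval n N x)] at a4
      have a5 : |P.meanEval n N x - dot T x| ≤ c * K * (γ / √(P.k n)) * Ov x := a1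
      linarith
    · have a5 : 0 ≤ c * K * (γ / √(P.k n)) * Ov x := a0
      linarith
  rw [hL.integral_add hc1, integral_const_mul] at h3
  have h4 := hC.integral_sum_overlap_le hR.toBoundsAt
  obtain ⟨h5, -⟩ := hC.colSupp_bounds (by linarith)
  set G := γ * ∑ h, (colSupp Φ N h : ℝ) with hG
  have hG0 : 0 ≤ G := by positivity
  have hST : ∑ i, |T i| ≤ S + K * P.d n := by
    have : ∑ i, |T i| ≤ ∑ i, (|T i - P.θ₀ n i| + K) := sum_le_sum fun i _ => by
      have := abs_sub_abs_le_abs_sub (T i) (P.θ₀ n i)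
      linarith [(hR.coeff i).2]
    refine this.trans (le_of_eq ?_)
    rw [sum_add_distrib, sum_const, card_univ, Fintype.card_fin, nsmul_eq_mul]
    ring
  have hloss : P.overlapLoss n N γ ≤ 7 / P.d n * G := by
    rw [Model.overlapLoss_eq (by linarith)]
    have b1 := mul_le_left (a := P.k n ^ 2 * √(P.k n) / (P.d n : ℝ) ^ 2) hC.sum_colSupp_mul_le
    have b2 : P.k n ^ 2 * √(P.k n) / (P.d n : ℝ) ^ 2 * (P.m n * G) ≤ 6 / P.d n * G := by
      rw [← mul_assoc]
      refine mul_le_right ?_ hG0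
      rw [div_mul_eq_mul_div, div_le_div_iff₀ (by positivity) hd]
      have := mul_le_right hmk hd.le
      linarith
    have b3 : P.k n * √(P.k n) / (P.d n : ℝ) ^ 3 * G ≤ 1 / P.d n * G := by
      refine mul_le_right ?_ hG0
      rw [div_le_div_iff₀ (by positivity) hd]
      have c1 : √(P.k n) ≤ P.d n := sqrt_le_iff.2
        ⟨hd.le, hL.k_le.trans (by nlinarith [hk, hL.k_le])⟩
      have c2 := mul_le_mul hL.k_le c1 (sqrt_nonneg _) hd.le
      have c3 := mul_le_right c2 hd.le
      linarith
    have e : 7 / P.d n * G = 6 / P.d n * G + 1 / P.d n * G := by ring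
    rw [e]
    linarith
  have h6 : (c * K) * (γ / √(P.k n) * ∫ x, (1 + numAct x) * Ov x ∂P.vecLaw n)
      ≤ c * C₃ * (S + K * P.d n) / P.d n := by
    have b1 : P.overlapLoss n N γ ≤ 7 / P.d n * (K * (S + K * P.d n)) :=
      hloss.trans (mul_le_left (h5.trans (mul_le_left hST
        (by linarith))))
    have b2 := mul_le_left (a := c * K) (h4.trans (mul_le_left (a := (3 + K) * K ^ 2) b1))
    refine b2.trans (le_of_eq ?_)
    rw [hC₃]; ring
  have h7 : w * S / P.d n ≤ w * η / 4 + c * C₃ * (S + K * P.d n) / P.d n := by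
    have e : 1 / (2 * (1 + 4 * K) * K * P.d n) * S = w * S / P.d n := by rw [hw]; field_simp
    rw [← e]
    linarith
  have hS0 : 0 ≤ S := sum_nonneg fun i _ => abs_nonneg _
  -- The overlap error is bounded through the strengths themselves, hence through `S`; a small ratio
  -- `c` lets half of `w S` on the left absorb it.
  have h8 : c * C₃ ≤ w / 2 := by
    have := (le_div_iff₀ (by positivity)).1 (hcc.trans (min_le_left _ _))
    linarith
  have h9 : c * C₃ * K ≤ w * η / 4 := by
    have := (le_div_iff₀ (by positivity)).1 (hcc.trans (min_le_right _ _))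
    linarith
  rw [← mul_le_mul_iff_of_pos_right hd, add_mul, div_mul_cancel₀ _ hd.ne',
    div_mul_cancel₀ _ hd.ne'] at h7
  have h10 := mul_le_right h8 hS0
  have h11 := mul_le_right h9 hd.le
  have h12 : w * S ≤ w * (η * P.d n) := by linarith
  exact le_of_mul_le_mul_left h12 hw0

end

/-! ### The expected waste of mixed nodes. -/

section

variable {d H : ℕ}

/-- The indicator that node `h` sees exactly one active feature and that `g` selects this feature,
for a calm feature vector. -/
def pick (K k : ℝ) (θ g : ℝ^d) (U : Matrix (Fin d) (Fin H) ℝ) (h : Fin H) (x : ℝ^d) : ℝ :=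
  ∑ i, g i * act (U i h) * (act (x i) * solo K k θ U h x)

@[fun_prop]
theorem cubeBounded_pick (K k : ℝ) (θ g : ℝ^d) (U : Matrix (Fin d) (Fin H) ℝ) (h : Fin H) :
    CubeBounded (fun x => pick K k θ g U h x) := by unfold pick; fun_prop

theorem pick_cases (K k : ℝ) (θ : ℝ^d) {g : ℝ^d} (hg : ∀ i, g i = 0 ∨ g i = 1)
    (U : Matrix (Fin d) (Fin H) ℝ) (h : Fin H) (x : ℝ^d) :
    pick K k θ g U h x = 0 ∨ (pick K k θ g U h x = 1 ∧ hits U h x = 1 ∧ calm K k θ x) := by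
  by_cases hs : hits U h x = 1 ∧ calm K k θ x
  · obtain ⟨m, hm⟩ : ∃ m : ℕ, pick K k θ g U h x = m := by
      unfold pick solo
      refine exists_nat_eq_sum fun i => ?_
      rcases hg i with h1 | h1 <;> rcases act_eq (U i h) with h2 | h2 <;>
        rcases act_eq (x i) with h3 | h3 <;> simp [h1, h2, h3, hs]
    have h1 : pick K k θ g U h x ≤ 1 := by
      rw [← hs.1, pick, hits]
      refine sum_le_sum fun i _ => ?_
      rw [solo, if_pos hs, mul_one]
      refine mul_le_right (mul_le_of_le_one_left (act_nonneg _) ?_) (act_nonneg _)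
      rcases hg i with h1 | h1 <;> rw [h1]; norm_num
    rw [hm] at h1 ⊢
    have h2 : m ≤ 1 := by exact_mod_cast h1
    interval_cases m
    · left; simp
    · right; exact ⟨by simp, hs⟩
  · left; simp [pick, solo, hs]

/-- Distinct features of one node are never its only active one simultaneously, so `pick` is still
an indicator, and the lower bounds for single features add up. -/
theorem FeatureBounds.le_integral_pick {K k : ℝ} {law : Measure ℝ}
    (hL : FeatureBounds K k d law) {θ g : ℝ^d} (hθ : ∀ i, |θ i| ≤ K)
    (hg : ∀ i, g i = 0 ∨ g i = 1) {U : Matrix (Fin d) (Fin H) ℝ} {h : Fin H}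
    (hp : (colSupp U h : ℝ) * rate law ≤ 1 / 4) :
    (∑ i, g i * act (U i h)) * (rate law / 2) ≤ ∫ x, pick K k θ g U h x ∂vecLaw d law := by
  unfold pick
  rw [hL.integral_sum, sum_mul]
  refine sum_le_sum fun i _ => ?_
  rw [integral_const_mul]
  by_cases hi : U i h = 0
  · simp [hi, act_zero]
  · refine mul_le_left (hL.le_integral_act_mul_solo hθ hp hi)
      (mul_nonneg ?_ (act_nonneg _))
    rcases hg i with h1 | h1 <;> rw [h1]; norm_num

end

section

variable {P : Model} {K c γ : ℝ} {n : ℕ} {N : P.Net n}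

theorem Model.offNorm_nonneg (x : ℝ^(P.d n)) : 0 ≤ P.offNorm n N x := sqrt_nonneg _

/-- The expected norm of the useless part of the gradient, weighted by the local curvature. -/
def Model.wasted (P : Model) (n : ℕ) (N : P.Net n) : ℝ :=
  ∫ x, exp (-|dot (P.θ₀ n) x|) * P.offNorm n N x ∂P.vecLaw n

theorem Model.exp_mul_le {x : ℝ^(P.d n)} {A : ℝ} (hA : A ≤ P.offNorm n N x)
    (h : A = 0 ∨ calm K (P.k n) (P.θ₀ n) x) : exp (-(16 * K ^ 2)) * A ≤
      exp (-|dot (P.θ₀ n) x|) * P.offNorm n N x := by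
  rcases h with h | h
  · rw [h, mul_zero]; exact mul_nonneg (exp_nonneg _) (offNorm_nonneg x)
  · exact (mul_le_left hA (exp_nonneg _)).trans (mul_le_right
      (exp_le_exp.2 (neg_le_neg h.2)) (offNorm_nonneg x))

variable (hC : P.ClassAt K c n N γ) (hR : P.RegimeAt K c n) (hc : SmallRatio K P.ζ c)
include hC hR hc

/-- Screening and `1 ≤ c log d` give `k m ≤ c ^ 4 d`, while the rate is at most `K k / d`; a node
therefore expects few active features. -/
theorem Model.ClassAt.colSupp_mul_rate_le (h : Fin (P.H n)) :
    (colSupp Φ N h : ℝ) * rate (P.law n) ≤ 1 / 4 := by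
  have hL := hR.feature
  have hK := hL.one_le_K
  have hd := hL.d_pos
  have hk := hL.one_le_k
  have hc0 := hc.pos
  have hs : (colSupp Φ N h : ℝ) ≤ P.m n := by exact_mod_cast hC.few_features h
  have h1 : √(P.k n * P.m n) ≤ c ^ 2 * √(P.d n) := by
    have a1 := mul_le_left hR.screened hc0.le
    have a2 := mul_le_left hR.one_le_log (sqrt_nonneg (P.k n * P.m n))
    linarith
  have h2 : P.k n * P.m n ≤ c ^ 4 * P.d n := by
    have := pow_le_pow_left₀ (sqrt_nonneg _) h1 2
    rw [mul_pow, sq_sqrt (by positivity), sq_sqrt hd.le] at this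
    linarith
  have h3 : K * c ^ 4 ≤ 1 / 4 := by
    have a1 : c * K ≤ c * K ^ 2 := mul_le_left (by nlinarith) hc0.le
    have a2 : c ^ 3 ≤ 1 / 2 := (pow_le_of_le_one hc0.le (by linarith [hc.le_half])
      (by norm_num)).trans hc.le_half
    have a3 := mul_le_mul (a1.trans hc.size) a2 (by positivity) (by norm_num)
    linarith
  refine (mul_le_mul hs hL.rate_le hL.rate_pos.le (Nat.cast_nonneg _)).trans ?_
  rw [mul_div_assoc', div_le_iff₀ hd]
  have a1 := mul_le_left h2 (by linarith : 0 ≤ K)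
  have a2 := mul_le_right h3 hd.le
  linarith

/-- The `ℓ¹` bound of `le_offNorm` over all nodes. Its integral charges `s (s - 1)` for each node
and later absorbs the overlap loss when `ψ` does not. -/
theorem Model.ClassAt.le_wasted : exp (-(16 * K ^ 2)) * (γ / (2 * K) *
      ((∑ h, (colSupp Φ N h : ℝ) * (colSupp Φ N h - 1)) *
        (rate (P.law n) / 2) / √(P.d n))) ≤ P.wasted n N := by
  have hγ := hC.scale_pos
  have hL := hR.feature
  have hK := hL.one_le_K
  have hg : ∀ i : Fin (P.d n), (fun _ => 1 : ℝ^(P.d n)) i = 0 ∨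
      (fun _ => 1 : ℝ^(P.d n)) i = 1 := fun _ => Or.inr rfl
  set U := Φ N with hU
  have h1 : ∫ x, exp (-(16 * K ^ 2)) * (γ / (2 * K) * ((∑ h, ((colSupp U h : ℝ) - 1) *
      pick K (P.k n) (P.θ₀ n) (fun _ => 1) U h x) / √(P.d n))) ∂P.vecLaw n ≤
      P.wasted n N := by
    refine hL.integral_mono (hG := CubeBounded.mul (by fun_prop) (P.cubeBounded_offNorm n N))
      fun x hx => Model.exp_mul_le (hC.le_offNorm hR hc hx fun h =>
        (pick_cases K (P.k n) (P.θ₀ n) hg U h x).imp_right fun h => ⟨h.1, h.2.1⟩).1 ?_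
    by_cases hx : calm K (P.k n) (P.θ₀ n) x
    · exact Or.inr hx
    · left
      rw [sum_eq_zero fun h _ => ?_, zero_div, mul_zero]
      rw [(pick_cases K (P.k n) (P.θ₀ n) hg U h x).resolve_right fun h => hx h.2.2, mul_zero]
  refine le_trans ?_ h1
  rw [integral_const_mul, integral_const_mul, integral_div, hL.integral_sum, sum_mul]
  refine mul_le_left (mul_le_left (div_le_div_of_nonneg_right
    (sum_le_sum fun h _ => ?_) (sqrt_nonneg _))) (exp_nonneg _)
  have h2 := hL.le_integral_pick (fun i => (hR.coeff i).2) hg (hC.colSupp_mul_rate_le hR hc h)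
  have h3 : (1 : ℝ) ≤ colSupp U h := by exact_mod_cast one_le_colSupp (hC.nonzero h)
  simp only [one_mul] at h2
  rw [integral_const_mul, mul_comm (colSupp U h : ℝ), mul_assoc]
  refine mul_le_left ?_ (by linarith)
  rwa [colSupp_eq]

/-- The integer bound of `le_offNorm` yields the root of `r S`, with `S` the number of selected
nodes. On calm vectors `S` is at most `B = 32 K ^ 3 k / γ`: each selected node puts weight at least
`γ / K` on an active feature of total strength at most `2 K`, and at most `16 K k` features are
active. Hence `√(r S) ≥ √(r / B) S`, which is linear in `S` and can be integrated. -/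
theorem Model.ClassAt.le_wasted_of_large {r : ℝ} (hr : 0 ≤ r) {a : ℝ^(P.H n)} {g : ℝ^(P.d n)}
    (ha : ∀ h, a h = 0 ∨ (a h = 1 ∧ r ≤ (colSupp Φ N h : ℝ) - 1))
    (hg : ∀ i, g i = 0 ∨ (g i = 1 ∧ |P.strength n N i| ≤ 2 * K)) :
    exp (-(16 * K ^ 2)) * (γ / (2 * K) * √(r / (32 * K ^ 3 * P.k n / γ)) *
      ((∑ h, a h * ∑ i, g i * act (Φ N i h)) * (rate (P.law n) / 2))) ≤
      P.wasted n N := by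
  have hγ := hC.scale_pos
  have hL := hR.feature
  have hK := hL.one_le_K
  have hk := hL.one_le_k
  have hg' : ∀ i, g i = 0 ∨ g i = 1 := fun i => (hg i).imp_right And.left
  have hg0 : ∀ i, 0 ≤ g i := fun i => by rcases hg' i with h | h <;> rw [h]; norm_num
  have ha0 : ∀ h, 0 ≤ a h := fun h => by rcases ha h with h | h <;> [rw [h]; (rw [h.1]; norm_num)]
  set U := Φ N with hU
  set S := fun x => ∑ h, a h * pick K (P.k n) (P.θ₀ n) g U h x with hS
  set B := 32 * K ^ 3 * P.k n / γ with hB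
  have hB0 : 0 < B := by positivity
  have h1 : ∫ x, exp (-(16 * K ^ 2)) * (γ / (2 * K) * √(r / B) * S x)
      ∂P.vecLaw n ≤ P.wasted n N := by
    refine hL.integral_mono (hG := CubeBounded.mul (by fun_prop) (P.cubeBounded_offNorm n N))
      fun x hx => ?_
    have hp := fun h => pick_cases K (P.k n) (P.θ₀ n) hg' U h x
    have hp0 : ∀ h, 0 ≤ pick K (P.k n) (P.θ₀ n) g U h x := fun h => by
      rcases hp h with h | h <;> [rw [h]; (rw [h.1]; norm_num)]
    by_cases hcx : calm K (P.k n) (P.θ₀ n) x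
    swap
    · refine Model.exp_mul_le ?_ (Or.inl ?_) <;>
      · have : S x = 0 := sum_eq_zero fun h _ => by
          rw [(hp h).resolve_right fun h => hcx h.2.2, mul_zero]
        rw [this, mul_zero]
        try exact Model.offNorm_nonneg x
    refine Model.exp_mul_le (le_trans ?_ (hC.le_offNorm hR hc hx
      (σ := fun h => a h * pick K (P.k n) (P.θ₀ n) g U h x) fun h => ?_).2) (Or.inr hcx)
    swap
    · rcases ha h with h1 | ⟨h1, -⟩ <;> rcases hp h with h2 | ⟨h2, h3, -⟩ <;> simp [h1, h2, ← hU]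
      exact h3
    rw [mul_assoc]
    refine mul_le_left ?_
    have hS0 : 0 ≤ S x := sum_nonneg fun h _ => mul_nonneg (ha0 h) (hp0 h)
    -- Double counting of the weight that selected nodes put on active features.
    have hSB : S x ≤ B := by
      rw [hB, le_div_iff₀ hγ]
      have b1 : ∀ h, a h * pick K (P.k n) (P.θ₀ n) g U h x * γ ≤
          ∑ i, K * (g i * act (x i) * |U i h|) := fun h => by
        have c1 : a h * pick K (P.k n) (P.θ₀ n) g U h x ≤ ∑ i, g i * act (U i h) * act (x i) := by
          refine (mul_le_of_le_one_left (hp0 h) ?_).trans ?_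
          · rcases ha h with h | h <;> [(rw [h]; norm_num); rw [h.1]]
          · refine sum_le_sum fun i _ => ?_
            refine mul_le_left (mul_le_of_le_one_right (act_nonneg _) ?_)
              (mul_nonneg (hg0 i) (act_nonneg _))
            unfold solo; split_ifs <;> norm_num
        refine (mul_le_right c1 hγ.le).trans ?_
        rw [sum_mul]
        refine sum_le_sum fun i _ => ?_
        by_cases hi : U i h = 0
        · simp [hi, act_zero]
        · have c2 := (hC.same_size i h hi).1
          rw [div_le_iff₀' (by linarith)] at c2
          have := mul_le_left c2 (mul_nonneg (hg0 i) (act_nonneg (x i)))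
          rw [act_of_ne hi, mul_one]
          linarith
      have b2 : S x * γ ≤ ∑ i, K * (g i * act (x i) * |P.strength n N i|) := by
        rw [hS, sum_mul]
        refine (sum_le_sum fun h _ => b1 h).trans (le_of_eq ?_)
        rw [sum_comm]
        simp only [hC.abs_strength_eq, mul_sum, ← hU]
      have b3 : ∑ i, K * (g i * act (x i) * |P.strength n N i|) ≤ ∑ i, 2 * K ^ 2 * act (x i) := by
        refine sum_le_sum fun i _ => ?_
        rcases hg i with h1 | ⟨h1, h2⟩
        · rw [h1, zero_mul, zero_mul, mul_zero]; exact mul_nonneg (by positivity) (act_nonneg _)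
        · have := mul_le_left h2
            (mul_nonneg (by linarith) (act_nonneg (x i)) : 0 ≤ K * act (x i))
          rw [h1]; linarith
      rw [← mul_sum _ _ (2 * K ^ 2)] at b3
      have b4 := mul_le_left (a := 2 * K ^ 2) hcx.1
      have b5 : ∑ i, act (x i) = numAct x := rfl
      rw [b5] at b3
      linarith
    refine le_sqrt_of_sq_le ?_
    rw [mul_pow, sq_sqrt (by positivity), div_mul_eq_mul_div, div_le_iff₀ hB0]
    have h2 : r * S x ≤ ∑ h, ((colSupp U h : ℝ) - 1) * (a h * pick K (P.k n) (P.θ₀ n) g U h x) := by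
      rw [hS, mul_sum]
      refine sum_le_sum fun h _ => ?_
      rcases ha h with h1 | ⟨-, h1⟩
      · simp [h1]
      · exact mul_le_right h1 (mul_nonneg (ha0 h) (hp0 h))
    have h3 := mul_le_mul h2 hSB hS0 ((mul_nonneg hr hS0).trans h2)
    linarith
  refine le_trans ?_ h1
  rw [integral_const_mul, integral_const_mul, hL.integral_sum, sum_mul]
  refine mul_le_left (mul_le_left (sum_le_sum fun h _ => ?_)) (exp_nonneg _)
  rw [integral_const_mul, mul_assoc]
  exact mul_le_left (hL.le_integral_pick (fun i => (hR.coeff i).2) hg'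
    (hC.colSupp_mul_rate_le hR hc h)) (ha0 h)

end

/-! ### Networks with a positive proportion of mixed nodes. -/

/-- If a positive proportion of the entries exceeds one, then large entries carry a positive
proportion of the total. -/
theorem exists_large_selection {H : ℕ} (hH : 0 < H) {s : Fin H → ℕ} (hs : ∀ h, 1 ≤ s h) {δ : ℝ}
    (hδ0 : 0 ≤ δ) (hδ1 : δ ≤ 1) (hδ : δ * H ≤ ({h | s h ≠ 1}.ncard : ℝ)) :
    ∃ a : Fin H → ℝ, (∀ h, a h = 0 ∨ (a h = 1 ∧ δ / 4 * ((∑ h, (s h : ℝ)) / H) ≤ (s h : ℝ) - 1)) ∧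
      δ / 2 * ∑ h, (s h : ℝ) ≤ ∑ h, a h * s h := by
  classical
  have hH' : (0 : ℝ) < H := by exact_mod_cast hH
  set R := (∑ h, (s h : ℝ)) / H with hR
  have hR0 : 0 ≤ R := by positivity
  have hRH : H * R = ∑ h, (s h : ℝ) := by rw [hR]; field_simp
  -- Entries that are at least two and not much below the mean `R`. For these `s - 1 ≥ s / 2`,
  -- whence the factor `δ / 4`.
  refine ⟨fun h => if 2 ≤ s h ∧ δ / 2 * R ≤ s h then 1 else 0, fun h => ?_, ?_⟩
  · by_cases h1 : 2 ≤ s h ∧ δ / 2 * R ≤ s h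
    · have h2 : (2 : ℝ) ≤ s h := by exact_mod_cast h1.1
      exact Or.inr ⟨if_pos h1, by linarith [h1.2]⟩
    · exact Or.inl (if_neg h1)
  -- Summed over `h`, the left side is at least the total, minus `(1 - δ) H`, minus `δ / 2` of the
  -- total; as `H` is at most the total, `δ / 2` of it remains.
  have h1 : ∀ h, (s h : ℝ) - 1 + (if s h ≠ 1 then 1 else 0) - δ / 2 * R ≤
      (if 2 ≤ s h ∧ δ / 2 * R ≤ s h then 1 else 0) * s h := fun h => by
    have h2 : 0 ≤ δ / 2 * R := by positivity
    by_cases h3 : s h = 1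
    · simp [h3]; linarith
    · have h4 : 2 ≤ s h := by have := hs h; omega
      by_cases h5 : δ / 2 * R ≤ s h
      · simp [h3, h4, h5]; linarith
      · simp [h3, h5]; linarith
  have h2 := sum_le_sum fun h (_ : h ∈ univ) => h1 h
  rw [sum_sub_distrib, sum_add_distrib, sum_sub_distrib, sum_boole,
    sum_const, sum_const, card_univ, Fintype.card_fin, nsmul_eq_mul,
    nsmul_eq_mul, mul_one] at h2
  have h3 : ({h | s h ≠ 1}.ncard : ℝ) = (Finset.univ.filter fun h => s h ≠ 1).card := by
    rw [← Set.ncard_coe_finset]; simp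
  rw [h3] at hδ
  have h4 : (H : ℝ) ≤ ∑ h, (s h : ℝ) := by
    have := sum_le_sum fun h (_ : h ∈ univ) => (by exact_mod_cast hs h : (1 : ℝ) ≤ s h)
    simpa using this
  have h5 := mul_le_left h4 (by linarith : 0 ≤ 1 - δ)
  have h6 : H * (δ / 2 * R) = δ / 2 * ∑ h, (s h : ℝ) := by rw [← hRH]; ring
  linarith

theorem half_le_log_sq {k : ℝ} (hk : 2 ≤ k) : 1 / 3 ≤ log k ^ 2 := by
  have h1 := Real.log_two_gt_d9
  have h2 := Real.log_le_log two_pos hk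
  nlinarith

theorem sq_mul_sqrt_le {k : ℝ} (hk : 1 ≤ k) :
    (k ≤ 2 → k ^ 2 * √k ≤ 3 * k) ∧ k ^ 2 * √k ≤ k ^ 3 := by
  have h1 : √k ≤ k := sqrt_le_iff.2 ⟨by linarith, by nlinarith⟩
  refine ⟨fun h => ?_, ?_⟩
  · have h2 : √k ≤ 3 / 2 := sqrt_le_iff.2 ⟨by norm_num, by linarith⟩
    have := mul_le_mul h h2 (sqrt_nonneg k) (by norm_num)
    nlinarith
  · have := mul_le_left h1 (sq_nonneg k)
    linarith

section

variable {P : Model} {K c γ δ : ℝ} {n : ℕ} {N : P.Net n}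

/-- Since the strengths are close to `θ₀` in `ℓ¹`, the total size of the supports is at least of
order `d / γ`. The large mixed nodes carry the proportion `δ / 2` of it, and features of strength
above `2 K` carry little, each deviating from `θ₀` by at least half its strength. So the selected
incidences number at least of order `d / γ`, with excess sizes of order `d / (γ H)`. In
`le_wasted_of_large` the factor `γ` cancels: `√(d / (k H))` times `d` times the rate `k / d` is `√k
√(d / H)`. -/
theorem Model.ClassAt.le_wasted_of_mixed (hC : P.ClassAt K c n N γ) (hR : P.RegimeAt K c n)
    (hc : SmallRatio K P.ζ c) (hδ0 : 0 < δ) (hδ1 : δ ≤ 1)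
    (hT : ∑ i, |P.strength n N i - P.θ₀ n i| ≤ δ / (16 * K ^ 3) * P.d n) (hH : 0 < P.H n)
    (hδ : δ * P.H n ≤ ({h | colSupp Φ N h ≠ 1}.ncard : ℝ)) :
    exp (-(16 * K ^ 2)) * (δ / (32 * K ^ 4) * √(δ / (256 * K ^ 5))) *
      (√(P.k n) * √(P.d n / P.H n)) ≤ P.wasted n N := by
  classical
  have hγ := hC.scale_pos
  have hL := hR.feature
  have hK := hL.one_le_K
  have hk := hL.one_le_k
  have hd := hL.d_pos
  have hH' : (0 : ℝ) < P.H n := by exact_mod_cast hH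
  set U := Φ N with hU
  set T := P.strength n N with hTd
  obtain ⟨a, ha, haS⟩ := exists_large_selection hH (fun h => one_le_colSupp (hC.nonzero h)) hδ0.le hδ1 hδ
  set S := ∑ h, (colSupp U h : ℝ) with hS
  set g : ℝ^(P.d n) := fun i => if |T i| ≤ 2 * K then 1 else 0 with hg
  have hθ : ∀ i, |P.θ₀ n i| ≤ |T i| + |T i - P.θ₀ n i| := fun i => by
    have := abs_sub_abs_le_abs_sub (P.θ₀ n i) (T i)
    rw [abs_sub_comm] at this; linarith
  have hη : δ / (16 * K ^ 3) ≤ 1 / (2 * K) := by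
    rw [div_le_div_iff₀ (by positivity) (by positivity)]
    have : K ≤ K ^ 3 := le_self_pow₀ hK (by norm_num)
    have := mul_le_right (a := 2 * K) hδ1
    linarith
  have hG : P.d n / (2 * K ^ 2) ≤ γ * S := by
    have b1 := (hC.colSupp_bounds (by linarith)).2
    have b2 : ∑ _i : Fin (P.d n), 1 / K ≤ ∑ i, (|T i| + |T i - P.θ₀ n i|) :=
      sum_le_sum fun i _ => (hR.coeff i).1.trans (hθ i)
    rw [sum_add_distrib, sum_const, card_univ, Fintype.card_fin, nsmul_eq_mul] at b2
    have b3 := mul_le_right hη hd.le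
    have b4 : P.d n * (1 / K) - 1 / (2 * K) * P.d n = K * (P.d n / (2 * K ^ 2)) := by field_simp; ring
    exact le_of_mul_le_mul_left (a := K) (by linarith) (by linarith)
  have hW : δ * P.d n / (8 * K ^ 2) ≤ γ * ∑ h, a h * ∑ i, g i * act (U i h) := by
    have hg1 : ∀ i, 0 ≤ 1 - g i := fun i => by simp only [hg]; split_ifs <;> norm_num
    have b1 : ∑ h, a h * (colSupp U h : ℝ) - ∑ i, (1 - g i) * ∑ h, act (U i h) ≤
        ∑ h, a h * ∑ i, g i * act (U i h) := by
      have : ∑ i, (1 - g i) * ∑ h, act (U i h) = ∑ h, ∑ i, (1 - g i) * act (U i h) := by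
        simp only [mul_sum]; exact sum_comm
      rw [this, ← sum_sub_distrib]
      refine sum_le_sum fun h _ => ?_
      rw [colSupp_eq, sub_le_iff_le_add, mul_sum, mul_sum, ← sum_add_distrib]
      refine sum_le_sum fun i _ => ?_
      have : a h ≤ 1 := by rcases ha h with h | h <;> [(rw [h]; norm_num); rw [h.1]]
      have := mul_le_right this (mul_nonneg (hg1 i) (act_nonneg (U i h)))
      linarith
    have b2 : γ * ∑ i, (1 - g i) * ∑ h, act (U i h) ≤ 2 * K * ∑ i, |T i - P.θ₀ n i| := by
      rw [mul_sum, mul_sum]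
      refine sum_le_sum fun i _ => ?_
      have c1 : γ * ∑ h, act (U i h) ≤ K * |T i| := by
        rw [hC.abs_strength_eq, mul_sum, mul_sum]
        refine sum_le_sum fun h _ => ?_
        by_cases hi : U i h = 0
        · simp [hi, act_zero, ← hU]
        · have := (hC.same_size i h hi).1
          rw [div_le_iff₀' (by linarith)] at this
          rwa [act_of_ne hi, mul_one]
      by_cases hi : |T i| ≤ 2 * K
      · simp only [hg, if_pos hi]; simp; positivity
      · simp only [hg, if_neg hi, sub_zero, one_mul]
        have c2 := (hR.coeff i).2
        have c3 := abs_sub_abs_le_abs_sub (T i) (P.θ₀ n i)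
        have c4 := mul_le_left (by linarith : |T i| ≤ 2 * |T i - P.θ₀ n i|)
          (by linarith : 0 ≤ K)
        linarith
    have b3 := mul_le_left b1 hγ.le
    have b4 := mul_le_left haS hγ.le
    have b5 := mul_le_left hT (by linarith : 0 ≤ 2 * K)
    have b6 := mul_le_left hG (by linarith : 0 ≤ δ / 2)
    have e : δ / 2 * (P.d n / (2 * K ^ 2)) - 2 * K * (δ / (16 * K ^ 3) * P.d n) =
      δ * P.d n / (8 * K ^ 2) := by field_simp; ring
    linarith
  refine le_trans ?_ (hC.le_wasted_of_large hR hc (r := δ / 4 * (S / P.H n)) (by positivity) ha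
    (g := g) fun i => ?_)
  swap
  · by_cases hi : |T i| ≤ 2 * K
    · exact Or.inr ⟨if_pos hi, hi⟩
    · exact Or.inl (if_neg hi)
  rw [mul_assoc]
  refine mul_le_left ?_ (exp_nonneg _)
  have hsk := sqrt_pos.2 (by linarith : 0 < P.k n)
  have b1 : √(δ / (256 * K ^ 5)) * √(P.d n / P.H n) / √(P.k n) ≤
      √(δ / 4 * (S / P.H n) / (32 * K ^ 3 * P.k n / γ)) := by
    rw [← sqrt_mul (by positivity), ← sqrt_div (by positivity)]
    refine sqrt_le_sqrt ?_
    have e : δ / 4 * (S / P.H n) / (32 * K ^ 3 * P.k n / γ) =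
      δ / (128 * K ^ 3 * P.k n * P.H n) * (γ * S) := by field_simp; ring
    have e' : δ / (256 * K ^ 5) * (P.d n / P.H n) / P.k n =
      δ / (128 * K ^ 3 * P.k n * P.H n) * (P.d n / (2 * K ^ 2)) := by field_simp; norm_num
    rw [e, e']
    exact mul_le_left hG
  have b2 : δ * P.d n / (8 * K ^ 2) * (P.k n / (K * P.d n)) ≤
      γ * (∑ h, a h * ∑ i, g i * act (U i h)) * rate (P.law n) :=
    mul_le_mul hW hL.rate_ge (by positivity) (le_trans (by positivity) hW)
  have b3 := mul_le_mul b1 b2 (by positivity) (sqrt_nonneg _)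
  have b4 := mul_le_left (a := 1 / (4 * K)) b3
  refine le_trans (le_of_eq ?_) (b4.trans (le_of_eq ?_))
  · rw [show P.k n / (K * P.d n) = √(P.k n) * √(P.k n) / (K * P.d n) by
      rw [mul_self_sqrt (by linarith)]]
    field_simp; norm_num
  · ring

/-- All from `d ≤ H ≤ ε d √d`. For the second inequality, `ε √d ≥ 1` improves the upper bound on `H`
to `(ε d) ^ 2`. -/
theorem Model.RegimeAt.one_le_attack_mul_sqrt (hR : P.RegimeAt K c n) (hc1 : c ≤ 1) :
    1 ≤ P.ε n * √(P.d n) ∧ √(P.d n) ≤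
      P.d n * (P.ε n * √(P.d n / P.H n)) ∧ 0 < P.H n ∧ (P.d n : ℝ) ≤ P.H n := by
  have hd := hR.feature.d_pos
  have hε := hR.attack_nonneg
  have hH : (P.d n : ℝ) ≤ P.H n := hR.wide.trans (mul_le_of_le_one_left (Nat.cast_nonneg _) hc1)
  have hn : (P.H n : ℝ) ≤ P.ε n * (P.d n * √(P.d n)) :=
    hR.narrow.trans (mul_le_of_le_one_left (by positivity) hc1)
  have h1 : 1 ≤ P.ε n * √(P.d n) := by
    refine le_of_mul_le_mul_right (a := (P.d n : ℝ)) ?_ hd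
    linarith
  have hH0 : (0 : ℝ) < P.H n := by linarith
  refine ⟨h1, ?_, by exact_mod_cast hH0, hH⟩
  have h2 : (P.H n : ℝ) ≤ (P.ε n * P.d n) ^ 2 := by
    have := mul_le_left (a := P.ε n * (P.d n * √(P.d n))) h1
    have e : P.ε n * (P.d n * √(P.d n)) * (P.ε n * √(P.d n)) = (P.ε n * P.d n) ^ 2 := by
      rw [show P.ε n * (P.d n * √(P.d n)) * (P.ε n * √(P.d n)) =
        P.ε n ^ 2 * P.d n * (√(P.d n) * √(P.d n)) by ring,
        mul_self_sqrt hd.le]; ring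
    linarith
  have h3 : √(P.H n) ≤ P.ε n * P.d n := sqrt_le_iff.2 ⟨by positivity, h2⟩
  have h4 := sqrt_pos.2 hH0
  rw [sqrt_div hd.le, mul_div_assoc', mul_div_assoc', le_div_iff₀ h4]
  have := mul_le_left h3 (sqrt_nonneg (P.d n))
  linarith

theorem Model.RegimeAt.le_ψ (hR : P.RegimeAt K c n) (hH : (P.d n : ℝ) ≤ P.H n) :
    2 ≤ P.k n → (P.m n : ℝ) ^ 3 * P.k n ^ 3 / P.d n ≤ 3 * P.ψ n := fun hk => by
  have hd := hR.feature.d_pos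
  have h1 := half_le_log_sq hk
  have h2 := mul_le_mul hH h1 (by norm_num) (Nat.cast_nonneg _)
  have h3 : P.H n * (P.m n : ℝ) ^ 3 * P.k n ^ 3 * log (P.k n) ^ 2 / (P.d n : ℝ) ^ 2 ≤ P.ψ n := by
    unfold Model.ψ; linarith [sqrt_nonneg (P.k n / P.d n)]
  have h4 : P.d n * (1 / 3) * ((P.m n : ℝ) ^ 3 * P.k n ^ 3) / (P.d n : ℝ) ^ 2 ≤
      P.H n * (P.m n : ℝ) ^ 3 * P.k n ^ 3 * log (P.k n) ^ 2 / (P.d n : ℝ) ^ 2 := by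
    refine div_le_div_of_nonneg_right ?_ (by positivity)
    have := mul_le_right (a := (P.m n : ℝ) ^ 3 * P.k n ^ 3) h2
    linarith
  have e : P.d n * (1 / 3) * ((P.m n : ℝ) ^ 3 * P.k n ^ 3) / (P.d n : ℝ) ^ 2 =
    1 / 3 * ((P.m n : ℝ) ^ 3 * P.k n ^ 3 / P.d n) := by field_simp
  linarith

/-- For `k ≥ 2` the logarithm in `ψ` is bounded below and `ψ` controls the pairs of superposed
features. For `k ≤ 2` it may vanish, and the sum over pairs is kept on the right, to be absorbed by
the gain of `le_wasted`. -/
theorem Model.ClassAt.overlapLoss_le (hC : P.ClassAt K c n N γ) (hR : P.RegimeAt K c n)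
    (hH : (P.d n : ℝ) ≤ P.H n) (hT : ∑ i, |P.strength n N i| ≤ 2 * K * P.d n) :
    P.overlapLoss n N γ ≤ 8 * K ^ 2 * P.ψ n + 3 * (P.k n / (P.d n : ℝ) ^ 2 *
      (γ * ∑ h, (colSupp Φ N h : ℝ) * (colSupp Φ N h - 1))) := by
  have hL := hR.feature
  have hK := hL.one_le_K
  have hk := hL.one_le_k
  have hd := hL.d_pos
  have hγ := hC.scale_pos
  have hψ := P.sqrt_le_ψ hk
  have hψ0 := P.ψ_nonneg hk
  have hm : (1 : ℝ) ≤ P.m n := by exact_mod_cast hR.one_le_m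
  rw [Model.overlapLoss_eq (by linarith)]
  have hA := hC.sum_colSupp_mul_le
  set G := γ * ∑ h, (colSupp Φ N h : ℝ)
  set A := γ * ∑ h, (colSupp Φ N h : ℝ) * (colSupp Φ N h - 1)
  have hG : G ≤ 2 * K ^ 2 * P.d n := by
    have := (hC.colSupp_bounds (by linarith)).1
    have := mul_le_left hT (by linarith : 0 ≤ K)
    linarith
  have hG0 : 0 ≤ G := by positivity
  have hA0 : 0 ≤ A := mul_nonneg hγ.le (sum_nonneg fun h _ => mul_nonneg (Nat.cast_nonneg _)
    (sub_nonneg.2 (by exact_mod_cast one_le_colSupp (hC.nonzero h))))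
  obtain ⟨hs1, hs2⟩ := sq_mul_sqrt_le hk
  have h2 : P.k n * √(P.k n) / (P.d n : ℝ) ^ 3 * G ≤ 2 * K ^ 2 * P.ψ n := by
    have b1 := mul_le_left (a := P.k n * √(P.k n) / (P.d n : ℝ) ^ 3) hG
    have b2 : P.k n * √(P.k n) / (P.d n : ℝ) ^ 2 ≤ √(P.k n / P.d n) := by
      rw [sqrt_div (by linarith), div_le_div_iff₀ (by positivity) (sqrt_pos.2 hd)]
      have c1 : √(P.d n) ≤ P.d n := sqrt_le_iff.2
        ⟨hd.le, by nlinarith [hL.k_le]⟩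
      have c2 := mul_le_mul hL.k_le c1 (sqrt_nonneg _) hd.le
      have := mul_le_left c2 (sqrt_nonneg (P.k n))
      linarith
    have b3 := mul_le_left (a := 2 * K ^ 2) (b2.trans hψ)
    have e : P.k n * √(P.k n) / (P.d n : ℝ) ^ 3 * (2 * K ^ 2 * P.d n) =
      2 * K ^ 2 * (P.k n * √(P.k n) / (P.d n : ℝ) ^ 2) := by field_simp
    linarith
  have h1 : P.k n ^ 2 * √(P.k n) / (P.d n : ℝ) ^ 2 * A ≤
      6 * K ^ 2 * P.ψ n + 3 * (P.k n / (P.d n : ℝ) ^ 2 * A) := by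
    rcases le_total (P.k n) 2 with h | h
    · have b1 : P.k n ^ 2 * √(P.k n) / (P.d n : ℝ) ^ 2 * A ≤ 3 * P.k n / (P.d n : ℝ) ^ 2 * A :=
            mul_le_right (div_le_div_of_nonneg_right (hs1 h) (by positivity)) hA0
      have : 0 ≤ 6 * K ^ 2 * P.ψ n := by positivity
      have e : 3 * P.k n / (P.d n : ℝ) ^ 2 * A = 3 * (P.k n / (P.d n : ℝ) ^ 2 * A) := by ring
      linarith
    · have b0 : A ≤ P.m n ^ 3 * (2 * K ^ 2 * P.d n) := by
        refine hA.trans (mul_le_mul (le_self_pow₀ hm (by norm_num)) hG hG0 (by positivity))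
      have b1 : P.k n ^ 2 * √(P.k n) / (P.d n : ℝ) ^ 2 * A ≤
          P.k n ^ 3 / (P.d n : ℝ) ^ 2 * (P.m n ^ 3 * (2 * K ^ 2 * P.d n)) := by gcongr
      have b2 := mul_le_left (a := 2 * K ^ 2) (hR.le_ψ hH h)
      have e : P.k n ^ 3 / (P.d n : ℝ) ^ 2 * (P.m n ^ 3 * (2 * K ^ 2 * P.d n)) =
        2 * K ^ 2 * ((P.m n : ℝ) ^ 3 * P.k n ^ 3 / P.d n) := by field_simp
      have : 0 ≤ 3 * (P.k n / (P.d n : ℝ) ^ 2 * A) := by positivity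
      linarith
  linarith

end

/-- A network of nearly optimal risk can have a positive proportion of mixed nodes only if the
attack is too weak to be felt. -/
theorem Model.exists_attack_le_ψ (P : Model) (hs : 0 < P.s) (τ : Task) {K : ℝ} (hK : 1 ≤ K) {δ : ℝ}
    (hδ0 : 0 < δ) (hδ1 : δ ≤ 1) : ∃ c₀ > 0, ∃ ρ > 0, ∃ κ > 0, ∃ C > 0, ∀ (n : ℕ) (c γ B : ℝ)
    (N : P.Net n) (T₀ : ℝ^(P.d n)), P.RegimeAt K c n → P.ClassAt K c n N γ →
    SmallRatio K P.ζ c → c ≤ c₀ → (∀ i, |T₀ i - P.θ₀ n i| ≤ |P.θ₀ n i| / 2) →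
    (∀ T', P.linRisk τ n T₀ ≤ P.linRisk τ n T') →
    P.m n * (P.k n ^ 2 * √(P.k n)) ≤ 6 * P.d n →
    P.advRisk τ n N ≤ bayesRisk τ P.s (P.law n) (P.θ₀ n) + ρ →
    P.advRisk τ n N ≤ P.linRisk τ n T₀ + B * P.ψ n →
    δ * P.H n ≤ ({h | colSupp Φ N h ≠ 1}.ncard : ℝ) →
    κ * (P.ε n * √(P.k n) * P.d n / P.H n) ≤ (B + C) * P.ψ n := by
  obtain ⟨c₁, hc₁, C₁, hC₁, hgain⟩ := P.exists_gain_le hs τ hK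
  obtain ⟨c₂, hc₂, ρ, hρ, hclose⟩ := P.exists_sum_abs_sub_le hs τ hK (η := δ / (16 * K ^ 3))
    (by positivity)
  set κ₀ := exp (-(16 * K ^ 2)) * (δ / (32 * K ^ 4) * √(δ / (256 * K ^ 5))) with hκ₀
  set κ₁ := exp (-(16 * K ^ 2)) / (4 * K ^ 2) with hκ₁
  have hκ₀0 : 0 < κ₀ := by positivity
  have hκ₁0 : 0 < κ₁ := by positivity
  -- The cost is quadratic in `l₀` and the gain linear. With this choice the cost takes at most a
  -- quarter of the gain from mixed nodes; that gain is counted at half its value, the other half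
  -- paying for overlaps.
  set l₀ := min 1 (c₁ * κ₀ / (8 * K * C₁)) with hl₀
  have hl₀0 : 0 < l₀ := by positivity
  have hl₀1 : l₀ ≤ 1 := min_le_left _ _
  have hl₀2 : 2 * K * C₁ * l₀ ≤ c₁ * κ₀ / 4 := by
    have := (le_div_iff₀ (by positivity)).1 (min_le_right 1 (c₁ * κ₀ / (8 * K * C₁)))
    rw [← hl₀] at this; linarith
  refine ⟨min (min 1 c₂) (c₁ * κ₁ * l₀ / (6 * C₁)), by positivity, ρ, hρ, c₁ * κ₀ * l₀ / 4,
    by positivity, 8 * C₁ * K ^ 2, by positivity,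
    fun n c γ B N T₀ hR hC hc hcc hT₀ hmin₀ hmk hb hadv hmix => ?_⟩
  have hc1 : c ≤ 1 := hcc.trans ((min_le_left _ _).trans (min_le_left _ _))
  have hc2 : c ≤ c₂ := hcc.trans ((min_le_left _ _).trans (min_le_right _ _))
  have hc3 : 3 * C₁ * c ≤ c₁ * κ₁ * l₀ / 2 := by
    have := (le_div_iff₀ (by positivity)).1 (hcc.trans (min_le_right _ _))
    linarith
  have hL := hR.feature
  have hd := hL.d_pos
  have hk := hL.one_le_k
  have hε := hR.attack_nonneg
  have hγ := hC.scale_pos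
  have hψ := P.ψ_nonneg hk
  obtain ⟨-, hεH, hH0, hdH⟩ := hR.one_le_attack_mul_sqrt hc1
  have hH : (0 : ℝ) < P.H n := by exact_mod_cast hH0
  have hS := hclose n c γ N hR hC hc hc2 hmk hb
  have hT : ∑ i, |P.strength n N i| ≤ 2 * K * P.d n := by
    have h1 : ∑ i, |P.strength n N i| ≤ ∑ i, (|P.strength n N i - P.θ₀ n i| + K) :=
      sum_le_sum fun i _ => by
        have := abs_sub_abs_le_abs_sub (P.strength n N i) (P.θ₀ n i)
        linarith [(hR.coeff i).2]
    rw [sum_add_distrib, sum_const, card_univ, Fintype.card_fin, nsmul_eq_mul] at h1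
    have h2 : δ / (16 * K ^ 3) ≤ K := by
      refine (div_le_of_le_mul₀ (by positivity) (by positivity) ?_)
      have := one_le_mul_of_one_le_of_one_le hK (one_le_pow₀ hK : 1 ≤ K ^ 3)
      linarith
    have h3 := mul_le_right h2 hd.le
    linarith
  set q := √(P.d n / P.H n) with hq
  have hq0 : 0 ≤ q := sqrt_nonneg _
  have hq1 : q ≤ 1 := sqrt_le_one.2 ((div_le_one hH).2 hdH)
  have hqq : q * q = P.d n / P.H n := mul_self_sqrt (by positivity)
  set A := γ * ∑ h, (colSupp Φ N h : ℝ) * (colSupp Φ N h - 1) with hA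
  have hA0 : 0 ≤ A := mul_nonneg hγ.le (sum_nonneg fun h _ => mul_nonneg (Nat.cast_nonneg _)
    (sub_nonneg.2 (by exact_mod_cast one_le_colSupp (hC.nonzero h))))
  set X := P.ε n * √(P.k n) * P.d n / P.H n with hX
  have hX0 : 0 ≤ X := by positivity
  have hX' : X = P.ε n * √(P.k n) * (q * q) := by rw [hqq, hX]; ring
  -- With `l = l₀ √(d / H)`, gain and cost are both multiples of `ε √k d / H`.
  have g0 := hgain n c γ N hR hC hc T₀ hT₀ hmin₀ (l₀ * q) (by positivity)
    (mul_le_one₀ hl₀1 hq0 hq1)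
  have g1 : κ₀ * l₀ * X ≤ P.ε n * (l₀ * q) * P.wasted n N := by
    have := mul_le_left (a := P.ε n * (l₀ * q)) (hC.le_wasted_of_mixed hR hc hδ0 hδ1 hS hH0 hmix)
    rw [← hκ₀, ← hq] at this
    rw [hX']; linarith
  -- The same waste, bounded below by the sum over pairs. The lower bound on `ε √(d / H)` makes it
  -- dominate `c` times the overlap loss that `ψ` does not control.
  have g2 : κ₁ * l₀ * (P.k n / (P.d n : ℝ) ^ 2 * A) ≤ P.ε n * (l₀ * q) * P.wasted n N := by
    have hsd := sqrt_pos.2 hd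
    refine le_trans ?_ (mul_le_left (hC.le_wasted hR hc))
    have b1 : 1 / P.d n ≤ P.ε n * q / √(P.d n) := by rw [div_le_div_iff₀ hd hsd]; linarith
    have b2 := mul_le_mul hL.rate_ge b1 (by positivity) hL.rate_pos.le
    have b3 := mul_le_left (a := exp (-(16 * K ^ 2)) / (4 * K) * l₀ * A) b2
    refine le_trans (le_of_eq ?_) (b3.trans (le_of_eq ?_))
    · rw [hκ₁]; field_simp
    · rw [hA]; ring
  have g3 := hC.overlapLoss_le hR hdH hT
  have g4 : P.ε n * (l₀ * q) ^ 2 * (√(P.k n) / P.d n) * (∑ i, |P.strength n N i|) ≤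
      2 * K * l₀ ^ 2 * X := by
    refine (mul_le_left hT).trans (le_of_eq ?_)
    rw [hX', mul_pow]; field_simp
  have hc0 := hc.pos
  have g5 := mul_le_left g3 hc0.le
  have g6 : c * (8 * K ^ 2 * P.ψ n) ≤ 8 * K ^ 2 * P.ψ n := mul_le_of_le_one_left (by positivity) hc1
  have g7 := mul_le_right (a := P.k n / (P.d n : ℝ) ^ 2 * A) hc3
  have g8 := mul_le_right (a := l₀ * X) hl₀2
  have g9 := mul_le_left (add_le_add g4 (g5.trans (le_of_eq (mul_add _ _ _)))) hC₁.le
  have g10 := mul_le_left g6 hC₁.le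
  have g11 := mul_le_left (add_le_add g1 g2) hc₁.le
  change _ + c₁ * (P.ε n * (l₀ * q) * P.wasted n N) ≤ _ at g0
  linarith

/-! ### Almost all nodes are purified. -/

section

variable {P : Model} {N : ∀ n, P.Net n} {τ : Task} {K : ℝ} {γ : ℕ → ℝ}

/-- For `k ≤ 2` the left side is at most `3 m k`, which screening controls. For `k ≥ 2` it is at
most `m ^ 3 k ^ 3`, which the first term of `ψ ≤ 1` controls. -/
theorem Model.RegimeAt.few_mul_le {c : ℝ} {n : ℕ} (hR : P.RegimeAt K c n) (hc1 : c ≤ 1)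
    (hψ : P.ψ n ≤ P.d n / P.H n) :
    P.m n * (P.k n ^ 2 * √(P.k n)) ≤ 6 * P.d n := by
  obtain ⟨-, -, hH0, hdH⟩ := hR.one_le_attack_mul_sqrt hc1
  have hd := hR.feature.d_pos
  have hk := hR.feature.one_le_k
  have hH : (0 : ℝ) < P.H n := by exact_mod_cast hH0
  have hm : (1 : ℝ) ≤ P.m n := by exact_mod_cast hR.one_le_m
  obtain ⟨h1, h2⟩ := sq_mul_sqrt_le hk
  rcases le_total (P.k n) 2 with h | h
  · have b1 : √(P.k n * P.m n) ≤ √(P.d n) := by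
      have a1 := hR.one_le_log
      have a2 : c * log (P.d n) ≤ log (P.d n) := mul_le_of_le_one_left (log_natCast_nonneg _) hc1
      have a3 := mul_le_left (a1.trans a2) (sqrt_nonneg (P.k n * P.m n))
      have a4 : c * √(P.d n) ≤ √(P.d n) := mul_le_of_le_one_left (sqrt_nonneg _) hc1
      linarith [hR.screened]
    have b2 := (Real.sqrt_le_sqrt_iff hd.le).1 b1
    have b3 := mul_le_left (h1 h) (by linarith : (0 : ℝ) ≤ P.m n)
    linarith
  · have b1 := hR.le_ψ hdH h
    have b2 : P.d n / P.H n ≤ (1 : ℝ) := (div_le_one hH).2 hdH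
    have b3 : (P.m n : ℝ) ^ 3 * P.k n ^ 3 ≤ 3 * P.d n := by
      rw [div_le_iff₀ hd] at b1
      have := mul_le_right (hψ.trans b2) hd.le
      linarith
    have b4 := mul_le_mul (le_self_pow₀ hm (by norm_num : 3 ≠ 0)) h2 (by positivity) (by positivity)
    linarith

/-- For each `δ`, a proportion `δ` of mixed nodes would force `ε √k d / H = O(ψ)` by
`Model.exists_attack_le_ψ`. The near-minimality used there is tested twice: on the purified network
built from the minimiser of `linRisk` for the sharp comparison, and on the one built from `θ₀` for
the excess over the Bayes risk. -/
theorem Model.InClass.tendsto_purified (hP : P.SparseCoding) (hN : P.InClass N)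
    (hK : 1 ≤ K) (hR : ∀ c > 0, ∀ᶠ n in atTop, P.RegimeAt K c n)
    (hC : ∀ c > 0, ∀ᶠ n in atTop, P.ClassAt K c n (N n) (γ n))
    (hmin : ∀ N' : ∀ n, P.Net n, P.InClass N' →
      ∃ C : ℝ, ∀ᶠ n in atTop, P.advRisk τ n (N n) ≤ P.advRisk τ n (N' n) + C * P.ψ n)
    (hψ : P.ψ =o[atTop] fun n => P.ε n * √(P.k n) * (P.d n : ℝ) / P.H n) :
    Tendsto (fun n => (P.purified n (N n) : ℝ) / P.H n) atTop (𝓝 1) := by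
  have hs := hP.regression_noise_pos
  have hK0 : 0 < K := by linarith
  obtain ⟨η, hη, hexists⟩ := exists_minimizer_linRisk τ hs hK
  set good : ∀ n, ℝ^(P.d n) → Prop := fun n T =>
    (∀ i, |T i - P.θ₀ n i| ≤ |P.θ₀ n i| / 2) ∧
    ∀ T', P.linRisk τ n T ≤ P.linRisk τ n T'
  -- A minimiser is available for large indices only; elsewhere `T` is zero unless a good vector
  -- happens to exist.
  have hT : ∀ n, ∃ T : ℝ^(P.d n), (∃ T', good n T') → good n T := fun n => by
    by_cases h : ∃ T', good n T'
    · exact h.imp fun T hT _ => hT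
    · exact ⟨0, fun h' => absurd h' h⟩
  choose T hT using hT
  have hgood : ∀ᶠ n in atTop, good n (T n) := by
    filter_upwards [hR (η / K) (by positivity), hP.tendsto_d.eventually_ge_atTop (1 / η)] with n h1 h2
    refine hT n (hexists h1.feature h1.coeff h1.attack_nonneg
      ((h1.attack_mul_sqrt_le (by positivity)).trans (by rw [div_mul_cancel₀ _ hK0.ne'])) ?_)
    rwa [one_div_le h1.feature.d_pos hη]
  obtain ⟨B, -, hB⟩ := hN.exists_advRisk_le hP hK hR hmin (hgood.mono fun n h => h.1)
  obtain ⟨B', hB', hBθ⟩ := hN.exists_advRisk_le hP hK hR hmin (T := P.θ₀)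
    (Eventually.of_forall fun n i => by rw [sub_self, abs_zero]; positivity)
  obtain ⟨C', hC', hself⟩ := linRisk_self_le τ P.s K
  obtain ⟨c₃, hc₃, hsmall⟩ := exists_smallRatio K hP.noise_pos
  rw [Metric.tendsto_nhds]
  intro e he
  set δ := min (1 / 2) (e / 2) with hδ
  have hδ0 : 0 < δ := by positivity
  have hδ1 : δ ≤ 1 := (min_le_left _ _).trans (by norm_num)
  obtain ⟨c₀, hc₀, ρ, hρ, κ, hκ, C, hCpos, hmain⟩ := P.exists_attack_le_ψ hs τ hK hδ0 hδ1
  -- The last bound makes `ε √k`, and with it `ψ`, small enough for the excess over the Bayes risk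
  -- to stay below `ρ`.
  set c := min (min c₀ c₃) (min (1 / K) (ρ / ((B' + C') * K))) with hc
  have hc0 : 0 < c := by positivity
  have hcK : c * K ≤ 1 := by
    have : c ≤ 1 / K := (min_le_right _ _).trans (min_le_left _ _)
    rwa [le_div_iff₀ hK0] at this
  have hcρ : (B' + C') * (c * K) ≤ ρ := by
    have : c ≤ ρ / ((B' + C') * K) := (min_le_right _ _).trans (min_le_right _ _)
    rw [le_div_iff₀ (by positivity)] at this
    linarith
  have hc1 : c ≤ 1 := (le_mul_of_one_le_right hc0.le hK).trans hcK
  set t := min 1 (κ / (2 * (|B| + C))) with ht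
  have ht0 : 0 < t := by positivity
  filter_upwards [hR c hc0, hC c hc0, hgood, hB, hBθ, hψ.bound ht0] with n a1 a2 a3 a4 a5 a6
  obtain ⟨b1, b2, hH0, hdH⟩ := a1.one_le_attack_mul_sqrt hc1
  have hH : (0 : ℝ) < P.H n := by exact_mod_cast hH0
  have hd := a1.feature.d_pos
  have hk := a1.feature.one_le_k
  have hε : 0 < P.ε n := by
    refine lt_of_le_of_ne a1.attack_nonneg fun h => ?_
    rw [← h, zero_mul] at b1; linarith
  have hψ0 := P.ψ_nonneg hk
  have hsk : 0 < √(P.k n) := sqrt_pos.2 (by linarith)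
  set X := P.ε n * √(P.k n) * P.d n / P.H n with hX
  have hX0 : 0 < X := by positivity
  rw [norm_of_nonneg hψ0, norm_of_nonneg hX0.le] at a6
  have a7 : P.ψ n ≤ X := a6.trans (mul_le_of_le_one_left hX0.le (min_le_left _ _))
  have hεk := a1.attack_mul_sqrt_le hc0.le
  have hdH1 : P.d n / P.H n ≤ (1 : ℝ) := (div_le_one hH).2 hdH
  have a8 : X ≤ P.ε n * √(P.k n) := by
    rw [hX, mul_div_assoc]; exact mul_le_of_le_one_right (by positivity) hdH1
  have a9 : X ≤ P.d n / P.H n := by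
    rw [hX, mul_div_assoc]; exact mul_le_of_le_one_left (by positivity) (hεk.trans hcK)
  have hbayes : P.advRisk τ n (N n) ≤ bayesRisk τ P.s (P.law n) (P.θ₀ n) + ρ := by
    have d1 := hself a1.feature (fun i => (a1.coeff i).2) hε.le (hεk.trans hcK)
    have d2 := mul_le_left ((a7.trans a8).trans hεk) hB'.le
    have d3 := mul_le_left hεk hC'.le
    linarith
  -- Otherwise `κ X ≤ (B + C) ψ ≤ (|B| + C) t X ≤ κ X / 2` with `X > 0`.
  have hmix : ({h | colSupp (P.features n (N n)) h ≠ 1}.ncard : ℝ) < δ * P.H n := by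
    by_contra hmix
    have d1 := hmain n c (γ n) B (N n) (T n) a1 a2
      (hsmall c hc0 ((min_le_left _ _).trans (min_le_right _ _)))
      ((min_le_left _ _).trans (min_le_left _ _)) a3.1 a3.2 (a1.few_mul_le hc1 (a7.trans a9))
      hbayes a4 (not_lt.1 hmix)
    have d2 := mul_le_left (a := |B| + C) a6
    have d3 := mul_le_right (le_abs_self B) hψ0
    have d4 : (|B| + C) * t ≤ κ / 2 := by
      have := min_le_right 1 (κ / (2 * (|B| + C)))
      rw [← ht, le_div_iff₀ (by positivity)] at this
      linarith
    have d5 := mul_le_right d4 hX0.le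
    have d6 := mul_pos hκ hX0
    linarith
  have hcount : (P.purified n (N n) : ℝ) +
      ({h | colSupp (P.features n (N n)) h ≠ 1}.ncard : ℝ) = P.H n := by
    have := Set.ncard_add_ncard_compl {h : Fin (P.H n) | colSupp (P.features n (N n)) h = 1}
    rw [Nat.card_eq_fintype_card, Fintype.card_fin] at this
    exact_mod_cast this
  have hle : δ ≤ e / 2 := min_le_right _ _
  rw [Real.dist_eq, abs_lt]
  have hm0 : (0 : ℝ) ≤ ({h | colSupp (P.features n (N n)) h ≠ 1}.ncard : ℝ) := Nat.cast_nonneg _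
  constructor
  · rw [lt_sub_iff_add_lt, lt_div_iff₀ hH]
    have := mul_le_right hle hH.le
    have := mul_pos he hH
    linarith
  · rw [sub_lt_iff_lt_add, div_lt_iff₀ hH]
    have := mul_pos he hH
    linarith

end

end

end FeaturePurification

theorem mainTheorem3 (P : FeaturePurification.Model) (hP : P.SparseCoding)
    (hε : FeaturePurification.IsOrder P.ε
      fun n => 1 / (Real.sqrt (P.k n * P.m n) * Real.log (P.d n)))
    (hH : (fun n => (P.H n : ℝ)) =o[atTop] fun n => P.ε n * (P.d n : ℝ) ^ (3 / 2 : ℝ))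
    (τ : FeaturePurification.Task)
    (N : ∀ n, FeaturePurification.Network (P.d n) (P.H n)) (hN : P.InClass N)
    (hmin : ∀ N' : ∀ n, FeaturePurification.Network (P.d n) (P.H n), P.InClass N' →
      ∃ C : ℝ, ∀ᶠ n in atTop, P.advRisk τ n (N n) ≤ P.advRisk τ n (N' n) + C * P.ψ n) :
    ((fun n => P.cleanRisk τ n (N n) - P.oracleRisk τ n) =O[atTop]
        fun n => P.ψ n + P.ε n * Real.sqrt (P.k n)) ∧
      (P.ψ =o[atTop] (fun n => P.ε n * Real.sqrt (P.k n) * (P.d n : ℝ) / P.H n) →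
        Tendsto (fun n => (P.purified n (N n) : ℝ) / P.H n) atTop (𝓝 1)) := by
  obtain ⟨K₁, hK₁, hR⟩ := hN.exists_regimeAt hP hε hH
  obtain ⟨γ, K₂, -, hC⟩ := hN.exists_classAt hP
  have hK : 1 ≤ max K₁ K₂ := hK₁.trans (le_max_left _ _)
  have hR := hR _ (le_max_left K₁ K₂)
  have hC := hC _ (le_max_right K₁ K₂)
  exact ⟨hN.cleanRisk_sub_oracleRisk_isBigO hP hK hR hC hmin,
    hN.tendsto_purified hP hK hR hC hmin⟩
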